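/- Let $p$ be a prime and $1\le k\le n$ integers. Let $S(n)=\mathbb Z/p\otimes_{K(n)_*}K(n)_*K(n)\otimes_{K(n)_*}\mathbb Z/p=\mathbb Z/p[t_1,t_2,\dots]/(t_s^{p^n}-t_s)$ (with $v_n\mapsto 1$) be the $n$-th Morava stabilizer algebra at $p$ and let $S(n,k)=S(n)/(t_s: s<k)$ be its quotient Hopf algebra. Let $C^s=\bar S(n,k)^{\otimes s}$, where $\bar S(n,k)=\operatorname{Ker}\varepsilon$, be the cobar complex, with $$d[\alpha_1|\cdots|\alpha_s]=\sum_{i}(-1)^i[\alpha_1|\cdots|\Delta(\alpha_i)-\alpha_i\otimes1-1\otimes\alpha_i|\cdots|\alpha_s],$$ and let $H^{s}S(n,k)=\operatorname{Ext}^{s}_{S(n,k)}(\mathbb Z/p,\mathbb Z/p)$ be its cohomology. The May filtration is given by $M(t_s^{p^j})=2s-1$ for $k\le s\le n+k-1$ and $M(t_s^{p^j})=\max\{2s-1,\;pM(t_{s-n}^{p^{j+n-1}})+1\}$ for $s\ge n+k$; it is extended to monomials $\prod_s t_s^{e_s}$ with $0\le e_s<p^n$ additively through the $p$-adic digits of the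 $e_s$, and to the cobar complex by $M([\alpha_1|\cdots|\alpha_s])=\sum_i M(\alpha_i)$. The increasing filtration of $C^*$ by the spans of the words $[\alpha_1|\cdots|\alpha_s]$ of monomials $\alpha_i\neq1$ of May filtration $\le M$ gives the May spectral sequence $E_r^{s,M}$, with $d_r:E_r^{s,M}\to E_r^{s+1,M-r}$. Suppose that $$\frac{2pn+p-2}{2(p-1)}\le n+k-1 .$$ Then: 1. The $E_2$-term of the May spectral sequence is the cohomology of the exterior algebra $E[h_{i,j}\mid k\le i\le n+k-1,\ j\in\mathbb Z/n]$ over $\mathbb Z/p$, in which $h_{i,j}$ has homological degree $1$ and May filtration $2i-1$, with respect to the antiderivation $d_1$ given by $$d_1(h_{i,j})=-\sum_{k\le m\le i-k}h_{m,j}\,h_{i-m,j+m}.$$ More precisely, for all $s$ and $M$ there is an isomorphism from the cohomology of the exterior algebra in bidegree $(s,M)$ onto $E_2^{s,M}$ that is induced by $h_{i,j}\mapsto t_i^{p^j}$: the class of a cocycle $\sum_a c_a\,h_{i_{a,1},j_{a,1}}\cdots h_{i_{a,s},j_{a,s}}$, all of whose monomials have May filtration $M$, goes to the class of an element of $C^s$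 that represents an element of $E_2^{s,M}$ and is congruent to $\sum_a c_a[t_{i_{a,1}}^{p^{j_{a,1}}}|\cdots|t_{i_{a,s}}^{p^{j_{a,s}}}]$ modulo words of May filtration $\le M-1$. 2. The cohomology of $S(n,k)$ has cohomological dimension $n^2$: $H^{s}S(n,k)=0$ for all $s>n^2$, and $H^{n^2}S(n,k)\ne0$. -/

import Mathlib

open scoped TensorProduct

noncomputable section

namespace Morava

/-! ### The Morava stabilizer algebra and its quotients `S(n,k)`

With `v_n = 1` and `v_i = 0` for `i ≠ n`, Hazewinkel's recursion
`p m_s = v_s + ∑_{0<i<s} v_{s-i}^{p^i} m_i` gives `m_{nl} = p^{-l}` and `m_s = 0` if `n ∤ s`. -/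

/-- The coefficients `m_i` of the logarithm of the Honda formal group law. -/
def logCoeff (p n i : ℕ) : ℚ := if n ∣ i then ((p : ℚ) ^ (i / n))⁻¹ else 0

/-- `∑_{j+l=a} x_j^{p^i} y_l^{p^{i+j}}`, where `x_j` is `X (inl j)` and `y_l` is `X (inr l)`. -/
def twistedSum (p a i : ℕ) : MvPolynomial (ℕ ⊕ ℕ) ℚ :=
  ∑ jl ∈ Finset.HasAntidiagonal.antidiagonal a,
    MvPolynomial.X (Sum.inl jl.1) ^ p ^ i * MvPolynomial.X (Sum.inr jl.2) ^ p ^ (i + jl.1)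

/-- The coproduct polynomials `D_s(x, y)`, with `x_j` standing for `t_j ⊗ 1` and `y_j` for
`1 ⊗ t_j`.  They are determined by the `BP_*BP` coproduct formula
`∑_{i+a=s} m_i D_a^{p^i} = ∑_{i+j+l=s} m_i x_j^{p^i} y_l^{p^{i+j}}` (see `coprodRat_spec`). -/
def coprodRat (p n : ℕ) : ℕ → MvPolynomial (ℕ ⊕ ℕ) ℚ
  | s => ∑ i ∈ Finset.range (s + 1), MvPolynomial.C (logCoeff p n i) * twistedSum p (s - i) i
      - ∑ a : Fin s, MvPolynomial.C (logCoeff p n (s - a)) * coprodRat p n a ^ p ^ (s - (a : ℕ))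

theorem logCoeff_zero (p n : ℕ) : logCoeff p n 0 = 1 := by simp [logCoeff]

theorem coprodRat_spec (p n s : ℕ) :
    ∑ i ∈ Finset.range (s + 1),
        MvPolynomial.C (logCoeff p n i) * coprodRat p n (s - i) ^ p ^ i =
      ∑ i ∈ Finset.range (s + 1), MvPolynomial.C (logCoeff p n i) * twistedSum p (s - i) i := by
  rw [← Finset.sum_range_reflect, Finset.sum_range_succ]
  have h : ∀ a ∈ Finset.range s,
      MvPolynomial.C (logCoeff p n (s + 1 - 1 - a)) *
        coprodRat p n (s - (s + 1 - 1 - a)) ^ p ^ (s + 1 - 1 - a) =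
      MvPolynomial.C (logCoeff p n (s - a)) * coprodRat p n a ^ p ^ (s - a) := by
    intro a ha
    have := Finset.mem_range.1 ha
    rw [show s + 1 - 1 - a = s - a by omega, show s - (s - a) = a by omega]
  rw [Finset.sum_congr rfl h]
  simp only [Nat.add_sub_cancel, Nat.sub_self, logCoeff_zero, map_one, one_mul, pow_zero, pow_one,
    Nat.sub_zero]
  conv_lhs => rw [coprodRat.eq_1 p n s]
  rw [Finset.sum_range fun a => MvPolynomial.C (logCoeff p n (s - a)) *
    coprodRat p n a ^ p ^ (s - a)]
  ring

theorem expand_pow_zmod {σ : Type*} (p : ℕ) [Fact p.Prime] (m : ℕ)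
    (f : MvPolynomial σ (ZMod p)) : MvPolynomial.expand (p ^ m) f = f ^ p ^ m := by
  induction m generalizing f with
  | zero => simp
  | succ m ih =>
    rw [pow_succ, MvPolynomial.expand_mul, MvPolynomial.expand_zmod, map_pow, ih, ← pow_mul]

theorem dvd_expand_sub_pow {σ : Type*} (p : ℕ) [Fact p.Prime] (m : ℕ) (f : MvPolynomial σ ℤ) :
    (p : MvPolynomial σ ℤ) ∣ MvPolynomial.expand (p ^ m) f - f ^ p ^ m := by
  have h := (MvPolynomial.C_dvd_iff_zmod p (MvPolynomial.expand (p ^ m) f - f ^ p ^ m)).2 (by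
    rw [map_sub, map_pow, MvPolynomial.map_expand, expand_pow_zmod, sub_self])
  simpa using h

theorem expand_twistedSum (p a i m : ℕ) :
    MvPolynomial.expand (p ^ m) (twistedSum p a i) = twistedSum p a (i + m) := by
  simp only [twistedSum, map_sum, map_mul, map_pow, MvPolynomial.expand_X, ← pow_mul, ← pow_add]
  refine Finset.sum_congr rfl fun x _ => ?_
  congr 3 <;> ring

theorem logCoeff_add (p n i : ℕ) (hn : 0 < n) :
    logCoeff p n (i + n) = (p : ℚ)⁻¹ * logCoeff p n i := by
  unfold logCoeff
  by_cases h : n ∣ i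
  · rw [if_pos h, if_pos (by simpa using h), Nat.add_div_right _ hn, pow_succ,
      mul_inv, mul_comm]
  · rw [if_neg h, if_neg (by simpa using h), mul_zero]

theorem logCoeff_mul_integral (p n : ℕ) [Fact p.Prime] (hn : 0 < n) (i : ℕ)
    (d : MvPolynomial (ℕ ⊕ ℕ) ℤ) :
    ∃ c : MvPolynomial (ℕ ⊕ ℕ) ℤ, MvPolynomial.map (Int.castRingHom ℚ) c =
      MvPolynomial.C (logCoeff p n (i + n)) * MvPolynomial.map (Int.castRingHom ℚ)
        (MvPolynomial.expand (p ^ n) d ^ p ^ i - d ^ p ^ (i + n)) := by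
  by_cases h : n ∣ i
  · obtain ⟨l, rfl⟩ := h
    obtain ⟨c, hc⟩ := dvd_sub_pow_of_dvd_sub (dvd_expand_sub_pow p n d) (n * l)
    have hl : l ≤ n * l := Nat.le_mul_of_pos_left l hn
    have hp : (p : ℚ) ≠ 0 := Nat.cast_ne_zero.2 (Fact.out : p.Prime).ne_zero
    refine ⟨(p : MvPolynomial (ℕ ⊕ ℕ) ℤ) ^ (n * l - l) * c, ?_⟩
    rw [show p ^ (n * l + n) = p ^ n * p ^ (n * l) by rw [← pow_add, add_comm],
      pow_mul d, hc]
    have e : logCoeff p n (n * l + n) = ((p : ℚ) ^ (l + 1))⁻¹ := by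
      rw [logCoeff, if_pos (by simp), Nat.add_div_right _ hn, Nat.mul_div_cancel_left _ hn]
    have e2 : (p : MvPolynomial (ℕ ⊕ ℕ) ℚ) = MvPolynomial.C (p : ℚ) := by simp
    rw [e]
    simp only [map_mul, map_pow, map_natCast]
    rw [e2, ← mul_assoc, ← map_pow, ← map_pow, ← map_mul]
    congr 2
    rw [show n * l + 1 = (l + 1) + (n * l - l) by omega, pow_add _ (l + 1), ← mul_assoc,
      inv_mul_cancel₀ (pow_ne_zero _ hp), one_mul]
  · refine ⟨0, ?_⟩
    rw [logCoeff, if_neg (by simpa using h)]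
    simp

theorem twistedSum_zero_integral (p s : ℕ) :
    ∃ d : MvPolynomial (ℕ ⊕ ℕ) ℤ, MvPolynomial.map (Int.castRingHom ℚ) d = twistedSum p s 0 :=
  ⟨∑ jl ∈ Finset.HasAntidiagonal.antidiagonal s,
    MvPolynomial.X (Sum.inl jl.1) ^ p ^ 0 * MvPolynomial.X (Sum.inr jl.2) ^ p ^ (0 + jl.1), by
      simp [twistedSum]⟩

/-- The coproduct polynomials have integer coefficients. -/
theorem coprodRat_integral (p n : ℕ) [Fact p.Prime] (hn : 0 < n) (s : ℕ) :
    ∃ d : MvPolynomial (ℕ ⊕ ℕ) ℤ, MvPolynomial.map (Int.castRingHom ℚ) d = coprodRat p n s := by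
  induction s using Nat.strong_induction_on with
  | _ s ih =>
  have hs := coprodRat_spec p n s
  rw [Finset.sum_range_succ', Finset.sum_range_succ' _ s] at hs
  simp only [logCoeff_zero, map_one, one_mul, Nat.sub_zero, pow_zero, pow_one] at hs
  obtain ⟨r, hr⟩ := twistedSum_zero_integral p s
  have hlt : ∀ i, i + 1 < n → logCoeff p n (i + 1) = 0 := fun i hi => by
    rw [logCoeff, if_neg (Nat.not_dvd_of_pos_of_lt (Nat.succ_pos i) hi)]
  -- the terms of positive index together are integral
  suffices h : ∃ c : MvPolynomial (ℕ ⊕ ℕ) ℤ, MvPolynomial.map (Int.castRingHom ℚ) c =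
      ∑ i ∈ Finset.range s, MvPolynomial.C (logCoeff p n (i + 1)) *
        (twistedSum p (s - (i + 1)) (i + 1) - coprodRat p n (s - (i + 1)) ^ p ^ (i + 1)) by
    obtain ⟨c, hc⟩ := h
    refine ⟨r + c, ?_⟩
    simp only [mul_sub, Finset.sum_sub_distrib] at hc
    rw [map_add, hr, hc]
    linear_combination -hs
  rcases lt_or_ge s n with hsn | hsn
  · refine ⟨0, ?_⟩
    rw [map_zero, Finset.sum_eq_zero]
    intro i hi
    rw [hlt i (by have := Finset.mem_range.1 hi; omega)]
    simp
  · obtain ⟨a, rfl⟩ := Nat.exists_eq_add_of_le' hsn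
    -- discard the terms with `i + 1 < n`
    have e : ∑ i ∈ Finset.range (a + n), MvPolynomial.C (logCoeff p n (i + 1)) *
          (twistedSum p (a + n - (i + 1)) (i + 1) -
            coprodRat p n (a + n - (i + 1)) ^ p ^ (i + 1)) =
        ∑ i ∈ Finset.range (a + 1), MvPolynomial.C (logCoeff p n (i + n)) *
          (twistedSum p (a - i) (i + n) - coprodRat p n (a - i) ^ p ^ (i + n)) := by
      rw [show a + n = (n - 1) + (a + 1) by omega, Finset.sum_range_add, Finset.sum_eq_zero,
        zero_add]
      · refine Finset.sum_congr rfl fun i _ => ?_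
        rw [show n - 1 + i + 1 = i + n by omega, show n - 1 + (a + 1) - (i + n) = a - i by omega]
      · intro i hi
        rw [hlt i (by have := Finset.mem_range.1 hi; omega)]
        simp
    rw [e]
    have key : ∑ i ∈ Finset.range (a + 1), MvPolynomial.C (logCoeff p n (i + n)) *
          twistedSum p (a - i) (i + n) =
        ∑ i ∈ Finset.range (a + 1), MvPolynomial.C (logCoeff p n (i + n)) *
          MvPolynomial.expand (p ^ n) (coprodRat p n (a - i)) ^ p ^ i := by
      have h := congrArg (fun f => MvPolynomial.C (p : ℚ)⁻¹ * MvPolynomial.expand (p ^ n) f)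
        (coprodRat_spec p n a)
      simp only [map_sum, map_mul, map_pow, MvPolynomial.expand_C, expand_twistedSum,
        Finset.mul_sum] at h
      simp only [logCoeff_add p n _ hn, map_mul, mul_assoc]
      exact h.symm
    choose! d hd using ih
    choose c hc using fun i => logCoeff_mul_integral p n hn i (d (a - i))
    refine ⟨∑ i ∈ Finset.range (a + 1), c i, ?_⟩
    simp only [mul_sub, Finset.sum_sub_distrib]
    rw [key, ← Finset.sum_sub_distrib, map_sum]
    refine Finset.sum_congr rfl fun i _ => ?_
    rw [hc, map_sub, map_pow, map_pow, MvPolynomial.map_expand, hd _ (by omega), mul_sub]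

/-- The coproduct polynomials, with integer coefficients. -/
def coprodInt (p n s : ℕ) : MvPolynomial (ℕ ⊕ ℕ) ℤ :=
  .ofCoeff <| .mapRange Rat.num (Rat.num_intCast 0) <| AddMonoidAlgebra.coeff <| coprodRat p n s

theorem map_coprodInt (p n : ℕ) [Fact p.Prime] (hn : 0 < n) (s : ℕ) :
    MvPolynomial.map (Int.castRingHom ℚ) (coprodInt p n s) = coprodRat p n s := by
  rw [coprodInt, MvPolynomial.map_mapRange_eq_iff]
  intro c
  obtain ⟨d, hd⟩ := coprodRat_integral p n hn s
  rw [← hd, MvPolynomial.coeff_map]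
  simp

/-- The ideal generated by the `t_s^{p^n} - t_s`, `s ≥ k`. -/
def relIdeal (p n k : ℕ) : Ideal (MvPolynomial {s : ℕ // k ≤ s} (ZMod p)) :=
  Ideal.span (Set.range fun s => MvPolynomial.X s ^ p ^ n - MvPolynomial.X s)

/-- The algebra `S(n,k) = Z/p[t_k, t_{k+1}, …] / (t_s^{p^n} - t_s)`. -/
def S (p n k : ℕ) : Type := MvPolynomial {s : ℕ // k ≤ s} (ZMod p) ⧸ relIdeal p n k

instance (p n k : ℕ) : CommRing (S p n k) :=
  inferInstanceAs (CommRing (MvPolynomial {s : ℕ // k ≤ s} (ZMod p) ⧸ relIdeal p n k))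

instance (p n k : ℕ) : Algebra (ZMod p) (S p n k) :=
  inferInstanceAs (Algebra (ZMod p) (MvPolynomial {s : ℕ // k ≤ s} (ZMod p) ⧸ relIdeal p n k))

/-- The quotient map `Z/p[t_k, t_{k+1}, …] → S(n,k)`. -/
def S.mk (p n k : ℕ) : MvPolynomial {s : ℕ // k ≤ s} (ZMod p) →ₐ[ZMod p] S p n k :=
  Ideal.Quotient.mkₐ (ZMod p) (relIdeal p n k)

/-- The image of `t_s` in `S(n,k)`, for `k ≥ 1`: `t_0 = 1`, and `t_s = 0` for `0 < s < k`. -/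
def t (p n k s : ℕ) : S p n k :=
  if h : k ≤ s then S.mk p n k (MvPolynomial.X ⟨s, h⟩) else if s = 0 then 1 else 0

/-- The monomial `∏ t_s^{e_s}`. -/
def mono (p n k : ℕ) (e : {s : ℕ // k ≤ s} →₀ ℕ) : S p n k :=
  S.mk p n k (MvPolynomial.monomial e 1)

/-- `Δ(t_s)` in `S(n,k) ⊗ S(n,k)`. -/
def comulT (p n k s : ℕ) : S p n k ⊗[ZMod p] S p n k :=
  MvPolynomial.aeval
    (Sum.elim (fun j => t p n k j ⊗ₜ[ZMod p] (1 : S p n k))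
      (fun j => (1 : S p n k) ⊗ₜ[ZMod p] t p n k j))
    (MvPolynomial.map (Int.castRingHom (ZMod p)) (coprodInt p n s))

theorem t_pow (p n k s : ℕ) [Fact p.Prime] : t p n k s ^ p ^ n = t p n k s := by
  have hp : p ^ n ≠ 0 := pow_ne_zero _ (Fact.out : p.Prime).ne_zero
  unfold t
  split_ifs with h h0
  · rw [← map_pow]
    refine Ideal.Quotient.eq.2 ?_
    exact Ideal.subset_span ⟨⟨s, h⟩, rfl⟩
  · simp
  · exact zero_pow hp

theorem aeval_expand_eq {σ R A : Type*} [CommRing R] [CommRing A] [Algebra R A] (q : ℕ)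
    (g : σ → A) (f : MvPolynomial σ R) :
    MvPolynomial.aeval g (MvPolynomial.expand q f) = MvPolynomial.aeval (fun i => g i ^ q) f := by
  induction f using MvPolynomial.induction_on with
  | C r => simp [MvPolynomial.algebraMap_eq]
  | add a b ha hb => simp only [map_add, ha, hb]
  | mul_X a i ha => simp only [map_mul, ha, MvPolynomial.expand_X, map_pow, MvPolynomial.aeval_X]

theorem comulT_pow (p n k s : ℕ) [Fact p.Prime] : comulT p n k s ^ p ^ n = comulT p n k s := by
  unfold comulT
  rw [← map_pow, ← expand_pow_zmod, aeval_expand_eq]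
  congr 2
  funext j
  rcases j with j | j <;>
    simp [Algebra.TensorProduct.tmul_pow, t_pow]

/-- The algebra map out of `S(n,k)` that sends `t_s` to `f s`. -/
def S.lift (p n k : ℕ) {A : Type*} [CommRing A] [Algebra (ZMod p) A]
    (f : {s : ℕ // k ≤ s} → A) (hf : ∀ s, f s ^ p ^ n = f s) : S p n k →ₐ[ZMod p] A :=
  Ideal.Quotient.liftₐ (relIdeal p n k) (MvPolynomial.aeval f) (by
    intro a ha
    have h : relIdeal p n k ≤ RingHom.ker (MvPolynomial.aeval (R := ZMod p) f) := by
      refine Ideal.span_le.2 ?_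
      rintro _ ⟨s, rfl⟩
      simp [RingHom.mem_ker, hf]
    exact h ha)

/-- The coproduct of `S(n,k)`. -/
def comul (p n k : ℕ) [Fact p.Prime] : S p n k →ₐ[ZMod p] S p n k ⊗[ZMod p] S p n k :=
  S.lift p n k (fun s => comulT p n k s) fun s => comulT_pow p n k s

/-- The augmentation of `S(n,k)`, with `ε(t_s) = 0` for all `s ≥ k`. -/
def counit (p n k : ℕ) [Fact p.Prime] : S p n k →ₐ[ZMod p] ZMod p :=
  S.lift p n k (fun _ => 0) fun _ => zero_pow (pow_ne_zero _ (Fact.out : p.Prime).ne_zero)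

/-! ### The cobar complex -/

section Skew

variable {R A : Type*} [CommRing R] [Ring A] [Algebra R A]

/-- The matrix `((-a, δ), (0, a))`.  The upper right entry of a product of such matrices is the
value of the antiderivation that sends each `a` to the corresponding `δ`. -/
def skewMatrix (a δ : A) : Matrix (Fin 2) (Fin 2) A := !![-a, δ; 0, a]

/-- `skewMatrix` as a linear map. -/
def skewLin {V : Type*} [AddCommGroup V] [Module R V] (i δ : V →ₗ[R] A) :
    V →ₗ[R] Matrix (Fin 2) (Fin 2) A where
  toFun v := skewMatrix (i v) (δ v)
  map_add' v w := by
    ext a b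
    fin_cases a <;> fin_cases b <;> simp [skewMatrix, add_comm]
  map_smul' r v := by
    ext a b
    fin_cases a <;> fin_cases b <;> simp [skewMatrix]

end Skew

/-- The augmentation ideal `S̄(n,k) = Ker ε`. -/
abbrev Aug (p n k : ℕ) [Fact p.Prime] : Submodule (ZMod p) (S p n k) := LinearMap.ker (counit p n k).toLinearMap

/-- The projection `a ↦ a - ε(a)` of `S(n,k)` onto `S̄(n,k)`. -/
def bar (p n k : ℕ) [Fact p.Prime] : S p n k →ₗ[ZMod p] Aug p n k :=
  LinearMap.codRestrict _ (LinearMap.id - (Algebra.linearMap (ZMod p) (S p n k)) ∘ₗ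
    (counit p n k).toLinearMap) (by intro a; simp)

/-- `⨁_s ⊗^s S̄(n,k)`, with juxtaposition as its product. -/
abbrev Cobar (p n k : ℕ) [Fact p.Prime] : Type := TensorAlgebra (ZMod p) (Aug p n k)

/-- The one-letter element `[a]` of the cobar complex; for a general `a` it means `[a - ε(a)]`. -/
def cell (p n k : ℕ) [Fact p.Prime] : S p n k →ₗ[ZMod p] Cobar p n k := TensorAlgebra.ι (ZMod p) ∘ₗ bar p n k

/-- `a ⊗ b ↦ [a|b]`. -/
def cell₂ (p n k : ℕ) [Fact p.Prime] : S p n k ⊗[ZMod p] S p n k →ₗ[ZMod p] Cobar p n k :=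
  TensorProduct.lift ((LinearMap.mul (ZMod p) (Cobar p n k)).compl₁₂ (cell p n k) (cell p n k))

/-- `a ↦ Δ(a) - a ⊗ 1 - 1 ⊗ a`. -/
def redComul (p n k : ℕ) [Fact p.Prime] : S p n k →ₗ[ZMod p] S p n k ⊗[ZMod p] S p n k :=
  (comul p n k).toLinearMap
    - (TensorProduct.mk (ZMod p) (S p n k) (S p n k)).flip 1
    - TensorProduct.mk (ZMod p) (S p n k) (S p n k) 1

/-- The algebra map whose upper right entry is the cobar differential. -/
def cobarHom (p n k : ℕ) [Fact p.Prime] : Cobar p n k →ₐ[ZMod p] Matrix (Fin 2) (Fin 2) (Cobar p n k) :=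
  TensorAlgebra.lift (ZMod p) (skewLin (TensorAlgebra.ι (ZMod p))
    (-(cell₂ p n k ∘ₗ redComul p n k ∘ₗ (Aug p n k).subtype)))

/-- The cobar differential
`d[a₁|…|a_s] = ∑ (-1)^i [a₁|…|Δ(a_i) - a_i ⊗ 1 - 1 ⊗ a_i|…|a_s]`. -/
def cobarD (p n k : ℕ) [Fact p.Prime] : Cobar p n k →ₗ[ZMod p] Cobar p n k where
  toFun x := cobarHom p n k x 0 1
  map_add' x y := by simp
  map_smul' r x := by simp

theorem cobarHom_one_one (p n k : ℕ) [Fact p.Prime] (x : Cobar p n k) :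
    cobarHom p n k x 1 0 = 0 ∧ cobarHom p n k x 1 1 = x := by
  induction x using TensorAlgebra.induction with
  | algebraMap r => simp [Matrix.algebraMap_matrix_apply]
  | ι a => simp [cobarHom, skewLin, skewMatrix]
  | mul x y hx hy => simp [Matrix.mul_apply, Fin.sum_univ_two, hx, hy]
  | add x y hx hy => simp [hx, hy]

theorem cobarD_one (p n k : ℕ) [Fact p.Prime] : cobarD p n k 1 = 0 := by simp [cobarD]

theorem cobarD_ι_mul (p n k : ℕ) [Fact p.Prime] (a : Aug p n k) (y : Cobar p n k) :
    cobarD p n k (TensorAlgebra.ι (ZMod p) a * y) =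
      -cell₂ p n k (redComul p n k a) * y - TensorAlgebra.ι (ZMod p) a * cobarD p n k y := by
  have h := (cobarHom_one_one p n k y).2
  simp [cobarD, Matrix.mul_apply, Fin.sum_univ_two, h]
  simp [cobarHom, skewLin, skewMatrix]
  abel

/-- `C^s = ⊗^s S̄(n,k)`. -/
def cobarC (p n k : ℕ) [Fact p.Prime] (s : ℕ) : Submodule (ZMod p) (Cobar p n k) :=
  LinearMap.range (TensorAlgebra.ι (ZMod p) (M := Aug p n k)) ^ s

/-- The cocycles in `C^s`. -/
def cocycles (p n k : ℕ) [Fact p.Prime] (s : ℕ) : Submodule (ZMod p) (Cobar p n k) :=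
  cobarC p n k s ⊓ LinearMap.ker (cobarD p n k)

/-- The coboundaries in `C^s`. -/
def coboundaries (p n k : ℕ) [Fact p.Prime] : ℕ → Submodule (ZMod p) (Cobar p n k)
  | 0 => ⊥
  | s + 1 => (cobarC p n k s).map (cobarD p n k)

/-- `H^s S(n,k) = Ext^s_{S(n,k)}(Z/p, Z/p)`, the cohomology of the cobar complex. -/
abbrev H (p n k : ℕ) [Fact p.Prime] (s : ℕ) : Type :=
  ↥(cocycles p n k s) ⧸ (coboundaries p n k s).submoduleOf (cocycles p n k s)

/-! ### The May filtration and the May spectral sequence -/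

/-- The May filtration `M(t_s^{p^j})`.  Its defining recursion
`M(t_s^{p^j}) = max (2s-1) (p M(t_{s-n}^{p^{j+n-1}}) + 1)` makes it independent of `j`. -/
def mayM (p n k : ℕ) (s : ℕ) : ℕ :=
  if _h : 0 < n ∧ n + k ≤ s then max (2 * s - 1) (p * mayM p n k (s - n) + 1) else 2 * s - 1
termination_by s
decreasing_by omega

/-- The May filtration of the monomial `∏ t_s^{e_s}`, from the `p`-adic digits of the `e_s`. -/
def mayWeight (p n k : ℕ) (e : {s : ℕ // k ≤ s} →₀ ℕ) : ℕ :=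
  e.sum fun s a => mayM p n k s * (Nat.digits p a).sum

/-- `F^M C^s`: the span of the `[a₁|…|a_s]`, where the `a_i ≠ 1` are monomials of the standard basis
of `S(n,k)` (all exponents less than `p^n`) with `∑ M(a_i) ≤ M`. -/
def mayF (p n k : ℕ) [Fact p.Prime] (s : ℕ) (M : ℤ) : Submodule (ZMod p) (Cobar p n k) :=
  Submodule.span (ZMod p) {x | ∃ e : Fin s → ({s : ℕ // k ≤ s} →₀ ℕ),
    (∀ i, e i ≠ 0 ∧ ∀ u, e i u < p ^ n) ∧ ∑ i, (mayWeight p n k (e i) : ℤ) ≤ M ∧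
      x = (List.ofFn fun i => cell p n k (mono p n k (e i))).prod}

/-- `Z_r^{s,M} = {x ∈ F^M C^s : d x ∈ F^{M-r} C^{s+1}}`. -/
def mayZ (p n k : ℕ) [Fact p.Prime] (r : ℤ) (s : ℕ) (M : ℤ) : Submodule (ZMod p) (Cobar p n k) :=
  mayF p n k s M ⊓ (mayF p n k (s + 1) (M - r)).comap (cobarD p n k)

/-- `B_r^{s,M} = Z_{r-1}^{s,M-1} + d Z_{r-1}^{s-1,M+r-1}`. -/
def mayB (p n k : ℕ) [Fact p.Prime] (r : ℤ) : ℕ → ℤ → Submodule (ZMod p) (Cobar p n k)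
  | 0, M => mayZ p n k (r - 1) 0 (M - 1)
  | s + 1, M => mayZ p n k (r - 1) (s + 1) (M - 1) ⊔
      (mayZ p n k (r - 1) s (M + r - 1)).map (cobarD p n k)

/-- `E_r^{s,M} = Z_r^{s,M} / B_r^{s,M}`, for `r ≥ 1`: the `E_r`-term of the spectral sequence of
the filtered complex `C^*`, so of the May spectral sequence, with `d_r : E_r^{s,M} → E_r^{s+1,M-r}`.
The internal degree is not displayed. -/
abbrev mayE (p n k : ℕ) [Fact p.Prime] (r : ℤ) (s : ℕ) (M : ℤ) : Type :=
  ↥(mayZ p n k r s M) ⧸ (mayB p n k r s M).submoduleOf (mayZ p n k r s M)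

/-! ### The exterior algebra `E[h_{i,j} | k ≤ i ≤ n+k-1, j ∈ Z/n]` -/

/-- The indices `(i, j)` with `k ≤ i ≤ n+k-1` and `j ∈ Z/n`. -/
abbrev Idx (n k : ℕ) : Type := {i : ℕ // k ≤ i ∧ i < n + k} × ZMod n

/-- The exterior algebra over `Z/p` on generators `h_{i,j}` with `(i, j)` in `Idx n k`. -/
abbrev Ext (p n k : ℕ) : Type := ExteriorAlgebra (ZMod p) (Idx n k →₀ ZMod p)

/-- The generator `h_{i,j}`; it is only used for `k ≤ i ≤ n+k-1`. -/
def h (p n k i : ℕ) (j : ZMod n) : Ext p n k :=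
  if hi : k ≤ i ∧ i < n + k then ExteriorAlgebra.ι (ZMod p) (Finsupp.single (⟨i, hi⟩, j) 1) else 0

/-- The linear map with `h_{i,j} ↦ - ∑_{k ≤ m ≤ i-k} h_{m,j} h_{i-m,j+m}`. -/
def extDGen (p n k : ℕ) : (Idx n k →₀ ZMod p) →ₗ[ZMod p] Ext p n k :=
  Finsupp.linearCombination (ZMod p) fun g : Idx n k =>
    -∑ m ∈ Finset.Icc k (g.1 - k), h p n k m g.2 * h p n k (g.1 - m) (g.2 + m)

theorem ι_mul_h (p n k i : ℕ) (j : ZMod n) (v : Idx n k →₀ ZMod p) :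
    ExteriorAlgebra.ι (ZMod p) v * h p n k i j =
      -(h p n k i j * ExteriorAlgebra.ι (ZMod p) v) := by
  unfold h
  split_ifs
  · exact eq_neg_of_add_eq_zero_left (ExteriorAlgebra.ι_add_mul_swap v _)
  · simp

theorem extDGen_comm (p n k : ℕ) (u v : Idx n k →₀ ZMod p) :
    extDGen p n k u * ExteriorAlgebra.ι (ZMod p) v =
      ExteriorAlgebra.ι (ZMod p) v * extDGen p n k u := by
  unfold extDGen
  induction u using Finsupp.induction_linear with
  | zero => simp
  | add a b ha hb => rw [map_add, add_mul, mul_add, ha, hb]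
  | single g r =>
    rw [Finsupp.linearCombination_single, smul_mul_assoc, mul_smul_comm, neg_mul, mul_neg,
      Finset.sum_mul, Finset.mul_sum]
    congr 2
    refine Finset.sum_congr rfl fun m _ => ?_
    rw [← mul_assoc, ι_mul_h, neg_mul, mul_assoc, mul_assoc, ι_mul_h, mul_neg, neg_neg]

/-- The algebra map whose upper right entry is `d₁`. -/
def extHom (p n k : ℕ) : Ext p n k →ₐ[ZMod p] Matrix (Fin 2) (Fin 2) (Ext p n k) :=
  ExteriorAlgebra.lift (ZMod p)
    ⟨skewLin (ExteriorAlgebra.ι (ZMod p)) (extDGen p n k), by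
      intro v
      ext a b
      fin_cases a <;> fin_cases b <;>
        simp [skewLin, skewMatrix, Matrix.mul_apply, Fin.sum_univ_two, extDGen_comm]⟩

/-- The differential `d₁`: the antiderivation of the exterior algebra with
`d₁ h_{i,j} = - ∑_{k ≤ m ≤ i-k} h_{m,j} h_{i-m,j+m}`. -/
def extD (p n k : ℕ) : Ext p n k →ₗ[ZMod p] Ext p n k where
  toFun x := extHom p n k x 0 1
  map_add' x y := by simp
  map_smul' r x := by simp

theorem extHom_one_one (p n k : ℕ) (x : Ext p n k) :
    extHom p n k x 1 0 = 0 ∧ extHom p n k x 1 1 = x := by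
  induction x using ExteriorAlgebra.induction with
  | algebraMap r => simp [Matrix.algebraMap_matrix_apply]
  | ι a => simp [extHom, skewLin, skewMatrix]
  | mul x y hx hy => simp [Matrix.mul_apply, Fin.sum_univ_two, hx, hy]
  | add x y hx hy => simp [hx, hy]

theorem extD_one (p n k : ℕ) : extD p n k 1 = 0 := by simp [extD]

theorem extD_ι_mul (p n k : ℕ) (v : Idx n k →₀ ZMod p) (y : Ext p n k) :
    extD p n k (ExteriorAlgebra.ι (ZMod p) v * y) =
      extDGen p n k v * y - ExteriorAlgebra.ι (ZMod p) v * extD p n k y := by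
  have h := (extHom_one_one p n k y).2
  simp [extD, Matrix.mul_apply, Fin.sum_univ_two, h]
  simp [extHom, skewLin, skewMatrix]
  abel

/-- The May filtration `∑ (2 i_a - 1)` of the word `h_{i_1,j_1} ⋯ h_{i_s,j_s}`. -/
def wordWeight {n k s : ℕ} (g : Fin s → Idx n k) : ℤ := ∑ a, (2 * ((g a).1 : ℤ) - 1)

/-- The product `h_{i_1,j_1} ⋯ h_{i_s,j_s}` in the exterior algebra. -/
def extWord (p : ℕ) {n k s : ℕ} (g : Fin s → Idx n k) : Ext p n k :=
  (List.ofFn fun a => h p n k (g a).1 (g a).2).prod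

/-- The element `[t_{i_1}^{p^{j_1}}|…|t_{i_s}^{p^{j_s}}]` of the cobar complex. -/
def cobarWord (p : ℕ) [Fact p.Prime] {n k s : ℕ} (g : Fin s → Idx n k) : Cobar p n k :=
  (List.ofFn fun a => cell p n k (t p n k (g a).1 ^ p ^ (g a).2.val)).prod

/-- The part of the exterior algebra of homological degree `s` and May filtration `M`. -/
def extPart (p n k s : ℕ) (M : ℤ) : Submodule (ZMod p) (Ext p n k) :=
  Submodule.span (ZMod p) {x | ∃ g : Fin s → Idx n k, wordWeight g = M ∧ x = extWord p g}

/-- The `d₁`-cocycles of bidegree `(s, M)`. -/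
def extZ (p n k s : ℕ) (M : ℤ) : Submodule (ZMod p) (Ext p n k) :=
  extPart p n k s M ⊓ LinearMap.ker (extD p n k)

/-- The `d₁`-coboundaries of bidegree `(s, M)`; `d₁` lowers the May filtration by `1`. -/
def extB (p n k : ℕ) : ℕ → ℤ → Submodule (ZMod p) (Ext p n k)
  | 0, _ => ⊥
  | s + 1, M => (extPart p n k s (M + 1)).map (extD p n k)

/-- The cohomology of `(E[h_{i,j} | k ≤ i ≤ n+k-1, j ∈ Z/n], d₁)` in bidegree `(s, M)`. -/
abbrev extH (p n k s : ℕ) (M : ℤ) : Type :=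
  ↥(extZ p n k s M) ⧸ (extB p n k s M).submoduleOf (extZ p n k s M)

end Morava

end

/-!
# The May spectral sequence of `S(n,k)`

For `g = (s, j)` write `t_g = t_s^{p^j}`. The divided powers `γ_a = ∏ t_g^{a_g} / a_g!` with
`0 ≤ a_g < p` form a basis of `S(n,k)`, and the May filtration is chosen so that
`Δ(γ_a) ≡ ∑_{b+c=a} γ_b ⊗ γ_c` modulo lower filtration (`comul_gam_sub_mem`). The leading part of
the cobar complex is therefore the cobar complex of a tensor product of truncated divided power
coalgebras, one for each `g`. The numerical hypothesis forces `p` to be odd, so that its cohomology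
is `E[h_g] ⊗ P[b_g]`. The proof uses the twisting cochain `τ` with `τ(γ_{δ_g}) = h_g` and
`τ(γ_{(p-1)δ_g}) = b_g ∂_g`, with values in the operators on `E[h_g] ⊗ P[b_g]`. The product of its
values along a word defines the symbol `rhoM` of a cochain. The twisted tensor product of the
coalgebra with `E[h_g] ⊗ P[b_g]` is acyclic (`exists_eq_twD_add`), and a chase in a double complex
shows that a leading cycle with zero symbol is a leading boundary (`exists_sub_cobarD_mem`).

The first differential on symbols comes from the part of the coproduct that is exactly one step
lower in filtration. For `s < n + k` one has `Δ(t_s) = ∑ t_m ⊗ t_{s-m}^{p^m}`, which gives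
`h_{s,j} ↦ -∑ h_{m,j} h_{s-m,j+m}`. The numerical hypothesis yields `2s ≤ p (2(s-n)-1) + 1`, and so
`M(t_s) = p M(t_{s-n}) + 1`, for all `s ≥ n + k`. For such `s` the sum above has lower filtration,
and the leading term of `Δ(t_s) - t_s ⊗ 1 - 1 ⊗ t_s` is, up to a Frobenius twist,
`-∑ p⁻¹ C(p,i) t_{s-n}^i ⊗ t_{s-n}^{p-i}` over `0 < i < p` (`comulT_leading`); so
`h_{s+n,j+1} ↦ -b_{s,j}`. Hence the `b_{s,j}` cancel against the `h_{s+n,j+1}` (`exists_eq_symD`),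
and what remains is the exterior algebra on the `h_{i,j}` with `k ≤ i < n + k`. Projecting the
symbol of a cycle onto this exterior algebra gives the isomorphism with the `E₂`-term
(`mem_mayB_of_extSymbol`, `exists_mem_mayZ`).

Two facts about the coproduct need separate arguments. Its leading terms are read off from the
recursion for the coproduct polynomials over `ℚ` by means of a Gauss norm that combines the `p`-adic
norm with the May weight of a monomial (`gaussLE_coprod_sub`, `coD_leading`). Its coassociativity,
which makes the cobar complex a complex, holds because the recursion describes, through Teichmüller
representatives in Witt vectors, the product in the ring of twisted power series in `S` modulo
`S^n - p` (`coVal_assoc`).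

The exterior algebra has `n²` generators, so the `E₂`-term vanishes in degrees above `n²`, and also
in filtrations above that of the product of all generators. Induction on the filtration then gives
the vanishing of the cohomology above degree `n²`. The product of all generators lifts to a cocycle,
which is not a coboundary because the exterior algebra vanishes in all higher filtrations.
-/

set_option linter.unusedSectionVars false

noncomputable section
namespace Morava

/-! ### Arithmetic of the May weights -/

/-- The numerical hypothesis of the theorem, with the denominator cleared. -/
structure Admissible (p n k : ℕ) : Prop where
  one_le : 1 ≤ k
  le : k ≤ n
  bound : 2 * p * n + p ≤ 2 * (p - 1) * (n + k - 1) + 2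

theorem admissible_of_le {p n k : ℕ} [Fact p.Prime] (hk : 1 ≤ k) (hkn : k ≤ n)
    (h : (2 * p * n + p - 2 : ℚ) / (2 * (p - 1)) ≤ n + k - 1) : Admissible p n k := by
  refine ⟨hk, hkn, ?_⟩
  have hp : 2 ≤ p := (Fact.out : p.Prime).two_le
  have hp' : (2 : ℚ) ≤ p := by exact_mod_cast hp
  rw [div_le_iff₀ (by linarith)] at h
  have : ((2 * p * n + p : ℕ) : ℚ) ≤ ((2 * (p - 1) * (n + k - 1) + 2 : ℕ) : ℚ) := by
    push_cast [Nat.cast_sub (show 1 ≤ p by omega), Nat.cast_sub (show 1 ≤ n + k by omega)]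
    linarith
  exact_mod_cast this

/-- For `p = 2` the numerical hypothesis reads `n + 1 ≤ k`, against `k ≤ n`. -/
theorem Admissible.three_le {p n k : ℕ} [Fact p.Prime] (H : Admissible p n k) : 3 ≤ p := by
  have hp : 2 ≤ p := (Fact.out : p.Prime).two_le
  by_contra h
  obtain rfl : p = 2 := by omega
  have := H.bound; have := H.le; have := H.one_le
  omega

theorem Admissible.n_pos {p n k : ℕ} (H : Admissible p n k) : 0 < n :=
  lt_of_lt_of_le H.one_le H.le

theorem mayM_of_lt {p n k s : ℕ} (h : s < n + k) : mayM p n k s = 2 * s - 1 := by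
  rw [mayM, dif_neg (by omega)]

theorem le_mayM (p n k s : ℕ) : 2 * s - 1 ≤ mayM p n k s := by
  rw [mayM]; split_ifs
  · exact le_max_left _ _
  · exact le_rfl

theorem self_le_mayM (p n k s : ℕ) : s ≤ mayM p n k s := by
  have := le_mayM p n k s
  omega

variable {p n k : ℕ} [Fact p.Prime]

theorem Admissible.two_mul_le (H : Admissible p n k) {s : ℕ} (h : n + k ≤ s) :
    2 * s ≤ p * (2 * (s - n) - 1) + 1 := by
  have h3 := H.three_le
  have h1 := H.one_le
  have hb := H.bound
  obtain ⟨q, rfl⟩ : ∃ q, p = q + 1 := ⟨p - 1, by omega⟩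
  obtain ⟨m, rfl⟩ : ∃ m, s = n + k + m := ⟨s - (n + k), by omega⟩
  obtain ⟨r, rfl⟩ : ∃ r, k = r + 1 := ⟨k - 1, by omega⟩
  simp only [Nat.add_sub_cancel, show n + (r + 1) - 1 = n + r by omega,
    show 2 * (n + (r + 1) + m - n) - 1 = 2 * r + 2 * m + 1 by omega] at hb ⊢
  nlinarith

/-- Under the numerical hypothesis the maximum in the recursion for `mayM` is its second
argument. -/
theorem Admissible.mayM_of_le (H : Admissible p n k) {s : ℕ} (h : n + k ≤ s) :
    mayM p n k s = p * mayM p n k (s - n) + 1 := by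
  rw [mayM, dif_pos ⟨H.n_pos, h⟩, max_eq_right]
  have h2 := H.two_mul_le h
  have h3 := Nat.mul_le_mul_left p (le_mayM p n k (s - n))
  omega

theorem Admissible.mayM_add (H : Admissible p n k) (s : ℕ) (h : k ≤ s) :
    mayM p n k (s + n) = p * mayM p n k s + 1 := by
  rw [H.mayM_of_le (by omega), Nat.add_sub_cancel]

theorem Admissible.two_mul_le_mayM (H : Admissible p n k) {s : ℕ} (h : n + k ≤ s) :
    2 * s ≤ mayM p n k s := by
  rw [H.mayM_of_le h]
  have h2 := H.two_mul_le h
  have h3 := Nat.mul_le_mul_left p (le_mayM p n k (s - n))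
  omega

/-- The terms `t_a ⊗ t_b^{p^a}` of the coproduct of `t_{a+b}` lower the filtration by at least `1`,
and by at least `2` if `a + b ≥ n + k`. -/
theorem Admissible.mayM_add_le (H : Admissible p n k) {a b : ℕ} (ha : k ≤ a) (hb : k ≤ b) :
    mayM p n k a + mayM p n k b + 1 ≤ mayM p n k (a + b) ∧
      (n + k ≤ a + b → mayM p n k a + mayM p n k b + 2 ≤ mayM p n k (a + b)) := by
  have h1 := H.one_le
  have h3 := H.three_le
  have hn := H.n_pos
  induction hs : a + b using Nat.strong_induction_on generalizing a b with
  | _ s ih =>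
  subst hs
  -- the case that one index, say `a`, is at least `n + k`
  have key : ∀ {a b : ℕ}, k ≤ a → k ≤ b → n + k ≤ a →
      (∀ m < a + b, ∀ {a b : ℕ}, k ≤ a → k ≤ b → a + b = m →
        mayM p n k a + mayM p n k b + 1 ≤ mayM p n k m ∧
        (n + k ≤ m → mayM p n k a + mayM p n k b + 2 ≤ mayM p n k m)) →
      mayM p n k a + mayM p n k b + 2 ≤ mayM p n k (a + b) := by
    intro a b _ hb h ih
    have := (ih (a + b - n) (by omega) (a := a - n) (b := b) (by omega) hb (by omega)).1
    rw [H.mayM_of_le h, H.mayM_of_le (show n + k ≤ a + b by omega)]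
    nlinarith
  rcases le_or_gt (n + k) a with h | h
  · have := key ha hb h ih
    exact ⟨by omega, fun _ => this⟩
  rcases le_or_gt (n + k) b with h' | h'
  · have := key hb ha h' (by rw [add_comm b a]; exact ih)
    rw [add_comm b a] at this
    exact ⟨by omega, fun _ => by omega⟩
  rw [mayM_of_lt h, mayM_of_lt h']
  have := le_mayM p n k (a + b)
  refine ⟨by omega, fun h'' => ?_⟩
  have := H.two_mul_le_mayM h''
  omega

theorem Admissible.pow_mul_mayM_le (H : Admissible p n k) {a : ℕ} (ha : k ≤ a) (l : ℕ) :
    p ^ (l + 1) * mayM p n k a + 1 ≤ mayM p n k (a + n * (l + 1)) := by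
  have h3 := H.three_le
  induction l with
  | zero => simp [H.mayM_add a ha]
  | succ l ih =>
    rw [show a + n * (l + 1 + 1) = a + n * (l + 1) + n by ring, H.mayM_add _ (by omega), pow_succ]
    nlinarith

/-! ### Digit sums and weighted Gauss norms -/

/-- The sum of the base `p` digits of `e`. -/
def digitSum (p e : ℕ) : ℕ := (Nat.digits p e).sum

theorem digitSum_zero (p : ℕ) : digitSum p 0 = 0 := by simp [digitSum]

theorem digitSum_add_mul {p : ℕ} (hp : 1 < p) {a : ℕ} (ha : a < p) (e : ℕ) :
    digitSum p (a + p * e) = a + digitSum p e := by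
  unfold digitSum
  by_cases h : a ≠ 0 ∨ e ≠ 0
  · rw [Nat.digits_add p hp a e ha h, List.sum_cons]
  · simp only [not_or, not_not] at h
    simp [h.1, h.2]

theorem digitSum_of_lt {p a : ℕ} (hp : 1 < p) (ha : a < p) : digitSum p a = a := by
  simpa [digitSum_zero] using digitSum_add_mul hp ha 0

theorem digitSum_mul {p : ℕ} (hp : 1 < p) (e : ℕ) : digitSum p (p * e) = digitSum p e := by
  simpa using digitSum_add_mul hp (show 0 < p by omega) e

theorem digitSum_pow_mul {p : ℕ} (hp : 1 < p) (m e : ℕ) :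
    digitSum p (p ^ m * e) = digitSum p e := by
  induction m with
  | zero => simp
  | succ m ih => rw [pow_succ', mul_assoc, digitSum_mul hp, ih]

theorem digitSum_succ_le {p : ℕ} (hp : 1 < p) (e : ℕ) : digitSum p (e + 1) ≤ digitSum p e + 1 := by
  induction e using Nat.strong_induction_on with
  | _ e ih =>
  have h0 := Nat.mod_lt e (show 0 < p by omega)
  have h1 := digitSum_add_mul hp h0 (e / p)
  rw [Nat.mod_add_div] at h1
  rcases lt_or_ge (e % p + 1) p with h | h
  · have h2 := digitSum_add_mul hp h (e / p)
    rw [show e % p + 1 + p * (e / p) = e + 1 by have := Nat.mod_add_div e p; omega] at h2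
    omega
  · have h2 := digitSum_mul hp (e / p + 1)
    rw [show p * (e / p + 1) = e + 1 by have := Nat.mod_add_div e p; rw [mul_add]; omega] at h2
    have hep : e ≠ 0 := by
      rintro rfl
      simp at h
      omega
    have := ih (e / p) (Nat.div_lt_self (by omega) hp)
    omega

theorem digitSum_add_le {p : ℕ} (hp : 1 < p) (a b : ℕ) :
    digitSum p (a + b) ≤ digitSum p a + digitSum p b := by
  induction a using Nat.strong_induction_on generalizing b with
  | _ a ih =>
  rcases Nat.eq_zero_or_pos a with rfl | ha
  · simp
  have hp0 : 0 < p := by omega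
  have h1 := digitSum_add_mul hp (Nat.mod_lt a hp0) (a / p)
  have h2 := digitSum_add_mul hp (Nat.mod_lt b hp0) (b / p)
  rw [Nat.mod_add_div] at h1 h2
  have h3 := ih (a / p) (Nat.div_lt_self ha hp) (b / p)
  have ea := Nat.mod_add_div a p
  have eb := Nat.mod_add_div b p
  have la := Nat.mod_lt a hp0
  have lb := Nat.mod_lt b hp0
  rcases lt_or_ge (a % p + b % p) p with h | h
  · have h4 := digitSum_add_mul hp h (a / p + b / p)
    rw [show a % p + b % p + p * (a / p + b / p) = a + b by rw [mul_add]; omega] at h4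
    omega
  · have h4 := digitSum_add_mul hp (show a % p + b % p - p < p by omega) (a / p + b / p + 1)
    rw [show a % p + b % p - p + p * (a / p + b / p + 1) = a + b by
      rw [mul_add, mul_add]; omega] at h4
    have h5 := digitSum_succ_le hp (a / p + b / p)
    omega

section Gauss

variable {σ : Type*} {p : ℕ} [Fact p.Prime]

/-- All coefficients of `P` are `p`-integral. -/
def PInt (p : ℕ) (P : MvPolynomial σ ℚ) : Prop := ∀ X, padicNorm p (P.coeff X) ≤ 1

/-- The bound `|c_X|_p w(X) ≤ M` for all coefficients `c_X` of `P`: the Gauss norm of `P` with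
respect to the `p`-adic norm and the weight function `w` on monomials is at most `M`. -/
def GaussLE (p : ℕ) (w : (σ →₀ ℕ) → ℕ) (M : ℚ) (P : MvPolynomial σ ℚ) : Prop :=
  ∀ X, padicNorm p (P.coeff X) * w X ≤ M

theorem padicNorm_mul_sum_le {ι : Type*} (s : Finset ι) (F : ι → ℚ) (w : ℕ) {M : ℚ} (hM : 0 ≤ M)
    (h : ∀ i ∈ s, padicNorm p (F i) * w ≤ M) : padicNorm p (∑ i ∈ s, F i) * w ≤ M := by
  rcases Nat.eq_zero_or_pos w with rfl | hw
  · simpa using hM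
  have hw' : (0 : ℚ) < w := by exact_mod_cast hw
  rw [← le_div_iff₀ hw']
  exact padicNorm.sum_le' (fun i hi => (le_div_iff₀ hw').2 (h i hi)) (by positivity)

theorem PInt.add {P Q : MvPolynomial σ ℚ} (hP : PInt p P) (hQ : PInt p Q) : PInt p (P + Q) := by
  intro X
  rw [MvPolynomial.coeff_add]
  exact padicNorm.nonarchimedean.trans (max_le (hP X) (hQ X))

theorem PInt.mul {P Q : MvPolynomial σ ℚ} (hP : PInt p P) (hQ : PInt p Q) : PInt p (P * Q) := by
  classical
  intro X
  rw [MvPolynomial.coeff_mul]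
  refine padicNorm.sum_le' (fun i _ => ?_) zero_le_one
  rw [padicNorm.mul]
  exact mul_le_one₀ (hP _) (padicNorm.nonneg _) (hQ _)

theorem PInt.map (P : MvPolynomial σ ℤ) : PInt p (MvPolynomial.map (Int.castRingHom ℚ) P) := by
  intro X
  rw [MvPolynomial.coeff_map]
  exact padicNorm.of_int _

theorem PInt.natCast (c : ℕ) : PInt p (c : MvPolynomial σ ℚ) := by
  simpa using PInt.map (σ := σ) (p := p) (c : MvPolynomial σ ℤ)

theorem PInt.pow {P : MvPolynomial σ ℚ} (hP : PInt p P) (m : ℕ) : PInt p (P ^ m) := by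
  induction m with
  | zero => simpa using PInt.natCast (σ := σ) (p := p) 1
  | succ m ih => rw [pow_succ]; exact ih.mul hP

variable {w : (σ →₀ ℕ) → ℕ} {M N : ℚ} {P Q : MvPolynomial σ ℚ}

theorem GaussLE.mono (h : GaussLE p w M P) (hMN : M ≤ N) : GaussLE p w N P :=
  fun X => (h X).trans hMN

theorem GaussLE.sum {ι : Type*} (s : Finset ι) {F : ι → MvPolynomial σ ℚ} (hM : 0 ≤ M)
    (h : ∀ i ∈ s, GaussLE p w M (F i)) : GaussLE p w M (∑ i ∈ s, F i) := by
  intro X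
  rw [MvPolynomial.coeff_sum]
  exact padicNorm_mul_sum_le s _ _ hM fun i hi => h i hi X

theorem GaussLE.nonneg (h : GaussLE p w M P) : 0 ≤ M :=
  le_trans (mul_nonneg (padicNorm.nonneg _) (Nat.cast_nonneg _)) (h 0)

theorem GaussLE.add (hP : GaussLE p w M P) (hQ : GaussLE p w M Q) : GaussLE p w M (P + Q) := by
  have := GaussLE.sum (p := p) (w := w) Finset.univ (F := ![P, Q]) hP.nonneg
    (by intro i _; fin_cases i <;> assumption)
  simpa using this

theorem GaussLE.neg (hP : GaussLE p w M P) : GaussLE p w M (-P) := by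
  intro X
  rw [MvPolynomial.coeff_neg, padicNorm.neg]
  exact hP X

theorem GaussLE.sub (hP : GaussLE p w M P) (hQ : GaussLE p w M Q) : GaussLE p w M (P - Q) := by
  rw [sub_eq_add_neg]
  exact hP.add hQ.neg

theorem GaussLE.zero (hM : 0 ≤ M) : GaussLE p w M (0 : MvPolynomial σ ℚ) := by
  intro X
  simpa using hM

theorem GaussLE.C_mul (c : ℚ) {r : ℚ} (hc : padicNorm p c ≤ r) (hP : GaussLE p w M P) :
    GaussLE p w (r * M) (MvPolynomial.C c * P) := by
  intro X
  rw [MvPolynomial.coeff_C_mul, padicNorm.mul, mul_assoc]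
  exact mul_le_mul hc (hP X) (mul_nonneg (padicNorm.nonneg _) (Nat.cast_nonneg _))
    ((padicNorm.nonneg _).trans hc)

theorem GaussLE.mul_natCast (hP : GaussLE p w M P) (c : ℕ) : GaussLE p w M (P * c) := by
  have := hP.C_mul (c : ℚ) (r := 1) (padicNorm.of_nat c)
  rwa [one_mul, map_natCast, mul_comm] at this

theorem GaussLE.monomial {X : σ →₀ ℕ} {c : ℚ} (h : padicNorm p c * w X ≤ M) (hM : 0 ≤ M) :
    GaussLE p w M (MvPolynomial.monomial X c) := by
  classical
  intro Y
  rw [MvPolynomial.coeff_monomial]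
  split_ifs with e
  · rwa [← e]
  · simpa using hM

/-- A weight on monomials that is subadditive and does not increase under `p`-th powers. -/
structure FrobWeight (p : ℕ) (w : (σ →₀ ℕ) → ℕ) : Prop where
  zero : w 0 = 0
  add_le : ∀ X Y, w (X + Y) ≤ w X + w Y
  smul_le : ∀ X, w (p • X) ≤ w X

theorem GaussLE.mul (hw : FrobWeight p w) (iP : PInt p P) (iQ : PInt p Q) (hP : GaussLE p w M P)
    (hQ : GaussLE p w N Q) : GaussLE p w (M + N) (P * Q) := by
  classical
  intro X
  rw [MvPolynomial.coeff_mul]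
  refine padicNorm_mul_sum_le _ _ _ (add_nonneg hP.nonneg hQ.nonneg) fun i hi => ?_
  rw [padicNorm.mul, ← Finset.HasAntidiagonal.mem_antidiagonal.1 hi]
  have h1 : (w (i.1 + i.2) : ℚ) ≤ w i.1 + w i.2 := by exact_mod_cast hw.add_le _ _
  have a0 := padicNorm.nonneg (p := p) (P.coeff i.1)
  have b0 := padicNorm.nonneg (p := p) (Q.coeff i.2)
  have a1 := iP i.1
  have b1 := iQ i.2
  have a2 := hP i.1
  have b2 := hQ i.2
  set a := padicNorm p (P.coeff i.1)
  set b := padicNorm p (Q.coeff i.2)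
  have e1 : a * b * (w (i.1 + i.2) : ℚ) ≤ a * b * (w i.1 + w i.2) :=
    mul_le_mul_of_nonneg_left h1 (mul_nonneg a0 b0)
  have e2 : b * (a * w i.1) ≤ 1 * (a * w i.1) :=
    mul_le_mul_of_nonneg_right b1 (mul_nonneg a0 (Nat.cast_nonneg _))
  have e3 : a * (b * w i.2) ≤ 1 * (b * w i.2) :=
    mul_le_mul_of_nonneg_right a1 (mul_nonneg b0 (Nat.cast_nonneg _))
  linarith

theorem GaussLE.one (hw : FrobWeight p w) : GaussLE p w 0 (1 : MvPolynomial σ ℚ) := by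
  refine GaussLE.monomial (X := 0) (c := 1) ?_ le_rfl
  simp [hw.zero]

theorem GaussLE.pow (hw : FrobWeight p w) (iP : PInt p P) (hP : GaussLE p w M P) (m : ℕ) :
    GaussLE p w (m * M) (P ^ m) := by
  induction m with
  | zero => simpa using GaussLE.one hw
  | succ m ih =>
    rw [pow_succ]
    convert ih.mul hw (iP.pow m) iP hP using 1
    push_cast; ring

theorem padicNorm_prime_mul (c : ℚ) : padicNorm p (p * c) = (p : ℚ)⁻¹ * padicNorm p c := by
  rw [padicNorm.mul, padicNorm.padicNorm_p_of_prime]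

/-- Multiplication by `p` divides the Gauss norm by `p`. -/
theorem GaussLE.prime_mul (hP : GaussLE p w (p * M) P) : GaussLE p w M ((p : MvPolynomial σ ℚ) * P) := by
  have hp : (p : ℚ) ≠ 0 := Nat.cast_ne_zero.2 (Fact.out : p.Prime).ne_zero
  have := hP.C_mul (p : ℚ) (r := (p : ℚ)⁻¹) (by rw [padicNorm.padicNorm_p_of_prime])
  rwa [inv_mul_cancel_left₀ hp, map_natCast] at this

theorem padicNorm_inv_pow (l : ℕ) : padicNorm p (((p : ℚ) ^ l)⁻¹) = (p : ℚ) ^ l := by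
  have hp : (p : ℚ) ≠ 0 := Nat.cast_ne_zero.2 (Fact.out : p.Prime).ne_zero
  have h1 : padicNorm p ((p : ℚ) ^ l) = ((p : ℚ) ^ l)⁻¹ := by
    induction l with
    | zero => simp
    | succ l ih => rw [pow_succ', padicNorm_prime_mul, ih, mul_inv]
  have h2 := padicNorm.mul (p := p) ((p : ℚ) ^ l)⁻¹ ((p : ℚ) ^ l)
  rw [inv_mul_cancel₀ (pow_ne_zero _ hp), padicNorm.one, h1] at h2
  field_simp at h2
  rw [← one_div]
  exact h2.symm

/-- The mixed terms of `(x + y) ^ p`, divided by `p`. -/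
def mixedTerms {R : Type*} [CommSemiring R] (p : ℕ) (x y : R) : R :=
  ∑ i ∈ Finset.Ioo 0 p, x ^ i * y ^ (p - i) * (p.choose i / p : ℕ)

theorem add_pow_eq_mixedTerms {R : Type*} [CommSemiring R] (x y : R) :
    (x + y) ^ p = x ^ p + y ^ p + p * mixedTerms p x y :=
  add_pow_prime_eq' (Fact.out : p.Prime) x y

/-- Each mixed term of `(P + Q) ^ p` contains at least one factor `Q`. -/
theorem GaussLE.mixedTerms (hw : FrobWeight p w) (hPi : PInt p P) (hQi : PInt p Q)
    (hP : GaussLE p w M P) (hQ : GaussLE p w N Q) (hNM : N ≤ M) :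
    GaussLE p w ((p - 1) * M + N) (mixedTerms p P Q) := by
  have hp : (2 : ℚ) ≤ p := by exact_mod_cast (Fact.out : p.Prime).two_le
  refine GaussLE.sum _ ?_ fun i hi => ?_
  · have := hP.nonneg; have := hQ.nonneg; nlinarith
  · rw [Finset.mem_Ioo] at hi
    refine GaussLE.mul_natCast (((hP.pow hw hPi i).mul hw (hPi.pow i) (hQi.pow _)
      (hQ.pow hw hQi (p - i))).mono ?_) _
    -- `i M + (p - i) N ≤ (p - 1) M + N` as `N ≤ M`
    have h1 : (1 : ℚ) ≤ ((p - i : ℕ) : ℚ) := by exact_mod_cast (by omega : 1 ≤ p - i)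
    have h2 : (i : ℚ) = p - ((p - i : ℕ) : ℚ) := by
      rw [Nat.cast_sub hi.2.le]; ring
    rw [h2]
    nlinarith

theorem GaussLE.induction_sum (P : MvPolynomial σ ℚ) {C : MvPolynomial σ ℚ → Prop} (h0 : C 0)
    (h : ∀ X s, s ⊆ P.support → X ∈ P.support →
      C (∑ Y ∈ s, MvPolynomial.monomial Y (P.coeff Y)) →
      C (MvPolynomial.monomial X (P.coeff X) +
        ∑ Y ∈ s, MvPolynomial.monomial Y (P.coeff Y))) : C P := by
  classical
  have key : ∀ s ⊆ P.support, C (∑ Y ∈ s, MvPolynomial.monomial Y (P.coeff Y)) := by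
    intro s
    induction s using Finset.induction_on with
    | empty => intro _; simpa using h0
    | insert X s hX ih =>
      intro hs
      rw [Finset.sum_insert hX]
      exact h X s ((Finset.subset_insert X s).trans hs) (hs (Finset.mem_insert_self X s))
        (ih ((Finset.subset_insert X s).trans hs))
  have := key P.support le_rfl
  rwa [MvPolynomial.support_sum_monomial_coeff] at this

theorem PInt.monomial {X : σ →₀ ℕ} {c : ℚ} (h : padicNorm p c ≤ 1) :
    PInt p (MvPolynomial.monomial X c) := by
  classical
  intro Y
  rw [MvPolynomial.coeff_monomial]
  split_ifs
  · exact h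
  · simp

/-- On `p`-integral polynomials, the `p`-th power does not increase the Gauss norm: the mixed terms
are divisible by `p`. -/
theorem GaussLE.pow_prime (hw : FrobWeight p w) (iP : PInt p P) (hP : GaussLE p w M P) :
    GaussLE p w M (P ^ p) := by
  have hM := hP.nonneg
  have hp : p ≠ 0 := (Fact.out : p.Prime).ne_zero
  suffices h : PInt p P ∧ GaussLE p w M P ∧ GaussLE p w M (P ^ p) from h.2.2
  refine GaussLE.induction_sum P (C := fun P => PInt p P ∧ GaussLE p w M P ∧ GaussLE p w M (P ^ p))
    ⟨fun X => by simp, GaussLE.zero hM, by rw [zero_pow hp]; exact GaussLE.zero hM⟩ ?_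
  -- split off one monomial: its `p`-th power is controlled by `FrobWeight.smul_le`
  rintro X s - - ⟨i2, g2, q2⟩
  have i1 : PInt p (MvPolynomial.monomial X (P.coeff X)) := PInt.monomial (iP X)
  have g1 : GaussLE p w M (MvPolynomial.monomial X (P.coeff X)) := GaussLE.monomial (hP X) hM
  refine ⟨i1.add i2, g1.add g2, ?_⟩
  rw [add_pow_eq_mixedTerms]
  refine (GaussLE.add ?_ q2).add ?_
  · rw [MvPolynomial.monomial_pow]
    refine GaussLE.monomial ?_ hM
    refine le_trans ?_ (hP X)
    have h1 : (w (p • X) : ℚ) ≤ w X := by exact_mod_cast hw.smul_le X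
    have h2 : padicNorm p (P.coeff X ^ p) ≤ padicNorm p (P.coeff X) := by
      have : padicNorm p (P.coeff X ^ p) = padicNorm p (P.coeff X) ^ p := by
        generalize p = m at *
        have e : ∀ j : ℕ, padicNorm m (P.coeff X ^ j) = padicNorm m (P.coeff X) ^ j := by
          intro j
          induction j with
          | zero => simp
          | succ j ih => rw [pow_succ, padicNorm.mul, ih, pow_succ]
        exact e m
      rw [this]
      exact pow_le_of_le_one (padicNorm.nonneg _) (iP X) hp
    exact mul_le_mul h2 h1 (Nat.cast_nonneg _) (padicNorm.nonneg _)
  · refine GaussLE.prime_mul ?_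
    have := GaussLE.mixedTerms hw i1 i2 g1 g2 le_rfl
    convert this using 1
    ring

theorem PInt.pow_prime_pow (hw : FrobWeight p w) (iP : PInt p P) (hP : GaussLE p w M P) (m : ℕ) :
    GaussLE p w M (P ^ p ^ m) := by
  induction m with
  | zero => simpa using hP
  | succ m ih => rw [pow_succ, pow_mul]; exact ih.pow_prime hw (iP.pow _)

theorem GaussLE.expand (hw : FrobWeight p w) (hP : GaussLE p w M P) (m : ℕ) :
    GaussLE p w M (MvPolynomial.expand (p ^ m) P) := by
  have hM := hP.nonneg
  have hs : ∀ X, w (p ^ m • X) ≤ w X := by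
    intro X
    induction m with
    | zero => simp
    | succ m ih => rw [pow_succ', mul_smul]; exact (hw.smul_le _).trans ih
  refine GaussLE.induction_sum P (C := fun P => GaussLE p w M (MvPolynomial.expand (p ^ m) P))
    (by rw [map_zero]; exact GaussLE.zero hM) ?_
  intro X s _ _ h2
  rw [map_add, MvPolynomial.expand_monomial]
  refine GaussLE.add (GaussLE.monomial ((mul_le_mul_of_nonneg_left ?_
    (padicNorm.nonneg _)).trans (hP X)) hM) h2
  exact_mod_cast hs X

theorem PInt.expand (iP : PInt p P) (m : ℕ) : PInt p (MvPolynomial.expand (p ^ m) P) := by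
  refine GaussLE.induction_sum P (C := fun P => PInt p (MvPolynomial.expand (p ^ m) P))
    (by rw [map_zero]; intro X; simp) ?_
  intro X s _ _ h2
  rw [map_add, MvPolynomial.expand_monomial]
  exact (PInt.monomial (iP X)).add h2

/-- An integral polynomial that is congruent modulo `p` to one of Gauss norm at most `M` has, modulo
`p`, only monomials of weight at most `M`. -/
theorem dvd_coeff_of_gaussLE {P : MvPolynomial σ ℤ} {G I : MvPolynomial σ ℚ}
    (h : MvPolynomial.map (Int.castRingHom ℚ) P = G + p * I) (hG : GaussLE p w M G)
    (hI : PInt p I) {X : σ →₀ ℕ} (hX : M < w X) : (p : ℤ) ∣ P.coeff X := by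
  rw [← padicNorm.int_lt_one_iff]
  have hp : (1 : ℚ) < p := by exact_mod_cast (Fact.out : p.Prime).one_lt
  have e : ((P.coeff X : ℤ) : ℚ) = G.coeff X + p * I.coeff X := by
    have := congrArg (MvPolynomial.coeff X) h
    rw [MvPolynomial.coeff_map, MvPolynomial.coeff_add,
      show (p : MvPolynomial σ ℚ) = MvPolynomial.C (p : ℚ) by simp, MvPolynomial.coeff_C_mul] at this
    simpa using this
  rw [e]
  refine lt_of_le_of_lt padicNorm.nonarchimedean (max_lt ?_ ?_)
  · have h1 := hG X
    have h0 := padicNorm.nonneg (p := p) (G.coeff X)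
    by_contra hge
    have : (w X : ℚ) ≤ padicNorm p (G.coeff X) * w X :=
      le_mul_of_one_le_left (Nat.cast_nonneg _) (not_lt.1 hge)
    linarith
  · rw [padicNorm_prime_mul]
    have := hI X
    have h2 : (p : ℚ)⁻¹ < 1 := inv_lt_one_of_one_lt₀ hp
    have h0 : 0 < (p : ℚ)⁻¹ := by positivity
    nlinarith [padicNorm.nonneg (p := p) (I.coeff X)]

end Gauss

/-! ### The coproduct polynomials up to lower May filtration -/

/-- The weight `∑ M(t_s) · (digit sum of the exponent)` of a monomial in the `x_s` and `y_s`. -/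
def coWt (p n k : ℕ) (X : ℕ ⊕ ℕ →₀ ℕ) : ℕ :=
  X.sum fun v e => mayM p n k (v.elim id id) * digitSum p e

theorem coWt_frob (p n k : ℕ) [Fact p.Prime] : FrobWeight p (coWt p n k) where
  zero := by simp [coWt]
  add_le X Y := by
    classical
    have hp := (Fact.out : p.Prime).one_lt
    have h0 : ∀ v ∈ X.support ∪ Y.support, mayM p n k (v.elim id id) * digitSum p 0 = 0 := by
      simp [digitSum_zero]
    unfold coWt
    rw [Finsupp.sum_of_support_subset X (Finset.subset_union_left (s₂ := Y.support)) _ h0,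
      Finsupp.sum_of_support_subset Y (Finset.subset_union_right (s₁ := X.support)) _ h0,
      Finsupp.sum_of_support_subset (X + Y) Finsupp.support_add _ h0, ← Finset.sum_add_distrib]
    refine Finset.sum_le_sum fun v _ => ?_
    rw [← mul_add]
    exact Nat.mul_le_mul_left _ (digitSum_add_le hp _ _)
  smul_le X := by
    have hp := (Fact.out : p.Prime).one_lt
    unfold coWt
    rw [Finsupp.sum_of_support_subset (p • X) Finsupp.support_smul _ (by simp [digitSum_zero]),
      Finsupp.sum]
    refine Finset.sum_le_sum fun v _ => ?_
    rw [Finsupp.smul_apply, smul_eq_mul, digitSum_mul hp]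

/-- The variables after `x_0 = y_0 = 1` and `x_j = y_j = 0` for `0 < j < k`. -/
def specX (R : Type*) [CommRing R] (k : ℕ) (v : ℕ ⊕ ℕ) : MvPolynomial (ℕ ⊕ ℕ) R :=
  if k ≤ v.elim id id then MvPolynomial.X v else if v.elim id id = 0 then 1 else 0

/-- The substitution `x_0 = y_0 = 1` and `x_j = y_j = 0` for `0 < j < k`. -/
def spec (R : Type*) [CommRing R] (k : ℕ) :
    MvPolynomial (ℕ ⊕ ℕ) R →ₐ[R] MvPolynomial (ℕ ⊕ ℕ) R := MvPolynomial.aeval (specX R k)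

theorem map_spec {R R' : Type*} [CommRing R] [CommRing R'] (f : R →+* R') (k : ℕ)
    (P : MvPolynomial (ℕ ⊕ ℕ) R) :
    MvPolynomial.map f (spec R k P) = spec R' k (MvPolynomial.map f P) := by
  induction P using MvPolynomial.induction_on with
  | C r => simp [spec, MvPolynomial.algebraMap_eq]
  | add a b ha hb => simp only [map_add, ha, hb]
  | mul_X a i ha =>
    simp only [map_mul, ha, MvPolynomial.map_X]
    congr 1
    simp only [spec, MvPolynomial.aeval_X, specX]
    split_ifs <;> simp

theorem expand_spec {R : Type*} [CommRing R] (k q : ℕ) (hq : q ≠ 0) (P : MvPolynomial (ℕ ⊕ ℕ) R) :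
    MvPolynomial.expand q (spec R k P) = spec R k (MvPolynomial.expand q P) := by
  induction P using MvPolynomial.induction_on with
  | C r => simp [spec, MvPolynomial.algebraMap_eq]
  | add a b ha hb => simp only [map_add, ha, hb]
  | mul_X a i ha =>
    simp only [map_mul, ha, MvPolynomial.expand_X, map_pow]
    congr 1
    simp only [spec, MvPolynomial.aeval_X, specX]
    split_ifs <;> simp [hq]

variable {p n k : ℕ} [Fact p.Prime]

theorem specX_of_le {R : Type*} [CommRing R] {v : ℕ ⊕ ℕ} (h : k ≤ v.elim id id) :
    specX R k v = MvPolynomial.X v := by rw [specX, if_pos h]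

theorem specX_zero {R : Type*} [CommRing R] (hk : 1 ≤ k) {v : ℕ ⊕ ℕ} (h : v.elim id id = 0) :
    specX R k v = 1 := by rw [specX, if_neg (by omega), if_pos h]

theorem specX_eq_zero {R : Type*} [CommRing R] {v : ℕ ⊕ ℕ} (h : v.elim id id < k)
    (h0 : 0 < v.elim id id) : specX R k v = 0 := by
  rw [specX, if_neg (by omega), if_neg (by omega)]

theorem spec_twistedSum (a i : ℕ) :
    spec ℚ k (twistedSum p a i) = ∑ j ∈ Finset.range (a + 1),
      specX ℚ k (Sum.inl j) ^ p ^ i * specX ℚ k (Sum.inr (a - j)) ^ p ^ (i + j) := by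
  rw [twistedSum, map_sum, Finset.Nat.sum_antidiagonal_eq_sum_range_succ_mk]
  simp [spec]

/-- The sum `∑ x_m y_{s-m}^{p^m}` over `k ≤ m ≤ s - k`. -/
def crossSum (R : Type*) [CommRing R] (p k s : ℕ) : MvPolynomial (ℕ ⊕ ℕ) R :=
  ∑ m ∈ Finset.Icc k (s - k),
    MvPolynomial.X (Sum.inl m) * MvPolynomial.X (Sum.inr (s - m)) ^ p ^ m

theorem spec_twistedSum_of_le (hk : 1 ≤ k) {a : ℕ} (ha : k ≤ a) (i : ℕ) :
    spec ℚ k (twistedSum p a i) =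
      MvPolynomial.X (Sum.inl a) ^ p ^ i + MvPolynomial.X (Sum.inr a) ^ p ^ i +
        MvPolynomial.expand (p ^ i) (crossSum ℚ p k a) := by
  obtain ⟨b, rfl⟩ : ∃ b, a = b + 1 := ⟨a - 1, by omega⟩
  rw [spec_twistedSum, Finset.sum_range_succ, Finset.sum_range_succ']
  rw [specX_zero hk (v := Sum.inl 0) rfl,
    specX_zero hk (v := Sum.inr (b + 1 - (b + 1))) (by simp),
    specX_of_le (v := Sum.inl (b + 1)) ha, specX_of_le (v := Sum.inr (b + 1 - 0)) ha]
  simp only [one_pow, one_mul, mul_one, Nat.sub_zero, add_zero]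
  have : ∑ j ∈ Finset.range b, specX ℚ k (Sum.inl (j + 1)) ^ p ^ i *
        specX ℚ k (Sum.inr (b + 1 - (j + 1))) ^ p ^ (i + (j + 1)) =
      MvPolynomial.expand (p ^ i) (crossSum ℚ p k (b + 1)) := by
    rw [crossSum, map_sum]
    have hp : ∀ m, p ^ m ≠ 0 := fun m => pow_ne_zero m (Fact.out : p.Prime).ne_zero
    symm
    refine Finset.sum_subset_zero_on_sdiff (s₁ := (Finset.Icc k (b + 1 - k)))
      (s₂ := (Finset.Icc 1 b)) (g := fun m => specX ℚ k (Sum.inl m) ^ p ^ i *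
        specX ℚ k (Sum.inr (b + 1 - m)) ^ p ^ (i + m)) ?_ ?_ ?_ |>.trans ?_
    · intro m hm; rw [Finset.mem_Icc] at hm ⊢; omega
    · intro m hm
      rw [Finset.mem_sdiff, Finset.mem_Icc, Finset.mem_Icc] at hm
      rcases lt_or_ge m k with h | h
      · rw [specX_eq_zero (v := Sum.inl m) h (by simp; omega), zero_pow (hp _), zero_mul]
      · rw [specX_eq_zero (v := Sum.inr (b + 1 - m)) (by simp; omega) (by simp; omega),
          zero_pow (hp _), mul_zero]
    · intro m hm
      rw [Finset.mem_Icc] at hm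
      rw [specX_of_le (v := Sum.inl m) hm.1, specX_of_le (v := Sum.inr (b + 1 - m)) (by simp; omega)]
      simp only [map_mul, map_pow, MvPolynomial.expand_X, ← pow_mul, ← pow_add]
    · refine Finset.sum_nbij' (fun m => m - 1) (fun j => j + 1) ?_ ?_ ?_ ?_ ?_
      · intro m hm; rw [Finset.mem_Icc] at hm; rw [Finset.mem_range]; omega
      · intro m hm; rw [Finset.mem_range] at hm; rw [Finset.mem_Icc]; omega
      · intro m hm; rw [Finset.mem_Icc] at hm; omega
      · intro m hm; omega
      · intro m hm
        rw [Finset.mem_Icc] at hm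
        rw [show m - 1 + 1 = m by omega]
  rw [this]
  ring

theorem spec_twistedSum_zero (hk : 1 ≤ k) (i : ℕ) : spec ℚ k (twistedSum p 0 i) = 1 := by
  rw [spec_twistedSum, Finset.sum_range_one, specX_zero hk (v := Sum.inl 0) rfl,
    specX_zero hk (v := Sum.inr (0 - 0)) rfl]
  simp

theorem spec_twistedSum_eq_zero {a : ℕ} (h0 : 0 < a) (h : a < k) (i : ℕ) :
    spec ℚ k (twistedSum p a i) = 0 := by
  have hp : ∀ m, p ^ m ≠ 0 := fun m => pow_ne_zero m (Fact.out : p.Prime).ne_zero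
  rw [spec_twistedSum]
  refine Finset.sum_eq_zero fun j hj => ?_
  rw [Finset.mem_range] at hj
  rcases Nat.eq_zero_or_pos j with rfl | h1
  · rw [specX_eq_zero (v := Sum.inr (a - 0)) h h0, zero_pow (hp _), mul_zero]
  · rw [specX_eq_zero (v := Sum.inl j) (by simp; omega) h1, zero_pow (hp _), zero_mul]

theorem spec_coprodRat (s : ℕ) :
    spec ℚ k (coprodRat p n s) = spec ℚ k (twistedSum p s 0) +
      ∑ i ∈ Finset.range s, MvPolynomial.C (logCoeff p n (i + 1)) *
        (spec ℚ k (twistedSum p (s - (i + 1)) (i + 1)) -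
          spec ℚ k (coprodRat p n (s - (i + 1))) ^ p ^ (i + 1)) := by
  have hs := congrArg (spec ℚ k) (coprodRat_spec p n s)
  rw [Finset.sum_range_succ', Finset.sum_range_succ' _ s] at hs
  simp only [logCoeff_zero, map_one, one_mul, Nat.sub_zero, pow_zero, pow_one, map_add, map_sum,
    map_mul, map_pow] at hs
  simp only [mul_sub, Finset.sum_sub_distrib]
  have hC : ∀ r : ℚ, spec ℚ k (MvPolynomial.C r) = MvPolynomial.C r := fun r => by
    simp [spec, MvPolynomial.algebraMap_eq]
  simp only [hC] at hs
  linear_combination hs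

theorem spec_coprodRat_zero (hk : 1 ≤ k) : spec ℚ k (coprodRat p n 0) = 1 := by
  rw [spec_coprodRat, spec_twistedSum_zero hk]
  simp

theorem spec_coprodRat_eq_zero (hk : 1 ≤ k) {s : ℕ} (h0 : 0 < s) (h : s < k) :
    spec ℚ k (coprodRat p n s) = 0 := by
  induction s using Nat.strong_induction_on with
  | _ s ih =>
  rw [spec_coprodRat, spec_twistedSum_eq_zero h0 h, zero_add]
  refine Finset.sum_eq_zero fun i hi => ?_
  rw [Finset.mem_range] at hi
  rcases Nat.eq_zero_or_pos (s - (i + 1)) with e | e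
  · rw [e, spec_twistedSum_zero hk, spec_coprodRat_zero hk, one_pow, sub_self, mul_zero]
  · rw [spec_twistedSum_eq_zero e (by omega), ih _ (by omega) e (by omega),
      zero_pow (pow_ne_zero _ (Fact.out : p.Prime).ne_zero), sub_self, mul_zero]

/-- The terms of the recursion that involve `D_a` with `a < k` vanish. -/
theorem spec_term_eq_zero (hk : 1 ≤ k) {a : ℕ} (h : a < k) (i : ℕ) :
    spec ℚ k (twistedSum p a i) - spec ℚ k (coprodRat p n a) ^ p ^ i = 0 := by
  rcases Nat.eq_zero_or_pos a with rfl | e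
  · rw [spec_twistedSum_zero hk, spec_coprodRat_zero hk, one_pow, sub_self]
  · rw [spec_twistedSum_eq_zero e h, spec_coprodRat_eq_zero hk e h,
      zero_pow (pow_ne_zero _ (Fact.out : p.Prime).ne_zero), sub_self]

/-- For `s < n + k` the coproduct polynomial has no formal group correction. -/
theorem spec_coprodRat_of_lt (H : Admissible p n k) {s : ℕ} (h : k ≤ s) (h' : s < n + k) :
    spec ℚ k (coprodRat p n s) =
      MvPolynomial.X (Sum.inl s) + MvPolynomial.X (Sum.inr s) + crossSum ℚ p k s := by
  rw [spec_coprodRat, spec_twistedSum_of_le H.one_le h, Finset.sum_eq_zero, add_zero]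
  · simp
  · intro i hi
    by_cases hd : n ∣ i + 1
    · have := Nat.le_of_dvd (Nat.succ_pos i) hd
      rw [spec_term_eq_zero H.one_le (by have := H.one_le; omega), mul_zero]
    · rw [logCoeff, if_neg hd, map_zero, zero_mul]

/-- `x_s + y_s`. -/
def linPart (R : Type*) [CommRing R] (s : ℕ) : MvPolynomial (ℕ ⊕ ℕ) R :=
  MvPolynomial.X (Sum.inl s) + MvPolynomial.X (Sum.inr s)

theorem le_sub_of_mem_range {s l : ℕ} (hn : 0 < n)
    (hl : l < (s - k) / n) : k + n * (l + 1) ≤ s := by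
  have h1 : n * (l + 1) ≤ s - k := by
    calc n * (l + 1) ≤ n * ((s - k) / n) := Nat.mul_le_mul_left _ hl
      _ ≤ s - k := Nat.mul_div_le _ _
  have : 0 < n * (l + 1) := by positivity
  omega

theorem sum_range_multiples {A : Type*} [AddCommMonoid A] (F : ℕ → A) (hn : 0 < n) {N L : ℕ}
    (h1 : ∀ i < N, ¬ n ∣ i + 1 → F i = 0) (h2 : ∀ l, L ≤ l → n * (l + 1) ≤ N →
      F (n * (l + 1) - 1) = 0) (h3 : ∀ l < L, n * (l + 1) ≤ N) :
    ∑ i ∈ Finset.range N, F i = ∑ l ∈ Finset.range L, F (n * (l + 1) - 1) := by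
  have hpos : ∀ l, 0 < n * (l + 1) := fun l => Nat.mul_pos hn (Nat.succ_pos l)
  symm
  refine Finset.sum_of_injOn (fun l => n * (l + 1) - 1) ?_ ?_ ?_ (fun _ _ => rfl)
  · intro a _ b _ hab
    have ha := hpos a
    have hb := hpos b
    have : n * (a + 1) = n * (b + 1) := by simp only at hab; omega
    have := Nat.eq_of_mul_eq_mul_left hn this
    omega
  · intro l hl
    simp only [Finset.coe_range, Set.mem_Iio] at hl ⊢
    have := h3 l hl
    have := hpos l
    omega
  · intro i hi hni
    rw [Finset.mem_range] at hi
    by_cases hd : n ∣ i + 1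
    · obtain ⟨l, hl⟩ := hd
      have hl0 : l ≠ 0 := by rintro rfl; simp at hl
      obtain ⟨l, rfl⟩ := Nat.exists_eq_succ_of_ne_zero hl0
      rw [Nat.succ_eq_add_one] at hl
      rw [show i = n * (l + 1) - 1 by omega]
      refine h2 l ?_ (by omega)
      by_contra hlt
      refine hni ⟨l, ?_, by simp only; omega⟩
      simp only [Finset.coe_range, Set.mem_Iio]
      omega
    · exact h1 i hi hd

/-- The recursion for `s ≥ n + k`, reindexed by the multiples of `n`. -/
theorem spec_coprodRat_of_le (H : Admissible p n k) {s : ℕ} (h : n + k ≤ s) :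
    spec ℚ k (coprodRat p n s) = linPart ℚ s + crossSum ℚ p k s +
        ∑ l ∈ Finset.range ((s - k) / n), MvPolynomial.C (((p : ℚ) ^ (l + 1))⁻¹) *
          (spec ℚ k (twistedSum p (s - n * (l + 1)) (n * (l + 1))) -
          spec ℚ k (coprodRat p n (s - n * (l + 1))) ^ p ^ (n * (l + 1))) := by
  have hn := H.n_pos
  have hk := H.one_le
  have hpos : ∀ l, 0 < n * (l + 1) := fun l => Nat.mul_pos hn (Nat.succ_pos l)
  rw [spec_coprodRat, spec_twistedSum_of_le H.one_le (by omega),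
    sum_range_multiples (n := n) (L := (s - k) / n) _ hn]
  · simp only [pow_zero, pow_one, MvPolynomial.expand_one_apply]
    have e : ∀ l, n * (l + 1) - 1 + 1 = n * (l + 1) := fun l => by have := hpos l; omega
    have e2 : ∀ l, logCoeff p n (n * (l + 1)) = ((p : ℚ) ^ (l + 1))⁻¹ := fun l => by
      rw [logCoeff, if_pos (Dvd.intro _ rfl), Nat.mul_div_cancel_left _ hn]
    simp only [e, e2]
    rw [linPart]
  · intro i _ hd
    rw [logCoeff, if_neg hd, map_zero, zero_mul]
  · intro l hl _
    have ha := hpos l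
    rw [show n * (l + 1) - 1 + 1 = n * (l + 1) by omega]
    rw [spec_term_eq_zero hk, mul_zero]
    by_contra hge
    have : l + 1 ≤ (s - k) / n := (Nat.le_div_iff_mul_le hn).2 (by rw [mul_comm]; omega)
    omega
  · intro l hl
    have := le_sub_of_mem_range hn hl
    omega

theorem coWt_single (v : ℕ ⊕ ℕ) (m : ℕ) :
    coWt p n k (Finsupp.single v (p ^ m)) = mayM p n k (v.elim id id) := by
  have hp := (Fact.out : p.Prime).one_lt
  rw [coWt, Finsupp.sum_single_index (by simp [digitSum_zero])]
  have := digitSum_pow_mul hp m 1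
  rw [mul_one, digitSum_of_lt hp hp] at this
  rw [this, mul_one]

theorem gaussLE_X_pow (v : ℕ ⊕ ℕ) (m : ℕ) :
    GaussLE p (coWt p n k) (mayM p n k (v.elim id id)) (MvPolynomial.X v ^ p ^ m) := by
  rw [MvPolynomial.X_pow_eq_monomial]
  refine GaussLE.monomial ?_ (Nat.cast_nonneg _)
  rw [coWt_single]
  simp

theorem gaussLE_X (v : ℕ ⊕ ℕ) :
    GaussLE p (coWt p n k) (mayM p n k (v.elim id id)) (MvPolynomial.X v) := by
  simpa using gaussLE_X_pow (p := p) (n := n) (k := k) v 0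

theorem pInt_neg_one : PInt p (-1 : MvPolynomial (ℕ ⊕ ℕ) ℚ) := by
  have := PInt.map (σ := ℕ ⊕ ℕ) (p := p) (-1)
  rwa [map_neg, map_one] at this

theorem pInt_X (v : ℕ ⊕ ℕ) : PInt p (MvPolynomial.X v) := PInt.monomial (by simp)

theorem crossSum_bound (H : Admissible p n k) (s : ℕ) (hs : k ≤ s) {M : ℚ}
    (hM : ∀ a b, k ≤ a → k ≤ b → a + b = s → (mayM p n k a + mayM p n k b : ℚ) ≤ M) (h0 : 0 ≤ M) :
    GaussLE p (coWt p n k) M (crossSum ℚ p k s) := by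
  refine GaussLE.sum _ h0 fun m hm => ?_
  rw [Finset.mem_Icc] at hm
  have := H.one_le
  exact ((gaussLE_X _).mul (coWt_frob p n k) (pInt_X _) ((pInt_X _).pow _)
    (gaussLE_X_pow _ _)).mono (hM m (s - m) hm.1 (by omega) (by omega))

/-- The coproduct polynomials of `S(n,k)`, with integer coefficients. -/
def coD (p n k s : ℕ) : MvPolynomial (ℕ ⊕ ℕ) ℤ := spec ℤ k (coprodInt p n s)

theorem map_coD (hn : 0 < n) (s : ℕ) :
    MvPolynomial.map (Int.castRingHom ℚ) (coD p n k s) = spec ℚ k (coprodRat p n s) := by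
  rw [coD, map_spec, map_coprodInt p n hn]

theorem pInt_spec_coprodRat (hn : 0 < n) (s : ℕ) : PInt p (spec ℚ k (coprodRat p n s)) := by
  rw [← map_coD hn]
  exact PInt.map _

theorem gaussLE_linPart (s : ℕ) : GaussLE p (coWt p n k) (mayM p n k s) (linPart ℚ s) :=
  (gaussLE_X (Sum.inl s)).add (gaussLE_X (Sum.inr s))

theorem pInt_linPart (s : ℕ) : PInt p (linPart ℚ s) := (pInt_X _).add (pInt_X _)

theorem twistedSum_eq_expand (a i : ℕ) :
    spec ℚ k (twistedSum p a i) = MvPolynomial.expand (p ^ i) (spec ℚ k (twistedSum p a 0)) := by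
  rw [expand_spec _ _ (pow_ne_zero _ (Fact.out : p.Prime).ne_zero), expand_twistedSum, zero_add]

theorem gaussLE_twistedSum (H : Admissible p n k) {a : ℕ} (ha : k ≤ a) (i : ℕ) :
    GaussLE p (coWt p n k) (mayM p n k a) (spec ℚ k (twistedSum p a i)) := by
  rw [twistedSum_eq_expand]
  refine GaussLE.expand (coWt_frob p n k) ?_ i
  rw [spec_twistedSum_of_le H.one_le ha]
  simp only [pow_zero, pow_one, MvPolynomial.expand_one_apply]
  refine (gaussLE_linPart a).add (crossSum_bound H a ha (fun b c hb hc e => ?_) (Nat.cast_nonneg _))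
  have := (H.mayM_add_le hb hc).1
  rw [e] at this
  exact_mod_cast (by omega : mayM p n k b + mayM p n k c ≤ mayM p n k a)

/-- `D_s - x_s - y_s` has Gauss norm at most `M(t_s) - 1`. -/
theorem gaussLE_coprod_sub (H : Admissible p n k) {s : ℕ} (hs : k ≤ s) :
    GaussLE p (coWt p n k) (mayM p n k s - 1) (spec ℚ k (coprodRat p n s) - linPart ℚ s) := by
  have hk := H.one_le
  have hn := H.n_pos
  induction s using Nat.strong_induction_on with
  | _ s ih =>
  have h1 : (1 : ℚ) ≤ mayM p n k s := by
    exact_mod_cast (show 1 ≤ s from by omega).trans (self_le_mayM p n k s)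
  have hc : GaussLE p (coWt p n k) (mayM p n k s - 1) (crossSum ℚ p k s) := by
    refine crossSum_bound H s hs (fun b c hb hc e => ?_) (by linarith)
    have := (H.mayM_add_le hb hc).1
    rw [e] at this
    rw [le_sub_iff_add_le]
    exact_mod_cast this
  rcases lt_or_ge s (n + k) with h | h
  · rw [spec_coprodRat_of_lt H hs h]
    convert hc using 1
    rw [linPart]; ring
  · rw [spec_coprodRat_of_le H h]
    have : GaussLE p (coWt p n k) (mayM p n k s - 1)
        (∑ l ∈ Finset.range ((s - k) / n), MvPolynomial.C (((p : ℚ) ^ (l + 1))⁻¹) *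
          (spec ℚ k (twistedSum p (s - n * (l + 1)) (n * (l + 1))) -
          spec ℚ k (coprodRat p n (s - n * (l + 1))) ^ p ^ (n * (l + 1)))) := by
      refine GaussLE.sum _ (by linarith) fun l hl => ?_
      rw [Finset.mem_range] at hl
      have h2 := le_sub_of_mem_range hn hl
      obtain ⟨a, rfl⟩ := Nat.exists_eq_add_of_le' (show n * (l + 1) ≤ s by omega)
      rw [Nat.add_sub_cancel]
      have ha : k ≤ a := by omega
      have hlt : a < a + n * (l + 1) := by
        have : 0 < n * (l + 1) := by positivity
        omega
      have hD : GaussLE p (coWt p n k) (mayM p n k a) (spec ℚ k (coprodRat p n a)) := by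
        have := ((ih a hlt ha).mono (show _ ≤ (mayM p n k a : ℚ) by linarith)).add
          (gaussLE_linPart a)
        rwa [sub_add_cancel] at this
      -- the factor `p^{-(l+1)}` multiplies the norm by `p^{l+1}`, which `M(t_s) - 1` absorbs
      refine (((gaussLE_twistedSum H ha _).sub (PInt.pow_prime_pow (coWt_frob p n k)
        (pInt_spec_coprodRat hn a) hD _)).C_mul _ (padicNorm_inv_pow (l + 1)).le).mono ?_
      rw [le_sub_iff_add_le]
      exact_mod_cast H.pow_mul_mayM_le ha l
    convert hc.add this using 1
    ring

theorem gaussLE_coprod (H : Admissible p n k) {s : ℕ} (hs : k ≤ s) :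
    GaussLE p (coWt p n k) (mayM p n k s) (spec ℚ k (coprodRat p n s)) := by
  have := ((gaussLE_coprod_sub H hs).mono (show _ ≤ (mayM p n k s : ℚ) by linarith)).add
    (gaussLE_linPart s)
  rwa [sub_add_cancel] at this

/-- `D ^ {p ^ n}` agrees modulo `p ^ 2` with the `p`-th power of a Frobenius twist of `D`. -/
theorem exists_pow_eq_expand_pow (m : ℕ) (d : MvPolynomial (ℕ ⊕ ℕ) ℤ) :
    ∃ c : MvPolynomial (ℕ ⊕ ℕ) ℤ,
      d ^ p ^ (m + 1) = MvPolynomial.expand (p ^ m) d ^ p - (p : MvPolynomial (ℕ ⊕ ℕ) ℤ) ^ 2 * c := by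
  obtain ⟨c, hc⟩ := dvd_sub_pow_of_dvd_sub (dvd_expand_sub_pow p m d) 1
  refine ⟨c, ?_⟩
  rw [pow_one, ← pow_mul, ← pow_succ] at hc
  rw [← hc]
  ring

/-- For `s = a + n ≥ n + k`, the polynomial `D_s` is
`x_s + y_s - (∑ p⁻¹ C(p,i) x_a^i y_a^{p-i})^{p^{n-1}}` modulo `p` and modulo monomials of weight
less than `M(t_s) - 1`. -/
theorem coD_leading (H : Admissible p n k) {a : ℕ} (ha : k ≤ a) {X : ℕ ⊕ ℕ →₀ ℕ}
    (hX : mayM p n k (a + n) < coWt p n k X + 2) :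
    (p : ℤ) ∣ (coD p n k (a + n) - linPart ℤ (a + n) + MvPolynomial.expand (p ^ (n - 1))
      (mixedTerms p (MvPolynomial.X (Sum.inl a)) (MvPolynomial.X (Sum.inr a)))).coeff X := by
  have hn := H.n_pos
  have hk := H.one_le
  have hw := coWt_frob p n k
  have hp2 : (2 : ℚ) ≤ p := by exact_mod_cast (Fact.out : p.Prime).two_le
  have hp0 : (p : ℚ) ≠ 0 := by linarith
  have hf := H.mayM_add a ha
  have hfa : (1 : ℚ) ≤ mayM p n k a := by
    exact_mod_cast (show 1 ≤ a from by omega).trans (self_le_mayM p n k a)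
  have hfQ : (mayM p n k (a + n) : ℚ) = p * mayM p n k a + 1 := by rw [hf]; push_cast; ring
  obtain ⟨m, rfl⟩ : ∃ m, n = m + 1 := ⟨n - 1, by omega⟩
  rw [Nat.add_sub_cancel]
  obtain ⟨c, hc⟩ := exists_pow_eq_expand_pow (p := p) m (coD p (m + 1) k a)
  have hc' := congrArg (MvPolynomial.map (Int.castRingHom ℚ)) hc
  simp only [map_pow, map_sub, map_mul, MvPolynomial.map_expand, map_coD hn, map_natCast] at hc'
  -- `D_a^{p^n} = (L + R)^p - p² c`, where the Frobenius twist of `D_a` is split into its linear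
  -- part `L = x + y` and the rest `R` of smaller norm
  set D := spec ℚ k (coprodRat p (m + 1) a) with hD
  set L : MvPolynomial (ℕ ⊕ ℕ) ℚ := MvPolynomial.expand (p ^ m) (linPart ℚ a) with hL
  set R := MvPolynomial.expand (p ^ m) (D - linPart ℚ a) with hR
  set x : MvPolynomial (ℕ ⊕ ℕ) ℚ := MvPolynomial.X (Sum.inl a) ^ p ^ m with hx
  set y : MvPolynomial (ℕ ⊕ ℕ) ℚ := MvPolynomial.X (Sum.inr a) ^ p ^ m with hy
  set cI := MvPolynomial.map (Int.castRingHom ℚ) c with hcI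
  have hLxy : L = x + y := by simp [hL, linPart, hx, hy]
  have hLR : MvPolynomial.expand (p ^ m) D = L + R := by rw [hL, hR, ← map_add]; congr 1; ring
  have iL : PInt p L := (pInt_linPart a).expand m
  have iD : PInt p D := pInt_spec_coprodRat hn a
  have iR : PInt p R := by
    refine PInt.expand ?_ m
    have := iD.add (((PInt.natCast (σ := ℕ ⊕ ℕ) (p := p) 0).mul (pInt_linPart a)).add
      (PInt.mul (Q := linPart ℚ a) (P := -1) pInt_neg_one (pInt_linPart a)))
    convert this using 1
    push_cast; ring
  have gL : GaussLE p (coWt p (m + 1) k) (mayM p (m + 1) k a) L := (gaussLE_linPart a).expand hw m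
  have gR : GaussLE p (coWt p (m + 1) k) (mayM p (m + 1) k a - 1) R :=
    (gaussLE_coprod_sub H ha).expand hw m
  set rest : MvPolynomial (ℕ ⊕ ℕ) ℚ := ∑ l ∈ Finset.range ((a + (m + 1) - k) / (m + 1) - 1),
    MvPolynomial.C (((p : ℚ) ^ (l + 1 + 1))⁻¹) *
      (spec ℚ k (twistedSum p (a + (m + 1) - (m + 1) * (l + 1 + 1)) ((m + 1) * (l + 1 + 1))) -
      spec ℚ k (coprodRat p (m + 1) (a + (m + 1) - (m + 1) * (l + 1 + 1))) ^
        p ^ ((m + 1) * (l + 1 + 1))) with hrest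
  have hCp : (p : MvPolynomial (ℕ ⊕ ℕ) ℚ) * MvPolynomial.C (p : ℚ)⁻¹ = 1 := by
    rw [show (p : MvPolynomial (ℕ ⊕ ℕ) ℚ) = MvPolynomial.C (p : ℚ) by simp, ← map_mul,
      mul_inv_cancel₀ hp0, map_one]
  have hcount : 1 ≤ (a + (m + 1) - k) / (m + 1) := (Nat.le_div_iff_mul_le hn).2 (by omega)
  -- separate the term `l = 0` of the recursion, with `m_n = p⁻¹`; the other terms, `rest`, turn out
  -- to have norm at most `M(t_s) - 2`
  have hDs : spec ℚ k (coprodRat p (m + 1) (a + (m + 1))) =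
      linPart ℚ (a + (m + 1)) + crossSum ℚ p k (a + (m + 1)) + (rest +
        MvPolynomial.C (p : ℚ)⁻¹ * (x ^ p + y ^ p +
          MvPolynomial.expand (p ^ (m + 1)) (crossSum ℚ p k a) - D ^ p ^ (m + 1))) := by
    rw [spec_coprodRat_of_le H (by omega), hrest]
    obtain ⟨N, hN⟩ := Nat.exists_eq_add_of_le' hcount
    have e0 : spec ℚ k (twistedSum p (a + (m + 1) - (m + 1) * (0 + 1)) ((m + 1) * (0 + 1))) =
        x ^ p + y ^ p + MvPolynomial.expand (p ^ (m + 1)) (crossSum ℚ p k a) := by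
      rw [zero_add, mul_one, Nat.add_sub_cancel, spec_twistedSum_of_le hk ha, hx, hy, ← pow_mul,
        ← pow_mul, ← pow_succ]
    have e1 : spec ℚ k (coprodRat p (m + 1) (a + (m + 1) - (m + 1) * (0 + 1))) ^
        p ^ ((m + 1) * (0 + 1)) = D ^ p ^ (m + 1) := by
      rw [zero_add, mul_one, Nat.add_sub_cancel, hD]
    rw [hN, Finset.sum_range_succ', Nat.add_sub_cancel, e0, e1, zero_add, pow_one]
  refine dvd_coeff_of_gaussLE (w := coWt p (m + 1) k) (M := mayM p (m + 1) k (a + (m + 1)) - 2)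
    (G := crossSum ℚ p k (a + (m + 1)) + rest + MvPolynomial.C (p : ℚ)⁻¹ *
      MvPolynomial.expand (p ^ (m + 1)) (crossSum ℚ p k a) - MvPolynomial.C (p : ℚ)⁻¹ * R ^ p -
      mixedTerms p L R) (I := cI) ?_ ?_ (PInt.map c) ?_
  · have e1 : (L + R) ^ p = L ^ p + R ^ p + p * mixedTerms p L R := add_pow_eq_mixedTerms L R
    have e2 : L ^ p = x ^ p + y ^ p + p * mixedTerms p x y := by
      rw [hLxy]; exact add_pow_eq_mixedTerms x y
    have e3 : MvPolynomial.map (Int.castRingHom ℚ) (MvPolynomial.expand (p ^ m)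
        (mixedTerms p (MvPolynomial.X (Sum.inl a)) (MvPolynomial.X (Sum.inr a)))) =
        mixedTerms p x y := by
      simp [mixedTerms, hx, hy]
    have e4 : MvPolynomial.map (Int.castRingHom ℚ) (linPart ℤ (a + (m + 1))) =
        linPart ℚ (a + (m + 1)) := by simp [linPart]
    rw [map_add, map_sub, map_coD hn, e3, e4, hDs, hc', hLR, e1, e2]
    linear_combination (-mixedTerms p x y - mixedTerms p L R + p * cI) * hCp
  · have hinv : padicNorm p (p : ℚ)⁻¹ ≤ p := by
      have := (padicNorm_inv_pow (p := p) 1).le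
      simpa using this
    have b1 : GaussLE p (coWt p (m + 1) k) (mayM p (m + 1) k (a + (m + 1)) - 2)
        (crossSum ℚ p k (a + (m + 1))) := by
      refine crossSum_bound H _ (by omega) (fun b c hb hc e => ?_) (by rw [hfQ]; nlinarith)
      have := (H.mayM_add_le hb hc).2 (by omega)
      rw [e] at this
      rw [le_sub_iff_add_le]
      exact_mod_cast this
    have b2 : GaussLE p (coWt p (m + 1) k) (mayM p (m + 1) k (a + (m + 1)) - 2) rest := by
      refine GaussLE.sum _ b1.nonneg fun l hl => ?_
      rw [Finset.mem_range] at hl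
      have h2 := le_sub_of_mem_range (k := k) (s := a + (m + 1)) hn (l := l + 1) (by omega)
      obtain ⟨b, hb⟩ := Nat.exists_eq_add_of_le' (show (m + 1) * (l + 1 + 1) ≤ a + (m + 1) by omega)
      rw [hb, Nat.add_sub_cancel]
      have hkb : k ≤ b := by omega
      refine (((gaussLE_twistedSum H hkb _).sub (PInt.pow_prime_pow hw
        (pInt_spec_coprodRat hn b) (gaussLE_coprod H hkb) _)).C_mul _
        (padicNorm_inv_pow (l + 1 + 1)).le).mono ?_
      have h3 := H.pow_mul_mayM_le hkb l
      have h4 : b + (m + 1) * (l + 1 + 1) = b + (m + 1) * (l + 1) + (m + 1) := by ring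
      rw [h4, H.mayM_add _ (by omega)]
      have h5 : (p : ℚ) ^ (l + 1) * mayM p (m + 1) k b + 1 ≤ mayM p (m + 1) k (b + (m + 1) * (l + 1)) := by
        exact_mod_cast h3
      push_cast
      rw [pow_succ]
      nlinarith
    have b3 : GaussLE p (coWt p (m + 1) k) (mayM p (m + 1) k (a + (m + 1)) - 2)
        (MvPolynomial.C (p : ℚ)⁻¹ * MvPolynomial.expand (p ^ (m + 1)) (crossSum ℚ p k a)) := by
      refine (((crossSum_bound (M := mayM p (m + 1) k a - 1) H a ha (fun b c hb hc e => ?_)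
        (by linarith)).expand hw (m + 1)).C_mul _ hinv).mono ?_
      · have := (H.mayM_add_le hb hc).1
        rw [e] at this
        rw [le_sub_iff_add_le]
        exact_mod_cast this
      · rw [hfQ]; nlinarith
    have b4 : GaussLE p (coWt p (m + 1) k) (mayM p (m + 1) k (a + (m + 1)) - 2)
        (MvPolynomial.C (p : ℚ)⁻¹ * R ^ p) := by
      refine ((gR.pow_prime hw iR).C_mul _ hinv).mono ?_
      rw [hfQ]; nlinarith
    have b5 : GaussLE p (coWt p (m + 1) k) (mayM p (m + 1) k (a + (m + 1)) - 2)
        (mixedTerms p L R) := by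
      refine (GaussLE.mixedTerms hw iL iR gL gR (by linarith)).mono ?_
      rw [hfQ]; nlinarith
    exact (((b1.add b2).add b3).sub b4).sub b5
  · rw [sub_lt_iff_lt_add]
    exact_mod_cast hX

/-- For `s < n + k` the coproduct polynomial is `x_s + y_s + ∑ x_m y_{s-m}^{p^m}`. -/
theorem coD_of_lt (H : Admissible p n k) {s : ℕ} (h : k ≤ s) (h' : s < n + k) :
    coD p n k s = linPart ℤ s + crossSum ℤ p k s := by
  refine MvPolynomial.map_injective (Int.castRingHom ℚ) Int.cast_injective ?_
  rw [map_coD H.n_pos, spec_coprodRat_of_lt H h h']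
  simp [linPart, crossSum]

/-! ### Filtrations by weighted monomials -/

section Filt

variable {p : ℕ} [Fact p.Prime] {G B : Type*} [CommRing B] [Algebra (ZMod p) B]

/-- The monomial `∏ x_g ^ a_g`. -/
def monom (x : G → B) (a : G →₀ ℕ) : B := a.prod fun g m => x g ^ m

theorem monom_zero (x : G → B) : monom x 0 = 1 := by simp [monom]

theorem monom_single (x : G → B) (g : G) (m : ℕ) : monom x (Finsupp.single g m) = x g ^ m := by
  simp [monom]

theorem monom_add (x : G → B) (a b : G →₀ ℕ) : monom x (a + b) = monom x a * monom x b := by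
  classical
  exact Finsupp.prod_add_index' (by simp) (by simp [pow_add])

theorem map_monom {B' : Type*} [CommRing B'] (φ : B →+* B') (x : G → B) (a : G →₀ ℕ) :
    φ (monom x a) = monom (fun g => φ (x g)) a := by
  simp [monom, Finsupp.prod, map_prod]

/-- The span of the monomials in the `x_g` of weight at most `M`, with `x_g` of weight `w g`. -/
def filt (p : ℕ) [Fact p.Prime] [Algebra (ZMod p) B] (x : G → B) (w : G → ℕ) (M : ℤ) :
    Submodule (ZMod p) B :=
  Submodule.span (ZMod p) {b | ∃ a : G →₀ ℕ, (Finsupp.weight w a : ℤ) ≤ M ∧ b = monom x a}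

variable {x : G → B} {w : G → ℕ} {M N : ℤ}

theorem monom_mem_filt {a : G →₀ ℕ} (h : (Finsupp.weight w a : ℤ) ≤ M) :
    monom x a ∈ filt p x w M := Submodule.subset_span ⟨a, h, rfl⟩

theorem filt_mono (h : M ≤ N) : filt p x w M ≤ filt p x w N :=
  Submodule.span_mono fun _ ⟨a, ha, e⟩ => ⟨a, ha.trans h, e⟩

theorem one_mem_filt (h : 0 ≤ M) : (1 : B) ∈ filt p x w M := by
  rw [← monom_zero x]
  exact monom_mem_filt (by simpa using h)

theorem pow_mem_filt' {g : G} {m : ℕ} (h : (m * w g : ℤ) ≤ M) : x g ^ m ∈ filt p x w M := by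
  rw [← monom_single]
  refine monom_mem_filt ?_
  rw [Finsupp.weight_single]
  simpa using h

theorem mem_filt_single {g : G} (h : (w g : ℤ) ≤ M) : x g ∈ filt p x w M := by
  simpa using pow_mem_filt' (p := p) (x := x) (m := 1) (by simpa using h)

theorem mul_mem_filt {u v : B} (hu : u ∈ filt p x w M) (hv : v ∈ filt p x w N) :
    u * v ∈ filt p x w (M + N) := by
  have : filt p x w M * filt p x w N ≤ filt p x w (M + N) := by
    rw [filt, filt, Submodule.span_mul_span]
    refine Submodule.span_le.2 ?_
    rintro _ ⟨_, ⟨a, ha, rfl⟩, _, ⟨b, hb, rfl⟩, rfl⟩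
    simp only
    rw [← monom_add]
    refine monom_mem_filt ?_
    rw [map_add]
    push_cast
    exact add_le_add ha hb
  exact this (Submodule.mul_mem_mul hu hv)

theorem pow_mem_filt {u : B} (hu : u ∈ filt p x w M) (m : ℕ) : u ^ m ∈ filt p x w (m * M) := by
  induction m with
  | zero => simpa using one_mem_filt (by simp)
  | succ m ih =>
    rw [pow_succ]
    have := mul_mem_filt ih hu
    convert this using 2
    push_cast; ring

theorem prod_mem_filt {ι : Type*} (s : Finset ι) (u : ι → B) (m : ι → ℤ)
    (hu : ∀ i ∈ s, u i ∈ filt p x w (m i)) : ∏ i ∈ s, u i ∈ filt p x w (∑ i ∈ s, m i) := by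
  classical
  induction s using Finset.induction_on with
  | empty => simpa using one_mem_filt le_rfl
  | insert i s hi ih =>
    rw [Finset.prod_insert hi, Finset.sum_insert hi]
    exact mul_mem_filt (hu i (by simp)) (ih fun j hj => hu j (by simp [hj]))

theorem mul_sub_mem_filt {u u' v v' : B} (hu : u ∈ filt p x w M) (hv' : v' ∈ filt p x w N)
    (h1 : u - u' ∈ filt p x w (M - 1)) (h2 : v - v' ∈ filt p x w (N - 1)) :
    u * v - u' * v' ∈ filt p x w (M + N - 1) := by
  have e : u * v - u' * v' = u * (v - v') + (u - u') * v' := by ring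
  rw [e]
  refine add_mem (filt_mono (by omega) (mul_mem_filt hu h2))
    (filt_mono (by omega) (mul_mem_filt h1 hv'))

theorem charP_cast_zero : (p : B) = 0 := by
  have := congrArg (algebraMap (ZMod p) B) (ZMod.natCast_self p)
  rwa [map_natCast, map_zero] at this

theorem add_pow_p (u v : B) : (u + v) ^ p = u ^ p + v ^ p := by
  rw [add_pow_eq_mixedTerms, charP_cast_zero, zero_mul, add_zero]

theorem smul_pow_p (c : ZMod p) (u : B) : (c • u) ^ p = c • u ^ p := by
  rw [smul_pow, ZMod.pow_card]

variable (p B) in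
/-- The Frobenius endomorphism of a commutative algebra over the prime field. -/
def frob : B →ₗ[ZMod p] B where
  toFun u := u ^ p
  map_add' := add_pow_p
  map_smul' := smul_pow_p

theorem frob_apply (u : B) : frob p B u = u ^ p := rfl

theorem frob_pow_apply (j : ℕ) (u : B) : (frob p B ^ j) u = u ^ p ^ j := by
  induction j with
  | zero => simp
  | succ j ih => rw [pow_succ', Module.End.mul_apply, ih, frob_apply, ← pow_mul, pow_succ]

/-- If `x_g ^ p` is a generator of the same weight as `x_g`, the filtration is stable under the
Frobenius. -/
theorem pow_p_mem_filt (σ : G → G) (hx : ∀ g, x g ^ p = x (σ g)) (hw : ∀ g, w (σ g) = w g) {u : B}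
    (hu : u ∈ filt p x w M) : u ^ p ∈ filt p x w M := by
  have : filt p x w M ≤ (filt p x w M).comap (frob p B) := by
    refine Submodule.span_le.2 ?_
    rintro _ ⟨a, ha, rfl⟩
    rw [SetLike.mem_coe, Submodule.mem_comap, frob_apply]
    have e : monom x a ^ p = monom x (a.mapDomain σ) := by
      unfold monom
      rw [Finsupp.prod_mapDomain_index (by simp) (by simp [pow_add]), Finsupp.prod, Finsupp.prod,
        ← Finset.prod_pow]
      refine Finset.prod_congr rfl fun g _ => ?_
      rw [← hx, ← pow_mul, ← pow_mul, mul_comm]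
    rw [e]
    refine monom_mem_filt ?_
    rw [Finsupp.weight_apply, Finsupp.sum_mapDomain_index (by simp) (by simp [add_mul])]
    simp only [hw]
    exact ha
  exact this hu

theorem pow_pow_mem_filt (σ : G → G) (hx : ∀ g, x g ^ p = x (σ g)) (hw : ∀ g, w (σ g) = w g)
    {u : B} (hu : u ∈ filt p x w M) (j : ℕ) : u ^ p ^ j ∈ filt p x w M := by
  induction j with
  | zero => simpa
  | succ j ih =>
    rw [pow_succ, pow_mul]
    exact pow_p_mem_filt σ hx hw ih

/-- If `x_g ^ p` is a generator of the same weight as `x_g`, the monomials with exponents less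
than `p` span the filtration. -/
theorem filt_le_span (σ : G → G) (hx : ∀ g, x g ^ p = x (σ g)) (hw : ∀ g, w (σ g) = w g) :
    filt p x w M ≤ Submodule.span (ZMod p) {b | ∃ a : G →₀ ℕ, (∀ g, a g < p) ∧
      (Finsupp.weight w a : ℤ) ≤ M ∧ b = monom x a} := by
  classical
  have hp2 := (Fact.out : p.Prime).two_le
  have key : ∀ d : ℕ, ∀ a : G →₀ ℕ, Finsupp.degree a ≤ d → ∃ b : G →₀ ℕ, (∀ g, b g < p) ∧
      Finsupp.weight w b ≤ Finsupp.weight w a ∧ monom x b = monom x a := by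
    intro d
    induction d with
    | zero =>
      intro a ha
      have : a = 0 := by
        rw [← Finsupp.degree_eq_zero_iff]; omega
      subst this
      exact ⟨0, fun g => by simp; omega, le_rfl, rfl⟩
    | succ d ih =>
      intro a ha
      by_cases h : ∀ g, a g < p
      · exact ⟨a, h, le_rfl, rfl⟩
      · push Not at h
        obtain ⟨g, hg⟩ := h
        have e : a = (a - Finsupp.single g p) + Finsupp.single g p := by
          ext g'
          by_cases h' : g = g'
          · subst h'; simp; omega
          · simp [Finsupp.single_eq_of_ne' h']
        set a' := a - Finsupp.single g p
        have hd : Finsupp.degree a = Finsupp.degree a' + p := by rw [e, map_add]; simp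
        obtain ⟨b, h1, h2, h3⟩ := ih (a' + Finsupp.single (σ g) 1) (by rw [map_add]; simp; omega)
        refine ⟨b, h1, h2.trans ?_, h3.trans ?_⟩
        · rw [e, map_add, map_add, Finsupp.weight_single, Finsupp.weight_single, hw]
          simp only [smul_eq_mul]
          have : 1 * w g ≤ p * w g := Nat.mul_le_mul_right _ (by omega)
          omega
        · rw [e, monom_add, monom_add, monom_single, monom_single, hx, pow_one]
  refine Submodule.span_le.2 ?_
  rintro _ ⟨a, ha, rfl⟩
  obtain ⟨b, h1, h2, h3⟩ := key _ a le_rfl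
  refine Submodule.subset_span ⟨b, h1, le_trans (by exact_mod_cast h2) ha, h3.symm⟩

end Filt

/-! ### The May filtration of `S(n,k)` and of `S(n,k) ⊗ S(n,k)` -/

/-- The indices `(s, j)` of the generators `t_s^{p^j}`. -/
abbrev Gen (n k : ℕ) : Type := {s : ℕ // k ≤ s} × ZMod n

/-- Exponents of the monomials in the `t_s^{p^j}`. -/
abbrev Expo (n k : ℕ) : Type := Gen n k →₀ ℕ

variable {p n k : ℕ} [Fact p.Prime]

/-- The May filtration of `t_s^{p^j}`. -/
def genWt (p : ℕ) {n k : ℕ} (g : Gen n k) : ℕ := mayM p n k g.1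

variable (p) in
/-- `t_s^{p^j}`. -/
def tg (g : Gen n k) : S p n k := t p n k g.1 ^ p ^ g.2.val

variable (p) in
/-- The `t_s^{p^j} ⊗ 1` and the `1 ⊗ t_s^{p^j}`. -/
def tg₂ : Gen n k ⊕ Gen n k → S p n k ⊗[ZMod p] S p n k :=
  Sum.elim (fun g => tg p g ⊗ₜ 1) (fun g => 1 ⊗ₜ tg p g)

/-- The May filtration of the `t_s^{p^j} ⊗ 1` and the `1 ⊗ t_s^{p^j}`. -/
def genWt₂ (p : ℕ) {n k : ℕ} : Gen n k ⊕ Gen n k → ℕ := Sum.elim (genWt p) (genWt p)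

variable (p n k) in
/-- The May filtration of `S(n,k)`. -/
abbrev FS (M : ℤ) : Submodule (ZMod p) (S p n k) := filt p (tg p) (genWt p) M

variable (p n k) in
/-- The May filtration of `S(n,k) ⊗ S(n,k)`. -/
abbrev FSS (M : ℤ) : Submodule (ZMod p) (S p n k ⊗[ZMod p] S p n k) :=
  filt p (tg₂ p) (genWt₂ p) M

theorem t_pow_mul (s j l : ℕ) : t p n k s ^ p ^ (j + n * l) = t p n k s ^ p ^ j := by
  induction l with
  | zero => simp
  | succ l ih =>
    rw [show j + n * (l + 1) = n + (j + n * l) by ring, pow_add, pow_mul, t_pow, ih]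

theorem t_pow_mod (s j : ℕ) : t p n k s ^ p ^ (j % n) = t p n k s ^ p ^ j := by
  conv_rhs => rw [← Nat.mod_add_div j n]
  rw [t_pow_mul]

theorem tg_natCast (s : {s : ℕ // k ≤ s}) (j : ℕ) :
    tg p ((s, (j : ZMod n)) : Gen n k) = t p n k s ^ p ^ j := by
  rw [tg, ZMod.val_natCast, t_pow_mod]

/-- `(s, j) ↦ (s, j + 1)`. -/
def genFrob (g : Gen n k) : Gen n k := (g.1, g.2 + 1)

theorem tg_add_natCast [NeZero n] (s : {s : ℕ // k ≤ s}) (j : ZMod n) (m : ℕ) :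
    tg p ((s, j + (m : ZMod n)) : Gen n k) = tg p (s, j) ^ p ^ m := by
  conv_lhs => rw [← ZMod.natCast_zmod_val j, ← Nat.cast_add, tg_natCast]
  rw [tg, ← pow_mul, ← pow_add]

theorem tg_pow [NeZero n] (g : Gen n k) : tg p g ^ p = tg p (genFrob g) := by
  have := tg_add_natCast (p := p) g.1 g.2 1
  simp only [Nat.cast_one, pow_one] at this
  exact this.symm

theorem tg₂_pow [NeZero n] (g : Gen n k ⊕ Gen n k) : tg₂ p g ^ p = tg₂ p (Sum.map genFrob genFrob g) := by
  rcases g with g | g <;> simp [tg₂, Algebra.TensorProduct.tmul_pow, tg_pow]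

theorem genWt₂_frob (g : Gen n k ⊕ Gen n k) :
    genWt₂ p (Sum.map genFrob genFrob g) = genWt₂ p g := by
  rcases g with g | g <;> rfl

theorem genWt_frob (g : Gen n k) : genWt p (genFrob g) = genWt p g := rfl

theorem pow_mem_FSS [NeZero n] {M : ℤ} {u : S p n k ⊗[ZMod p] S p n k} (hu : u ∈ FSS p n k M) (j : ℕ) :
    u ^ p ^ j ∈ FSS p n k M :=
  pow_pow_mem_filt _ tg₂_pow genWt₂_frob hu j

/-! ### The coproduct of the generators -/

variable (p n k) in
/-- The generators `x_j ↦ t_j ⊗ 1` and `y_j ↦ 1 ⊗ t_j`. -/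
def coVar : ℕ ⊕ ℕ → S p n k ⊗[ZMod p] S p n k :=
  Sum.elim (fun j => t p n k j ⊗ₜ[ZMod p] (1 : S p n k)) (fun j => (1 : S p n k) ⊗ₜ[ZMod p] t p n k j)

variable (p n k) in
/-- Evaluation of integral polynomials in `S(n,k) ⊗ S(n,k)`. -/
def coEv : MvPolynomial (ℕ ⊕ ℕ) ℤ →+* S p n k ⊗[ZMod p] S p n k :=
  (MvPolynomial.aeval (R := ZMod p) (coVar p n k)).toRingHom.comp
    (MvPolynomial.map (Int.castRingHom (ZMod p)))

theorem comulT_eq (s : ℕ) : comulT p n k s = coEv p n k (coprodInt p n s) := rfl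

theorem coEv_X (v : ℕ ⊕ ℕ) : coEv p n k (MvPolynomial.X v) = coVar p n k v := by simp [coEv]

theorem t_zero (hk : 1 ≤ k) : t p n k 0 = 1 := by
  rw [t, dif_neg (by omega), if_pos rfl]

theorem t_eq_zero {s : ℕ} (h0 : 0 < s) (h : s < k) : t p n k s = 0 := by
  rw [t, dif_neg (by omega), if_neg (by omega)]

theorem coVar_spec (hk : 1 ≤ k) (v : ℕ ⊕ ℕ) : coEv p n k (specX ℤ k v) = coVar p n k v := by
  unfold specX
  split_ifs with h h0
  · exact coEv_X v
  · rw [map_one]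
    rcases v with v | v <;> simp only [Sum.elim_inl, Sum.elim_inr, id] at h0 <;> subst h0 <;>
      simp [coVar, t_zero hk] <;> rfl
  · rw [map_zero]
    rcases v with v | v <;> simp only [Sum.elim_inl, Sum.elim_inr, id] at h h0 <;>
      simp [coVar, t_eq_zero (p := p) (n := n) (show 0 < v by omega) (show v < k by omega)]

theorem coEv_spec (hk : 1 ≤ k) (P : MvPolynomial (ℕ ⊕ ℕ) ℤ) :
    coEv p n k (spec ℤ k P) = coEv p n k P := by
  induction P using MvPolynomial.induction_on with
  | C r => simp [spec]
  | add a b ha hb => simp only [map_add, ha, hb]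
  | mul_X a i ha => rw [map_mul, map_mul, map_mul, ha, coEv_X, ← coVar_spec hk]; simp [spec]

theorem comulT_eq_coD (hk : 1 ≤ k) (s : ℕ) : comulT p n k s = coEv p n k (coD p n k s) := by
  rw [comulT_eq, coD, coEv_spec hk]

theorem t_pow_mem (B : Type*) [CommRing B] [Algebra (ZMod p) B] {G : Type*} {x : G → B} {w : G → ℕ}
    (y : B) (g : ℕ → G) (m : ℕ) (hg : ∀ j, y ^ p ^ j = x (g j)) (hw : ∀ j, w (g j) = m) (e : ℕ) :
    y ^ e ∈ filt p x w (m * digitSum p e : ℕ) := by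
  have hp := (Fact.out : p.Prime).one_lt
  suffices h : ∀ e j : ℕ, y ^ (p ^ j * e) ∈ filt p x w (m * digitSum p e : ℕ) by
    simpa using h e 0
  intro e
  induction e using Nat.strong_induction_on with
  | _ e ih =>
  intro j
  rcases Nat.eq_zero_or_pos e with rfl | he
  · simpa [digitSum_zero] using one_mem_filt le_rfl
  have h1 := digitSum_add_mul hp (Nat.mod_lt e (show 0 < p by omega)) (e / p)
  have h2 : p ^ j * e = p ^ j * (e % p) + p ^ (j + 1) * (e / p) := by
    conv_lhs => rw [← Nat.mod_add_div e p]
    ring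
  rw [Nat.mod_add_div] at h1
  rw [h2, pow_add, h1, pow_mul, hg]
  have h3 : x (g j) ^ (e % p) ∈ filt p x w (m * (e % p) : ℕ) := by
    refine pow_mem_filt' ?_
    rw [hw]; push_cast; rw [mul_comm]
  have := mul_mem_filt h3 (ih (e / p) (Nat.div_lt_self he hp) (j + 1))
  refine filt_mono (le_of_eq ?_) this
  push_cast; ring

theorem coVar_pow_mem [NeZero n] (hk : 1 ≤ k) (v : ℕ ⊕ ℕ) (e : ℕ) :
    coVar p n k v ^ e ∈ FSS p n k (mayM p n k (v.elim id id) * digitSum p e : ℕ) := by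
  by_cases hv : k ≤ v.elim id id
  · rcases v with v | v
    · refine t_pow_mem _ _ (fun j => Sum.inl (⟨v, hv⟩, (j : ZMod n))) _ (fun j => ?_) (fun j => rfl) e
      simp [tg₂, coVar, tg_natCast, Algebra.TensorProduct.tmul_pow]
    · refine t_pow_mem _ _ (fun j => Sum.inr (⟨v, hv⟩, (j : ZMod n))) _ (fun j => ?_) (fun j => rfl) e
      simp [tg₂, coVar, tg_natCast, Algebra.TensorProduct.tmul_pow]
  · have h := coVar_spec (p := p) (n := n) hk v
    unfold specX at h
    rw [if_neg hv] at h
    split_ifs at h with h0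
    · rw [map_one] at h
      rw [← h, one_pow]
      exact one_mem_filt (by positivity)
    · rw [map_zero] at h
      rw [← h]
      rcases Nat.eq_zero_or_pos e with rfl | he
      · rw [pow_zero]; exact one_mem_filt (by positivity)
      · rw [zero_pow he.ne']; exact zero_mem _

/-- A polynomial whose coefficients at the monomials of weight more than `M` are divisible by `p`
has its value in filtration `M`. -/
theorem coEv_mem [NeZero n] (hk : 1 ≤ k) {P : MvPolynomial (ℕ ⊕ ℕ) ℤ} {M : ℤ}
    (h : ∀ X, M < coWt p n k X → (p : ℤ) ∣ P.coeff X) : coEv p n k P ∈ FSS p n k M := by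
  rw [MvPolynomial.as_sum P, map_sum]
  refine sum_mem fun X _ => ?_
  have e : coEv p n k (MvPolynomial.monomial X (P.coeff X)) =
      ((P.coeff X : ℤ) : ZMod p) • monom (coVar p n k) X := by
    rw [coEv, RingHom.comp_apply, MvPolynomial.map_monomial]
    simp [MvPolynomial.aeval_monomial, monom, Algebra.smul_def]
  rw [e]
  by_cases hX : M < coWt p n k X
  · rw [(ZMod.intCast_zmod_eq_zero_iff_dvd _ p).2 (h X hX), zero_smul]
    exact zero_mem _
  · refine Submodule.smul_mem _ _ (filt_mono (not_lt.1 hX) ?_)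
    have := prod_mem_filt X.support (fun v => coVar p n k v ^ X v) _
      fun v _ => coVar_pow_mem (p := p) (n := n) hk v (X v)
    rw [coWt, Finsupp.sum]
    push_cast at this ⊢
    exact this

theorem comul_t {s : ℕ} (hs : k ≤ s) : comul p n k (t p n k s) = comulT p n k s := by
  rw [t, dif_pos hs, comul, S.lift, S.mk]
  erw [Ideal.Quotient.liftₐ_apply, Ideal.Quotient.lift_mk]
  simp

/-- `Δ(t_s) ≡ t_s ⊗ 1 + 1 ⊗ t_s` modulo lower filtration. -/
theorem comulT_sub_mem [NeZero n] (H : Admissible p n k) {s : ℕ} (hs : k ≤ s) :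
    comulT p n k s - t p n k s ⊗ₜ 1 - 1 ⊗ₜ t p n k s ∈ FSS p n k (mayM p n k s - 1) := by
  have : comulT p n k s - t p n k s ⊗ₜ 1 - 1 ⊗ₜ t p n k s =
      coEv p n k (coD p n k s - linPart ℤ s) := by
    rw [map_sub, comulT_eq_coD H.one_le, linPart, map_add, coEv_X, coEv_X, coVar, Sum.elim_inl,
      Sum.elim_inr]
    ring
  rw [this]
  refine coEv_mem H.one_le fun X hX => ?_
  refine dvd_coeff_of_gaussLE (w := coWt p n k) (M := mayM p n k s - 1) (I := 0)
    (G := spec ℚ k (coprodRat p n s) - linPart ℚ s) ?_ (gaussLE_coprod_sub H hs) ?_ ?_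
  · rw [map_sub, map_coD H.n_pos]
    simp [linPart]
  · intro X; simp
  · exact_mod_cast hX

theorem comulT_of_lt (H : Admissible p n k) {s : ℕ} (h : k ≤ s) (h' : s < n + k) :
    comulT p n k s = t p n k s ⊗ₜ 1 + 1 ⊗ₜ t p n k s +
      ∑ m ∈ Finset.Icc k (s - k), t p n k m ⊗ₜ (t p n k (s - m) ^ p ^ m) := by
  rw [comulT_eq_coD H.one_le, coD_of_lt H h h', linPart, crossSum]
  simp only [map_add, map_sum, map_mul, map_pow, coEv_X, coVar, Sum.elim_inl, Sum.elim_inr,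
    Algebra.TensorProduct.tmul_pow, Algebra.TensorProduct.tmul_mul_tmul, one_pow, one_mul, mul_one]

theorem comulT_leading [NeZero n] (H : Admissible p n k) {a : ℕ} (ha : k ≤ a) :
    comulT p n k (a + n) - t p n k (a + n) ⊗ₜ 1 - 1 ⊗ₜ t p n k (a + n) +
      mixedTerms p (t p n k a ⊗ₜ 1) (1 ⊗ₜ t p n k a) ^ p ^ (n - 1) ∈
        FSS p n k (mayM p n k (a + n) - 2) := by
  have e : ∀ (m : ℕ) (P : MvPolynomial (ℕ ⊕ ℕ) ℤ),
      coEv p n k (MvPolynomial.expand (p ^ m) P) = coEv p n k P ^ p ^ m := fun m P => by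
    simp only [coEv, RingHom.comp_apply, MvPolynomial.map_expand, expand_pow_zmod, map_pow]
  have : comulT p n k (a + n) - t p n k (a + n) ⊗ₜ 1 - 1 ⊗ₜ t p n k (a + n) +
      mixedTerms p (t p n k a ⊗ₜ 1) (1 ⊗ₜ t p n k a) ^ p ^ (n - 1) =
      coEv p n k (coD p n k (a + n) - linPart ℤ (a + n) + MvPolynomial.expand (p ^ (n - 1))
        (mixedTerms p (MvPolynomial.X (Sum.inl a)) (MvPolynomial.X (Sum.inr a)))) := by
    rw [map_add, map_sub, e, comulT_eq_coD H.one_le, linPart, map_add, coEv_X, coEv_X]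
    simp only [mixedTerms, map_sum, map_mul, map_pow, map_natCast, coEv_X, coVar, Sum.elim_inl,
      Sum.elim_inr]
    ring
  rw [this]
  refine coEv_mem H.one_le fun X hX => coD_leading H ha ?_
  omega

/-! ### Divided powers -/

section DividedPower

variable {p : ℕ} [Fact p.Prime] {G B : Type*} [CommRing B] [Algebra (ZMod p) B]

/-- The product `∏ a_g!` modulo `p`. -/
def facts (p : ℕ) (a : G →₀ ℕ) : ZMod p := a.prod fun _ m => (m.factorial : ZMod p)

/-- The divided power monomial `∏ x_g ^ a_g / a_g!`, which is zero if some `a_g` is at least `p`. -/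
def dpow (p : ℕ) [Fact p.Prime] [Algebra (ZMod p) B] (x : G → B) (a : G →₀ ℕ) : B :=
  (facts p a)⁻¹ • monom x a

theorem facts_ne_zero {a : G →₀ ℕ} (ha : ∀ g, a g < p) : facts p a ≠ 0 := by
  refine Finset.prod_ne_zero_iff.2 fun g _ => ?_
  rw [Ne, ZMod.natCast_eq_zero_iff, (Fact.out : p.Prime).dvd_factorial]
  exact not_le.2 (ha g)

theorem facts_eq_zero {a : G →₀ ℕ} {g : G} (ha : p ≤ a g) : facts p a = 0 := by
  refine Finset.prod_eq_zero (i := g) ?_ ?_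
  · rw [Finsupp.mem_support_iff]
    have := (Fact.out : p.Prime).pos
    omega
  · rw [ZMod.natCast_eq_zero_iff, (Fact.out : p.Prime).dvd_factorial]
    exact ha

theorem dpow_eq_zero {x : G → B} {a : G →₀ ℕ} (ha : ¬ ∀ g, a g < p) : dpow p x a = 0 := by
  push Not at ha
  obtain ⟨g, hg⟩ := ha
  rw [dpow, facts_eq_zero hg, inv_zero, zero_smul]

theorem dpow_zero (x : G → B) : dpow p x 0 = 1 := by simp [dpow, facts, monom_zero]

theorem facts_smul_dpow {x : G → B} {a : G →₀ ℕ} (ha : ∀ g, a g < p) :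
    facts p a • dpow p x a = monom x a := by
  rw [dpow, smul_smul, mul_inv_cancel₀ (facts_ne_zero ha), one_smul]

theorem map_dpow {B' : Type*} [CommRing B'] [Algebra (ZMod p) B'] (φ : B →ₐ[ZMod p] B') (x : G → B)
    (a : G →₀ ℕ) : φ (dpow p x a) = dpow p (fun g => φ (x g)) a := by
  rw [dpow, map_smul, dpow]
  exact congrArg _ (map_monom φ.toRingHom x a)

theorem dpow_single_add (x : G → B) {g : G} {m : ℕ} {f : G →₀ ℕ} (hf : f g = 0) :
    dpow p x (Finsupp.single g m + f) = dpow p x (Finsupp.single g m) * dpow p x f := by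
  classical
  have : facts p (Finsupp.single g m + f) = facts p (Finsupp.single g m) * facts p f := by
    refine Finsupp.prod_add_index_of_disjoint ?_ _
    rw [Finset.disjoint_left]
    intro g' h1 h2
    have := Finsupp.support_single_subset h1
    rw [Finset.mem_singleton] at this
    subst this
    exact (Finsupp.mem_support_iff.1 h2) hf
  rw [dpow, this, mul_inv, monom_add, dpow, dpow, smul_mul_smul_comm]

open Finset.HasAntidiagonal in
theorem sum_antidiagonal_single_add [DecidableEq G] {A : Type*} [AddCommMonoid A]
    (F : (G →₀ ℕ) → (G →₀ ℕ) → A) {g : G} {m : ℕ} {f : G →₀ ℕ} (hf : f g = 0) :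
    ∑ x ∈ antidiagonal (Finsupp.single g m + f), F x.1 x.2 =
      ∑ i ∈ antidiagonal m, ∑ x ∈ antidiagonal f,
        F (Finsupp.single g i.1 + x.1) (Finsupp.single g i.2 + x.2) := by
  rw [← Finset.sum_product']
  symm
  refine Finset.sum_bij' (fun y _ => (Finsupp.single g y.1.1 + y.2.1,
      Finsupp.single g y.1.2 + y.2.2))
    (fun x _ => ((x.1 g, x.2 g), (x.1.erase g, x.2.erase g))) ?_ ?_ ?_ ?_ ?_
  · rintro ⟨⟨i, j⟩, ⟨b, c⟩⟩ h
    simp only [Finset.mem_product, mem_antidiagonal] at h ⊢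
    rw [← h.1, ← h.2, Finsupp.single_add]
    abel
  · rintro ⟨b, c⟩ h
    simp only [Finset.mem_product, mem_antidiagonal] at h ⊢
    constructor
    · have := DFunLike.congr_fun h g
      simpa [hf] using this
    · rw [← Finsupp.erase_add, h, Finsupp.erase_add, Finsupp.erase_single, zero_add,
        Finsupp.erase_of_notMem_support (by simpa using hf)]
  · rintro ⟨⟨i, j⟩, ⟨b, c⟩⟩ h
    simp only [Finset.mem_product, mem_antidiagonal] at h ⊢
    have h1 := DFunLike.congr_fun h.2 g
    rw [Finsupp.add_apply, hf] at h1
    have hb : b g = 0 := by omega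
    have hc : c g = 0 := by omega
    simp [hb, hc, Finsupp.erase_of_notMem_support]
  · rintro ⟨b, c⟩ h
    simp [Finsupp.single_add_erase]
  · intro _ _
    rfl

theorem add_pow_dpow (u v : B) {m : ℕ} (hm : m < p) :
    ((m.factorial : ZMod p))⁻¹ • (u + v) ^ m = ∑ i ∈ Finset.HasAntidiagonal.antidiagonal m,
      (((i.1.factorial : ZMod p))⁻¹ • u ^ i.1) * (((i.2.factorial : ZMod p))⁻¹ • v ^ i.2) := by
  have hfac : ∀ j < p, (j.factorial : ZMod p) ≠ 0 := fun j hj => by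
    rw [Ne, ZMod.natCast_eq_zero_iff, (Fact.out : p.Prime).dvd_factorial]
    omega
  rw [(Commute.all u v).add_pow', Finset.smul_sum]
  refine Finset.sum_congr rfl fun i hi => ?_
  rw [Finset.HasAntidiagonal.mem_antidiagonal] at hi
  rw [← Nat.cast_smul_eq_nsmul (ZMod p), smul_smul, smul_mul_smul_comm]
  congr 1
  have h1 := hfac i.1 (by omega)
  have h2 := hfac i.2 (by omega)
  have h3 := hfac m hm
  have := Nat.add_choose_mul_factorial_mul_factorial i.1 i.2
  rw [← Nat.choose_symm_add, hi] at this
  rw [← this] at h3 ⊢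
  push_cast at h3 ⊢
  have h4 := left_ne_zero_of_mul (left_ne_zero_of_mul h3)
  field_simp

/-- The binomial theorem for divided powers. -/
theorem dpow_add [DecidableEq G] (x y : G → B) {a : G →₀ ℕ} (ha : ∀ g, a g < p) :
    dpow p (fun g => x g + y g) a =
      ∑ b ∈ Finset.HasAntidiagonal.antidiagonal a, dpow p x b.1 * dpow p y b.2 := by
  induction a using Finsupp.induction with
  | zero => simp [dpow_zero]
  | single_add g m f hf hm ih =>
    have hf0 : f g = 0 := by simpa using hf
    have hm' : m < p := by simpa [hf0] using ha g
    have hfp : ∀ g', f g' < p := fun g' => lt_of_le_of_lt (by simp) (ha g')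
    rw [sum_antidiagonal_single_add (fun b c => dpow p x b * dpow p y c) hf0,
      dpow_single_add _ hf0, ih hfp]
    have e : dpow p (fun g => x g + y g) (Finsupp.single g m) =
        ∑ i ∈ Finset.HasAntidiagonal.antidiagonal m,
          dpow p x (Finsupp.single g i.1) * dpow p y (Finsupp.single g i.2) := by
      simp only [dpow, facts, monom_single]
      rw [Finsupp.prod_single_index (by simp), add_pow_dpow _ _ hm']
      refine Finset.sum_congr rfl fun i _ => ?_
      rw [Finsupp.prod_single_index (by simp), Finsupp.prod_single_index (by simp)]
    rw [e, Finset.sum_mul]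
    refine Finset.sum_congr rfl fun i _ => ?_
    rw [Finset.mul_sum]
    refine Finset.sum_congr rfl fun b hb => ?_
    rw [Finset.HasAntidiagonal.mem_antidiagonal] at hb
    have h1 := DFunLike.congr_fun hb g
    rw [Finsupp.add_apply, hf0] at h1
    rw [dpow_single_add x (by omega : b.1 g = 0), dpow_single_add y (by omega : b.2 g = 0)]
    ring

/-- Replacing the factors of a monomial by elements congruent to them modulo lower filtration
changes it by lower filtration. -/
theorem monom_sub_mem_filt {G' : Type*} {x : G' → B} {w : G' → ℕ} {u v : G → B} {w' : G → ℕ}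
    (hu : ∀ g, u g ∈ filt p x w (w' g)) (hv : ∀ g, v g ∈ filt p x w (w' g))
    (h : ∀ g, u g - v g ∈ filt p x w (w' g - 1)) (a : G →₀ ℕ) :
    monom u a - monom v a ∈ filt p x w (Finsupp.weight w' a - 1) ∧
      monom u a ∈ filt p x w (Finsupp.weight w' a) ∧
      monom v a ∈ filt p x w (Finsupp.weight w' a) := by
  have single : ∀ g (m : ℕ), u g ^ m - v g ^ m ∈ filt p x w (m * w' g - 1) := by
    intro g m
    induction m with
    | zero => simp
    | succ m ih =>
      rw [pow_succ, pow_succ]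
      have := mul_sub_mem_filt (pow_mem_filt (hu g) m) (hv g) ih (h g)
      convert this using 2
      push_cast; ring
  induction a using Finsupp.induction_linear with
  | zero => simpa [monom_zero] using one_mem_filt le_rfl
  | add a b ha hb =>
    rw [monom_add, monom_add, map_add]
    push_cast
    exact ⟨mul_sub_mem_filt ha.2.1 hb.2.2 ha.1 hb.1, mul_mem_filt ha.2.1 hb.2.1,
      mul_mem_filt ha.2.2 hb.2.2⟩
  | single g m =>
    rw [monom_single, monom_single, Finsupp.weight_single]
    simp only [smul_eq_mul, Nat.cast_mul]
    exact ⟨single g m, pow_mem_filt (hu g) m, pow_mem_filt (hv g) m⟩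

end DividedPower

/-! ### The divided power basis of `S(n,k)` -/

variable {p n k : ℕ} [Fact p.Prime]

/-- The exponents less than `p`, which index a basis of `S(n,k)`. -/
def Valid (p : ℕ) {n k : ℕ} (a : Expo n k) : Prop := ∀ g, a g < p

/-- The May filtration of a monomial in the `t_s^{p^j}`. -/
def wt (p : ℕ) {n k : ℕ} : Expo n k →+ ℕ := Finsupp.weight (genWt p)

variable (p) in
/-- The basis element `∏ t_g^{a_g} / a_g!` of `S(n,k)`. -/
def gam (a : Expo n k) : S p n k := dpow p (tg p) a

theorem gam_zero : gam p (0 : Expo n k) = 1 := dpow_zero _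

theorem gam_eq_zero {a : Expo n k} (h : ¬ Valid p a) : gam p a = 0 := dpow_eq_zero h

section Digits

theorem sum_digits_succ (p : ℕ) (c : ℕ → ℕ) (m : ℕ) :
    ∑ j ∈ Finset.range (m + 1), c j * p ^ j =
      c 0 + p * ∑ j ∈ Finset.range m, c (j + 1) * p ^ j := by
  rw [Finset.sum_range_succ', Finset.mul_sum, pow_zero, mul_one, add_comm]
  congr 1
  refine Finset.sum_congr rfl fun j _ => ?_
  ring

theorem sum_digits_div_mod {p : ℕ} {c : ℕ → ℕ} (hc : ∀ j, c j < p) {m i : ℕ} (hi : i < m) :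
    (∑ j ∈ Finset.range m, c j * p ^ j) / p ^ i % p = c i := by
  have hp : 0 < p := lt_of_le_of_lt (Nat.zero_le _) (hc 0)
  induction i generalizing c m with
  | zero =>
    obtain ⟨m, rfl⟩ := Nat.exists_eq_succ_of_ne_zero (by omega : m ≠ 0)
    rw [Nat.succ_eq_add_one, sum_digits_succ, pow_zero, Nat.div_one, Nat.add_mul_mod_self_left,
      Nat.mod_eq_of_lt (hc 0)]
  | succ i ih =>
    obtain ⟨m, rfl⟩ := Nat.exists_eq_succ_of_ne_zero (by omega : m ≠ 0)
    rw [Nat.succ_eq_add_one, sum_digits_succ, pow_succ', ← Nat.div_div_eq_div_mul,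
      Nat.add_mul_div_left _ _ hp, Nat.div_eq_of_lt (hc 0), zero_add]
    exact ih (fun j => hc (j + 1)) (by omega)

theorem digitSum_sum_digits {p : ℕ} (hp : 1 < p) {c : ℕ → ℕ} (hc : ∀ j, c j < p) (m : ℕ) :
    digitSum p (∑ j ∈ Finset.range m, c j * p ^ j) = ∑ j ∈ Finset.range m, c j := by
  induction m generalizing c with
  | zero => simp [digitSum_zero]
  | succ m ih =>
    rw [sum_digits_succ, digitSum_add_mul hp (hc 0), ih fun j => hc (j + 1),
      Finset.sum_range_succ', add_comm]

theorem sum_digits_lt {p : ℕ} {c : ℕ → ℕ} (hc : ∀ j, c j < p) (m : ℕ) :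
    ∑ j ∈ Finset.range m, c j * p ^ j < p ^ m := by
  induction m generalizing c with
  | zero => simp
  | succ m ih =>
    rw [sum_digits_succ, pow_succ']
    have h1 := ih fun j => hc (j + 1)
    have h2 := hc 0
    have h3 : p * (∑ j ∈ Finset.range m, c (j + 1) * p ^ j + 1) ≤ p * p ^ m :=
      Nat.mul_le_mul_left _ h1
    rw [mul_add] at h3
    omega

theorem sum_div_mod (p e m : ℕ) : ∑ j ∈ Finset.range m, e / p ^ j % p * p ^ j = e % p ^ m := by
  induction m with
  | zero => simp [Nat.mod_one]
  | succ m ih => rw [Finset.sum_range_succ, ih, Nat.mod_pow_succ, mul_comm]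

theorem sum_zmod_val [NeZero n] {A : Type*} [AddCommMonoid A] (F : ℕ → A) :
    ∑ j : ZMod n, F j.val = ∑ j ∈ Finset.range n, F j := by
  refine Finset.sum_nbij' ZMod.val (fun j => (j : ZMod n)) ?_ ?_ ?_ ?_ ?_
  · intro j _; exact Finset.mem_range.2 (ZMod.val_lt j)
  · intro j _; exact Finset.mem_univ _
  · intro j _; exact ZMod.natCast_zmod_val j
  · intro j hj; exact ZMod.val_cast_of_lt (Finset.mem_range.1 hj)
  · intro j _; rfl

end Digits

variable (p) in
/-- The exponents of the `t_s` in a monomial in the `t_s^{p^j}`. -/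
def expo (a : Expo n k) : {s : ℕ // k ≤ s} →₀ ℕ :=
  Finsupp.linearCombination ℕ (fun g : Gen n k => Finsupp.single g.1 (p ^ g.2.val)) a

variable (p n) in
/-- The `p`-adic digits of the exponents of a monomial in the `t_s`. -/
def digs [NeZero n] (e : {s : ℕ // k ≤ s} →₀ ℕ) : Expo n k :=
  Finsupp.onFinset (e.support ×ˢ Finset.univ) (fun g => e g.1 / p ^ g.2.val % p) (by
    intro g hg
    rw [Finset.mem_product, Finsupp.mem_support_iff]
    refine ⟨fun h => hg ?_, Finset.mem_univ _⟩
    rw [h, Nat.zero_div, Nat.zero_mod])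

theorem digs_apply [NeZero n] (e : {s : ℕ // k ≤ s} →₀ ℕ) (g : Gen n k) :
    digs p n e g = e g.1 / p ^ g.2.val % p := rfl

theorem valid_digs [NeZero n] (e : {s : ℕ // k ≤ s} →₀ ℕ) : Valid p (digs p n e) := fun _ =>
  Nat.mod_lt _ (Fact.out : p.Prime).pos

theorem expo_apply [NeZero n] (a : Expo n k) (s : {s : ℕ // k ≤ s}) :
    expo p a s = ∑ j ∈ Finset.range n, a (s, (j : ZMod n)) * p ^ j := by
  have : ∑ j ∈ Finset.range n, a (s, (j : ZMod n)) * p ^ j = ∑ j : ZMod n, a (s, j) * p ^ j.val := by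
    rw [← sum_zmod_val]
    refine Finset.sum_congr rfl fun j _ => ?_
    rw [ZMod.natCast_zmod_val]
  rw [this]
  induction a using Finsupp.induction_linear with
  | zero => simp [expo]
  | add a b ha hb =>
    rw [expo, map_add, Finsupp.add_apply, ← expo, ← expo, ha (sum_zmod_val _ |>.symm.trans (by simp)),
      hb (sum_zmod_val _ |>.symm.trans (by simp)), ← Finset.sum_add_distrib]
    simp [add_mul]
  | single g m =>
    classical
    rw [expo, Finsupp.linearCombination_single, Finsupp.smul_apply]
    by_cases h : g.1 = s
    · subst h
      rw [Finset.sum_eq_single g.2]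
      · simp
      · intro j _ hj
        rw [Finsupp.single_eq_of_ne, zero_mul]
        intro e
        exact hj (congrArg Prod.snd e)
      · simp
    · rw [Finsupp.single_eq_of_ne' h, smul_zero, Finset.sum_eq_zero]
      intro j _
      rw [Finsupp.single_eq_of_ne, zero_mul]
      intro e
      exact h (congrArg Prod.fst e).symm

theorem digs_expo [NeZero n] {a : Expo n k} (ha : Valid p a) : digs p n (expo p a) = a := by
  ext g
  rw [digs_apply, expo_apply]
  refine (sum_digits_div_mod (c := fun j => a (g.1, (j : ZMod n))) (fun j => ha _)
    (ZMod.val_lt g.2)).trans ?_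
  rw [ZMod.natCast_zmod_val]

theorem expo_lt [NeZero n] {a : Expo n k} (ha : Valid p a) (s : {s : ℕ // k ≤ s}) :
    expo p a s < p ^ n := by
  rw [expo_apply]
  exact sum_digits_lt (fun j => ha _) n

theorem expo_digs [NeZero n] {e : {s : ℕ // k ≤ s} →₀ ℕ} (he : ∀ s, e s < p ^ n) :
    expo p (digs p n e) = e := by
  ext s
  rw [expo_apply]
  refine Eq.trans ?_ ((sum_div_mod p (e s) n).trans (Nat.mod_eq_of_lt (he s)))
  refine Finset.sum_congr rfl fun j hj => ?_
  rw [digs_apply, ZMod.val_cast_of_lt (Finset.mem_range.1 hj)]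

theorem mayWeight_expo [NeZero n] {a : Expo n k} (ha : Valid p a) :
    mayWeight p n k (expo p a) = wt p a := by
  classical
  have hp := (Fact.out : p.Prime).one_lt
  have h1 : ∀ s ∉ a.support.image Prod.fst, ∀ j, a (s, j) = 0 := by
    intro s hs j
    by_contra h
    exact hs (Finset.mem_image.2 ⟨(s, j), Finsupp.mem_support_iff.2 h, rfl⟩)
  have h2 : (expo p a).support ⊆ a.support.image Prod.fst := by
    intro s hs
    by_contra h
    refine Finsupp.mem_support_iff.1 hs ?_
    rw [expo_apply, Finset.sum_eq_zero]
    intro j _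
    rw [h1 s h, zero_mul]
  rw [mayWeight, Finsupp.sum_of_support_subset _ h2 _ (by simp), wt, Finsupp.weight_apply,
    Finsupp.sum_of_support_subset a (s := a.support.image Prod.fst ×ˢ Finset.univ)
      (by
        intro g hg
        exact Finset.mem_product.2 ⟨Finset.mem_image_of_mem _ hg, Finset.mem_univ _⟩) _ (by simp),
    Finset.sum_product]
  refine Finset.sum_congr rfl fun s _ => ?_
  have := digitSum_sum_digits hp (c := fun j => a (s, (j : ZMod n))) (fun j => ha _) n
  rw [expo_apply, ← digitSum, this, ← sum_zmod_val, Finset.mul_sum]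
  refine Finset.sum_congr rfl fun j _ => ?_
  rw [ZMod.natCast_zmod_val, smul_eq_mul, mul_comm]
  rfl

theorem mono_add (e f : {s : ℕ // k ≤ s} →₀ ℕ) :
    mono p n k (e + f) = mono p n k e * mono p n k f := by
  rw [mono, mono, mono, ← map_mul, MvPolynomial.monomial_mul, one_mul]

theorem monom_tg (a : Expo n k) : monom (tg p) a = mono p n k (expo p a) := by
  induction a using Finsupp.induction_linear with
  | zero => simp [monom_zero, expo, mono]
  | add a b ha hb =>
    rw [monom_add, ha, hb, ← mono_add, expo, expo, expo, map_add]
  | single g m =>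
    rw [monom_single, expo, Finsupp.linearCombination_single, tg, ← pow_mul, t, dif_pos g.1.2, mono,
      ← map_pow, MvPolynomial.X_pow_eq_monomial, Finsupp.smul_single, smul_eq_mul, mul_comm]

theorem mono_eq_dpow [NeZero n] {e : {s : ℕ // k ≤ s} →₀ ℕ} (he : ∀ s, e s < p ^ n) :
    mono p n k e = facts p (digs p n e) • gam p (digs p n e) := by
  rw [gam, facts_smul_dpow (valid_digs e), monom_tg, expo_digs he]

/-- The reduction of exponents modulo the relation `t ^ q = t`. -/
def redExp (q e : ℕ) : ℕ := if e = 0 then 0 else (e - 1) % (q - 1) + 1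

theorem redExp_zero (q : ℕ) : redExp q 0 = 0 := if_pos rfl

theorem redExp_add (q e : ℕ) (hq : 0 < q) : redExp q (e + q) = redExp q (e + 1) := by
  unfold redExp
  rw [if_neg (by omega), if_neg (by omega)]
  congr 1
  rw [show e + q - 1 = e + 1 - 1 + (q - 1) by omega, Nat.add_mod_right]

theorem redExp_of_lt {q e : ℕ} (h : e < q) : redExp q e = e := by
  unfold redExp
  split_ifs with h0
  · exact h0.symm
  · rw [Nat.mod_eq_of_lt (by omega)]; omega

variable (p n k) in
/-- The linear map that reduces the exponents of all monomials. -/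
def redPoly : MvPolynomial {s : ℕ // k ≤ s} (ZMod p) →ₗ[ZMod p]
    (({s : ℕ // k ≤ s} →₀ ℕ) →₀ ZMod p) :=
  (MvPolynomial.basisMonomials _ _).constr (ZMod p) fun e =>
    Finsupp.single (e.mapRange (redExp (p ^ n)) (redExp_zero _)) 1

theorem redPoly_monomial (e : {s : ℕ // k ≤ s} →₀ ℕ) :
    redPoly p n k (MvPolynomial.monomial e 1) =
      Finsupp.single (e.mapRange (redExp (p ^ n)) (redExp_zero _)) 1 := by
  have := (MvPolynomial.basisMonomials {s : ℕ // k ≤ s} (ZMod p)).constr_basis (ZMod p)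
    (fun e => Finsupp.single (e.mapRange (redExp (p ^ n)) (redExp_zero _)) (1 : ZMod p)) e
  rwa [MvPolynomial.coe_basisMonomials] at this

theorem redPoly_mul_rel (P : MvPolynomial {s : ℕ // k ≤ s} (ZMod p)) (s : {s : ℕ // k ≤ s}) :
    redPoly p n k (P * (MvPolynomial.X s ^ p ^ n - MvPolynomial.X s)) = 0 := by
  classical
  suffices h : redPoly p n k ∘ₗ
      LinearMap.mulRight (ZMod p) (MvPolynomial.X s ^ p ^ n - MvPolynomial.X s) = 0 from
    LinearMap.congr_fun h P
  refine (MvPolynomial.basisMonomials _ _).ext fun e => ?_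
  have hq : 0 < p ^ n := pow_pos (Fact.out : p.Prime).pos n
  rw [MvPolynomial.coe_basisMonomials, LinearMap.comp_apply, LinearMap.mulRight_apply, mul_sub,
    MvPolynomial.X_pow_eq_monomial, MvPolynomial.X, MvPolynomial.monomial_mul,
    MvPolynomial.monomial_mul, one_mul, map_sub, redPoly_monomial, redPoly_monomial,
    LinearMap.zero_apply, sub_eq_zero]
  congr 1
  ext u
  simp only [Finsupp.mapRange_apply, Finsupp.add_apply]
  by_cases hu : s = u
  · subst hu
    rw [Finsupp.single_eq_same, Finsupp.single_eq_same, redExp_add _ _ hq]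
  · rw [Finsupp.single_eq_of_ne' hu, Finsupp.single_eq_of_ne' hu]

theorem redPoly_relIdeal {P : MvPolynomial {s : ℕ // k ≤ s} (ZMod p)} (hP : P ∈ relIdeal p n k) :
    redPoly p n k P = 0 := by
  suffices h : ∀ Q, redPoly p n k (Q * P) = 0 by simpa using h 1
  refine Submodule.span_induction (p := fun x _ => ∀ Q, redPoly p n k (Q * x) = 0) ?_ ?_ ?_ ?_ hP
  · rintro _ ⟨s, rfl⟩ Q
    exact redPoly_mul_rel Q s
  · intro Q; simp
  · intro x y _ _ hx hy Q
    rw [mul_add, map_add, hx, hy, add_zero]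
  · intro r x _ hx Q
    rw [smul_eq_mul, ← mul_assoc]
    exact hx _

theorem S.mk_surjective : Function.Surjective (S.mk p n k) := Ideal.Quotient.mk_surjective

theorem S.ker_mk_le : LinearMap.ker (S.mk p n k).toLinearMap ≤ LinearMap.ker (redPoly p n k) :=
  fun _ hP => redPoly_relIdeal (Ideal.Quotient.eq_zero_iff_mem.1 hP)

variable (p n k) in
/-- The coordinates with respect to the basis `gam`. -/
def crdS [NeZero n] : S p n k →ₗ[ZMod p] (Expo n k →₀ ZMod p) :=
  (Finsupp.lsum (ZMod p) fun e =>
      LinearMap.toSpanSingleton (ZMod p) (Expo n k →₀ ZMod p)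
        (Finsupp.single (digs p n e) (facts p (digs p n e)))) ∘ₗ
    Submodule.liftQ _ (redPoly p n k) S.ker_mk_le ∘ₗ
    ((S.mk p n k).toLinearMap.quotKerEquivOfSurjective S.mk_surjective).symm.toLinearMap

theorem crdS_mono [NeZero n] {e : {s : ℕ // k ≤ s} →₀ ℕ} (he : ∀ s, e s < p ^ n) :
    crdS p n k (mono p n k e) = Finsupp.single (digs p n e) (facts p (digs p n e)) := by
  have h1 : ((S.mk p n k).toLinearMap.quotKerEquivOfSurjective S.mk_surjective).symm
      (mono p n k e) = Submodule.Quotient.mk (MvPolynomial.monomial e 1) := by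
    rw [LinearEquiv.symm_apply_eq]
    rfl
  rw [crdS, LinearMap.comp_apply, LinearMap.comp_apply]
  erw [h1]
  rw [Submodule.liftQ_apply, redPoly_monomial]
  have h2 : e.mapRange (redExp (p ^ n)) (redExp_zero _) = e := by
    ext s
    rw [Finsupp.mapRange_apply, redExp_of_lt (he s)]
  rw [h2]
  simp

theorem crdS_gam [NeZero n] {a : Expo n k} (ha : Valid p a) :
    crdS p n k (gam p a) = Finsupp.single a 1 := by
  rw [gam, dpow, map_smul, monom_tg, crdS_mono (expo_lt ha), digs_expo ha, Finsupp.smul_single,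
    smul_eq_mul, inv_mul_cancel₀ (facts_ne_zero ha)]

theorem FS_le_span [NeZero n] (M : ℤ) : FS p n k M ≤
    Submodule.span (ZMod p) {b | ∃ a : Expo n k, Valid p a ∧ (wt p a : ℤ) ≤ M ∧ b = gam p a} := by
  refine (filt_le_span _ tg_pow genWt_frob).trans (Submodule.span_le.2 ?_)
  rintro _ ⟨a, ha, hM, rfl⟩
  rw [← facts_smul_dpow (p := p) ha]
  exact Submodule.smul_mem _ _ (Submodule.subset_span ⟨a, ha, hM, rfl⟩)

theorem exists_mem_FS [NeZero n] (x : S p n k) : ∃ M, x ∈ FS p n k M := by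
  obtain ⟨P, rfl⟩ := S.mk_surjective x
  induction P using MvPolynomial.induction_on with
  | C r =>
    refine ⟨0, ?_⟩
    rw [← MvPolynomial.algebraMap_eq, AlgHom.commutes, Algebra.algebraMap_eq_smul_one]
    exact Submodule.smul_mem _ _ (one_mem_filt le_rfl)
  | add a b ha hb =>
    obtain ⟨M, hM⟩ := ha
    obtain ⟨N, hN⟩ := hb
    rw [map_add]
    exact ⟨max M N, add_mem (filt_mono (le_max_left _ _) hM) (filt_mono (le_max_right _ _) hN)⟩
  | mul_X a s ha =>
    obtain ⟨M, hM⟩ := ha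
    rw [map_mul]
    have h : tg p ((s, 0) : Gen n k) = S.mk p n k (MvPolynomial.X s) := by
      rw [tg, t, dif_pos s.2, ZMod.val_zero, pow_zero, pow_one]
    rw [← h]
    exact ⟨_, mul_mem_filt hM (mem_filt_single le_rfl)⟩

theorem linearCombination_crdS [NeZero n] (x : S p n k) :
    Finsupp.linearCombination (ZMod p) (gam p) (crdS p n k x) = x := by
  obtain ⟨M, hM⟩ := exists_mem_FS x
  refine Submodule.span_induction (p := fun x _ =>
    Finsupp.linearCombination (ZMod p) (gam p) (crdS p n k x) = x) ?_ (by simp) ?_ ?_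
    (FS_le_span M hM)
  · rintro _ ⟨a, ha, -, rfl⟩
    rw [crdS_gam ha, Finsupp.linearCombination_single, one_smul]
  · intro x y _ _ hx hy
    rw [map_add, map_add, hx, hy]
  · intro c x _ hx
    rw [map_smul, map_smul, hx]

theorem crdS_support [NeZero n] {x : S p n k} {M : ℤ} (hx : x ∈ FS p n k M) {a : Expo n k}
    (ha : crdS p n k x a ≠ 0) : Valid p a ∧ (wt p a : ℤ) ≤ M := by
  have : crdS p n k x ∈ Finsupp.supported (ZMod p) (ZMod p)
      {a : Expo n k | Valid p a ∧ (wt p a : ℤ) ≤ M} := by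
    have h : FS p n k M ≤ (Finsupp.supported (ZMod p) (ZMod p)
      {a : Expo n k | Valid p a ∧ (wt p a : ℤ) ≤ M}).comap (crdS p n k) := by
      refine (FS_le_span M).trans (Submodule.span_le.2 ?_)
      rintro _ ⟨a, ha, hM, rfl⟩
      rw [SetLike.mem_coe, Submodule.mem_comap, crdS_gam ha]
      exact Finsupp.single_mem_supported _ _ ⟨ha, hM⟩
    exact h hx
  rw [Finsupp.mem_supported] at this
  exact this (Finsupp.mem_support_iff.2 ha)

theorem FSS_le_span [NeZero n] (M : ℤ) : FSS p n k M ≤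
    Submodule.span (ZMod p) {z | ∃ b c : Expo n k, Valid p b ∧ Valid p c ∧
      (wt p b + wt p c : ℤ) ≤ M ∧ z = gam p b ⊗ₜ gam p c} := by
  refine (filt_le_span _ tg₂_pow genWt₂_frob).trans (Submodule.span_le.2 ?_)
  rintro _ ⟨a, ha, hM, rfl⟩
  set b : Expo n k := a.comapDomain Sum.inl Sum.inl_injective.injOn
  set c : Expo n k := a.comapDomain Sum.inr Sum.inr_injective.injOn
  have hb : Valid p b := fun g => ha _
  have hc : Valid p c := fun g => ha _
  have e : a = b.mapDomain Sum.inl + c.mapDomain Sum.inr := by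
    ext g
    rcases g with g | g
    · rw [Finsupp.add_apply, Finsupp.mapDomain_apply Sum.inl_injective,
        Finsupp.mapDomain_of_notMem_range _ _ (by simp), add_zero]
      rfl
    · rw [Finsupp.add_apply, Finsupp.mapDomain_apply Sum.inr_injective,
        Finsupp.mapDomain_of_notMem_range _ _ (by simp), zero_add]
      rfl
  have e1 : monom (tg₂ p) (b.mapDomain Sum.inl) = monom (tg p) b ⊗ₜ 1 := by
    rw [monom, Finsupp.prod_mapDomain_index (by simp) (by simp [pow_add])]
    exact (map_monom (Algebra.TensorProduct.includeLeft (R := ZMod p) (S := ZMod p)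
      (A := S p n k) (B := S p n k)).toRingHom (tg p) b).symm
  have e2 : monom (tg₂ p) (c.mapDomain Sum.inr) = 1 ⊗ₜ monom (tg p) c := by
    rw [monom, Finsupp.prod_mapDomain_index (by simp) (by simp [pow_add])]
    exact (map_monom (Algebra.TensorProduct.includeRight (R := ZMod p)
      (A := S p n k) (B := S p n k)).toRingHom (tg p) c).symm
  rw [e, monom_add, e1, e2, Algebra.TensorProduct.tmul_mul_tmul, mul_one, one_mul,
    ← facts_smul_dpow (p := p) hb, ← facts_smul_dpow (p := p) hc, TensorProduct.smul_tmul_smul]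
  refine Submodule.smul_mem _ _ (Submodule.subset_span ⟨b, c, hb, hc, ?_, rfl⟩)
  rw [e, map_add, Finsupp.weight_apply, Finsupp.weight_apply,
    Finsupp.sum_mapDomain_index (by simp) (by simp [add_mul]),
    Finsupp.sum_mapDomain_index (by simp) (by simp [add_mul])] at hM
  push_cast at hM
  exact_mod_cast hM

/-! ### The coproduct of the divided power basis -/

theorem comul_tg_sub_mem [NeZero n] (H : Admissible p n k) (g : Gen n k) :
    comul p n k (tg p g) - (tg p g ⊗ₜ 1 + 1 ⊗ₜ tg p g) ∈ FSS p n k (genWt p g - 1) := by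
  have h := pow_mem_FSS (comulT_sub_mem H g.1.2) g.2.val
  rw [← frob_pow_apply, map_sub, map_sub, frob_pow_apply, frob_pow_apply, frob_pow_apply,
    ← comul_t g.1.2, Algebra.TensorProduct.tmul_pow, Algebra.TensorProduct.tmul_pow, one_pow,
    ← map_pow] at h
  rw [← sub_sub]
  exact h

open Finset.HasAntidiagonal in
/-- `Δ(γ_a) ≡ ∑_{b+c=a} γ_b ⊗ γ_c` modulo lower filtration. -/
theorem comul_gam_sub_mem [NeZero n] (H : Admissible p n k) {a : Expo n k} (ha : Valid p a) :
    comul p n k (gam p a) - ∑ b ∈ antidiagonal a, gam p b.1 ⊗ₜ gam p b.2 ∈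
      FSS p n k (wt p a - 1) := by
  classical
  have hl : ∀ g : Gen n k, (tg p g ⊗ₜ 1 : S p n k ⊗[ZMod p] S p n k) ∈ FSS p n k (genWt p g) :=
    fun g => mem_filt_single (g := Sum.inl g) le_rfl
  have hr : ∀ g : Gen n k, (1 ⊗ₜ tg p g : S p n k ⊗[ZMod p] S p n k) ∈ FSS p n k (genWt p g) :=
    fun g => mem_filt_single (g := Sum.inr g) le_rfl
  have h1 : ∑ b ∈ antidiagonal a, (gam p b.1 ⊗ₜ gam p b.2 : S p n k ⊗[ZMod p] S p n k) =
      dpow p (fun g => (tg p g ⊗ₜ 1 + 1 ⊗ₜ tg p g : S p n k ⊗[ZMod p] S p n k)) a := by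
    have := dpow_add (p := p) (fun g => (tg p g ⊗ₜ 1 : S p n k ⊗[ZMod p] S p n k))
      (fun g => 1 ⊗ₜ tg p g) ha
    rw [this]
    refine Finset.sum_congr (by congr!) fun b _ => ?_
    have e1 := map_dpow (Algebra.TensorProduct.includeLeft (R := ZMod p) (S := ZMod p)
      (A := S p n k) (B := S p n k)) (tg p) b.1
    have e2 := map_dpow (Algebra.TensorProduct.includeRight (R := ZMod p)
      (A := S p n k) (B := S p n k)) (tg p) b.2
    simp only [Algebra.TensorProduct.includeLeft_apply,
      Algebra.TensorProduct.includeRight_apply] at e1 e2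
    rw [← e1, ← e2, Algebra.TensorProduct.tmul_mul_tmul, mul_one, one_mul]
    rfl
  rw [h1, gam, map_dpow, dpow, dpow, ← smul_sub]
  refine Submodule.smul_mem _ _ (monom_sub_mem_filt (w' := genWt p) (fun g => ?_) (fun g => ?_)
    (fun g => comul_tg_sub_mem H g) a).1
  · rw [← sub_add_cancel (comul p n k (tg p g)) (tg p g ⊗ₜ 1 + 1 ⊗ₜ tg p g)]
    exact add_mem (filt_mono (by omega) (comul_tg_sub_mem H g)) (add_mem (hl g) (hr g))
  · exact add_mem (hl g) (hr g)

/-! ### Coassociativity -/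

section Twisted

open Finset.HasAntidiagonal

/-- The product `(c * c')_s = ∑_{j+m=s} c_j φ^j(c'_m)` of sequences, that is, of power series in a
variable `S` with `S w = φ(w) S`. -/
def twConv {W : Type*} [CommRing W] (φ : W →+* W) (c c' : ℕ → W) (s : ℕ) : W :=
  ∑ x ∈ antidiagonal s, c x.1 * (φ ^ x.1) (c' x.2)

/-- The congruence of power series modulo `S^n - p`. -/
def TwRel {W : Type*} [CommRing W] (p n : ℕ) (c c' : ℕ → W) : Prop :=
  ∃ b : ℕ → W, ∀ s, c s - c' s = p * b s - if n ≤ s then b (s - n) else 0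

variable {W : Type*} [CommRing W] {φ : W →+* W} {p n : ℕ}

theorem TwRel.symm {c c' : ℕ → W} : TwRel p n c c' → TwRel p n c' c := by
  rintro ⟨b, hb⟩
  refine ⟨fun s => -b s, fun s => ?_⟩
  have := hb s
  split_ifs at this ⊢ <;> linear_combination -this

theorem TwRel.trans {c c' c'' : ℕ → W} : TwRel p n c c' → TwRel p n c' c'' → TwRel p n c c'' := by
  rintro ⟨b, hb⟩ ⟨b', hb'⟩
  refine ⟨fun s => b s + b' s, fun s => ?_⟩
  have h1 := hb s
  have h2 := hb' s
  split_ifs at h1 h2 ⊢ <;> linear_combination h1 + h2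

theorem twConv_assoc (c c' c'' : ℕ → W) :
    twConv φ (twConv φ c c') c'' = twConv φ c (twConv φ c' c'') := by
  funext s
  simp only [twConv, Finset.sum_mul, map_sum, Finset.mul_sum]
  rw [Finset.sum_sigma', Finset.sum_sigma']
  refine Finset.sum_bij' (fun x _ => ⟨(x.2.1, x.2.2 + x.1.2), (x.2.2, x.1.2)⟩)
    (fun x _ => ⟨(x.1.1 + x.2.1, x.2.2), (x.1.1, x.2.1)⟩) ?_ ?_ ?_ ?_ ?_
  · rintro ⟨⟨a, b⟩, ⟨x, y⟩⟩ h
    simp only [Finset.mem_sigma, mem_antidiagonal] at h ⊢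
    exact ⟨by omega, trivial⟩
  · rintro ⟨⟨a, b⟩, ⟨x, y⟩⟩ h
    simp only [Finset.mem_sigma, mem_antidiagonal] at h ⊢
    exact ⟨by omega, trivial⟩
  · rintro ⟨⟨a, b⟩, ⟨x, y⟩⟩ h
    simp only [Finset.mem_sigma, mem_antidiagonal] at h ⊢
    obtain ⟨h1, rfl⟩ := h
    rfl
  · rintro ⟨⟨a, b⟩, ⟨x, y⟩⟩ h
    simp only [Finset.mem_sigma, mem_antidiagonal] at h ⊢
    obtain ⟨h1, rfl⟩ := h
    rfl
  · rintro ⟨⟨a, b⟩, ⟨x, y⟩⟩ h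
    simp only [Finset.mem_sigma, mem_antidiagonal] at h ⊢
    rw [← h.2, pow_add, map_mul, mul_assoc]
    rfl

theorem sum_antidiagonal_shift_left (F : ℕ → ℕ → W) (s : ℕ) :
    ∑ x ∈ antidiagonal s, (if n ≤ x.1 then F (x.1 - n) x.2 else 0) =
      if n ≤ s then ∑ x ∈ antidiagonal (s - n), F x.1 x.2 else 0 := by
  rw [← Finset.sum_filter]
  split_ifs with h
  · refine Finset.sum_bij' (fun x _ => (x.1 - n, x.2)) (fun x _ => (x.1 + n, x.2)) ?_ ?_ ?_ ?_ ?_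
    · rintro ⟨a, b⟩ h
      simp only [Finset.mem_filter, mem_antidiagonal] at h ⊢
      omega
    · rintro ⟨a, b⟩ h
      simp only [Finset.mem_filter, mem_antidiagonal] at h ⊢
      omega
    · rintro ⟨a, b⟩ h
      simp only [Finset.mem_filter, mem_antidiagonal] at h ⊢
      rw [Nat.sub_add_cancel h.2]
    · rintro ⟨a, b⟩ h
      simp
    · intros; rfl
  · refine Finset.sum_eq_zero fun x hx => ?_
    simp only [Finset.mem_filter, mem_antidiagonal] at hx
    omega

theorem sum_antidiagonal_shift_right (F : ℕ → ℕ → W) (s : ℕ) :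
    ∑ x ∈ antidiagonal s, (if n ≤ x.2 then F x.1 (x.2 - n) else 0) =
      if n ≤ s then ∑ x ∈ antidiagonal (s - n), F x.1 x.2 else 0 := by
  have h1 := sum_antidiagonal_shift_left (n := n) (fun a b => F b a) s
  rw [← Finset.Nat.sum_antidiagonal_swap] at h1
  rw [← Finset.Nat.sum_antidiagonal_swap (n := s - n)] at h1
  exact h1

theorem TwRel.conv_left (hφ : φ ^ n = 1) {c c' : ℕ → W} (e : ℕ → W) :
    TwRel p n c c' → TwRel p n (twConv φ c e) (twConv φ c' e) := by
  rintro ⟨b, hb⟩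
  refine ⟨twConv φ b e, fun s => ?_⟩
  have h1 : twConv φ c e s - twConv φ c' e s = p * twConv φ b e s -
      ∑ x ∈ antidiagonal s, (if n ≤ x.1 then b (x.1 - n) * (φ ^ (x.1 - n)) (e x.2) else 0) := by
    simp only [twConv, Finset.mul_sum, ← Finset.sum_sub_distrib]
    refine Finset.sum_congr rfl fun x _ => ?_
    rw [← sub_mul, hb]
    split_ifs with h
    · have : φ ^ x.1 = φ ^ (x.1 - n) := by
        conv_lhs => rw [← Nat.sub_add_cancel h, pow_add, hφ, mul_one]
      rw [this]; ring
    · ring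
  rw [h1, sum_antidiagonal_shift_left (fun i j => b i * (φ ^ i) (e j)) s]
  rfl

theorem TwRel.conv_right {c c' : ℕ → W} (e : ℕ → W) :
    TwRel p n c c' → TwRel p n (twConv φ e c) (twConv φ e c') := by
  rintro ⟨b, hb⟩
  refine ⟨twConv φ e b, fun s => ?_⟩
  have h1 : twConv φ e c s - twConv φ e c' s = p * twConv φ e b s -
      ∑ x ∈ antidiagonal s, (if n ≤ x.2 then e x.1 * (φ ^ x.1) (b (x.2 - n)) else 0) := by
    simp only [twConv, Finset.mul_sum, ← Finset.sum_sub_distrib]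
    refine Finset.sum_congr rfl fun x _ => ?_
    rw [← mul_sub, ← map_sub, hb]
    split_ifs with h
    · rw [map_sub, map_mul, map_natCast]; ring
    · rw [sub_zero, map_mul, map_natCast]; ring
  rw [h1, sum_antidiagonal_shift_right (fun i j => e i * (φ ^ i) (b j)) s]
  rfl

end Twisted

section Integral

variable {p n : ℕ} [Fact p.Prime]

/-- `twistedSum` with integer coefficients. -/
def twistedInt (p a i : ℕ) : MvPolynomial (ℕ ⊕ ℕ) ℤ :=
  ∑ jl ∈ Finset.HasAntidiagonal.antidiagonal a,
    MvPolynomial.X (Sum.inl jl.1) ^ p ^ i * MvPolynomial.X (Sum.inr jl.2) ^ p ^ (i + jl.1)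

theorem map_twistedInt (a i : ℕ) :
    MvPolynomial.map (Int.castRingHom ℚ) (twistedInt p a i) = twistedSum p a i := by
  simp [twistedInt, twistedSum]

theorem sum_logCoeff (hn : 0 < n) (s : ℕ) (F : ℕ → MvPolynomial (ℕ ⊕ ℕ) ℚ) :
    ∑ i ∈ Finset.range (s + 1), MvPolynomial.C (logCoeff p n i) * F i =
      ∑ l ∈ Finset.range (s / n + 1), MvPolynomial.C (((p : ℚ) ^ l)⁻¹) * F (n * l) := by
  have hpos : ∀ l, 0 < n * (l + 1) := fun l => Nat.mul_pos hn (Nat.succ_pos l)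
  have e : ∀ l, n * (l + 1) - 1 + 1 = n * (l + 1) := fun l => by have := hpos l; omega
  rw [Finset.sum_range_succ', Finset.sum_range_succ',
    sum_range_multiples (n := n) (L := s / n) _ hn]
  · congr 1
    · refine Finset.sum_congr rfl fun l _ => ?_
      rw [e, logCoeff, if_pos (Dvd.intro _ rfl), Nat.mul_div_cancel_left _ hn]
    · simp [logCoeff]
  · intro i _ hd
    rw [logCoeff, if_neg hd, map_zero, zero_mul]
  · intro l hl h
    have : l + 1 ≤ s / n := (Nat.le_div_iff_mul_le hn).2 (by rwa [mul_comm])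
    omega
  · intro l hl
    rw [mul_comm]
    exact (Nat.le_div_iff_mul_le hn).1 hl

/-- The defining recursion of the coproduct polynomials, without denominators. -/
theorem coprodInt_spec (hn : 0 < n) (s : ℕ) :
    ∑ l ∈ Finset.range (s / n + 1), (p : MvPolynomial (ℕ ⊕ ℕ) ℤ) ^ (s / n - l) *
        coprodInt p n (s - n * l) ^ p ^ (n * l) =
      ∑ l ∈ Finset.range (s / n + 1), (p : MvPolynomial (ℕ ⊕ ℕ) ℤ) ^ (s / n - l) *
        twistedInt p (s - n * l) (n * l) := by
  have hp : (p : ℚ) ≠ 0 := Nat.cast_ne_zero.2 (Fact.out : p.Prime).ne_zero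
  refine MvPolynomial.map_injective (Int.castRingHom ℚ) Int.cast_injective ?_
  have h := congrArg (fun P => MvPolynomial.C ((p : ℚ) ^ (s / n)) * P) (coprodRat_spec p n s)
  rw [sum_logCoeff hn s (fun i => coprodRat p n (s - i) ^ p ^ i),
    sum_logCoeff hn s (fun i => twistedSum p (s - i) i)] at h
  simp only [Finset.mul_sum, ← mul_assoc, ← map_mul] at h
  have e : ∀ l ∈ Finset.range (s / n + 1), (MvPolynomial.C ((p : ℚ) ^ (s / n) * ((p : ℚ) ^ l)⁻¹) :
      MvPolynomial (ℕ ⊕ ℕ) ℚ) = (p : MvPolynomial (ℕ ⊕ ℕ) ℚ) ^ (s / n - l) := fun l hl => by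
    rw [Finset.mem_range] at hl
    rw [← pow_sub₀ _ hp (by omega)]
    simp
  rw [map_sum, map_sum]
  simp only [map_mul, map_pow, map_natCast, map_coprodInt p n hn, map_twistedInt]
  refine (Finset.sum_congr rfl fun l hl => ?_).trans (h.trans
    (Finset.sum_congr rfl fun l hl => ?_))
  · rw [e l hl]
  · rw [e l hl]

end Integral

/-- The values of the coproduct polynomials at two sequences. -/
def coVal (p n : ℕ) {Q : Type*} [CommRing Q] (x y : ℕ → Q) (s : ℕ) : Q :=
  MvPolynomial.eval₂ (Int.castRingHom Q) (Sum.elim x y) (coprodInt p n s)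

theorem coVal_map {p n : ℕ} {Q Q' : Type*} [CommRing Q] [CommRing Q'] (f : Q →+* Q') (x y : ℕ → Q) (s : ℕ) :
    f (coVal p n x y s) = coVal p n (fun j => f (x j)) (fun j => f (y j)) s := by
  rw [coVal, MvPolynomial.hom_eval₂, coVal]
  congr 1
  · exact RingHom.ext_int _ _
  · funext v; rcases v with v | v <;> rfl

section Witt

open WittVector

variable {p n : ℕ} [Fact p.Prime] {Q : Type*} [CommRing Q] [CharP Q p]

theorem witt_eq_zero_of_mul (hn : 0 < n) (hq : ∀ u : Q, u ^ p ^ n = u) {x : WittVector p Q}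
    (h : (p : WittVector p Q) * x = 0) : x = 0 := by
  ext i
  rw [WittVector.zero_coeff]
  have h1 : ((p : WittVector p Q) * x).coeff (i + 1) = (0 : WittVector p Q).coeff (i + 1) := by
    rw [h]
  rw [mul_comm, mul_charP_coeff_succ, WittVector.zero_coeff] at h1
  obtain ⟨m, rfl⟩ : ∃ m, n = m + 1 := ⟨n - 1, by omega⟩
  rw [← hq (x.coeff i), pow_succ', pow_mul, h1,
    zero_pow (pow_ne_zero _ (Fact.out : p.Prime).ne_zero)]

theorem witt_dvd_of_coeff (hn : 0 < n) (hq : ∀ u : Q, u ^ p ^ n = u) {x : WittVector p Q}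
    (h : x.coeff 0 = 0) : (p : WittVector p Q) ∣ x := by
  refine ⟨WittVector.mk p fun i => x.coeff (i + 1) ^ p ^ (n - 1), ?_⟩
  ext i
  rw [mul_comm]
  rcases i with _ | i
  · rw [mul_charP_coeff_zero, h]
  · obtain ⟨m, rfl⟩ : ∃ m, n = m + 1 := ⟨n - 1, by omega⟩
    rw [mul_charP_coeff_succ, WittVector.coeff_mk, Nat.add_sub_cancel, ← pow_mul, ← pow_succ, hq]

theorem witt_frobenius_pow (hq : ∀ u : Q, u ^ p ^ n = u) :
    (WittVector.frobenius : WittVector p Q →+* WittVector p Q) ^ n = 1 := by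
  refine RingHom.ext fun x => ?_
  rw [RingHom.coe_pow]
  ext i
  rw [iterate_frobenius_coeff, hq]
  rfl

theorem witt_frobenius_pow_teichmuller (u : Q) (j : ℕ) :
    ((WittVector.frobenius : WittVector p Q →+* WittVector p Q) ^ j) (teichmuller p u) =
      teichmuller p u ^ p ^ j := by
  induction j with
  | zero => simp
  | succ j ih =>
    rw [pow_succ', RingHom.mul_def, RingHom.comp_apply, ih, map_pow, frobenius_eq_map_frobenius,
      map_teichmuller, frobenius_def, map_pow, ← pow_mul, pow_succ']

/-- A sequence in `Q` is determined by its sequence of Teichmüller representatives modulo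
`S^n - p`. -/
theorem TwRel.teichmuller_injective (hn : 0 < n) (hq : ∀ u : Q, u ^ p ^ n = u) {u v : ℕ → Q}
    (h : TwRel p n (fun s => teichmuller p (u s)) (fun s => teichmuller p (v s))) : u = v := by
  obtain ⟨b, hb⟩ := h
  -- the constant coefficient gives `u s = v s`, and then `p * b s = 0` gives `b s = 0`
  suffices H : ∀ s, u s = v s ∧ b s = 0 from funext fun s => (H s).1
  intro s
  induction s using Nat.strong_induction_on with
  | _ s ih =>
  have h1 : teichmuller p (u s) - teichmuller p (v s) = p * b s := by
    rw [hb s]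
    split_ifs with h
    · rw [(ih (s - n) (by omega)).2, sub_zero]
    · rw [sub_zero]
  have h2 : u s = v s := by
    have := congrArg WittVector.constantCoeff h1
    simp only [map_sub, map_mul, map_natCast, CharP.cast_eq_zero, zero_mul] at this
    exact sub_eq_zero.1 this
  refine ⟨h2, witt_eq_zero_of_mul hn hq ?_⟩
  rw [← h1, h2, sub_self]

/-- The values of the coproduct polynomials are the components of a product of power series
modulo `S^n - p`. -/
theorem coVal_rel (hn : 0 < n) (hq : ∀ u : Q, u ^ p ^ n = u) (x y : ℕ → Q) :
    TwRel p n (fun s => teichmuller p (coVal p n x y s))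
      (twConv WittVector.frobenius (fun s => teichmuller p (x s))
        (fun s => teichmuller p (y s))) := by
  have hτ : ∀ (u : Q) l, teichmuller p u ^ p ^ (n * l) = teichmuller p u := fun u l => by
    rw [← map_pow]
    congr 1
    induction l with
    | zero => simp
    | succ l ih => rw [mul_add, mul_one, pow_add, pow_mul, ih, hq]
  set T := twConv WittVector.frobenius (fun s => teichmuller p (x s)) (fun s => teichmuller p (y s))
    with hT
  -- evaluation at Teichmüller representatives
  set ev : MvPolynomial (ℕ ⊕ ℕ) ℤ →+* WittVector p Q :=
    MvPolynomial.eval₂Hom (Int.castRingHom _)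
      (Sum.elim (fun s => teichmuller p (x s)) (fun s => teichmuller p (y s))) with hev
  have hevT : ∀ a l, ev (twistedInt p a (n * l)) = T a := fun a l => by
    rw [twistedInt, hT, twConv, map_sum]
    refine Finset.sum_congr rfl fun z _ => ?_
    simp only [map_mul, map_pow, hev, MvPolynomial.coe_eval₂Hom, MvPolynomial.eval₂_X, Sum.elim_inl,
      Sum.elim_inr]
    rw [pow_add, pow_mul (teichmuller p (y z.2)), hτ, hτ, witt_frobenius_pow_teichmuller]
  -- `D_a` and the Teichmüller representative of its value agree modulo `p`, so their `p^{nl}`-th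
  -- powers agree modulo `p^{nl+1}`
  have hevD : ∀ a l, (p : WittVector p Q) ^ (n * l + 1) ∣
      ev (coprodInt p n a) ^ p ^ (n * l) - teichmuller p (coVal p n x y a) := fun a l => by
    rw [← hτ (coVal p n x y a) l]
    suffices h0 : (ev (coprodInt p n a) - teichmuller p (coVal p n x y a)).coeff 0 = 0 from
      dvd_sub_pow_of_dvd_sub (witt_dvd_of_coeff hn hq h0) (n * l)
    have h1 : ((ev (coprodInt p n a) - teichmuller p (coVal p n x y a)).coeff 0) =
      WittVector.constantCoeff (ev (coprodInt p n a) - teichmuller p (coVal p n x y a)) := rfl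
    rw [h1, map_sub, sub_eq_zero, hev, MvPolynomial.coe_eval₂Hom]
    exact coVal_map (n := n) WittVector.constantCoeff (fun s => teichmuller p (x s))
      (fun s => teichmuller p (y s)) a
  set e : ℕ → WittVector p Q := fun s => teichmuller p (coVal p n x y s) - T s with he
  have hdvd : ∀ s, (p : WittVector p Q) ^ (s / n + 1) ∣
      ∑ l ∈ Finset.range (s / n + 1), (p : WittVector p Q) ^ (s / n - l) * e (s - n * l) := by
    intro s
    have h := congrArg ev (coprodInt_spec (p := p) hn s)
    simp only [map_sum, map_mul, map_pow, map_natCast, hevT] at h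
    have h2 : ∑ l ∈ Finset.range (s / n + 1), (p : WittVector p Q) ^ (s / n - l) * e (s - n * l) =
        -∑ l ∈ Finset.range (s / n + 1), (p : WittVector p Q) ^ (s / n - l) *
          (ev (coprodInt p n (s - n * l)) ^ p ^ (n * l) -
            teichmuller p (coVal p n x y (s - n * l))) := by
      simp only [he, mul_sub, Finset.sum_sub_distrib] at h ⊢
      linear_combination h
    rw [h2, dvd_neg]
    refine Finset.dvd_sum fun l hl => ?_
    rw [Finset.mem_range] at hl
    have hl' : l ≤ n * l := Nat.le_mul_of_pos_left l hn
    refine (pow_dvd_pow _ (show s / n + 1 ≤ (s / n - l) + (n * l + 1) by omega)).trans ?_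
    rw [pow_add]
    exact mul_dvd_mul_left _ (hevD _ _)
  -- dividing by `p^{⌊s/n⌋+1}` gives the multiplier of `S^n - p`
  choose b hb using hdvd
  have cancel : ∀ (m : ℕ) (u v : WittVector p Q), (p : WittVector p Q) ^ m * u = p ^ m * v →
      u = v := by
    intro m u v h
    induction m with
    | zero => simpa using h
    | succ m ih =>
      refine ih (sub_eq_zero.1 (witt_eq_zero_of_mul hn hq ?_))
      rw [pow_succ'] at h
      linear_combination h
  refine ⟨b, fun s => cancel (s / n) _ _ ?_⟩
  have h1 := hb s
  split_ifs with h
  · have h2 : s / n = (s - n) / n + 1 := by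
      conv_lhs => rw [← Nat.sub_add_cancel h, Nat.add_div_right _ hn]
    have h3 := hb (s - n)
    rw [Finset.sum_range_succ'] at h1
    have h4 : ∑ l ∈ Finset.range (s / n), (p : WittVector p Q) ^ (s / n - (l + 1)) *
        e (s - n * (l + 1)) = p ^ (s / n) * b (s - n) := by
      rw [h2, ← h3]
      refine Finset.sum_congr rfl fun l _ => ?_
      rw [show s - n * (l + 1) = s - n - n * l by rw [mul_add, mul_one]; omega,
        show (s - n) / n + 1 - (l + 1) = (s - n) / n - l by omega]
    rw [h4, mul_zero, Nat.sub_zero, Nat.sub_zero, pow_succ] at h1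
    simp only [he] at h1
    linear_combination h1
  · rw [Nat.div_eq_of_lt (by omega)] at h1 ⊢
    simpa [he] using h1

/-- Associativity of the coproduct polynomials where all elements satisfy `u ^ {p ^ n} = u`. -/
theorem coVal_assoc (hn : 0 < n) (hq : ∀ u : Q, u ^ p ^ n = u) (x y z : ℕ → Q) :
    coVal p n (coVal p n x y) z = coVal p n x (coVal p n y z) := by
  have hφ := witt_frobenius_pow (p := p) hq
  refine TwRel.teichmuller_injective hn hq ?_
  refine (coVal_rel hn hq _ _).trans (TwRel.trans ((coVal_rel hn hq x y).conv_left hφ _) ?_)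
  rw [twConv_assoc]
  exact ((coVal_rel hn hq y z).conv_right _).symm.trans (coVal_rel hn hq _ _).symm

end Witt

section Coassoc

variable {p n k : ℕ} [Fact p.Prime]

theorem S.pow_eq (u : S p n k) : u ^ p ^ n = u := by
  obtain ⟨P, rfl⟩ := S.mk_surjective u
  induction P using MvPolynomial.induction_on with
  | C r => rw [← map_pow, ← map_pow, ZMod.pow_card_pow]
  | add a b ha hb => rw [map_add, ← frob_pow_apply, map_add, frob_pow_apply, frob_pow_apply, ha, hb]
  | mul_X a s ha =>
    have := t_pow p n k s
    rw [t, dif_pos s.2] at this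
    rw [map_mul, mul_pow, ha, this]

theorem tensor_pow_eq {A B : Type*} [CommRing A] [CommRing B] [Algebra (ZMod p) A]
    [Algebra (ZMod p) B] (hA : ∀ u : A, u ^ p ^ n = u) (hB : ∀ u : B, u ^ p ^ n = u)
    (u : A ⊗[ZMod p] B) : u ^ p ^ n = u := by
  induction u using TensorProduct.induction_on with
  | zero => exact zero_pow (pow_ne_zero _ (Fact.out : p.Prime).ne_zero)
  | tmul a b => rw [Algebra.TensorProduct.tmul_pow, hA, hB]
  | add a b ha hb => rw [← frob_pow_apply, map_add, frob_pow_apply, frob_pow_apply, ha, hb]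

theorem comulT_eq_coVal (s : ℕ) :
    comulT p n k s = coVal p n (fun j => t p n k j ⊗ₜ[ZMod p] (1 : S p n k))
      (fun j => (1 : S p n k) ⊗ₜ[ZMod p] t p n k j) s := by
  rw [comulT_eq, coEv, coVal]
  simp only [AlgHom.toRingHom_eq_coe, RingHom.comp_apply]
  erw [MvPolynomial.aeval_def, MvPolynomial.eval₂_map]
  congr 1

theorem comul_t' (H : Admissible p n k) (s : ℕ) : comul p n k (t p n k s) = comulT p n k s := by
  rcases le_or_gt k s with h | h
  · exact comul_t h
  · have h1 : coD p n k s = if s = 0 then 1 else 0 := by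
      refine MvPolynomial.map_injective (Int.castRingHom ℚ) Int.cast_injective ?_
      rw [map_coD H.n_pos]
      split_ifs with h0
      · rw [h0, spec_coprodRat_zero H.one_le, map_one]
      · rw [spec_coprodRat_eq_zero H.one_le (by omega) h, map_zero]
    rw [comulT_eq_coD H.one_le, h1]
    split_ifs with h0
    · rw [h0, t_zero H.one_le, map_one, map_one]
    · rw [t_eq_zero (by omega) h, map_zero, map_zero]

theorem S.algHom_ext {A : Type*} [CommRing A] [Algebra (ZMod p) A] {f g : S p n k →ₐ[ZMod p] A}
    (h : ∀ s, f (t p n k s) = g (t p n k s)) : f = g := by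
  have : f.comp (S.mk p n k) = g.comp (S.mk p n k) := by
    refine MvPolynomial.algHom_ext fun s => ?_
    have := h s
    rwa [t, dif_pos s.2] at this
  refine AlgHom.ext fun u => ?_
  obtain ⟨P, rfl⟩ := S.mk_surjective u
  exact AlgHom.congr_fun this P

theorem map_comul_t (H : Admissible p n k) {Q : Type*} [CommRing Q] [Algebra (ZMod p) Q]
    (f : S p n k ⊗[ZMod p] S p n k →ₐ[ZMod p] Q) (s : ℕ) :
    f (comul p n k (t p n k s)) =
      coVal p n (fun j => f (t p n k j ⊗ₜ 1)) (fun j => f (1 ⊗ₜ t p n k j)) s := by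
  rw [comul_t' H, comulT_eq_coVal]
  exact coVal_map (f : S p n k ⊗[ZMod p] S p n k →+* Q) (fun j => t p n k j ⊗ₜ[ZMod p] (1 : S p n k))
    (fun j => (1 : S p n k) ⊗ₜ[ZMod p] t p n k j) s

/-- The coproduct of `S(n,k)` is coassociative. -/
theorem comul_coassoc (H : Admissible p n k) :
    (Algebra.TensorProduct.assoc (ZMod p) (ZMod p) (ZMod p) (S p n k) (S p n k)
        (S p n k)).toAlgHom.comp
      ((Algebra.TensorProduct.map (comul p n k) (AlgHom.id (ZMod p) (S p n k))).comp
        (comul p n k)) =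
    (Algebra.TensorProduct.map (AlgHom.id (ZMod p) (S p n k)) (comul p n k)).comp
      (comul p n k) := by
  rcases subsingleton_or_nontrivial (S p n k ⊗[ZMod p] (S p n k ⊗[ZMod p] S p n k)) with h | h
  · exact AlgHom.ext fun x => Subsingleton.elim _ _
  have hch : CharP (S p n k ⊗[ZMod p] (S p n k ⊗[ZMod p] S p n k)) p :=
    charP_of_injective_algebraMap
      (algebraMap (ZMod p) (S p n k ⊗[ZMod p] (S p n k ⊗[ZMod p] S p n k))).injective p
  refine S.algHom_ext fun s => ?_
  let X : ℕ → S p n k ⊗[ZMod p] (S p n k ⊗[ZMod p] S p n k) := fun j => t p n k j ⊗ₜ (1 ⊗ₜ 1)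
  let Y : ℕ → S p n k ⊗[ZMod p] (S p n k ⊗[ZMod p] S p n k) := fun j => 1 ⊗ₜ (t p n k j ⊗ₜ 1)
  let Z : ℕ → S p n k ⊗[ZMod p] (S p n k ⊗[ZMod p] S p n k) := fun j => 1 ⊗ₜ (1 ⊗ₜ t p n k j)
  have key := coVal_assoc (p := p) H.n_pos
    (tensor_pow_eq S.pow_eq (tensor_pow_eq (S.pow_eq (k := k)) S.pow_eq))
    X Y Z
  have hL : ∀ j, ((Algebra.TensorProduct.assoc (ZMod p) (ZMod p) (ZMod p) (S p n k) (S p n k)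
      (S p n k)).toAlgHom.comp (Algebra.TensorProduct.map (comul p n k)
        (AlgHom.id (ZMod p) (S p n k)))) (t p n k j ⊗ₜ 1) =
      coVal p n X Y j :=
    fun j => map_comul_t H (((Algebra.TensorProduct.assoc (ZMod p) (ZMod p) (ZMod p) (S p n k)
      (S p n k) (S p n k)).toAlgHom.comp Algebra.TensorProduct.includeLeft)) j
  have hR : ∀ j, Algebra.TensorProduct.map (AlgHom.id (ZMod p) (S p n k)) (comul p n k)
      ((1 : S p n k) ⊗ₜ[ZMod p] t p n k j) =
      coVal p n Y Z j :=
    fun j => map_comul_t H (Algebra.TensorProduct.includeRight (R := ZMod p) (A := S p n k)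
      (B := S p n k ⊗[ZMod p] S p n k)) j
  have e1 := map_comul_t H (((Algebra.TensorProduct.assoc (ZMod p) (ZMod p) (ZMod p) (S p n k)
      (S p n k) (S p n k)).toAlgHom.comp (Algebra.TensorProduct.map (comul p n k)
        (AlgHom.id (ZMod p) (S p n k))))) s
  have e2 := map_comul_t H (Algebra.TensorProduct.map (AlgHom.id (ZMod p) (S p n k))
      (comul p n k)) s
  refine e1.trans (Eq.trans ?_ e2.symm)
  rw [funext hL, funext hR]
  have f1 : (fun j => ((Algebra.TensorProduct.assoc (ZMod p) (ZMod p) (ZMod p) (S p n k) (S p n k)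
      (S p n k)).toAlgHom.comp (Algebra.TensorProduct.map (comul p n k)
        (AlgHom.id (ZMod p) (S p n k)))) ((1 : S p n k) ⊗ₜ[ZMod p] t p n k j)) = Z := by
    funext j
    simp [Z, Algebra.TensorProduct.one_def]
  have f2 : (fun j => Algebra.TensorProduct.map (AlgHom.id (ZMod p) (S p n k)) (comul p n k)
      (t p n k j ⊗ₜ[ZMod p] (1 : S p n k))) = X := by
    funext j
    simp [X, Algebra.TensorProduct.one_def]
  rw [f1, f2, key]

end Coassoc

variable {p n k : ℕ} [Fact p.Prime]

/-! ### The cobar differential -/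

section CobarD

theorem bar_val (x : S p n k) : (bar p n k x : S p n k) =
    x - algebraMap (ZMod p) (S p n k) (counit p n k x) := rfl

theorem cell_algebraMap (r : ZMod p) : cell p n k (algebraMap (ZMod p) (S p n k) r) = 0 := by
  have : bar p n k (algebraMap (ZMod p) (S p n k) r) = 0 := by
    apply Subtype.ext
    rw [bar_val]
    simp
  rw [cell, LinearMap.comp_apply, this, map_zero]

theorem cell_one : cell p n k 1 = 0 := by
  simpa using cell_algebraMap (p := p) (n := n) (k := k) 1

theorem bar_coe (v : Aug p n k) : bar p n k (v : S p n k) = v := by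
  apply Subtype.ext
  have hv : counit p n k (v : S p n k) = 0 := v.2
  rw [bar_val, hv]
  simp

theorem cell_coe (v : Aug p n k) : cell p n k (v : S p n k) = TensorAlgebra.ι (ZMod p) v := by
  rw [cell, LinearMap.comp_apply, bar_coe]

theorem cell₂_tmul (x y : S p n k) :
    cell₂ p n k (x ⊗ₜ y) = cell p n k x * cell p n k y := by
  simp [cell₂]

theorem cell₂_redComul (x : S p n k) :
    cell₂ p n k (redComul p n k x) = cell₂ p n k (comul p n k x) := by
  simp [redComul, cell₂_tmul, cell_one]

theorem cell₂_comul_bar (x : S p n k) :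
    cell₂ p n k (comul p n k (bar p n k x : S p n k)) = cell₂ p n k (comul p n k x) := by
  rw [bar_val]
  simp [Algebra.TensorProduct.algebraMap_apply, cell₂_tmul, cell_one]

theorem cobarD_cell_mul (x : S p n k) (y : Cobar p n k) :
    cobarD p n k (cell p n k x * y) =
      -cell₂ p n k (comul p n k x) * y - cell p n k x * cobarD p n k y := by
  have := cobarD_ι_mul p n k (bar p n k x) y
  rw [cell₂_redComul, cell₂_comul_bar] at this
  exact this

theorem cobarD_cell (x : S p n k) :
    cobarD p n k (cell p n k x) = -cell₂ p n k (comul p n k x) := by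
  simpa [cobarD_one] using cobarD_cell_mul x 1

/-- Induction over the tensor algebra by multiplication on the right. -/
theorem cobar_induction_right (N : Submodule (ZMod p) (Cobar p n k)) (h1 : 1 ∈ N)
    (h : ∀ z ∈ N, ∀ v : Aug p n k, z * TensorAlgebra.ι (ZMod p) v ∈ N) (z : Cobar p n k) :
    z ∈ N := by
  suffices H : ∀ y : Cobar p n k, ∀ x ∈ N, x * y ∈ N by simpa using H z 1 h1
  intro y
  induction y using TensorAlgebra.induction with
  | algebraMap r =>
    intro x hx
    rw [← Algebra.commutes, ← Algebra.smul_def]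
    exact N.smul_mem _ hx
  | ι v => exact fun x hx => h x hx v
  | mul a b ha hb => exact fun x hx => by rw [← mul_assoc]; exact hb _ (ha _ hx)
  | add a b ha hb => exact fun x hx => by rw [mul_add]; exact N.add_mem (ha _ hx) (hb _ hx)

/-- Induction over the tensor algebra by multiplication on the left. -/
theorem cobar_induction_left (N : Submodule (ZMod p) (Cobar p n k)) (h1 : 1 ∈ N)
    (h : ∀ z ∈ N, ∀ v : Aug p n k, TensorAlgebra.ι (ZMod p) v * z ∈ N) (z : Cobar p n k) :
    z ∈ N := by
  suffices H : ∀ y : Cobar p n k, ∀ x ∈ N, y * x ∈ N by simpa using H z 1 h1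
  intro y
  induction y using TensorAlgebra.induction with
  | algebraMap r =>
    intro x hx
    rw [← Algebra.smul_def]
    exact N.smul_mem _ hx
  | ι v => exact fun x hx => h x hx v
  | mul a b ha hb => exact fun x hx => by rw [mul_assoc]; exact ha _ (hb _ hx)
  | add a b ha hb => exact fun x hx => by rw [add_mul]; exact N.add_mem (ha _ hx) (hb _ hx)

theorem cobarC_zero : cobarC p n k 0 = 1 := pow_zero _

theorem cobarC_succ (s : ℕ) : cobarC p n k (s + 1) =
    LinearMap.range (TensorAlgebra.ι (ZMod p) (M := Aug p n k)) * cobarC p n k s := pow_succ' _ _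

theorem cell_mem_cobarC (x : S p n k) : cell p n k x ∈ cobarC p n k 1 := by
  rw [cobarC, pow_one]
  exact ⟨_, rfl⟩

theorem mul_mem_cobarC {s s' : ℕ} {x y : Cobar p n k} (hx : x ∈ cobarC p n k s)
    (hy : y ∈ cobarC p n k s') : x * y ∈ cobarC p n k (s + s') := by
  rw [cobarC, pow_add]
  exact Submodule.mul_mem_mul hx hy

theorem cell₂_mem_cobarC (z : S p n k ⊗[ZMod p] S p n k) : cell₂ p n k z ∈ cobarC p n k 2 := by
  induction z using TensorProduct.induction_on with
  | zero => rw [map_zero]; exact zero_mem _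
  | tmul x y => rw [cell₂_tmul]; exact mul_mem_cobarC (cell_mem_cobarC x) (cell_mem_cobarC y)
  | add a b ha hb => rw [map_add]; exact add_mem ha hb

theorem cobarC_induction {s : ℕ} {P : Cobar p n k → Prop}
    (hadd : ∀ x y, P x → P y → P (x + y))
    (hmul : ∀ (v : Aug p n k), ∀ y ∈ cobarC p n k s, P (TensorAlgebra.ι (ZMod p) v * y))
    {x : Cobar p n k} (hx : x ∈ cobarC p n k (s + 1)) : P x := by
  rw [cobarC_succ] at hx
  refine Submodule.mul_induction_on hx ?_ hadd
  rintro _ ⟨v, rfl⟩ y hy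
  exact hmul v y hy

/-- The Leibniz rule. -/
theorem cobarD_mul {s : ℕ} {x : Cobar p n k} (hx : x ∈ cobarC p n k s) (y : Cobar p n k) :
    cobarD p n k (x * y) = cobarD p n k x * y + (-1) ^ s * (x * cobarD p n k y) := by
  induction s generalizing x with
  | zero =>
    rw [cobarC_zero, Submodule.mem_one] at hx
    obtain ⟨r, rfl⟩ := hx
    rw [Algebra.algebraMap_eq_smul_one, smul_mul_assoc, one_mul, map_smul, map_smul, cobarD_one]
    simp
  | succ s ih =>
    refine cobarC_induction (P := fun x => cobarD p n k (x * y) =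
      cobarD p n k x * y + (-1) ^ (s + 1) * (x * cobarD p n k y)) (fun a b ha hb => ?_)
      (fun v z hz => ?_) hx
    · rw [add_mul, map_add, map_add, ha, hb]
      noncomm_ring
    · rw [mul_assoc, ← cell_coe, cobarD_cell_mul, cobarD_cell_mul, ih hz, pow_succ]
      have : ∀ (u : Cobar p n k), u * (-1) ^ s = (-1) ^ s * u := fun u =>
        ((Commute.neg_one_right u).pow_right s).eq
      simp only [mul_add, sub_mul, mul_assoc, neg_mul, mul_neg, mul_one]
      rw [← mul_assoc (cell p n k (v : S p n k)) ((-1) ^ s), this, mul_assoc]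
      abel

variable (p n k) in
/-- `a ⊗ b ⊗ c ↦ [a|b|c]`. -/
def cell₃ : S p n k ⊗[ZMod p] (S p n k ⊗[ZMod p] S p n k) →ₗ[ZMod p] Cobar p n k :=
  TensorProduct.lift ((LinearMap.mul (ZMod p) (Cobar p n k)).compl₁₂ (cell p n k) (cell₂ p n k))

theorem cell₃_tmul (x : S p n k) (y : S p n k ⊗[ZMod p] S p n k) :
    cell₃ p n k (x ⊗ₜ y) = cell p n k x * cell₂ p n k y := by
  simp [cell₃]

theorem cell₃_assoc (z : S p n k ⊗[ZMod p] S p n k) (y : S p n k) :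
    cell₃ p n k (Algebra.TensorProduct.assoc (ZMod p) (ZMod p) (ZMod p) (S p n k) (S p n k)
      (S p n k) (z ⊗ₜ y)) = cell₂ p n k z * cell p n k y := by
  induction z using TensorProduct.induction_on with
  | zero => simp
  | tmul a b => simp [cell₃_tmul, cell₂_tmul, mul_assoc]
  | add a b ha hb => simp only [TensorProduct.add_tmul, map_add, ha, hb, add_mul]

theorem cobarD_cell₂_comul (H : Admissible p n k) (x : S p n k) :
    cobarD p n k (cell₂ p n k (comul p n k x)) = 0 := by
  have key : ∀ z : S p n k ⊗[ZMod p] S p n k, cobarD p n k (cell₂ p n k z) =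
      cell₃ p n k (Algebra.TensorProduct.map (AlgHom.id (ZMod p) (S p n k)) (comul p n k) z) -
      cell₃ p n k (Algebra.TensorProduct.assoc (ZMod p) (ZMod p) (ZMod p) (S p n k) (S p n k)
        (S p n k) (Algebra.TensorProduct.map (comul p n k) (AlgHom.id (ZMod p) (S p n k)) z)) := by
    intro z
    induction z using TensorProduct.induction_on with
    | zero => simp
    | tmul a b =>
      rw [cell₂_tmul, cobarD_cell_mul, cobarD_cell, Algebra.TensorProduct.map_tmul,
        Algebra.TensorProduct.map_tmul, AlgHom.id_apply, AlgHom.id_apply, cell₃_tmul, cell₃_assoc]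
      noncomm_ring
    | add a b ha hb => simp only [map_add, ha, hb]; abel
  rw [key]
  have := AlgHom.congr_fun (comul_coassoc H) x
  simp only [AlgHom.comp_apply] at this
  rw [← this]
  exact sub_self _

/-- The cobar complex is a complex. -/
theorem cobarD_cobarD (H : Admissible p n k) (z : Cobar p n k) :
    cobarD p n k (cobarD p n k z) = 0 := by
  suffices h : z ∈ LinearMap.ker (cobarD p n k ∘ₗ cobarD p n k) from h
  refine cobar_induction_left _ ?_ ?_ z
  · simp [cobarD_one]
  · intro y hy v
    rw [LinearMap.mem_ker, LinearMap.comp_apply] at hy ⊢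
    rw [← cell_coe, cobarD_cell_mul, map_sub, neg_mul, map_neg, cobarD_mul (cell₂_mem_cobarC _),
      cobarD_cell₂_comul H, cobarD_cell_mul, hy]
    noncomm_ring

end CobarD

/-! ### Words in the divided power basis -/

section Words

variable [NeZero n]

/-- Words in the letters `a`, read from right to left, all of which are valid and nonzero. -/
def OkWord (p : ℕ) {n k : ℕ} (l : List (Expo n k)) : Prop := ∀ a ∈ l, a ≠ 0 ∧ Valid p a

/-- The May filtration of a word. -/
def wordWt (p : ℕ) {n k : ℕ} (l : List (Expo n k)) : ℕ := (l.map (wt p)).sum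

theorem wordWt_cons (a : Expo n k) (l : List (Expo n k)) :
    wordWt p (a :: l) = wt p a + wordWt p l := by simp [wordWt]

theorem okWord_cons {a : Expo n k} {l : List (Expo n k)} :
    OkWord p (a :: l) ↔ (a ≠ 0 ∧ Valid p a) ∧ OkWord p l := by simp [OkWord]

/-- The words of length `s` and May filtration at most `M`. -/
def okSet (p n k s : ℕ) (M : ℤ) : Set (List (Expo n k)) :=
  {l | OkWord p l ∧ l.length = s ∧ (wordWt p l : ℤ) ≤ M}

variable (p) in
/-- The element `[γ_{a_s}|…|γ_{a_1}]` for the list `a_1, …, a_s`. -/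
def word : List (Expo n k) → Cobar p n k
  | [] => 1
  | a :: l => word l * cell p n k (gam p a)

theorem word_append (l l' : List (Expo n k)) : word p (l' ++ l) = word p l * word p l' := by
  induction l' with
  | nil => simp [word]
  | cons a l' ih => rw [List.cons_append, word, word, ih, mul_assoc]

theorem word_mem_cobarC (l : List (Expo n k)) : word p l ∈ cobarC p n k l.length := by
  induction l with
  | nil => rw [List.length_nil, cobarC_zero]; exact Submodule.one_le.1 le_rfl
  | cons a l ih => exact mul_mem_cobarC ih (cell_mem_cobarC _)

theorem counit_gam {a : Expo n k} (ha : a ≠ 0) : counit p n k (gam p a) = 0 := by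
  obtain ⟨g, hg⟩ := Finsupp.ne_iff.1 ha
  have h : counit p n k (tg p g) = 0 := by
    rw [tg, map_pow, t, dif_pos g.1.2, counit, S.lift, S.mk]
    erw [Ideal.Quotient.liftₐ_apply, Ideal.Quotient.lift_mk]
    simp [(Fact.out : p.Prime).ne_zero]
  rw [gam, map_dpow, dpow, monom, Finsupp.prod, Finset.prod_eq_zero (i := g), smul_zero]
  · exact Finsupp.mem_support_iff.2 hg
  · rw [h, zero_pow hg]

theorem crdS_aug (v : Aug p n k) : crdS p n k v 0 = 0 := by
  have h1 : counit p n k (v : S p n k) = 0 := v.2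
  rw [← linearCombination_crdS (v : S p n k), Finsupp.linearCombination_apply, Finsupp.sum,
    map_sum, Finset.sum_eq_single (0 : Expo n k)] at h1
  · simpa [gam_zero] using h1
  · intro a _ ha
    rw [map_smul, counit_gam ha, smul_zero]
  · intro h
    rw [Finsupp.notMem_support_iff.1 h, zero_smul, map_zero]

variable (p n k) in
/-- The operator that prepends the letters of `v` to words. -/
def consOp : Aug p n k →ₗ[ZMod p] (Module.End (ZMod p) (List (Expo n k) →₀ ZMod p))ᵐᵒᵖ :=
  (MulOpposite.opLinearEquiv (ZMod p)).toLinearMap ∘ₗ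
    (Finsupp.lsum (ZMod p) fun a : Expo n k => LinearMap.toSpanSingleton (ZMod p) _
      (Finsupp.lmapDomain (ZMod p) (ZMod p) (List.cons a))) ∘ₗ crdS p n k ∘ₗ (Aug p n k).subtype

variable (p n k) in
/-- The coordinates of an element of the cobar complex with respect to the words. -/
def crd : Cobar p n k →ₗ[ZMod p] (List (Expo n k) →₀ ZMod p) :=
  (LinearMap.applyₗ (Finsupp.single [] 1)) ∘ₗ
    (MulOpposite.opLinearEquiv (ZMod p)).symm.toLinearMap ∘ₗ
    (TensorAlgebra.lift (ZMod p) (consOp p n k)).toLinearMap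

theorem crd_one : crd p n k 1 = Finsupp.single [] 1 := by simp [crd]

theorem crd_mul_ι (z : Cobar p n k) (v : Aug p n k) :
    crd p n k (z * TensorAlgebra.ι (ZMod p) v) =
      (crdS p n k v).sum fun a c => c • (crd p n k z).mapDomain (List.cons a) := by
  simp [crd, consOp, Finsupp.sum, Finsupp.coe_lsum]

theorem bar_gam {a : Expo n k} (ha : a ≠ 0) : (bar p n k (gam p a) : S p n k) = gam p a := by
  rw [bar_val, counit_gam ha]
  simp

theorem crd_mul_cell {a : Expo n k} (ha : a ≠ 0) (hv : Valid p a) (z : Cobar p n k) :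
    crd p n k (z * cell p n k (gam p a)) = (crd p n k z).mapDomain (List.cons a) := by
  have : cell p n k (gam p a) = TensorAlgebra.ι (ZMod p) (bar p n k (gam p a)) := rfl
  rw [this, crd_mul_ι, bar_gam ha, crdS_gam hv, Finsupp.sum_single_index (by simp), one_smul]

theorem crd_word {l : List (Expo n k)} (hl : OkWord p l) :
    crd p n k (word p l) = Finsupp.single l 1 := by
  induction l with
  | nil => rw [word, crd_one]
  | cons a l ih =>
    rw [okWord_cons] at hl
    rw [word, crd_mul_cell hl.1.1 hl.1.2, ih hl.2, Finsupp.mapDomain_single]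

theorem linearCombination_crd (z : Cobar p n k) :
    Finsupp.linearCombination (ZMod p) (word p) (crd p n k z) = z := by
  suffices h : z ∈ LinearMap.ker
      (Finsupp.linearCombination (ZMod p) (word p) ∘ₗ crd p n k - LinearMap.id) by
    simpa [sub_eq_zero] using h
  refine cobar_induction_right _ ?_ ?_ z
  · simp [crd_one, word]
  · intro z hz v
    simp only [LinearMap.mem_ker, LinearMap.sub_apply, LinearMap.comp_apply, LinearMap.id_apply,
      sub_eq_zero] at hz ⊢
    rw [crd_mul_ι, Finsupp.sum, map_sum]
    have : ∀ a ∈ (crdS p n k (v : S p n k)).support,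
        Finsupp.linearCombination (ZMod p) (word p)
          (crdS p n k (v : S p n k) a • (crd p n k z).mapDomain (List.cons a)) =
        z * cell p n k (crdS p n k (v : S p n k) a • gam p a) := by
      intro a _
      rw [map_smul, Finsupp.linearCombination_mapDomain, map_smul, mul_smul_comm]
      congr 1
      conv_rhs => rw [← hz]
      rw [Finsupp.linearCombination_apply, Finsupp.linearCombination_apply, Finsupp.sum, Finsupp.sum,
        Finset.sum_mul]
      refine Finset.sum_congr rfl fun l _ => ?_
      rw [Function.comp_apply, word, smul_mul_assoc]
    rw [Finset.sum_congr rfl this, ← Finset.mul_sum, ← map_sum]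
    have h2 := linearCombination_crdS (v : S p n k)
    rw [Finsupp.linearCombination_apply, Finsupp.sum] at h2
    rw [h2, cell_coe]

theorem crd_okWord (z : Cobar p n k) {l : List (Expo n k)} (h : crd p n k z l ≠ 0) :
    OkWord p l := by
  suffices H : z ∈ (Finsupp.supported (ZMod p) (ZMod p) {l : List (Expo n k) | OkWord p l}).comap
      (crd p n k) from H (Finsupp.mem_support_iff.2 h)
  refine cobar_induction_right _ ?_ ?_ z
  · rw [Submodule.mem_comap, crd_one]
    exact Finsupp.single_mem_supported _ _ (by simp [OkWord])
  · intro z hz v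
    rw [Submodule.mem_comap] at hz ⊢
    rw [crd_mul_ι]
    refine Submodule.sum_mem _ fun a ha => Submodule.smul_mem _ _ ?_
    rw [Finsupp.mem_supported] at hz ⊢
    intro l hl
    classical
    have := Finsupp.mapDomain_support hl
    rw [Finset.mem_image] at this
    obtain ⟨l', hl', rfl⟩ := this
    rw [Finsupp.mem_support_iff] at ha
    obtain ⟨M, hM⟩ := exists_mem_FS (v : S p n k)
    refine okWord_cons.2 ⟨⟨?_, (crdS_support hM ha).1⟩, hz hl'⟩
    rintro rfl
    exact ha (crdS_aug v)

theorem crd_injective {z : Cobar p n k} (h : crd p n k z = 0) : z = 0 := by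
  rw [← linearCombination_crd z, h, map_zero]

/-- Membership in the span of the words of a set, by coordinates. -/
theorem mem_span_word {X : Set (List (Expo n k))} {z : Cobar p n k} :
    z ∈ Submodule.span (ZMod p) (word p '' {l | OkWord p l ∧ l ∈ X}) ↔
      ∀ l, crd p n k z l ≠ 0 → l ∈ X := by
  constructor
  · intro hz
    have h : Submodule.span (ZMod p) (word p '' {l | OkWord p l ∧ l ∈ X}) ≤
        (Finsupp.supported (ZMod p) (ZMod p) X).comap (crd p n k) := by
      refine Submodule.span_le.2 ?_
      rintro _ ⟨l, ⟨hl, hX⟩, rfl⟩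
      rw [SetLike.mem_coe, Submodule.mem_comap, crd_word hl]
      exact Finsupp.single_mem_supported _ _ hX
    exact fun l hl => h hz (Finsupp.mem_support_iff.2 hl)
  · intro h
    rw [← linearCombination_crd z, Finsupp.linearCombination_apply]
    refine Submodule.sum_mem _ fun l hl => Submodule.smul_mem _ _ (Submodule.subset_span ?_)
    rw [Finsupp.mem_support_iff] at hl
    exact ⟨l, ⟨crd_okWord z hl, h l hl⟩, rfl⟩

theorem prod_map_smul {A : Type*} [Ring A] [Algebra (ZMod p) A] {ι : Type*} (l : List ι)
    (c : ι → ZMod p) (x : ι → A) :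
    (l.map fun a => c a • x a).prod = (l.map c).prod • (l.map x).prod := by
  induction l with
  | nil => simp
  | cons a l ih => simp only [List.map_cons, List.prod_cons, ih, smul_mul_smul_comm]

theorem word_eq_prod (l : List (Expo n k)) :
    word p l = (l.reverse.map fun a => cell p n k (gam p a)).prod := by
  induction l with
  | nil => simp [word]
  | cons a l ih => simp [word, ih]

theorem mayF_eq (s : ℕ) (M : ℤ) : mayF p n k s M =
    Submodule.span (ZMod p) (word p '' {l | OkWord p l ∧ l ∈ okSet p n k s M}) := by
  apply le_antisymm
  · refine Submodule.span_le.2 ?_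
    rintro _ ⟨e, he, hM, rfl⟩
    have h1 : (List.ofFn fun i => cell p n k (mono p n k (e i))) =
        (List.ofFn fun i => digs p n (e i)).map
          fun a => facts p a • cell p n k (gam p a) := by
      rw [List.map_ofFn]
      congr 1
      funext i
      rw [Function.comp_apply, ← map_smul, ← mono_eq_dpow (he i).2]
    rw [SetLike.mem_coe, h1, prod_map_smul]
    refine Submodule.smul_mem _ _ (Submodule.subset_span
      ⟨(List.ofFn fun i => digs p n (e i)).reverse, ?_, ?_⟩)
    · have hok : OkWord p (List.ofFn fun i => digs p n (e i)).reverse := by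
        intro a ha
        rw [List.mem_reverse, List.mem_ofFn] at ha
        obtain ⟨i, rfl⟩ := ha
        refine ⟨fun h0 => (he i).1 ?_, valid_digs _⟩
        rw [← expo_digs (he i).2, h0]
        simp [expo]
      refine ⟨hok, hok, by simp, ?_⟩
      refine le_trans (le_of_eq ?_) hM
      rw [wordWt, List.map_reverse, List.sum_reverse, List.map_ofFn, List.sum_ofFn]
      push_cast
      refine Finset.sum_congr rfl fun i _ => ?_
      rw [Function.comp_apply, ← mayWeight_expo (valid_digs _), expo_digs (he i).2]
    · rw [word_eq_prod, List.reverse_reverse]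
  · refine Submodule.span_le.2 ?_
    rintro _ ⟨l, ⟨hl, -, rfl, hM⟩, rfl⟩
    have hmem : ∀ i : Fin l.length, l.reverse.get (i.cast (by simp)) ∈ l := fun i =>
      List.mem_reverse.1 (List.get_mem _ _)
    have h1 : l.reverse = List.ofFn fun i : Fin l.length => l.reverse.get (i.cast (by simp)) := by
      refine List.ext_get (by simp) fun i h1 h2 => by simp
    have h2 : (l.reverse.map fun a => cell p n k (gam p a)) =
        l.reverse.map fun a => (facts p a)⁻¹ • cell p n k (mono p n k (expo p a)) := by
      refine List.map_congr_left fun a ha => ?_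
      rw [gam, dpow, map_smul, monom_tg]
    rw [SetLike.mem_coe, word_eq_prod, h2, prod_map_smul]
    refine Submodule.smul_mem _ _ (Submodule.subset_span
      ⟨fun i => expo p (l.reverse.get (i.cast (by simp))), ?_, ?_, ?_⟩)
    · intro i
      obtain ⟨ha, hv⟩ := hl _ (hmem i)
      refine ⟨fun h0 => ha ?_, fun u => expo_lt hv u⟩
      have h0' : expo p (l.reverse.get (i.cast (by simp))) = 0 := h0
      rw [← digs_expo hv, h0']
      ext g
      simp [digs_apply]
    · refine le_trans (le_of_eq ?_) hM
      rw [wordWt, ← List.sum_reverse, ← List.map_reverse]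
      conv_rhs => rw [h1]
      rw [List.map_ofFn, List.sum_ofFn]
      push_cast
      refine Finset.sum_congr rfl fun i _ => ?_
      rw [mayWeight_expo (hl _ (hmem i)).2]
      rfl
    · conv_lhs => rw [h1]
      rw [List.map_ofFn]
      rfl

theorem mem_mayF {s : ℕ} {M : ℤ} {z : Cobar p n k} :
    z ∈ mayF p n k s M ↔ ∀ l, crd p n k z l ≠ 0 → l ∈ okSet p n k s M := by
  rw [mayF_eq, mem_span_word]

theorem word_mem_mayF {l : List (Expo n k)} (hl : OkWord p l) {s : ℕ} {M : ℤ} (hs : l.length = s)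
    (hM : (wordWt p l : ℤ) ≤ M) : word p l ∈ mayF p n k s M := by
  rw [mayF_eq]
  exact Submodule.subset_span ⟨l, ⟨hl, hl, hs, hM⟩, rfl⟩

theorem mayF_mono {s : ℕ} {M N : ℤ} (h : M ≤ N) : mayF p n k s M ≤ mayF p n k s N :=
  fun _ hz => mem_mayF.2 fun l hl => by
    obtain ⟨h1, h2, h3⟩ := mem_mayF.1 hz l hl
    exact ⟨h1, h2, h3.trans h⟩

theorem mayF_le_cobarC (s : ℕ) (M : ℤ) : mayF p n k s M ≤ cobarC p n k s := by
  rw [mayF_eq]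
  refine Submodule.span_le.2 ?_
  rintro _ ⟨l, ⟨-, -, rfl, -⟩, rfl⟩
  exact word_mem_cobarC l

theorem mayF_neg {s : ℕ} {M : ℤ} (h : M < 0) : mayF p n k s M = ⊥ := by
  refine (Submodule.eq_bot_iff _).2 fun z hz => crd_injective (Finsupp.ext fun l => ?_)
  by_contra h1
  have := (mem_mayF.1 hz l h1).2.2
  have : (0 : ℤ) ≤ wordWt p l := Nat.cast_nonneg _
  omega

theorem mul_mem_mayF {s s' : ℕ} {M M' : ℤ} {x y : Cobar p n k} (hx : x ∈ mayF p n k s M)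
    (hy : y ∈ mayF p n k s' M') : x * y ∈ mayF p n k (s + s') (M + M') := by
  have : mayF p n k s M * mayF p n k s' M' ≤ mayF p n k (s + s') (M + M') := by
    conv_lhs => rw [mayF_eq, mayF_eq, Submodule.span_mul_span]
    refine Submodule.span_le.2 ?_
    rintro _ ⟨_, ⟨l, ⟨h1, -, h2, h3⟩, rfl⟩, _, ⟨l', ⟨h1', -, h2', h3'⟩, rfl⟩, rfl⟩
    simp only
    rw [← word_append]
    refine word_mem_mayF ?_ ?_ ?_
    · intro a ha
      rcases List.mem_append.1 ha with ha | ha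
      · exact h1' a ha
      · exact h1 a ha
    · rw [List.length_append]; omega
    · have : wordWt p (l' ++ l) = wordWt p l' + wordWt p l := by simp [wordWt]
      rw [this]
      push_cast
      omega
  exact this (Submodule.mul_mem_mul hx hy)

theorem one_mem_mayF {M : ℤ} (h : 0 ≤ M) : (1 : Cobar p n k) ∈ mayF p n k 0 M :=
  word_mem_mayF (l := []) (by simp [OkWord]) rfl (by simpa [wordWt] using h)

theorem cell_gam_mem {a : Expo n k} {M : ℤ} (h : (wt p a : ℤ) ≤ M) :
    cell p n k (gam p a) ∈ mayF p n k 1 M := by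
  by_cases h0 : a = 0
  · rw [h0, gam_zero, cell_one]; exact zero_mem _
  by_cases hv : Valid p a
  · have := word_mem_mayF (p := p) (l := [a]) (s := 1) (M := M) (by simp [OkWord, h0, hv]) rfl
      (by simpa [wordWt] using h)
    simpa [word] using this
  · rw [gam_eq_zero hv, map_zero]; exact zero_mem _

theorem cell_mem_mayF {M : ℤ} {x : S p n k} (hx : x ∈ FS p n k M) :
    cell p n k x ∈ mayF p n k 1 M := by
  have : FS p n k M ≤ (mayF p n k 1 M).comap (cell p n k) := by
    refine (FS_le_span M).trans (Submodule.span_le.2 ?_)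
    rintro _ ⟨a, -, hM, rfl⟩
    exact cell_gam_mem hM
  exact this hx

theorem cell₂_mem_mayF {M : ℤ} {z : S p n k ⊗[ZMod p] S p n k} (hz : z ∈ FSS p n k M) :
    cell₂ p n k z ∈ mayF p n k 2 M := by
  have h := FSS_le_span M hz
  clear hz
  induction h using Submodule.span_induction with
  | mem x hx =>
    obtain ⟨a, b, -, -, hM, rfl⟩ := hx
    have m : cell p n k (gam p a) * cell p n k (gam p b) ∈ mayF p n k (1 + 1) (wt p a + wt p b) :=
      mul_mem_mayF (cell_gam_mem le_rfl) (cell_gam_mem le_rfl)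
    rw [cell₂_tmul]
    exact mayF_mono hM m
  | zero => rw [map_zero]; exact zero_mem _
  | add x y _ _ hx hy => rw [map_add]; exact add_mem hx hy
  | smul c x _ hx => rw [map_smul]; exact Submodule.smul_mem _ _ hx

theorem exists_mem_mayF {s : ℕ} {z : Cobar p n k} (hz : z ∈ cobarC p n k s) :
    ∃ M, z ∈ mayF p n k s M := by
  induction s generalizing z with
  | zero =>
    rw [cobarC_zero, Submodule.mem_one] at hz
    obtain ⟨r, rfl⟩ := hz
    rw [Algebra.algebraMap_eq_smul_one]
    exact ⟨0, Submodule.smul_mem _ _ (one_mem_mayF le_rfl)⟩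
  | succ s ih =>
    refine cobarC_induction (P := fun z => ∃ M, z ∈ mayF p n k (s + 1) M) ?_ ?_ hz
    · rintro x y ⟨M, hM⟩ ⟨N, hN⟩
      exact ⟨max M N, add_mem (mayF_mono (le_max_left _ _) hM) (mayF_mono (le_max_right _ _) hN)⟩
    · intro v y hy
      obtain ⟨M, hM⟩ := ih hy
      obtain ⟨N, hN⟩ := exists_mem_FS (v : S p n k)
      rw [← cell_coe, add_comm s 1]
      exact ⟨_, mul_mem_mayF (cell_mem_mayF hN) hM⟩

end Words

/-! ### The leading part of the cobar differential -/

section Leading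

variable [NeZero n]

open Finset.HasAntidiagonal

/-- The sign `(-1)^s` for a word of length `s`. -/
def sgn (p : ℕ) {n k : ℕ} (l : List (Expo n k)) : ZMod p := (-1) ^ l.length

theorem sgn_cons (a : Expo n k) (l : List (Expo n k)) : sgn p (a :: l) = -sgn p l := by
  rw [sgn, sgn, List.length_cons, pow_succ, mul_neg_one]

theorem sgn_mul_self (l : List (Expo n k)) : sgn p l * sgn p l = 1 := by
  rw [sgn, ← mul_pow]; simp

variable (p) in
/-- The sum of the words `c, b, …` over all `b + c = a` with `b, c ≠ 0`. -/
def splitSum (a : Expo n k) (l : List (Expo n k)) : List (Expo n k) →₀ ZMod p :=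
  ∑ x ∈ (antidiagonal a).filter (fun x => x.1 ≠ 0 ∧ x.2 ≠ 0), Finsupp.single (x.2 :: x.1 :: l) 1

variable (p) in
/-- The differential of the cobar complex of the divided power coalgebra, on words. -/
def wordD : List (Expo n k) → (List (Expo n k) →₀ ZMod p)
  | [] => 0
  | a :: l => (wordD l).mapDomain (List.cons a) - sgn p l • splitSum p a l

variable (p n k) in
/-- The differential of the cobar complex of the divided power coalgebra. -/
def wordDLin : (List (Expo n k) →₀ ZMod p) →ₗ[ZMod p] (List (Expo n k) →₀ ZMod p) :=
  Finsupp.linearCombination (ZMod p) (wordD p)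

theorem valid_of_add {a b c : Expo n k} (h : b + c = a) (ha : Valid p a) :
    Valid p b ∧ Valid p c := by
  subst h
  exact ⟨fun g => lt_of_le_of_lt (by simp) (ha g), fun g => lt_of_le_of_lt (by simp) (ha g)⟩

/-- The words of given length and weight. -/
def homSet (p n k s M : ℕ) : Set (List (Expo n k)) :=
  {l | OkWord p l ∧ l.length = s ∧ wordWt p l = M}

theorem splitSum_mem {a : Expo n k} {l : List (Expo n k)} (hl : OkWord p (a :: l)) :
    splitSum p a l ∈ Finsupp.supported (ZMod p) (ZMod p)
      (homSet p n k (l.length + 2) (wordWt p (a :: l))) := by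
  refine Submodule.sum_mem _ fun x hx => Finsupp.single_mem_supported _ _ ?_
  rw [Finset.mem_filter, mem_antidiagonal] at hx
  rw [okWord_cons] at hl
  obtain ⟨h1, h2⟩ := valid_of_add hx.1 hl.1.2
  refine ⟨okWord_cons.2 ⟨⟨hx.2.2, h2⟩, okWord_cons.2 ⟨⟨hx.2.1, h1⟩, hl.2⟩⟩, rfl, ?_⟩
  rw [wordWt_cons, wordWt_cons, wordWt_cons, ← hx.1, map_add]
  omega

theorem mapDomain_cons_mem {a : Expo n k} (ha : a ≠ 0) (hv : Valid p a) {s M : ℕ}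
    {z : List (Expo n k) →₀ ZMod p}
    (hz : z ∈ Finsupp.supported (ZMod p) (ZMod p) (homSet p n k s M)) :
    z.mapDomain (List.cons a) ∈ Finsupp.supported (ZMod p) (ZMod p)
      (homSet p n k (s + 1) (wt p a + M)) := by
  classical
  rw [Finsupp.mem_supported] at hz ⊢
  intro l hl
  have := Finsupp.mapDomain_support hl
  rw [Finset.mem_image] at this
  obtain ⟨l', hl', rfl⟩ := this
  obtain ⟨h1, h2, h3⟩ := hz hl'
  refine ⟨okWord_cons.2 ⟨⟨ha, hv⟩, h1⟩, ?_, ?_⟩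
  · rw [List.length_cons, h2]
  · rw [wordWt_cons, h3]

theorem wordD_mem {l : List (Expo n k)} (hl : OkWord p l) :
    wordD p l ∈ Finsupp.supported (ZMod p) (ZMod p)
      (homSet p n k (l.length + 1) (wordWt p l)) := by
  induction l with
  | nil => exact zero_mem _
  | cons a l ih =>
    have hl' := okWord_cons.1 hl
    rw [wordD]
    refine sub_mem ?_ (Submodule.smul_mem _ _ (splitSum_mem hl))
    rw [wordWt_cons]
    exact mapDomain_cons_mem hl'.1.1 hl'.1.2 (ih hl'.2)

theorem linearCombination_splitSum (a : Expo n k) (l : List (Expo n k)) :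
    Finsupp.linearCombination (ZMod p) (word p) (splitSum p a l) =
      word p l * ∑ x ∈ antidiagonal a, cell p n k (gam p x.1) * cell p n k (gam p x.2) := by
  rw [splitSum, map_sum, Finset.mul_sum, Finset.sum_filter]
  refine Finset.sum_congr rfl fun x _ => ?_
  split_ifs with h
  · rw [Finsupp.linearCombination_single, one_smul, word, word, mul_assoc]
  · rw [not_and_or, not_not, not_not] at h
    rcases h with h | h <;> simp [h, gam_zero, cell_one]

theorem cobarD_cell_gam (H : Admissible p n k) {a : Expo n k} (ha : Valid p a) :
    cobarD p n k (cell p n k (gam p a)) +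
      ∑ x ∈ antidiagonal a, cell p n k (gam p x.1) * cell p n k (gam p x.2) ∈
        mayF p n k 2 (wt p a - 1) := by
  have := neg_mem (cell₂_mem_mayF (comul_gam_sub_mem H ha))
  rw [map_sub, map_sum] at this
  simp only [cell₂_tmul] at this
  rw [cobarD_cell]
  convert this using 1
  abel

/-- `d` agrees with `wordD` on words modulo lower filtration. -/
theorem cobarD_word_sub_mem (H : Admissible p n k) {l : List (Expo n k)} (hl : OkWord p l) :
    cobarD p n k (word p l) - Finsupp.linearCombination (ZMod p) (word p) (wordD p l) ∈
      mayF p n k (l.length + 1) (wordWt p l - 1) := by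
  induction l with
  | nil => simp [word, wordD, cobarD_one]
  | cons a l ih =>
    have hl' := okWord_cons.1 hl
    have e1 : Finsupp.linearCombination (ZMod p) (word p) ((wordD p l).mapDomain (List.cons a)) =
        Finsupp.linearCombination (ZMod p) (word p) (wordD p l) * cell p n k (gam p a) := by
      rw [Finsupp.linearCombination_mapDomain, Finsupp.linearCombination_apply,
        Finsupp.linearCombination_apply, Finsupp.sum, Finsupp.sum, Finset.sum_mul]
      refine Finset.sum_congr rfl fun l _ => ?_
      rw [Function.comp_apply, word, smul_mul_assoc]
    have e2 : ∀ y : Cobar p n k, (-1) ^ l.length * y = sgn p l • y := by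
      intro y
      rw [sgn, Algebra.smul_def, map_pow, map_neg, map_one]
    rw [word, wordD, cobarD_mul (word_mem_cobarC l), map_sub, map_smul, e1,
      linearCombination_splitSum, e2]
    have m1 := mul_mem_mayF (ih hl'.2) (cell_gam_mem (p := p) (a := a) le_rfl)
    have m2 := mul_mem_mayF (word_mem_mayF hl'.2 rfl le_rfl) (cobarD_cell_gam H hl'.1.2)
    have m3 := add_mem (mayF_mono (show _ ≤ (wordWt p (a :: l) - 1 : ℤ) by
      rw [wordWt_cons]; push_cast; omega) m1) (Submodule.smul_mem _ (sgn p l)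
        (mayF_mono (show _ ≤ (wordWt p (a :: l) - 1 : ℤ) by rw [wordWt_cons]; push_cast; omega) m2))
    refine (congrArg (· ∈ mayF p n k (l.length + 1 + 1) (wordWt p (a :: l) - 1)) ?_).mp m3
    rw [sub_mul, mul_add, smul_add]
    abel

theorem lc_mem_mayF {s : ℕ} {M : ℤ} {u : List (Expo n k) →₀ ZMod p}
    (hu : u ∈ Finsupp.supported (ZMod p) (ZMod p) (okSet p n k s M)) :
    Finsupp.linearCombination (ZMod p) (word p) u ∈ mayF p n k s M := by
  rw [Finsupp.linearCombination_apply]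
  refine Submodule.sum_mem _ fun l hl => Submodule.smul_mem _ _ ?_
  obtain ⟨h1, h2, h3⟩ := hu hl
  exact word_mem_mayF h1 h2 h3

theorem crd_lc {u : List (Expo n k) →₀ ZMod p} (hu : ∀ l, u l ≠ 0 → OkWord p l) :
    crd p n k (Finsupp.linearCombination (ZMod p) (word p) u) = u := by
  rw [Finsupp.linearCombination_apply, Finsupp.sum, map_sum]
  conv_rhs => rw [← Finsupp.sum_single u, Finsupp.sum]
  refine Finset.sum_congr rfl fun l hl => ?_
  rw [map_smul, crd_word (hu l (Finsupp.mem_support_iff.1 hl)), Finsupp.smul_single, smul_eq_mul,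
    mul_one]

theorem homSet_subset {s M : ℕ} {N : ℤ} (h : (M : ℤ) ≤ N) : homSet p n k s M ⊆ okSet p n k s N := by
  rintro l ⟨h1, h2, h3⟩
  exact ⟨h1, h2, by rw [h3]; exact h⟩

theorem wordDLin_mem {s : ℕ} {M : ℤ} {u : List (Expo n k) →₀ ZMod p}
    (hu : u ∈ Finsupp.supported (ZMod p) (ZMod p) (okSet p n k s M)) :
    wordDLin p n k u ∈ Finsupp.supported (ZMod p) (ZMod p) (okSet p n k (s + 1) M) := by
  rw [wordDLin, Finsupp.linearCombination_apply]
  refine Submodule.sum_mem _ fun l hl => Submodule.smul_mem _ _ ?_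
  obtain ⟨h1, rfl, h3⟩ := hu hl
  exact Finsupp.supported_mono (homSet_subset h3) (wordD_mem h1)

/-- `d` agrees with `wordD` modulo lower filtration. -/
theorem cobarD_sub_mem (H : Admissible p n k) {s : ℕ} {M : ℤ} {z : Cobar p n k}
    (hz : z ∈ mayF p n k s M) :
    cobarD p n k z - Finsupp.linearCombination (ZMod p) (word p) (wordDLin p n k (crd p n k z)) ∈
      mayF p n k (s + 1) (M - 1) := by
  rw [mayF_eq] at hz
  induction hz using Submodule.span_induction with
  | mem x hx =>
    obtain ⟨l, ⟨hl, -, rfl, hM⟩, rfl⟩ := hx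
    rw [crd_word hl, wordDLin, Finsupp.linearCombination_single, one_smul]
    exact mayF_mono (by omega) (cobarD_word_sub_mem H hl)
  | zero => simp
  | add x y _ _ hx hy =>
    have := add_mem hx hy
    simp only [map_add]
    convert this using 1
    abel
  | smul c x _ hx =>
    have := Submodule.smul_mem _ c hx
    simp only [map_smul]
    rwa [← smul_sub]

theorem crd_supported {s : ℕ} {M : ℤ} {z : Cobar p n k} (hz : z ∈ mayF p n k s M) :
    crd p n k z ∈ Finsupp.supported (ZMod p) (ZMod p) (okSet p n k s M) := fun l hl =>
  mem_mayF.1 hz l (Finsupp.mem_support_iff.1 hl)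

theorem cobarD_mem_mayF (H : Admissible p n k) {s : ℕ} {M : ℤ} {z : Cobar p n k}
    (hz : z ∈ mayF p n k s M) : cobarD p n k z ∈ mayF p n k (s + 1) M := by
  rw [← sub_add_cancel (cobarD p n k z)
    (Finsupp.linearCombination (ZMod p) (word p) (wordDLin p n k (crd p n k z)))]
  exact add_mem (mayF_mono (by omega) (cobarD_sub_mem H hz))
    (lc_mem_mayF (wordDLin_mem (crd_supported hz)))

/-- `wordD` computes the coordinates of `d` in top filtration. -/
theorem crd_cobarD (H : Admissible p n k) {s : ℕ} {M : ℤ} {z : Cobar p n k}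
    (hz : z ∈ mayF p n k s M) {l : List (Expo n k)} (hl : M ≤ wordWt p l) :
    crd p n k (cobarD p n k z) l = wordDLin p n k (crd p n k z) l := by
  by_contra h
  have h1 := mem_mayF.1 (cobarD_sub_mem H hz) l (by
    rw [map_sub, crd_lc fun l hl => ?_, Finsupp.sub_apply]
    · exact sub_ne_zero.2 h
    · exact (wordDLin_mem (crd_supported hz) (Finsupp.mem_support_iff.2 hl)).1)
  have := h1.2.2
  omega

/-- `wordD` is a differential, because it is homogeneous in the weight and is the leading part of
`d`. -/
theorem wordDLin_wordD (H : Admissible p n k) {l : List (Expo n k)} (hl : OkWord p l) :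
    wordDLin p n k (wordD p l) = 0 := by
  have hs := wordD_mem hl
  set u := Finsupp.linearCombination (ZMod p) (word p) (wordD p l) with hu
  have hcu : crd p n k u = wordD p l := crd_lc fun l' h' => (hs (Finsupp.mem_support_iff.2 h')).1
  have hum : u ∈ mayF p n k (l.length + 1) (wordWt p l) :=
    lc_mem_mayF (Finsupp.supported_mono (homSet_subset le_rfl) hs)
  have h1 := cobarD_mem_mayF H (cobarD_word_sub_mem H hl)
  rw [map_sub, cobarD_cobarD H, zero_sub] at h1
  have h1 := neg_mem h1
  rw [neg_neg] at h1
  ext l'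
  rw [Finsupp.zero_apply]
  by_contra h
  have h2 : wordDLin p n k (wordD p l) ∈ Finsupp.supported (ZMod p) (ZMod p)
      (homSet p n k (l.length + 2) (wordWt p l)) := by
    rw [wordDLin, Finsupp.linearCombination_apply]
    refine Submodule.sum_mem _ fun l' hl' => Submodule.smul_mem _ _ ?_
    obtain ⟨a1, a2, a3⟩ := hs hl'
    have := wordD_mem a1
    rwa [a2, a3] at this
  have h3 := (h2 (Finsupp.mem_support_iff.2 h)).2.2
  have h4 := crd_cobarD H hum (l := l') (by rw [h3])
  rw [hcu] at h4
  rw [← h4] at h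
  have := (mem_mayF.1 h1 l' h).2.2
  omega

end Leading

/-! ### The exterior algebra tensored with a polynomial algebra -/

section Operators

variable {p : ℕ} {G : Type*}

/-- The exterior algebra on generators `h_g`. -/
abbrev Lam (p : ℕ) (G : Type*) : Type _ := ExteriorAlgebra (ZMod p) (G →₀ ZMod p)

/-- The exterior algebra on the `h_g` tensored with the polynomial algebra on generators `b_g`,
as the finitely supported functions from the monomials in the `b_g` to the exterior algebra. -/
abbrev EP (p : ℕ) (G : Type*) : Type _ := (G →₀ ℕ) →₀ Lam p G

variable (p) in
/-- The generator `h_g`. -/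
def hGen (g : G) : Lam p G := ExteriorAlgebra.ι (ZMod p) (Finsupp.single g 1)

theorem hGen_mul_self (g : G) : hGen p g * hGen p g = 0 := ExteriorAlgebra.ι_sq_zero _

theorem hGen_mul_ι (g : G) (v : G →₀ ZMod p) :
    hGen p g * ExteriorAlgebra.ι (ZMod p) v = -(ExteriorAlgebra.ι (ZMod p) v * hGen p g) :=
  eq_neg_of_add_eq_zero_left (ExteriorAlgebra.ι_add_mul_swap _ v)

variable (p) in
/-- The contraction dual to `h_g`. -/
def contr (g : G) : Lam p G →ₗ[ZMod p] Lam p G :=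
  CliffordAlgebra.contractLeft (Q := (0 : QuadraticForm (ZMod p) (G →₀ ZMod p))) (Finsupp.lapply g)

theorem contr_ι_mul (g : G) (v : G →₀ ZMod p) (x : Lam p G) :
    contr p g (ExteriorAlgebra.ι (ZMod p) v * x) =
      v g • x - ExteriorAlgebra.ι (ZMod p) v * contr p g x :=
  CliffordAlgebra.contractLeft_ι_mul _ _ _

theorem contr_one (g : G) : contr p g 1 = 0 :=
  CliffordAlgebra.contractLeft_one (Q := (0 : QuadraticForm (ZMod p) (G →₀ ZMod p))) _

theorem contr_algebraMap (g : G) (r : ZMod p) : contr p g (algebraMap (ZMod p) (Lam p G) r) = 0 :=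
  CliffordAlgebra.contractLeft_algebraMap _ _ r

theorem contr_contr (g : G) (x : Lam p G) : contr p g (contr p g x) = 0 :=
  CliffordAlgebra.contractLeft_contractLeft _ _

theorem contr_comm (g g' : G) (x : Lam p G) :
    contr p g (contr p g' x) = -contr p g' (contr p g x) := CliffordAlgebra.contractLeft_comm _ _ x

theorem contr_hGen_mul_self (g : G) (x : Lam p G) :
    contr p g (hGen p g * x) = x - hGen p g * contr p g x := by
  rw [hGen, contr_ι_mul, Finsupp.single_eq_same, one_smul]

theorem contr_hGen_mul_of_ne {g g' : G} (h : g ≠ g') (x : Lam p G) :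
    contr p g (hGen p g' * x) = -(hGen p g' * contr p g x) := by
  rw [hGen, contr_ι_mul, Finsupp.single_eq_of_ne h, zero_smul, zero_sub]

/-- Left induction in the exterior algebra. -/
theorem lam_induction {R M : Type*} [CommRing R] [AddCommGroup M] [Module R M]
    {P : ExteriorAlgebra R M → Prop} (halg : ∀ r, P (algebraMap R _ r))
    (hadd : ∀ x y, P x → P y → P (x + y))
    (hmul : ∀ v x, P x → P (ExteriorAlgebra.ι R v * x)) (x : ExteriorAlgebra R M) : P x :=
  CliffordAlgebra.left_induction (Q := 0) halg hadd (fun x v hx => hmul v x hx) x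

variable (p) in
/-- The projection of the span of the `h_g` that kills a given `h_g`. -/
def killLin (g : G) : (G →₀ ZMod p) →ₗ[ZMod p] (G →₀ ZMod p) :=
  LinearMap.id - Finsupp.lsingle g ∘ₗ Finsupp.lapply g

theorem killLin_apply (g : G) (v : G →₀ ZMod p) :
    killLin p g v = v - v g • Finsupp.single g 1 := by
  simp [killLin]

/-- The operator `∂_g h_g` is the algebra endomorphism that kills `h_g`. -/
theorem contr_hGen_mul_eq_map (g : G) (x : Lam p G) :
    contr p g (hGen p g * x) = ExteriorAlgebra.map (killLin p g) x := by
  induction x using lam_induction with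
  | halg r => simp [contr_hGen_mul_self, contr_algebraMap]
  | hadd x y hx hy => rw [mul_add, map_add, map_add, hx, hy]
  | hmul v x hx =>
    have h1 : hGen p g * ExteriorAlgebra.map (killLin p g) x = hGen p g * x := by
      rw [← hx, contr_hGen_mul_self, mul_sub, ← mul_assoc, hGen_mul_self, zero_mul, sub_zero]
    rw [← mul_assoc, hGen_mul_ι, neg_mul, map_neg, mul_assoc, contr_ι_mul, hx, map_mul,
      ExteriorAlgebra.map_apply_ι, killLin_apply, map_sub, map_smul, sub_mul, smul_mul_assoc]
    change _ = _ - v g • (hGen p g * _)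
    rw [h1]
    abel

variable (p) in
/-- Multiplication by `h_g`. -/
def Lop (g : G) : EP p G →ₗ[ZMod p] EP p G :=
  Finsupp.mapRange.linearMap (LinearMap.mulLeft (ZMod p) (hGen p g))

variable (p) in
/-- The derivative with respect to `h_g`. -/
def Dop (g : G) : EP p G →ₗ[ZMod p] EP p G := Finsupp.mapRange.linearMap (contr p g)

variable (p) in
/-- Multiplication by `b_g`. -/
def Bop (g : G) : EP p G →ₗ[ZMod p] EP p G :=
  Finsupp.lmapDomain (Lam p G) (ZMod p) fun m => m + Finsupp.single g 1

variable (p) in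
/-- Division by `b_g`. -/
def Cop (g : G) : EP p G →ₗ[ZMod p] EP p G :=
  Finsupp.lcomapDomain (fun m => m + Finsupp.single g 1) (add_left_injective _)

variable (p) in
/-- The operator `b_g ∂_g`. -/
def Aop (g : G) : EP p G →ₗ[ZMod p] EP p G := Bop p g ∘ₗ Dop p g

variable (p) in
/-- The projection `∂_g h_g (1 - b_g b_g⁻¹)` to the part that does not involve `h_g` and `b_g`. -/
def Eop (g : G) : EP p G →ₗ[ZMod p] EP p G :=
  Dop p g ∘ₗ Lop p g ∘ₗ (LinearMap.id - Bop p g ∘ₗ Cop p g)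

theorem Lop_apply (g : G) (v : EP p G) (m : G →₀ ℕ) : Lop p g v m = hGen p g * v m := rfl

theorem Dop_apply (g : G) (v : EP p G) (m : G →₀ ℕ) : Dop p g v m = contr p g (v m) := rfl

theorem Cop_apply (g : G) (v : EP p G) (m : G →₀ ℕ) :
    Cop p g v m = v (m + Finsupp.single g 1) := rfl

theorem Bop_apply_add (g : G) (v : EP p G) (m : G →₀ ℕ) :
    Bop p g v (m + Finsupp.single g 1) = v m :=
  Finsupp.mapDomain_apply (add_left_injective (Finsupp.single g 1)) v m

theorem Bop_apply_of_eq_zero (g : G) (v : EP p G) {m : G →₀ ℕ} (h : m g = 0) :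
    Bop p g v m = 0 := by
  refine Finsupp.mapDomain_of_notMem_range _ _ ?_
  rintro ⟨m', rfl⟩
  simp at h

theorem Bop_apply (g : G) (v : EP p G) (m : G →₀ ℕ) :
    Bop p g v m = if m g = 0 then 0 else v (m - Finsupp.single g 1) := by
  split_ifs with h
  · exact Bop_apply_of_eq_zero g v h
  · conv_lhs => rw [← Finsupp.sub_add_single_one_cancel h, Bop_apply_add]

theorem Lop_single (g : G) (m : G →₀ ℕ) (x : Lam p G) :
    Lop p g (Finsupp.single m x) = Finsupp.single m (hGen p g * x) := by simp [Lop]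

theorem Dop_single (g : G) (m : G →₀ ℕ) (x : Lam p G) :
    Dop p g (Finsupp.single m x) = Finsupp.single m (contr p g x) := by simp [Dop]

theorem Bop_single (g : G) (m : G →₀ ℕ) (x : Lam p G) :
    Bop p g (Finsupp.single m x) = Finsupp.single (m + Finsupp.single g 1) x := by simp [Bop]

theorem Lop_Lop (g g' : G) (v : EP p G) : Lop p g (Lop p g' v) = -Lop p g' (Lop p g v) := by
  ext m
  rw [Lop_apply, Lop_apply, Finsupp.neg_apply, Lop_apply, Lop_apply, ← mul_assoc, hGen, hGen,
    ← hGen, hGen_mul_ι, neg_mul, mul_assoc]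

theorem Lop_self (g : G) (v : EP p G) : Lop p g (Lop p g v) = 0 := by
  ext m
  rw [Lop_apply, Lop_apply, ← mul_assoc, hGen_mul_self, zero_mul, Finsupp.zero_apply]

theorem Dop_Dop (g g' : G) (v : EP p G) : Dop p g (Dop p g' v) = -Dop p g' (Dop p g v) := by
  ext m
  rw [Dop_apply, Dop_apply, Finsupp.neg_apply, Dop_apply, Dop_apply, contr_comm]

theorem Dop_self (g : G) (v : EP p G) : Dop p g (Dop p g v) = 0 := by
  ext m
  rw [Dop_apply, Dop_apply, contr_contr, Finsupp.zero_apply]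

theorem Dop_Lop_self (g : G) (v : EP p G) : Dop p g (Lop p g v) = v - Lop p g (Dop p g v) := by
  ext m
  rw [Dop_apply, Lop_apply, contr_hGen_mul_self, Finsupp.sub_apply, Lop_apply, Dop_apply]

theorem Dop_Lop_of_ne {g g' : G} (h : g ≠ g') (v : EP p G) :
    Dop p g (Lop p g' v) = -Lop p g' (Dop p g v) := by
  ext m
  rw [Dop_apply, Lop_apply, contr_hGen_mul_of_ne h, Finsupp.neg_apply, Lop_apply, Dop_apply]

theorem Lop_Bop (g g' : G) (v : EP p G) : Lop p g (Bop p g' v) = Bop p g' (Lop p g v) := by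
  ext m
  rw [Lop_apply, Bop_apply, Bop_apply]
  split_ifs
  · rw [mul_zero]
  · rw [Lop_apply]

theorem Dop_Bop (g g' : G) (v : EP p G) : Dop p g (Bop p g' v) = Bop p g' (Dop p g v) := by
  ext m
  rw [Dop_apply, Bop_apply, Bop_apply]
  split_ifs
  · rw [map_zero]
  · rw [Dop_apply]

theorem Lop_Cop (g g' : G) (v : EP p G) : Lop p g (Cop p g' v) = Cop p g' (Lop p g v) := by
  ext m
  rw [Lop_apply, Cop_apply, Cop_apply, Lop_apply]

theorem Dop_Cop (g g' : G) (v : EP p G) : Dop p g (Cop p g' v) = Cop p g' (Dop p g v) := by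
  ext m
  rw [Dop_apply, Cop_apply, Cop_apply, Dop_apply]

theorem Cop_Bop_self (g : G) (v : EP p G) : Cop p g (Bop p g v) = v := by
  ext m
  rw [Cop_apply, Bop_apply_add]

theorem Bop_Bop (g g' : G) (v : EP p G) : Bop p g (Bop p g' v) = Bop p g' (Bop p g v) := by
  suffices h : Bop p g ∘ₗ Bop p g' = Bop p g' ∘ₗ Bop p g from LinearMap.congr_fun h v
  refine Finsupp.lhom_ext fun m x => ?_
  simp only [LinearMap.comp_apply, Bop_single]
  rw [add_right_comm]

theorem Cop_Bop_of_ne {g g' : G} (h : g ≠ g') (v : EP p G) :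
    Cop p g (Bop p g' v) = Bop p g' (Cop p g v) := by
  ext m
  have e : (m + Finsupp.single g 1 : G →₀ ℕ) g' = m g' := by
    simp [Finsupp.single_eq_of_ne' h]
  rw [Cop_apply, Bop_apply, Bop_apply, e]
  split_ifs with h0
  · rfl
  · rw [Cop_apply]
    congr 1
    conv_lhs => rw [← Finsupp.sub_add_single_one_cancel h0]
    rw [add_right_comm, add_tsub_cancel_right]

theorem Eop_single (g : G) (m : G →₀ ℕ) (x : Lam p G) : Eop p g (Finsupp.single m x) =
    if m g = 0 then Finsupp.single m (ExteriorAlgebra.map (killLin p g) x) else 0 := by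
  rw [← contr_hGen_mul_eq_map]
  simp only [Eop, LinearMap.comp_apply, LinearMap.sub_apply, LinearMap.id_apply]
  split_ifs with h
  · have : Cop p g (Finsupp.single m x) = 0 := by
      ext m'
      rw [Cop_apply, Finsupp.zero_apply, Finsupp.single_eq_of_ne]
      rintro rfl
      simp at h
    rw [this, map_zero, sub_zero, Lop_single, Dop_single]
  · have : Bop p g (Cop p g (Finsupp.single m x)) = Finsupp.single m x := by
      have e : Finsupp.single m x = Bop p g (Finsupp.single (m - Finsupp.single g 1) x) := by
        rw [Bop_single, Finsupp.sub_add_single_one_cancel h]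
      rw [e, Cop_Bop_self]
    rw [this, sub_self, map_zero, map_zero]

end Operators

/-! ### The twisting cochain -/

section Twisting

variable {p : ℕ} {G : Type*}

open Classical in
variable (p) in
/-- The twisting cochain: `τ(γ_{δ_g}) = h_g`, `τ(γ_{(p-1)δ_g}) = b_g ∂_g`, and zero otherwise. -/
def tau (a : G →₀ ℕ) : EP p G →ₗ[ZMod p] EP p G :=
  if h : ∃ g, a = Finsupp.single g 1 then Lop p h.choose
  else if h : ∃ g, a = Finsupp.single g (p - 1) then Aop p h.choose else 0

theorem tau_single_one (g : G) : tau p (Finsupp.single g 1) = Lop p g := by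
  have h : ∃ g', (Finsupp.single g 1 : G →₀ ℕ) = Finsupp.single g' 1 := ⟨g, rfl⟩
  have := Finsupp.single_left_injective one_ne_zero h.choose_spec
  rw [tau, dif_pos h, ← this]

theorem tau_single_pred (hp : 3 ≤ p) (g : G) : tau p (Finsupp.single g (p - 1)) = Aop p g := by
  have h0 : ¬∃ g', (Finsupp.single g (p - 1) : G →₀ ℕ) = Finsupp.single g' 1 := by
    rintro ⟨g', h⟩
    have := congrArg Finsupp.degree h
    rw [Finsupp.degree_single, Finsupp.degree_single] at this
    omega
  have h : ∃ g', (Finsupp.single g (p - 1) : G →₀ ℕ) = Finsupp.single g' (p - 1) := ⟨g, rfl⟩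
  have := Finsupp.single_left_injective (by omega : p - 1 ≠ 0) h.choose_spec
  rw [tau, dif_neg h0, dif_pos h, ← this]

theorem tau_eq_zero {a : G →₀ ℕ} (h1 : ∀ g, a ≠ Finsupp.single g 1)
    (h2 : ∀ g, a ≠ Finsupp.single g (p - 1)) : tau p a = 0 := by
  rw [tau, dif_neg (by simpa using h1), dif_neg (by simpa using h2)]

theorem tau_cases (hp : 3 ≤ p) (a : G →₀ ℕ) :
    (∃ g, a = Finsupp.single g 1 ∧ tau p a = Lop p g) ∨
      (∃ g, a = Finsupp.single g (p - 1) ∧ tau p a = Aop p g) ∨ tau p a = 0 := by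
  by_cases h1 : ∃ g, a = Finsupp.single g 1
  · obtain ⟨g, rfl⟩ := h1
    exact Or.inl ⟨g, rfl, tau_single_one g⟩
  · by_cases h2 : ∃ g, a = Finsupp.single g (p - 1)
    · obtain ⟨g, rfl⟩ := h2
      exact Or.inr (Or.inl ⟨g, rfl, tau_single_pred hp g⟩)
    · exact Or.inr (Or.inr (tau_eq_zero (by simpa using h1) (by simpa using h2)))

theorem tau_zero (hp : 3 ≤ p) : tau p (0 : G →₀ ℕ) = 0 := by
  refine tau_eq_zero (fun g h => ?_) (fun g h => ?_)
  · exact one_ne_zero (Finsupp.single_eq_zero.1 h.symm)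
  · have := Finsupp.single_eq_zero.1 h.symm
    omega

theorem Aop_eq (g : G) (v : EP p G) : Aop p g v = Bop p g (Dop p g v) := rfl

theorem tau_Dop (hp : 3 ≤ p) {g : G} {a : G →₀ ℕ} (h : a g = 0) (v : EP p G) :
    tau p a (Dop p g v) = -Dop p g (tau p a v) := by
  rcases tau_cases hp a with ⟨g', rfl, e⟩ | ⟨g', rfl, e⟩ | e
  · have hg : g ≠ g' := by rintro rfl; simp at h
    rw [e, Dop_Lop_of_ne hg, neg_neg]
  · rw [e, Aop_eq, Aop_eq, Dop_Bop, Dop_Dop g, map_neg, neg_neg]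
  · rw [e]; simp

theorem tau_Lop_Cop (hp : 3 ≤ p) {g : G} {a : G →₀ ℕ} (h : a g = 0) (v : EP p G) :
    tau p a (Lop p g (Cop p g v)) = -Lop p g (Cop p g (tau p a v)) := by
  rcases tau_cases hp a with ⟨g', rfl, e⟩ | ⟨g', rfl, e⟩ | e
  · rw [e, Lop_Lop, Lop_Cop]
  · have hg : g ≠ g' := by
      rintro rfl
      simp at h
      omega
    rw [e, Aop_eq, Aop_eq, Dop_Lop_of_ne hg.symm, map_neg, Cop_Bop_of_ne hg, Lop_Bop, Dop_Cop]
  · rw [e]; simp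

/-- The values of the twisting cochain anticommute whenever the sum of the arguments is valid. -/
theorem tau_tau (hp : 3 ≤ p) {a b : G →₀ ℕ} (h : ∀ g, (a + b) g < p) (v : EP p G) :
    tau p a (tau p b v) = -tau p b (tau p a v) := by
  have key : ∀ g g', (∀ i, (Finsupp.single g 1 + Finsupp.single g' (p - 1) : G →₀ ℕ) i < p) →
      ∀ v : EP p G, Lop p g (Aop p g' v) = -Aop p g' (Lop p g v) := by
    intro g g' h v
    have hg : g ≠ g' := by
      rintro rfl
      have := h g
      simp at this
      omega
    rw [Aop_eq, Aop_eq, Dop_Lop_of_ne hg.symm, map_neg, neg_neg, Lop_Bop]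
  rcases tau_cases hp a with ⟨g, rfl, e⟩ | ⟨g, rfl, e⟩ | e <;>
    rcases tau_cases hp b with ⟨g', rfl, e'⟩ | ⟨g', rfl, e'⟩ | e' <;> rw [e, e']
  · exact Lop_Lop _ _ _
  · exact key _ _ h v
  · simp
  · rw [key g' g (by simpa only [add_comm] using h), neg_neg]
  · rw [Aop_eq, Aop_eq, Aop_eq, Aop_eq, Dop_Bop, Dop_Bop, Bop_Bop, Dop_Dop, map_neg, map_neg]
  · simp
  · simp
  · simp
  · simp

open Finset.HasAntidiagonal in
/-- The twisting cochain equation: for odd `p`, the sum is its own negative. -/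
theorem sum_tau_tau [DecidableEq G] [Fact p.Prime] (hp : 3 ≤ p) {a : G →₀ ℕ}
    (h : ∀ g, a g < p) (v : EP p G) :
    ∑ x ∈ antidiagonal a, tau p x.1 (tau p x.2 v) = 0 := by
  have h1 : ∑ x ∈ antidiagonal a, tau p x.1 (tau p x.2 v) =
      -∑ x ∈ antidiagonal a, tau p x.1 (tau p x.2 v) := by
    conv_lhs => rw [← Finset.HasAntidiagonal.map_swap_antidiagonal, Finset.sum_map]
    rw [← Finset.sum_neg_distrib]
    refine Finset.sum_congr rfl fun x hx => ?_
    rw [mem_antidiagonal] at hx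
    exact tau_tau hp (a := x.2) (b := x.1) (by rw [add_comm, hx]; exact h) v
  have h2 : (2 : ZMod p) ≠ 0 := by
    intro h0
    have : ((2 : ℕ) : ZMod p) = 0 := by exact_mod_cast h0
    rw [ZMod.natCast_eq_zero_iff] at this
    have := Nat.le_of_dvd (by omega) this
    omega
  have h3 : (2 : ZMod p) • ∑ x ∈ antidiagonal a, tau p x.1 (tau p x.2 v) = 0 := by
    rw [two_smul]
    nth_rewrite 1 [h1]
    rw [neg_add_cancel]
  exact (smul_eq_zero.1 h3).resolve_left h2

end Twisting

/-! ### The twisted tensor product of the divided power coalgebra is acyclic -/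

section Acyclic

/-- The zero of an additive commutative group. -/
abbrev zeroOf (M : Type*) [AddCommGroup M] : Zero M := inferInstance

/-- The zero of `EP p G`, taken from its group structure so that finitely supported functions with
values in `EP p G` form a group without unfolding. -/
instance EP.instZero (p : ℕ) (G : Type*) : Zero (EP p G) := @zeroOf (EP p G) Finsupp.instAddCommGroup

open Finset.HasAntidiagonal

theorem sum_antidiagonal_triple {A M : Type*} [AddCommMonoid A] [Finset.HasAntidiagonal A]
    [AddCommMonoid M] (F : A → A → A → M) (a : A) :
    ∑ x ∈ antidiagonal a, ∑ y ∈ antidiagonal x.1, F y.1 y.2 x.2 =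
      ∑ x ∈ antidiagonal a, ∑ y ∈ antidiagonal x.2, F x.1 y.1 y.2 := by
  rw [Finset.sum_sigma', Finset.sum_sigma']
  refine Finset.sum_nbij' (fun x => ⟨(x.2.1, x.2.2 + x.1.2), (x.2.2, x.1.2)⟩)
    (fun x => ⟨(x.1.1 + x.2.1, x.2.2), (x.1.1, x.2.1)⟩) ?_ ?_ ?_ ?_ ?_ <;>
    rintro ⟨⟨a, b⟩, ⟨c, d⟩⟩ h <;> simp only [Finset.mem_sigma, mem_antidiagonal] at h ⊢
  · exact ⟨by rw [← add_assoc, h.2, h.1], trivial⟩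
  · exact ⟨by rw [add_assoc, h.2, h.1], trivial⟩
  · obtain ⟨h1, rfl⟩ := h; rfl
  · obtain ⟨h1, rfl⟩ := h; rfl

variable {p : ℕ} {G : Type*} [DecidableEq G]

/-- The divided power algebra on the states `a : G →₀ ℕ` tensored with `EP p G`. -/
abbrev TwK (p : ℕ) (G : Type*) : Type _ := (G →₀ ℕ) →₀ EP p G

variable (p G) in
/-- The twisted differential `γ_a ⊗ v ↦ ∑_{b+c=a} γ_b ⊗ τ(γ_c) v`. -/
def twD : TwK p G →ₗ[ZMod p] TwK p G :=
  Finsupp.lsum (ZMod p) fun a => ∑ x ∈ antidiagonal a, Finsupp.lsingle x.1 ∘ₗ tau p x.2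

theorem twD_single (a : G →₀ ℕ) (v : EP p G) : twD p G (Finsupp.single a v) =
    ∑ x ∈ antidiagonal a, Finsupp.single x.1 (tau p x.2 v) := by
  simp [twD]

variable (p G) in
/-- The part of `TwK p G` on states with all digits less than `p`. -/
def twOk : Submodule (ZMod p) (TwK p G) :=
  Finsupp.supported (EP p G) (ZMod p) {a | ∀ g, a g < p}

theorem single_mem_twOk {a : G →₀ ℕ} (h : ∀ g, a g < p) (v : EP p G) :
    Finsupp.single a v ∈ twOk p G := Finsupp.single_mem_supported _ _ h

theorem twOk_induction {P : TwK p G → Prop} (hadd : ∀ x y, P x → P y → P (x + y)) (h0 : P 0)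
    (hs : ∀ a v, (∀ g, a g < p) → P (Finsupp.single a v)) {x : TwK p G} (hx : x ∈ twOk p G) :
    P x := by
  rw [← Finsupp.sum_single x, Finsupp.sum]
  exact Finset.sum_induction _ P hadd h0 fun a ha => hs a _ (hx ha)

theorem twD_mem {x : TwK p G} (hx : x ∈ twOk p G) : twD p G x ∈ twOk p G := by
  refine twOk_induction (P := fun x => twD p G x ∈ twOk p G) ?_ ?_ ?_ hx
  · intro x y hx hy; rw [map_add]; exact add_mem hx hy
  · rw [map_zero]; exact zero_mem _
  · intro a v h
    rw [twD_single]
    refine Submodule.sum_mem _ fun x hx => single_mem_twOk (fun g => ?_) _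
    rw [mem_antidiagonal] at hx
    exact lt_of_le_of_lt (by rw [← hx]; simp) (h g)

theorem twD_twD [Fact p.Prime] (hp : 3 ≤ p) {x : TwK p G} (hx : x ∈ twOk p G) :
    twD p G (twD p G x) = 0 := by
  refine twOk_induction (P := fun x => twD p G (twD p G x) = 0) ?_ ?_ ?_ hx
  · intro x y hx hy; rw [map_add, map_add, hx, hy, add_zero]
  · simp
  · intro a v h
    rw [twD_single, map_sum]
    simp only [twD_single]
    rw [sum_antidiagonal_triple (fun b c d => Finsupp.single b (tau p c (tau p d v)))]
    refine Finset.sum_eq_zero fun x hx => ?_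
    rw [mem_antidiagonal] at hx
    rw [← Finsupp.single_finsetSum, sum_tau_tau hp, Finsupp.single_zero]
    exact fun g => lt_of_le_of_lt (by rw [← hx]; simp) (h g)

/-- The part of the differential on `γ_{i g} γ_a` that does not split `i g`. -/
def twRest (b a : G →₀ ℕ) (v : EP p G) : TwK p G :=
  ∑ x ∈ antidiagonal a, Finsupp.single (b + x.1) (tau p x.2 v)

theorem tau_single_add {g : G} {i : ℕ} {a : G →₀ ℕ} (ha : a g = 0) (hi : i ≠ 0)
    (h0 : a ≠ 0) : tau p (Finsupp.single g i + a) = 0 := by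
  obtain ⟨g', hg'⟩ := Finsupp.ne_iff.1 h0
  rw [Finsupp.zero_apply] at hg'
  have hne : g ≠ g' := by rintro rfl; exact hg' ha
  have key : ∀ g₁ m, Finsupp.single g i + a ≠ Finsupp.single g₁ m := by
    intro g₁ m h
    have e1 := DFunLike.congr_fun h g
    have e2 := DFunLike.congr_fun h g'
    simp only [Finsupp.add_apply, Finsupp.single_apply, ha] at e1 e2
    split_ifs at e1 e2 <;> simp_all
  exact tau_eq_zero (fun _ => key _ _) (fun _ => key _ _)

theorem tau_single_of_ne {g : G} {i : ℕ} (h1 : i ≠ 1) (h2 : i ≠ p - 1) :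
    tau p (Finsupp.single g i) = 0 := by
  refine tau_eq_zero ?_ ?_ <;> intro g' h
  · have := congrArg Finsupp.degree h
    rw [Finsupp.degree_single, Finsupp.degree_single] at this
    exact h1 this
  · have := congrArg Finsupp.degree h
    rw [Finsupp.degree_single, Finsupp.degree_single] at this
    exact h2 this

theorem twD_split (hp : 3 ≤ p) {g : G} {i : ℕ} {a : G →₀ ℕ} (ha : a g = 0) (hi : i < p)
    (v : EP p G) : twD p G (Finsupp.single (Finsupp.single g i + a) v) =
      (if i = 0 then 0 else Finsupp.single (Finsupp.single g (i - 1) + a) (Lop p g v)) +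
      (if i = p - 1 then Finsupp.single a (Aop p g v) else 0) +
      twRest (Finsupp.single g i) a v := by
  rw [twD_single, sum_antidiagonal_single_add (fun b c => Finsupp.single b (tau p c v)) ha]
  -- only `x = (i, 0)` has a contribution from `x.2 = 0`
  have h1 : ∀ x ∈ antidiagonal i, x.2 ≠ 0 →
      ∑ y ∈ antidiagonal a, (Finsupp.single (Finsupp.single g x.1 + y.1)
        (tau p (Finsupp.single g x.2 + y.2) v) : TwK p G) =
      Finsupp.single (Finsupp.single g x.1 + a) (tau p (Finsupp.single g x.2) v) := by
    intro x _ hx0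
    rw [Finset.sum_eq_single (a, 0)]
    · simp
    · intro y hy hy0
      have : y.2 ≠ 0 := by
        intro h
        rw [mem_antidiagonal, h, add_zero] at hy
        exact hy0 (Prod.ext hy h)
      rw [mem_antidiagonal] at hy
      rw [tau_single_add ?_ hx0 this, LinearMap.zero_apply, Finsupp.single_zero]
      have := DFunLike.congr_fun hy g
      rw [Finsupp.add_apply, ha] at this
      omega
    · intro h
      exact absurd (by simp) h
  rw [← Finset.add_sum_erase _ _ (show (i, 0) ∈ antidiagonal i by simp), add_comm]
  congr 1
  · have h2 : ∀ x ∈ (antidiagonal i).erase (i, 0),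
        ∑ y ∈ antidiagonal a, (Finsupp.single (Finsupp.single g x.1 + y.1)
          (tau p (Finsupp.single g x.2 + y.2) v) : TwK p G) =
        (if x = (i - 1, 1) then Finsupp.single (Finsupp.single g (i - 1) + a) (Lop p g v) else 0) +
        (if x = (0, p - 1) then Finsupp.single a (Aop p g v) else 0) := by
      intro x hx
      rw [Finset.mem_erase, mem_antidiagonal] at hx
      obtain ⟨x1, x2⟩ := x
      have h0 : x2 ≠ 0 := by
        rintro rfl
        exact hx.1 (Prod.ext (by simpa using hx.2) rfl)
      simp only at hx ⊢
      rw [h1 (x1, x2) (by simpa using hx.2) h0]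
      simp only [Prod.mk.injEq]
      by_cases e1 : x2 = 1
      · subst e1
        rw [if_pos ⟨by omega, rfl⟩, if_neg (by omega), add_zero, tau_single_one,
          show x1 = i - 1 by omega]
      · rw [if_neg (by tauto), zero_add]
        by_cases e2 : x2 = p - 1
        · rw [if_pos ⟨by omega, e2⟩, e2, tau_single_pred hp, show x1 = 0 by omega,
            Finsupp.single_zero, zero_add]
        · rw [if_neg (by tauto), tau_single_of_ne e1 e2, LinearMap.zero_apply,
            Finsupp.single_zero]
    rw [Finset.sum_congr rfl h2, Finset.sum_add_distrib, Finset.sum_ite_eq', Finset.sum_ite_eq']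
    congr 1
    · by_cases e : i = 0
      · rw [if_neg, if_pos e]
        simp [e]
      · rw [if_pos, if_neg e]
        simp only [Finset.mem_erase, mem_antidiagonal, ne_eq, Prod.mk.injEq]
        omega
    · by_cases e : i = p - 1
      · rw [if_pos, if_pos e]
        simp only [Finset.mem_erase, mem_antidiagonal, ne_eq, Prod.mk.injEq]
        omega
      · rw [if_neg, if_neg e]
        simp only [Finset.mem_erase, mem_antidiagonal, ne_eq, Prod.mk.injEq]
        omega
  · simp [twRest]

variable (p) in
/-- The contracting homotopy in the direction of `g`. -/
def twH (g : G) : TwK p G →ₗ[ZMod p] TwK p G :=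
  Finsupp.lsum (ZMod p) fun a =>
    (if a g + 2 ≤ p then Finsupp.lsingle (Finsupp.single g 1 + a) ∘ₗ Dop p g else 0) +
    (if a g = 0 then Finsupp.lsingle (Finsupp.single g (p - 1) + a) ∘ₗ Lop p g ∘ₗ Cop p g else 0)

theorem twH_single {g : G} {i : ℕ} {a : G →₀ ℕ} (ha : a g = 0) (v : EP p G) :
    twH p g (Finsupp.single (Finsupp.single g i + a) v) =
      (if i + 2 ≤ p then Finsupp.single (Finsupp.single g (i + 1) + a) (Dop p g v) else 0) +
      (if i = 0 then Finsupp.single (Finsupp.single g (p - 1) + a) (Lop p g (Cop p g v))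
        else 0) := by
  have e : (Finsupp.single g i + a : G →₀ ℕ) g = i := by simp [ha]
  rw [twH, Finsupp.lsum_single, e, LinearMap.add_apply, ← add_assoc, ← Finsupp.single_add,
    add_comm 1 i]
  congr 1
  · split_ifs <;> rfl
  · split_ifs with h
    · subst h; simp
    · rfl

variable (p) in
/-- The projection to the part that does not involve `g`. -/
def twE (g : G) : TwK p G →ₗ[ZMod p] TwK p G :=
  Finsupp.lsum (ZMod p) fun a => if a g = 0 then Finsupp.lsingle a ∘ₗ Eop p g else 0

theorem twE_single (g : G) (a : G →₀ ℕ) (v : EP p G) : twE p g (Finsupp.single a v) =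
    if a g = 0 then Finsupp.single a (Eop p g v) else 0 := by
  rw [twE, Finsupp.lsum_single]
  split_ifs <;> rfl

theorem twH_twRest (hp : 3 ≤ p) {g : G} {i : ℕ} {a : G →₀ ℕ} (ha : a g = 0) (v : EP p G) :
    twH p g (twRest (Finsupp.single g i) a v) =
      -((if i + 2 ≤ p then twRest (Finsupp.single g (i + 1)) a (Dop p g v) else 0) +
        (if i = 0 then twRest (Finsupp.single g (p - 1)) a (Lop p g (Cop p g v)) else 0)) := by
  have h : ∀ x ∈ antidiagonal a, x.1 g = 0 ∧ x.2 g = 0 := by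
    intro x hx
    rw [mem_antidiagonal] at hx
    have := DFunLike.congr_fun hx g
    rw [Finsupp.add_apply, ha] at this
    omega
  rw [twRest, map_sum]
  rw [Finset.sum_congr rfl fun x hx => twH_single (h x hx).1 _, Finset.sum_add_distrib, neg_add]
  congr 1
  · split_ifs
    · rw [twRest, ← Finset.sum_neg_distrib]
      refine Finset.sum_congr rfl fun x hx => ?_
      rw [tau_Dop hp (h x hx).2, ← Finsupp.single_neg, neg_neg]
    · simp
  · split_ifs
    · rw [twRest, ← Finset.sum_neg_distrib]
      refine Finset.sum_congr rfl fun x hx => ?_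
      rw [tau_Lop_Cop hp (h x hx).2, ← Finsupp.single_neg, neg_neg]
    · simp

theorem Eop_eq (g : G) (v : EP p G) :
    v - Eop p g v = Lop p g (Dop p g v) + Aop p g (Lop p g (Cop p g v)) := by
  simp only [Eop, LinearMap.comp_apply, LinearMap.sub_apply, LinearMap.id_apply, map_sub, Aop_eq]
  rw [Dop_Lop_self, Lop_Bop, Dop_Bop]
  abel

/-- `κ_g` is a homotopy from the identity to the projection `twE`. -/
theorem twD_twH (hp : 3 ≤ p) (g : G) {x : TwK p G} (hx : x ∈ twOk p G) :
    twD p G (twH p g x) + twH p g (twD p G x) = x - twE p g x := by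
  refine twOk_induction (P := fun x =>
    twD p G (twH p g x) + twH p g (twD p G x) = x - twE p g x) ?_ ?_ ?_ hx
  · intro x y hx hy
    simp only [map_add]
    rw [add_sub_add_comm, ← hx, ← hy]
    abel
  · simp
  · intro a₀ v h
    obtain ⟨a, i, ha, hi, rfl⟩ : ∃ (a : G →₀ ℕ) (i : ℕ), a g = 0 ∧ i < p ∧
        a₀ = Finsupp.single g i + a :=
      ⟨a₀.erase g, a₀ g, by simp, h g, by rw [Finsupp.single_add_erase]⟩
    have e : (Finsupp.single g i + a : G →₀ ℕ) g = i := by simp [ha]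
    rw [twE_single, e, twH_single ha, twD_split hp ha hi, map_add, map_add, map_add,
      twH_twRest hp ha]
    have hz : ∀ v : EP p G, Aop p g (Dop p g v) = 0 := fun v => by rw [Aop_eq, Dop_self, map_zero]
    have hz2 : ∀ v : EP p G, Dop p g (Aop p g v) = 0 := fun v => by
      rw [Aop_eq, Dop_Bop, Dop_self, map_zero]
    have hLL : ∀ v : EP p G, Lop p g (Cop p g (Lop p g v)) = 0 := fun v => by
      rw [← Lop_Cop, Lop_self]
    -- `i = 0`, where the projection enters
    by_cases h0 : i = 0
    · subst h0
      rw [if_pos (by omega), if_pos rfl, if_pos rfl, if_pos rfl, if_neg (by omega), map_zero,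
        twD_split hp ha (by omega), twD_split hp ha (by omega), if_neg (by omega),
        if_neg (by omega), if_neg (by omega), if_pos rfl, Lop_self, if_pos (by omega), if_pos rfl]
      have ea : (Finsupp.single g 0 + a : G →₀ ℕ) = a := by simp
      rw [zero_add 1, Nat.sub_self, ea, ← Finsupp.single_sub, Eop_eq, Finsupp.single_add]
      simp only [Finsupp.single_zero, zero_add, add_zero]
      abel
    · obtain ⟨j, rfl⟩ : ∃ j, i = j + 1 := ⟨i - 1, by omega⟩
      have c0 : j + 1 ≤ p := by omega
      have ea : ∀ w : EP p G, (Finsupp.single a w : TwK p G) =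
          Finsupp.single (Finsupp.single g 0 + a) w := by simp
      simp only [if_neg h0, map_zero, add_zero, sub_zero, Nat.add_sub_cancel]
      rw [twH_single ha, hLL, Finsupp.single_zero, ite_self, add_zero,
        if_pos (show j + 2 ≤ p by omega), Dop_Lop_self, Finsupp.single_sub]
      -- at the top digit `i = p - 1` the differential reaches `i = 0` through `b_g ∂_g`
      by_cases h1 : j + 1 = p - 1
      · have e3 : Lop p g (Cop p g (Aop p g v)) = Lop p g (Dop p g v) := by
          rw [Aop_eq, Cop_Bop_self]
        have c1 : ¬j + 1 + 2 ≤ p := by omega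
        rw [if_pos h1, ea, twH_single ha, hz2, e3, if_pos rfl, ← h1]
        simp only [if_neg c1, Finsupp.single_zero, ite_self, map_zero, neg_zero]
        abel
      · have c1 : j + 1 + 2 ≤ p := by omega
        simp only [if_neg h1, if_pos c1, map_zero, add_zero]
        rw [twD_split hp ha (by omega), if_neg (show ¬j + 1 + 1 = 0 by omega),
          Nat.add_sub_cancel, hz, Finsupp.single_zero, ite_self]
        abel

end Acyclic

section Exactness

open Finset.HasAntidiagonal

variable {p : ℕ} {G : Type*}

variable (p) in
/-- The algebra endomorphism of the exterior algebra that kills `h_g` for `g` in a list. -/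
def lamKill : List G → Lam p G →ₗ[ZMod p] Lam p G
  | [] => LinearMap.id
  | g :: L => (ExteriorAlgebra.map (killLin p g)).toLinearMap ∘ₗ lamKill L

variable (p) in
/-- The projection of the span of the `h_g` that kills `h_g` for `g` in a list. -/
def killList : List G → (G →₀ ZMod p) →ₗ[ZMod p] (G →₀ ZMod p)
  | [] => LinearMap.id
  | g :: L => killLin p g ∘ₗ killList L

theorem lamKill_algebraMap (L : List G) (r : ZMod p) :
    lamKill p L (algebraMap (ZMod p) (Lam p G) r) = algebraMap (ZMod p) (Lam p G) r := by
  induction L with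
  | nil => rfl
  | cons g L ih => rw [lamKill, LinearMap.comp_apply, ih, AlgHom.toLinearMap_apply, AlgHom.commutes]

theorem lamKill_ι_mul (L : List G) (v : G →₀ ZMod p) (x : Lam p G) :
    lamKill p L (ExteriorAlgebra.ι (ZMod p) v * x) =
      ExteriorAlgebra.ι (ZMod p) (killList p L v) * lamKill p L x := by
  induction L with
  | nil => rfl
  | cons g L ih =>
    rw [lamKill, LinearMap.comp_apply, ih, AlgHom.toLinearMap_apply, map_mul,
      ExteriorAlgebra.map_apply_ι]
    rfl

theorem killList_apply_of_mem (L : List G) (v : G →₀ ZMod p) {g : G} (h : g ∈ L ∨ v g = 0) :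
    killList p L v g = 0 := by
  induction L with
  | nil => simpa [killList] using h
  | cons g' L ih =>
    rw [killList, LinearMap.comp_apply, killLin_apply, Finsupp.sub_apply, Finsupp.smul_apply]
    by_cases e : g = g'
    · subst e; simp
    · rw [Finsupp.single_eq_of_ne e, smul_zero, sub_zero]
      refine ih (h.imp_left fun h => ?_)
      exact (List.mem_cons.1 h).resolve_left e

theorem exists_lamKill_eq (x : Lam p G) : ∃ S : Finset G, ∀ L : List G, (∀ g ∈ S, g ∈ L) →
    lamKill p L x = algebraMap (ZMod p) _ (ExteriorAlgebra.algebraMapInv x) := by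
  classical
  induction x using lam_induction with
  | halg r =>
    exact ⟨∅, fun L _ => by rw [lamKill_algebraMap, ExteriorAlgebra.algebraMap_leftInverse]⟩
  | hadd x y hx hy =>
    obtain ⟨S, hS⟩ := hx
    obtain ⟨T, hT⟩ := hy
    refine ⟨S ∪ T, fun L hL => ?_⟩
    rw [map_add, map_add, map_add, hS L fun g hg => hL g (Finset.mem_union_left _ hg),
      hT L fun g hg => hL g (Finset.mem_union_right _ hg)]
  | hmul v x hx =>
    refine ⟨v.support, fun L hL => ?_⟩
    have : killList p L v = 0 := by
      ext g
      rw [Finsupp.zero_apply]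
      refine killList_apply_of_mem L v ?_
      by_cases h : v g = 0
      · exact Or.inr h
      · exact Or.inl (hL g (Finsupp.mem_support_iff.2 h))
    rw [lamKill_ι_mul, this, map_zero, zero_mul, map_mul]
    simp [ExteriorAlgebra.algebraMapInv]

variable (p) in
/-- The projection to the part that does not involve any `g` in a list. -/
def twEList [DecidableEq G] : List G → TwK p G →ₗ[ZMod p] TwK p G
  | [] => LinearMap.id
  | g :: L => twE p g ∘ₗ twEList L

theorem twEList_single [DecidableEq G] (L : List G) (a m : G →₀ ℕ) (x : Lam p G) :
    twEList p L (Finsupp.single a (Finsupp.single m x)) =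
      if ∀ g ∈ L, a g = 0 ∧ m g = 0 then
        Finsupp.single a (Finsupp.single m (lamKill p L x)) else 0 := by
  induction L with
  | nil => simp [twEList, lamKill]
  | cons g L ih =>
    rw [twEList, LinearMap.comp_apply, ih]
    by_cases h : ∀ g ∈ L, a g = 0 ∧ m g = 0
    · rw [if_pos h, twE_single]
      by_cases h1 : a g = 0
      · rw [if_pos h1, Eop_single]
        by_cases h2 : m g = 0
        · rw [if_pos h2, if_pos (by simpa [h1, h2] using h)]
          rfl
        · rw [if_neg h2, if_neg (by simp [h2]), Finsupp.single_zero]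
      · rw [if_neg h1, if_neg (by simp [h1])]
    · rw [if_neg h, if_neg (fun h' => h fun g hg => h' g (List.mem_cons_of_mem _ hg)), map_zero]

variable (p G) in
/-- The inclusion of the scalars. -/
def twJ : ZMod p →ₗ[ZMod p] TwK p G :=
  Finsupp.lsingle 0 ∘ₗ (Finsupp.lsingle 0 : Lam p G →ₗ[ZMod p] EP p G) ∘ₗ
    Algebra.linearMap (ZMod p) (Lam p G)

variable (p G) in
/-- The projection onto the scalars. -/
def epPi : EP p G →ₗ[ZMod p] ZMod p :=
  ExteriorAlgebra.algebraMapInv.toLinearMap ∘ₗ (Finsupp.lapply 0 : EP p G →ₗ[ZMod p] Lam p G)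

variable (p G) in
/-- The projection onto the scalars. -/
def twPi : TwK p G →ₗ[ZMod p] ZMod p := epPi p G ∘ₗ Finsupp.lapply 0

theorem epPi_apply (v : EP p G) : epPi p G v = ExteriorAlgebra.algebraMapInv (v 0) := rfl

theorem twJ_apply (r : ZMod p) : twJ p G r =
    Finsupp.single 0 (Finsupp.single 0 (algebraMap (ZMod p) (Lam p G) r)) := rfl

theorem twPi_twJ (r : ZMod p) : twPi p G (twJ p G r) = r := by
  rw [twPi, LinearMap.comp_apply, twJ_apply, Finsupp.lapply_apply, Finsupp.single_eq_same,
    epPi_apply, Finsupp.single_eq_same, ExteriorAlgebra.algebraMap_leftInverse]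

theorem epPi_tau (hp : 3 ≤ p) (a : G →₀ ℕ) (v : EP p G) : epPi p G (tau p a v) = 0 := by
  rcases tau_cases hp a with ⟨g, -, e⟩ | ⟨g, -, e⟩ | e <;> rw [e]
  · rw [epPi_apply, Lop_apply, map_mul]
    simp [hGen, ExteriorAlgebra.algebraMapInv]
  · rw [epPi_apply, Aop_eq, Bop_apply_of_eq_zero _ _ rfl, map_zero]
  · rw [LinearMap.zero_apply, map_zero]

variable [DecidableEq G]

theorem exists_twEList_eq (x : TwK p G) : ∃ S : Finset G, ∀ L : List G, (∀ g ∈ S, g ∈ L) →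
    twEList p L x = twJ p G (twPi p G x) := by
  induction x using Finsupp.induction_linear with
  | zero => exact ⟨∅, by simp⟩
  | add x y hx hy =>
    obtain ⟨S, hS⟩ := hx
    obtain ⟨T, hT⟩ := hy
    refine ⟨S ∪ T, fun L hL => ?_⟩
    rw [map_add, map_add, map_add, hS L fun g hg => hL g (Finset.mem_union_left _ hg),
      hT L fun g hg => hL g (Finset.mem_union_right _ hg)]
  | single a v =>
    induction v using Finsupp.induction_linear with
    | zero => exact ⟨∅, fun L _ => by rw [show (0 : (G →₀ ℕ) →₀ Lam p G) = (0 : EP p G) from rfl,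
        Finsupp.single_zero, map_zero, map_zero, map_zero]⟩
    | add x y hx hy =>
      obtain ⟨S, hS⟩ := hx
      obtain ⟨T, hT⟩ := hy
      refine ⟨S ∪ T, fun L hL => ?_⟩
      rw [Finsupp.single_add, map_add, map_add, map_add,
        hS L fun g hg => hL g (Finset.mem_union_left _ hg),
        hT L fun g hg => hL g (Finset.mem_union_right _ hg)]
    | single m x =>
      obtain ⟨S, hS⟩ := exists_lamKill_eq x
      refine ⟨S ∪ a.support ∪ m.support, fun L hL => ?_⟩
      rw [twEList_single]
      by_cases h : a = 0 ∧ m = 0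
      · obtain ⟨rfl, rfl⟩ := h
        rw [if_pos (by simp), hS L fun g hg => hL g (by simp [hg]), twPi, LinearMap.comp_apply,
          Finsupp.lapply_apply, Finsupp.single_eq_same, epPi_apply, Finsupp.single_eq_same,
          twJ_apply]
      · have e : twPi p G (Finsupp.single a (Finsupp.single m x)) = 0 := by
          rw [twPi, LinearMap.comp_apply, Finsupp.lapply_apply]
          by_cases ha : a = 0
          · have hm : m ≠ 0 := fun hm => h ⟨ha, hm⟩
            rw [ha, Finsupp.single_eq_same, epPi_apply, Finsupp.single_eq_of_ne hm.symm, map_zero]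
          · rw [Finsupp.single_eq_of_ne (Ne.symm ha), map_zero]
        rw [e, map_zero, if_neg]
        intro h'
        refine h ⟨?_, ?_⟩ <;> ext g <;> rw [Finsupp.zero_apply] <;> by_contra hg
        · exact hg (h' g (hL g (by simp [hg]))).1
        · exact hg (h' g (hL g (by simp [hg]))).2

theorem twH_mem (hp : 3 ≤ p) (g : G) {x : TwK p G} (hx : x ∈ twOk p G) :
    twH p g x ∈ twOk p G := by
  refine twOk_induction (P := fun x => twH p g x ∈ twOk p G) ?_ ?_ ?_ hx
  · intro x y hx hy; rw [map_add]; exact add_mem hx hy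
  · rw [map_zero]; exact zero_mem _
  · intro a v h
    rw [twH, Finsupp.lsum_single, LinearMap.add_apply]
    refine add_mem ?_ ?_ <;> split_ifs with h1
    · refine single_mem_twOk (fun g' => ?_) _
      rw [Finsupp.add_apply, Finsupp.single_apply]
      split_ifs with e
      · subst e; omega
      · rw [zero_add]; exact h g'
    · exact zero_mem _
    · refine single_mem_twOk (fun g' => ?_) _
      rw [Finsupp.add_apply, Finsupp.single_apply]
      split_ifs with e
      · subst e; omega
      · rw [zero_add]; exact h g'
    · exact zero_mem _

/-- A cycle of the twisted differential is a boundary up to a scalar. -/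
theorem exists_eq_twD_add [Fact p.Prime] (hp : 3 ≤ p) {x : TwK p G} (hx : x ∈ twOk p G)
    (h : twD p G x = 0) : ∃ w ∈ twOk p G, x = twD p G w + twJ p G (twPi p G x) := by
  -- contract in one direction `g` after the other; finitely many directions suffice
  have key : ∀ L : List G, ∃ w ∈ twOk p G, x = twD p G w + twEList p L x := by
    intro L
    induction L with
    | nil => exact ⟨0, zero_mem _, by simp [twEList]⟩
    | cons g L ih =>
      obtain ⟨w, hw, e⟩ := ih
      have e' : twEList p L x = x - twD p G w := by
        nth_rewrite 2 [e]
        rw [add_sub_cancel_left]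
      have h1 : twEList p L x ∈ twOk p G := by
        rw [e']; exact sub_mem hx (twD_mem hw)
      have h2 : twD p G (twEList p L x) = 0 := by
        rw [e', map_sub, h, twD_twD hp hw, sub_zero]
      have h3 := twD_twH hp g h1
      rw [h2, map_zero, add_zero] at h3
      refine ⟨w + twH p g (twEList p L x), add_mem hw (twH_mem hp g h1), ?_⟩
      rw [map_add, h3, twEList, LinearMap.comp_apply, add_assoc, sub_add_cancel]
      exact e
  obtain ⟨S, hS⟩ := exists_twEList_eq x
  obtain ⟨w, hw, e⟩ := key S.toList
  rw [hS _ fun g hg => Finset.mem_toList.2 hg] at e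
  exact ⟨w, hw, e⟩

theorem twPi_twD (hp : 3 ≤ p) (x : TwK p G) : twPi p G (twD p G x) = 0 := by
  induction x using Finsupp.induction_linear with
  | zero => simp
  | add x y hx hy => rw [map_add, map_add, hx, hy, add_zero]
  | single a v =>
    rw [twD_single, map_sum]
    refine Finset.sum_eq_zero fun x _ => ?_
    rw [twPi, LinearMap.comp_apply, Finsupp.lapply_apply]
    by_cases h : x.1 = 0
    · rw [h, Finsupp.single_eq_same, epPi_tau hp]
    · rw [Finsupp.single_eq_of_ne (Ne.symm h), map_zero]

theorem twD_single_zero (hp : 3 ≤ p) (v : EP p G) : twD p G (Finsupp.single 0 v) = 0 := by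
  rw [twD_single]
  refine Finset.sum_eq_zero fun x hx => ?_
  rw [mem_antidiagonal] at hx
  have : x.2 = 0 := by
    ext g
    have := DFunLike.congr_fun hx g
    rw [Finsupp.add_apply, Finsupp.zero_apply] at this
    rw [Finsupp.zero_apply]
    omega
  rw [this, tau_zero hp, LinearMap.zero_apply, Finsupp.single_zero]

theorem twD_apply_zero (a : G →₀ ℕ) (v : EP p G) :
    twD p G (Finsupp.single a v) 0 = tau p a v := by
  rw [twD_single, Finsupp.finsetSum_apply, Finset.sum_eq_single (0, a)]
  · rw [Finsupp.single_eq_same]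
  · intro x hx h
    rw [Finsupp.single_eq_of_ne]
    intro h0
    rw [mem_antidiagonal, ← h0, zero_add] at hx
    exact h (Prod.ext h0.symm hx)
  · intro h
    exact absurd (by simp) h

end Exactness

/-! ### Words with coefficients in the acyclic twisted complex -/

section Bicomplex

open Finset.HasAntidiagonal

variable {p n k : ℕ} [Fact p.Prime] [NeZero n]

/-- Words with coefficients in the twisted tensor product. -/
abbrev WordTw (p n k : ℕ) : Type := List (Expo n k) →₀ TwK p (Gen n k)

variable (p n k) in
/-- A combination of words times a coefficient. -/
def tens : (List (Expo n k) →₀ ZMod p) →ₗ[ZMod p] TwK p (Gen n k) →ₗ[ZMod p] WordTw p n k :=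
  Finsupp.linearCombination (ZMod p) fun l => Finsupp.lsingle l

theorem tens_single (l : List (Expo n k)) (r : ZMod p) (x : TwK p (Gen n k)) :
    tens p n k (Finsupp.single l r) x = r • Finsupp.single l x := by
  rw [tens, Finsupp.linearCombination_single]
  rfl

/-- The part of the horizontal differential that splits the coefficient. -/
def splitH (l : List (Expo n k)) : TwK p (Gen n k) →ₗ[ZMod p] WordTw p n k :=
  Finsupp.lsum (ZMod p) fun a => ∑ x ∈ antidiagonal a,
    if x.1 = 0 then 0 else Finsupp.lsingle (x.1 :: l) ∘ₗ Finsupp.lsingle x.2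

theorem splitH_single (l : List (Expo n k)) (a : Expo n k) (v : EP p (Gen n k)) :
    splitH l (Finsupp.single a v) = ∑ x ∈ antidiagonal a,
      if x.1 = 0 then 0 else Finsupp.single (x.1 :: l) (Finsupp.single x.2 v) := by
  rw [splitH, Finsupp.lsum_single, LinearMap.sum_apply]
  refine Finset.sum_congr rfl fun x _ => ?_
  split_ifs <;> rfl

variable (p n k) in
/-- The horizontal differential: the differential of the cobar complex with coefficients in the
divided power coalgebra. -/
def dH : WordTw p n k →ₗ[ZMod p] WordTw p n k :=
  Finsupp.lsum (ZMod p) fun l => tens p n k (wordD p l) - sgn p l • splitH l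

theorem dH_single (l : List (Expo n k)) (x : TwK p (Gen n k)) :
    dH p n k (Finsupp.single l x) = tens p n k (wordD p l) x - sgn p l • splitH l x := by
  rw [dH, Finsupp.lsum_single]
  rfl

variable (p n k) in
/-- The vertical differential: the twisted differential of the coefficients. -/
def dV : WordTw p n k →ₗ[ZMod p] WordTw p n k :=
  Finsupp.mapRange.linearMap (twD p (Gen n k))

theorem dV_single (l : List (Expo n k)) (x : TwK p (Gen n k)) :
    dV p n k (Finsupp.single l x) = Finsupp.single l (twD p (Gen n k) x) := by
  simp [dV]

/-- The value of the contracting homotopy on a word. -/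
def hHAux : List (Expo n k) → TwK p (Gen n k) →ₗ[ZMod p] WordTw p n k
  | [] => 0
  | b :: l => (-sgn p l) • (Finsupp.lsingle l ∘ₗ Finsupp.lsingle b ∘ₗ Finsupp.lapply 0)

variable (p n k) in
/-- The contracting homotopy of the horizontal differential. -/
def hH : WordTw p n k →ₗ[ZMod p] WordTw p n k := Finsupp.lsum (ZMod p) hHAux

theorem hH_nil (x : TwK p (Gen n k)) : hH p n k (Finsupp.single [] x) = 0 := by
  rw [hH, Finsupp.lsum_single]
  rfl

theorem hH_cons (b : Expo n k) (l : List (Expo n k)) (x : TwK p (Gen n k)) :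
    hH p n k (Finsupp.single (b :: l) x) =
      (-sgn p l) • Finsupp.single l (Finsupp.single b (x 0)) := by
  rw [hH, Finsupp.lsum_single]
  rfl

variable (p) in
/-- The product of the values of the twisting cochain along a word. -/
def act : List (Expo n k) → EP p (Gen n k) →ₗ[ZMod p] EP p (Gen n k)
  | [] => LinearMap.id
  | a :: l => act l ∘ₗ tau p a

variable (p n k) in
/-- The evaluation of words with coefficients. -/
def ev : WordTw p n k →ₗ[ZMod p] EP p (Gen n k) :=
  Finsupp.lsum (ZMod p) fun l => Finsupp.lsum (ZMod p) fun a => act p l ∘ₗ tau p a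

theorem ev_single (l : List (Expo n k)) (a : Expo n k) (v : EP p (Gen n k)) :
    ev p n k (Finsupp.single l (Finsupp.single a v)) = act p l (tau p a v) := by
  rw [ev, Finsupp.lsum_single, Finsupp.lsum_single]
  rfl

variable (p n k) in
/-- The valid words of length `r` with valid coefficients. -/
def wordOk (r : ℕ) : Submodule (ZMod p) (WordTw p n k) :=
  Submodule.span (ZMod p) {x | ∃ l a v, OkWord p l ∧ l.length = r ∧ Valid p a ∧
    x = Finsupp.single l (Finsupp.single a v)}

theorem single_mem_wordOk {l : List (Expo n k)} (hl : OkWord p l) {r : ℕ} (hr : l.length = r)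
    {x : TwK p (Gen n k)} (hx : x ∈ twOk p (Gen n k)) : Finsupp.single l x ∈ wordOk p n k r := by
  refine twOk_induction (P := fun x => Finsupp.single l x ∈ wordOk p n k r) ?_ ?_ ?_ hx
  · intro x y hx hy; rw [Finsupp.single_add]; exact add_mem hx hy
  · rw [Finsupp.single_zero]; exact zero_mem _
  · intro a v ha
    exact Submodule.subset_span ⟨l, a, v, hl, hr, ha, rfl⟩

theorem tens_mem_wordOk {u : List (Expo n k) →₀ ZMod p} {r : ℕ}
    (hu : ∀ l, u l ≠ 0 → OkWord p l ∧ l.length = r)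
    {x : TwK p (Gen n k)} (hx : x ∈ twOk p (Gen n k)) : tens p n k u x ∈ wordOk p n k r := by
  rw [← Finsupp.sum_single u, Finsupp.sum, map_sum, LinearMap.sum_apply]
  refine Submodule.sum_mem _ fun l hl => ?_
  rw [tens_single]
  obtain ⟨h1, h2⟩ := hu l (Finsupp.mem_support_iff.1 hl)
  exact Submodule.smul_mem _ _ (single_mem_wordOk h1 h2 hx)

theorem wordD_ok {l : List (Expo n k)} (hl : OkWord p l) (l' : List (Expo n k))
    (h : wordD p l l' ≠ 0) : OkWord p l' ∧ l'.length = l.length + 1 := by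
  have := wordD_mem hl (Finsupp.mem_support_iff.2 h)
  exact ⟨this.1, this.2.1⟩

theorem wordOk_induction {r : ℕ} {P : WordTw p n k → Prop}
    (h0 : P 0) (hadd : ∀ x y, P x → P y → P (x + y)) (hsmul : ∀ (c : ZMod p) x, P x → P (c • x))
    (hs : ∀ l a v, OkWord p l → l.length = r → Valid p a →
      P (Finsupp.single l (Finsupp.single a v))) {x : WordTw p n k} (hx : x ∈ wordOk p n k r) :
    P x := by
  induction hx using Submodule.span_induction with
  | mem x hx =>
    obtain ⟨l, a, v, h1, h2, h3, rfl⟩ := hx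
    exact hs l a v h1 h2 h3
  | zero => exact h0
  | add x y _ _ hx hy => exact hadd x y hx hy
  | smul c x _ hx => exact hsmul c x hx

theorem dH_mem {r : ℕ} {x : WordTw p n k} (hx : x ∈ wordOk p n k r) :
    dH p n k x ∈ wordOk p n k (r + 1) := by
  refine (show wordOk p n k r ≤ (wordOk p n k (r + 1)).comap (dH p n k) from
    Submodule.span_le.2 ?_) hx
  rintro _ ⟨l, a, v, hl, rfl, ha, rfl⟩
  rw [SetLike.mem_coe, Submodule.mem_comap, dH_single, splitH_single]
  refine sub_mem (tens_mem_wordOk (wordD_ok hl) (single_mem_twOk ha v)) (Submodule.smul_mem _ _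
    (Submodule.sum_mem _ fun x hx => ?_))
  rw [mem_antidiagonal] at hx
  obtain ⟨h1, h2⟩ := valid_of_add hx ha
  split_ifs with h
  · exact zero_mem _
  · exact Submodule.subset_span ⟨_, _, _, okWord_cons.2 ⟨⟨h, h1⟩, hl⟩, rfl, h2, rfl⟩

theorem dV_mem {r : ℕ} {x : WordTw p n k} (hx : x ∈ wordOk p n k r) :
    dV p n k x ∈ wordOk p n k r := by
  refine (show wordOk p n k r ≤ (wordOk p n k r).comap (dV p n k) from
    Submodule.span_le.2 ?_) hx
  rintro _ ⟨l, a, v, hl, rfl, ha, rfl⟩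
  rw [SetLike.mem_coe, Submodule.mem_comap, dV_single]
  exact single_mem_wordOk hl rfl (twD_mem (single_mem_twOk ha v))

theorem hH_mem {r : ℕ} {x : WordTw p n k} (hx : x ∈ wordOk p n k (r + 1)) :
    hH p n k x ∈ wordOk p n k r := by
  refine (show wordOk p n k (r + 1) ≤ (wordOk p n k r).comap (hH p n k) from
    Submodule.span_le.2 ?_) hx
  rintro _ ⟨l, a, v, hl, hr, ha, rfl⟩
  rw [SetLike.mem_coe, Submodule.mem_comap]
  rcases l with - | ⟨b, l⟩
  · rw [hH_nil]; exact zero_mem _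
  · rw [hH_cons]
    exact Submodule.smul_mem _ _ (Submodule.subset_span ⟨_, _, _, (okWord_cons.1 hl).2,
      by simpa using hr, (okWord_cons.1 hl).1.2, rfl⟩)

theorem hH_tens_of_eq_zero (u : List (Expo n k) →₀ ZMod p) {x : TwK p (Gen n k)} (hx : x 0 = 0) :
    hH p n k (tens p n k u x) = 0 := by
  induction u using Finsupp.induction_linear with
  | zero => simp
  | add u v hu hv => rw [map_add, LinearMap.add_apply, map_add, hu, hv, add_zero]
  | single l r =>
    rw [tens_single, map_smul]
    rcases l with - | ⟨b, l⟩
    · rw [hH_nil, smul_zero]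
    · rw [hH_cons, hx]; simp

theorem hH_tens_mapDomain_cons (b : Expo n k) (m : ℕ) {u : List (Expo n k) →₀ ZMod p}
    (hu : ∀ l, u l ≠ 0 → l.length = m) (x : TwK p (Gen n k)) :
    hH p n k (tens p n k (u.mapDomain (List.cons b)) x) =
      (-(-1) ^ m : ZMod p) • tens p n k u (Finsupp.single b (x 0)) := by
  rw [← Finsupp.sum_single u, Finsupp.sum, Finsupp.mapDomain_finsetSum, map_sum, map_sum,
    LinearMap.sum_apply, LinearMap.sum_apply, map_sum, Finset.smul_sum]
  refine Finset.sum_congr rfl fun l hl => ?_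
  rw [Finsupp.mapDomain_single, tens_single, tens_single, map_smul, hH_cons, sgn,
    hu l (Finsupp.mem_support_iff.1 hl), smul_comm]

/-- The contracting homotopy contracts the words with coefficients. -/
theorem hH_dH_single {l : List (Expo n k)} (hl : OkWord p l) (a : Expo n k)
    (v : EP p (Gen n k)) (h : l ≠ [] ∨ a ≠ 0) :
    hH p n k (dH p n k (Finsupp.single l (Finsupp.single a v))) +
      dH p n k (hH p n k (Finsupp.single l (Finsupp.single a v))) =
      Finsupp.single l (Finsupp.single a v) := by
  by_cases ha : a = 0
  · subst ha
    rcases l with - | ⟨b, l⟩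
    · simp at h
    have hb := (okWord_cons.1 hl).1.1
    have e0 : splitH (b :: l) (Finsupp.single 0 v) = (0 : WordTw p n k) := by
      rw [splitH_single]
      refine Finset.sum_eq_zero fun x hx => if_pos ?_
      rw [mem_antidiagonal] at hx
      ext g
      have := DFunLike.congr_fun hx g
      rw [Finsupp.add_apply, Finsupp.zero_apply] at this
      rw [Finsupp.zero_apply]
      omega
    have e1 : hH p n k (tens p n k (splitSum p b l) (Finsupp.single 0 v)) =
        sgn p l • ∑ x ∈ (antidiagonal b).filter (fun x => x.1 ≠ 0 ∧ x.2 ≠ 0),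
          Finsupp.single (x.1 :: l) (Finsupp.single x.2 v) := by
      rw [splitSum, map_sum, LinearMap.sum_apply, map_sum, Finset.smul_sum]
      refine Finset.sum_congr rfl fun x _ => ?_
      rw [tens_single, one_smul, hH_cons, sgn_cons, neg_neg, Finsupp.single_eq_same]
    have e2 : splitH l (Finsupp.single b v) = (Finsupp.single (b :: l) (Finsupp.single 0 v) +
        ∑ x ∈ (antidiagonal b).filter (fun x => x.1 ≠ 0 ∧ x.2 ≠ 0),
          Finsupp.single (x.1 :: l) (Finsupp.single x.2 v) : WordTw p n k) := by
      rw [splitH_single, ← Finset.add_sum_erase _ _ (show (b, 0) ∈ antidiagonal b by simp),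
        if_neg hb]
      congr 1
      rw [Finset.sum_ite, Finset.sum_const_zero, zero_add]
      refine Finset.sum_congr ?_ fun _ _ => rfl
      ext x
      simp only [Finset.mem_filter, Finset.mem_erase, mem_antidiagonal]
      constructor
      · rintro ⟨⟨h1, h2⟩, h3⟩
        refine ⟨h2, h3, fun h4 => h1 (Prod.ext ?_ h4)⟩
        rw [h4, add_zero] at h2
        exact h2
      · rintro ⟨h1, h2, h3⟩
        exact ⟨⟨fun h4 => h3 (by rw [h4]), h1⟩, h2⟩
    rw [dH_single, e0, smul_zero, sub_zero, wordD, map_sub, map_smul, LinearMap.sub_apply,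
      LinearMap.smul_apply, map_sub, map_smul, e1, hH_tens_mapDomain_cons b (l.length + 1)
        (fun l' h' => (wordD_ok (okWord_cons.1 hl).2 l' h').2), hH_cons, map_smul, dH_single,
      Finsupp.single_eq_same, e2, smul_smul, sgn_mul_self, one_smul, smul_sub, smul_smul, neg_mul,
      sgn_mul_self, pow_succ, mul_neg_one, neg_neg, ← sgn]
    simp only [neg_smul, one_smul]
    abel
  · have e1 : dH p n k (hH p n k (Finsupp.single l (Finsupp.single a v))) = 0 := by
      rcases l with - | ⟨b, l⟩
      · rw [hH_nil, map_zero]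
      · rw [hH_cons, Finsupp.single_eq_of_ne (Ne.symm ha)]; simp
    rw [e1, add_zero, dH_single, map_sub, map_smul, hH_tens_of_eq_zero _
      (Finsupp.single_eq_of_ne (Ne.symm ha)), splitH_single, map_sum,
      Finset.sum_eq_single (a, 0)]
    · rw [if_neg ha, hH_cons, Finsupp.single_eq_same, smul_smul, mul_neg, sgn_mul_self, neg_smul,
        one_smul, sub_neg_eq_add, zero_add]
    · intro x hx h0
      split_ifs with h1
      · rw [map_zero]
      · have : x.2 ≠ 0 := by
          intro h2
          rw [mem_antidiagonal, h2, add_zero] at hx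
          exact h0 (Prod.ext hx h2)
        rw [hH_cons, Finsupp.single_eq_of_ne (Ne.symm this)]
        simp
    · intro h
      exact absurd (by simp) h

theorem hH_dH {r : ℕ} {x : WordTw p n k} (hx : x ∈ wordOk p n k (r + 1)) :
    hH p n k (dH p n k x) + dH p n k (hH p n k x) = x := by
  refine wordOk_induction (P := fun x => hH p n k (dH p n k x) + dH p n k (hH p n k x) = x)
    (by simp) ?_ ?_ ?_ hx
  · intro x y hx hy
    simp only [map_add]
    rw [add_add_add_comm, hx, hy]
  · intro c x hx
    simp only [map_smul]
    rw [← smul_add, hx]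
  · intro l a v hl hr ha
    exact hH_dH_single hl a v (Or.inl (by rintro rfl; simp at hr))

theorem hH_dH_zero {x : WordTw p n k} (hx : x ∈ wordOk p n k 0) :
    hH p n k (dH p n k x) + Finsupp.single [] (Finsupp.single 0 (x [] 0)) = x := by
  refine wordOk_induction (P := fun x =>
    hH p n k (dH p n k x) + Finsupp.single [] (Finsupp.single 0 (x [] 0)) = x) (by simp) ?_ ?_ ?_ hx
  · intro x y hx hy
    simp only [map_add, Finsupp.add_apply, Finsupp.single_add]
    rw [add_add_add_comm, hx, hy]
  · intro c x hx
    simp only [map_smul, Finsupp.smul_apply, ← Finsupp.smul_single]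
    rw [← smul_add, hx]
  · intro l a v hl hr ha
    rw [List.length_eq_zero_iff] at hr
    subst hr
    rw [Finsupp.single_eq_same]
    by_cases h : a = 0
    · subst h
      rw [Finsupp.single_eq_same, dH_single, wordD, splitH_single, Finset.sum_eq_zero]
      · simp
      · intro x hx
        refine if_pos ?_
        rw [mem_antidiagonal] at hx
        ext g
        have := DFunLike.congr_fun hx g
        rw [Finsupp.add_apply, Finsupp.zero_apply] at this
        rw [Finsupp.zero_apply]
        omega
    · have := hH_dH_single (p := p) (l := []) (by simp [OkWord]) a v (Or.inr h)
      rw [hH_nil, map_zero, add_zero] at this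
      rw [this, Finsupp.single_eq_of_ne (Ne.symm h)]
      simp

end Bicomplex

section Chase

open Finset.HasAntidiagonal

variable {p n k : ℕ} [Fact p.Prime] [NeZero n]

theorem dV_tens (u : List (Expo n k) →₀ ZMod p) (x : TwK p (Gen n k)) :
    dV p n k (tens p n k u x) = tens p n k u (twD p (Gen n k) x) := by
  induction u using Finsupp.induction_linear with
  | zero => simp
  | add u v hu hv => simp only [map_add, LinearMap.add_apply, hu, hv]
  | single l r => rw [tens_single, tens_single, map_smul, dV_single]

/-- The two differentials commute. -/
theorem dV_dH (x : WordTw p n k) : dV p n k (dH p n k x) = dH p n k (dV p n k x) := by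
  suffices h : ∀ (l : List (Expo n k)) (x : TwK p (Gen n k)),
      dV p n k (splitH l x) = splitH l (twD p (Gen n k) x) by
    induction x using Finsupp.induction_linear with
    | zero => simp
    | add x y hx hy => simp only [map_add, hx, hy]
    | single l x =>
      rw [dH_single, dV_single, dH_single, map_sub, map_smul, dV_tens, h]
  intro l x
  induction x using Finsupp.induction_linear with
  | zero => simp
  | add x y hx hy => simp only [map_add, hx, hy]
  | single a v =>
    have e := sum_antidiagonal_triple (fun b c d : Expo n k => if b = 0 then (0 : WordTw p n k) else
      Finsupp.single (b :: l) (Finsupp.single c (tau p d v))) a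
    rw [splitH_single, twD_single, map_sum, map_sum]
    simp only [splitH_single]
    rw [e]
    refine Finset.sum_congr rfl fun x _ => ?_
    split_ifs with h
    · simp
    · rw [dV_single, twD_single, Finsupp.single_finsetSum]

/-- The inclusion of scalar coefficients. -/
def inJ : (List (Expo n k) →₀ ZMod p) →ₗ[ZMod p] WordTw p n k :=
  Finsupp.mapRange.linearMap (twJ p (Gen n k))

/-- The projection to scalar coefficients. -/
def outJ : WordTw p n k →ₗ[ZMod p] (List (Expo n k) →₀ ZMod p) :=
  Finsupp.mapRange.linearMap (twPi p (Gen n k))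

theorem inJ_single (l : List (Expo n k)) (r : ZMod p) :
    inJ (Finsupp.single l r) = Finsupp.single l (twJ p (Gen n k) r) := by simp [inJ]

theorem outJ_inJ (u : List (Expo n k) →₀ ZMod p) : outJ (inJ u) = u := by
  ext l
  simp [outJ, inJ, twPi_twJ]

theorem outJ_dV (H : Admissible p n k) (x : WordTw p n k) : outJ (dV p n k x) = 0 := by
  ext l
  simp [outJ, dV, twPi_twD H.three_le]

theorem tens_twJ (u : List (Expo n k) →₀ ZMod p) (r : ZMod p) :
    tens p n k u (twJ p (Gen n k) r) = inJ (r • u) := by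
  induction u using Finsupp.induction_linear with
  | zero => simp
  | add u v hu hv => simp only [map_add, LinearMap.add_apply, hu, hv, smul_add]
  | single l s =>
    rw [tens_single, Finsupp.smul_single, ← map_smul, Finsupp.smul_single, inJ_single, smul_eq_mul,
      smul_eq_mul, mul_comm]

theorem splitH_single_zero (l : List (Expo n k)) (v : EP p (Gen n k)) :
    splitH l (Finsupp.single 0 v) = (0 : WordTw p n k) := by
  rw [splitH_single]
  refine Finset.sum_eq_zero fun x hx => if_pos ?_
  rw [mem_antidiagonal] at hx
  ext g
  have := DFunLike.congr_fun hx g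
  rw [Finsupp.add_apply, Finsupp.zero_apply] at this
  rw [Finsupp.zero_apply]
  omega

theorem dH_inJ (u : List (Expo n k) →₀ ZMod p) : dH p n k (inJ u) = inJ (wordDLin p n k u) := by
  induction u using Finsupp.induction_linear with
  | zero => simp
  | add u v hu hv => simp only [map_add, hu, hv]
  | single l r =>
    rw [inJ_single, dH_single, twJ_apply, splitH_single_zero, smul_zero, sub_zero, ← twJ_apply,
      tens_twJ, wordDLin, Finsupp.linearCombination_single]

theorem dV_inJ (H : Admissible p n k) (u : List (Expo n k) →₀ ZMod p) :
    dV p n k (inJ u) = 0 := by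
  ext1 l
  simp [dV, inJ, twJ_apply, twD_single_zero H.three_le]

theorem dV_dV (H : Admissible p n k) {r : ℕ} {x : WordTw p n k} (hx : x ∈ wordOk p n k r) :
    dV p n k (dV p n k x) = 0 := by
  refine wordOk_induction (P := fun x => dV p n k (dV p n k x) = 0) (by simp) ?_ ?_ ?_ hx
  · intro x y hx hy; simp only [map_add, hx, hy, add_zero]
  · intro c x hx; simp only [map_smul, hx, smul_zero]
  · intro l a v _ _ ha
    rw [dV_single, dV_single, twD_twD H.three_le (single_mem_twOk ha v), Finsupp.single_zero]

theorem dH_dH (H : Admissible p n k) {r : ℕ} {x : WordTw p n k} (hx : x ∈ wordOk p n k r) :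
    dH p n k (dH p n k x) = 0 := by
  have key : ∀ (l : List (Expo n k)) (v : EP p (Gen n k)), OkWord p l →
      dH p n k (dH p n k (Finsupp.single l (Finsupp.single 0 v))) = 0 := by
    intro l v hl
    have e : ∀ u : List (Expo n k) →₀ ZMod p, dH p n k (tens p n k u (Finsupp.single 0 v)) =
        tens p n k (wordDLin p n k u) (Finsupp.single 0 v) := by
      intro u
      induction u using Finsupp.induction_linear with
      | zero => simp
      | add u v hu hv => simp only [map_add, LinearMap.add_apply, hu, hv]
      | single l r =>
        rw [tens_single, map_smul, dH_single, splitH_single_zero, smul_zero, sub_zero, wordDLin,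
          Finsupp.linearCombination_single, map_smul, LinearMap.smul_apply]
    rw [dH_single, splitH_single_zero, smul_zero, sub_zero, e, wordDLin_wordD H hl, map_zero,
      LinearMap.zero_apply]
  refine wordOk_induction (P := fun x => dH p n k (dH p n k x) = 0) (by simp) ?_ ?_ ?_ hx
  · intro x y hx hy; simp only [map_add, hx, hy, add_zero]
  · intro c x hx; simp only [map_smul, hx, smul_zero]
  · intro l a v hl _ ha
    by_cases h : a = 0
    · subst h; exact key l v hl
    · -- `x` is the image of `y` under the homotopy
      have hl' : OkWord p (a :: l) := okWord_cons.2 ⟨⟨h, ha⟩, hl⟩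
      set y : WordTw p n k := Finsupp.single (a :: l) (Finsupp.single 0 v) with hy
      have hym : y ∈ wordOk p n k (l.length + 1) :=
        Submodule.subset_span ⟨_, _, _, hl', rfl, fun g => by
          rw [Finsupp.zero_apply]; exact (Fact.out : p.Prime).pos, rfl⟩
      have e : Finsupp.single l (Finsupp.single a v) = (-sgn p l) • hH p n k y := by
        rw [hy, hH_cons, Finsupp.single_eq_same, smul_smul, neg_mul_neg, sgn_mul_self, one_smul]
      have h1 := congrArg (dH p n k) (hH_dH hym)
      have h2 := hH_dH (dH_mem hym)
      rw [key _ v hl', map_zero, zero_add] at h2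
      rw [map_add, h2, add_eq_left] at h1
      rw [e, map_smul, map_smul, h1, smul_zero]

theorem ev_hH_dV {r : ℕ} {x : WordTw p n k} (hx : x ∈ wordOk p n k (r + 1)) :
    ev p n k (hH p n k (dV p n k x)) = (-(-1) ^ r : ZMod p) • ev p n k x := by
  refine wordOk_induction (P := fun x =>
    ev p n k (hH p n k (dV p n k x)) = (-(-1) ^ r : ZMod p) • ev p n k x) (by simp) ?_ ?_ ?_ hx
  · intro x y hx hy; simp only [map_add, hx, hy, smul_add]
  · intro c x hx; simp only [map_smul, hx, smul_comm c]
  · intro l a v hl hr ha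
    rcases l with - | ⟨b, l⟩
    · simp at hr
    · rw [dV_single, hH_cons, twD_apply_zero, map_smul, ev_single, ev_single, sgn,
        show l.length = r by simpa using hr]
      rfl

theorem wordOk_apply {r : ℕ} {y : WordTw p n k} (hy : y ∈ wordOk p n k r) :
    ∀ l, y l ∈ twOk p (Gen n k) ∧ (y l ≠ 0 → OkWord p l ∧ l.length = r) := by
  refine wordOk_induction (P := fun y => ∀ l, y l ∈ twOk p (Gen n k) ∧
    (y l ≠ 0 → OkWord p l ∧ l.length = r)) ?_ ?_ ?_ ?_ hy
  · intro l; exact ⟨zero_mem _, fun h => absurd rfl h⟩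
  · intro x y hx hy l
    refine ⟨add_mem (hx l).1 (hy l).1, fun h => ?_⟩
    by_cases hxl : x l = 0
    · refine (hy l).2 fun hyl => h ?_
      rw [Finsupp.add_apply, hxl, hyl, add_zero]
    · exact (hx l).2 hxl
  · intro c x hx l
    refine ⟨Submodule.smul_mem _ _ (hx l).1, fun h => (hx l).2 fun hxl => h ?_⟩
    rw [Finsupp.smul_apply, hxl, smul_zero]
  · intro l a v hl hr ha l'
    by_cases e : l' = l
    · subst e
      rw [Finsupp.single_eq_same]
      exact ⟨single_mem_twOk ha v, fun _ => ⟨hl, hr⟩⟩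
    · rw [Finsupp.single_eq_of_ne e]
      exact ⟨zero_mem _, fun h => absurd rfl h⟩

theorem exists_eq_dV_add (H : Admissible p n k) {r : ℕ} {y : WordTw p n k}
    (hy : y ∈ wordOk p n k r) (h : dV p n k y = 0) :
    ∃ w ∈ wordOk p n k r, y = dV p n k w + inJ (outJ y) := by
  have h2 : ∀ l, twD p (Gen n k) (y l) = 0 := fun l => by
    have := DFunLike.congr_fun h l
    simpa [dV] using this
  choose w hw e using fun l => exists_eq_twD_add H.three_le (wordOk_apply hy l).1 (h2 l)
  refine ⟨∑ l ∈ y.support, Finsupp.single l (w l), Submodule.sum_mem _ fun l hl => ?_, ?_⟩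
  · obtain ⟨a1, a2⟩ := (wordOk_apply hy l).2 (Finsupp.mem_support_iff.1 hl)
    exact single_mem_wordOk a1 a2 (hw l)
  · have e1 : inJ (outJ y) = ∑ l ∈ y.support, Finsupp.single l (twJ p (Gen n k)
        (twPi p (Gen n k) (y l))) := by
      conv_lhs => rw [← Finsupp.sum_single y, Finsupp.sum]
      rw [map_sum, map_sum]
      refine Finset.sum_congr rfl fun l _ => ?_
      rw [← inJ_single]
      simp [outJ]
    rw [e1, map_sum, ← Finset.sum_add_distrib]
    conv_lhs => rw [← Finsupp.sum_single y, Finsupp.sum]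
    refine Finset.sum_congr rfl fun l _ => ?_
    rw [dV_single, ← Finsupp.single_add, ← e l]

/-- An element with vanishing evaluation can be changed to a vertical cycle with the same
horizontal differential. -/
theorem exists_vertical_cycle (H : Admissible p n k) (r : ℕ) : ∀ x ∈ wordOk p n k r,
    dH p n k (dV p n k x) = 0 → ev p n k x = 0 →
      ∃ x' ∈ wordOk p n k r, dV p n k x' = 0 ∧ dH p n k x' = dH p n k x := by
  induction r with
  | zero =>
    intro x hx h hev
    refine ⟨x, hx, ?_, rfl⟩
    have h1 := hH_dH_zero (dV_mem hx)
    have h2 : dV p n k x [] 0 = ev p n k x := by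
      refine wordOk_induction (P := fun x => dV p n k x [] 0 = ev p n k x) (by simp) ?_ ?_ ?_ hx
      · intro x y hx hy
        rw [map_add, map_add, Finsupp.add_apply, Finsupp.add_apply, hx, hy]
      · intro c x hx
        rw [map_smul, map_smul, Finsupp.smul_apply, Finsupp.smul_apply, hx]
      · intro l a v _ hr _
        rw [List.length_eq_zero_iff] at hr
        subst hr
        rw [dV_single, Finsupp.single_eq_same, twD_apply_zero, ev_single]
        rfl
    rw [h, map_zero, zero_add, h2, hev, Finsupp.single_zero, Finsupp.single_zero] at h1
    exact h1.symm
  | succ r ih =>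
    intro x hx h hev
    have hy := dV_mem hx
    have e1 : dH p n k (hH p n k (dV p n k x)) = dV p n k x := by
      have := hH_dH hy
      rwa [h, map_zero, zero_add] at this
    -- `hH (dV x)` has one letter less and satisfies the same hypotheses
    obtain ⟨y, hyok, hy1, hy2⟩ := ih (hH p n k (dV p n k x)) (hH_mem hy)
      (by rw [← dV_dH, e1, dV_dV H hx]) (by rw [ev_hH_dV hx, hev, smul_zero])
    -- so `y` is vertically exact up to scalar coefficients, and `dH w` corrects `x`
    obtain ⟨w, hw, ew⟩ := exists_eq_dV_add H hyok hy1
    have e2 : dV p n k x = dV p n k (dH p n k w) + inJ (wordDLin p n k (outJ y)) := by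
      rw [← e1, ← hy2, dV_dH, ← dH_inJ, ← map_add, ← ew]
    have e3 : wordDLin p n k (outJ y) = 0 := by
      have := congrArg outJ e2
      rwa [outJ_dV H, map_add, outJ_dV H, outJ_inJ, zero_add, eq_comm] at this
    rw [e3, map_zero, add_zero] at e2
    refine ⟨x - dH p n k w, sub_mem hx (dH_mem hw), ?_, ?_⟩
    · rw [map_sub, e2, sub_self]
    · rw [map_sub, dH_dH H hw, sub_zero]

/-! ### The symbol of a cochain -/

variable (p n k) in
/-- The symbol of filtration `M` of an element of the cobar complex: the sum of the values of the
twisting cochain on the words of weight `M`. -/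
def rhoM (M : ℤ) : Cobar p n k →ₗ[ZMod p] EP p (Gen n k) :=
  (Finsupp.linearCombination (ZMod p) fun l =>
    if (wordWt p l : ℤ) = M then act p l (Finsupp.single 0 1) else 0) ∘ₗ crd p n k

theorem linearCombination_filter {A : Type*} [AddCommGroup A] [Module (ZMod p) A]
    (f : List (Expo n k) → A) (P : List (Expo n k) → Prop) [DecidablePred P]
    (u : List (Expo n k) →₀ ZMod p) :
    Finsupp.linearCombination (ZMod p) f (u.filter P) =
      Finsupp.linearCombination (ZMod p) (fun l => if P l then f l else 0) u := by
  classical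
  rw [Finsupp.linearCombination_apply, Finsupp.linearCombination_apply, Finsupp.sum, Finsupp.sum,
    Finsupp.support_filter, Finset.sum_filter]
  refine Finset.sum_congr rfl fun l _ => ?_
  split_ifs with h
  · rw [Finsupp.filter_apply_pos P _ h]
  · rw [smul_zero]

theorem rhoM_apply (M : ℤ) (z : Cobar p n k) : rhoM p n k M z =
    Finsupp.linearCombination (ZMod p) (fun l => act p l (Finsupp.single 0 1))
      ((crd p n k z).filter fun l => (wordWt p l : ℤ) = M) := by
  rw [linearCombination_filter]
  rfl

theorem wordDLin_filter {u : List (Expo n k) →₀ ZMod p}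
    (hu : ∀ l, u l ≠ 0 → OkWord p l) (M : ℤ) (l : List (Expo n k)) :
    wordDLin p n k (u.filter fun l => (wordWt p l : ℤ) = M) l =
      if (wordWt p l : ℤ) = M then wordDLin p n k u l else 0 := by
  rw [wordDLin, linearCombination_filter, Finsupp.linearCombination_apply,
    Finsupp.linearCombination_apply, Finsupp.sum, Finsupp.sum, Finsupp.finsetSum_apply,
    Finsupp.finsetSum_apply]
  have key : ∀ l' ∈ u.support, (u l' • if (wordWt p l' : ℤ) = M then wordD p l' else 0) l =
      if (wordWt p l : ℤ) = M then (u l' • wordD p l') l else 0 := by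
    intro l' hl'
    rw [Finsupp.smul_apply, Finsupp.smul_apply]
    by_cases h : wordD p l' l = 0
    · rw [h, smul_zero, ite_self]
      split_ifs <;> simp [h]
    · have := (wordD_mem (hu l' (Finsupp.mem_support_iff.1 hl'))
        (Finsupp.mem_support_iff.2 h)).2.2
      rw [this]
      split_ifs <;> simp
  rw [Finset.sum_congr rfl key]
  split_ifs <;> simp

theorem ev_hH_inJ {s : ℕ} {u : List (Expo n k) →₀ ZMod p} (hu : ∀ l, u l ≠ 0 → l.length = s + 1) :
    ev p n k (hH p n k (inJ u)) = (-(-1) ^ s : ZMod p) •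
      Finsupp.linearCombination (ZMod p) (fun l => act p l (Finsupp.single 0 1)) u := by
  rw [← Finsupp.sum_single u, Finsupp.sum]
  simp only [map_sum, Finset.smul_sum]
  refine Finset.sum_congr rfl fun l hl => ?_
  have hl := hu l (Finsupp.mem_support_iff.1 hl)
  rcases l with - | ⟨b, l⟩
  · simp at hl
  · have e : (Finsupp.single 0 (algebraMap (ZMod p) (Lam p (Gen n k)) (u (b :: l))) :
        EP p (Gen n k)) = u (b :: l) • Finsupp.single 0 1 := by
      rw [Algebra.algebraMap_eq_smul_one, ← Finsupp.smul_single]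
    rw [inJ_single, hH_cons, twJ_apply, Finsupp.single_eq_same, map_smul, ev_single, e, map_smul,
      map_smul, Finsupp.linearCombination_single, sgn, show l.length = s by simpa using hl]
    rfl

theorem outJ_ok {r : ℕ} {y : WordTw p n k} (hy : y ∈ wordOk p n k r) (l : List (Expo n k))
    (h : outJ y l ≠ 0) : OkWord p l ∧ l.length = r := by
  have e : outJ y l = twPi p (Gen n k) (y l) := by simp [outJ]
  rw [e] at h
  exact (wordOk_apply hy l).2 fun h0 => h (by rw [h0, map_zero])

/-- A leading cycle with vanishing symbol is a leading boundary: up to lower filtration, `z` is the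
coboundary of an element of the same filtration. -/
theorem exists_sub_cobarD_mem (H : Admissible p n k) {s : ℕ} {M : ℤ} {z : Cobar p n k}
    (hz : z ∈ mayF p n k (s + 1) M) (hdz : cobarD p n k z ∈ mayF p n k (s + 2) (M - 1))
    (h : rhoM p n k M z = 0) :
    ∃ u ∈ mayF p n k s M, z - cobarD p n k u ∈ mayF p n k (s + 1) (M - 1) := by
  rw [rhoM_apply] at h
  -- the leading part of `z`, a cycle of the leading differential
  set c := (crd p n k z).filter fun l => (wordWt p l : ℤ) = M with hc
  have hc1 : ∀ l, c l ≠ 0 → OkWord p l ∧ l.length = s + 1 := by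
    intro l hl
    have : crd p n k z l ≠ 0 := by
      intro h0
      apply hl
      rw [hc, Finsupp.filter_apply, h0, ite_self]
    exact ⟨(mem_mayF.1 hz l this).1, (mem_mayF.1 hz l this).2.1⟩
  have hc2 : wordDLin p n k c = 0 := by
    ext l
    rw [hc, wordDLin_filter (fun l hl => crd_okWord z hl), Finsupp.zero_apply]
    split_ifs with hl
    · rw [← crd_cobarD H hz hl.ge]
      by_contra h0
      have := (mem_mayF.1 hdz l h0).2.2
      omega
    · rfl
  have hJ : inJ c ∈ wordOk p n k (s + 1) := by
    rw [← one_smul (ZMod p) c, ← tens_twJ]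
    refine tens_mem_wordOk hc1 (single_mem_twOk (fun g => ?_) _)
    rw [Finsupp.zero_apply]
    exact (Fact.out : p.Prime).pos
  have e1 : dH p n k (hH p n k (inJ c)) = inJ c := by
    have := hH_dH hJ
    rwa [dH_inJ, hc2, map_zero, map_zero, zero_add] at this
  -- `c` is the horizontal boundary of `hH c`; make that a vertical cycle; then `c` is the
  -- boundary of its scalar part
  obtain ⟨x, hx, hx1, hx2⟩ := exists_vertical_cycle H s _ (hH_mem hJ)
    (by rw [← dV_dH, e1, dV_inJ H]) (by rw [ev_hH_inJ fun l hl => (hc1 l hl).2, h, smul_zero])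
  obtain ⟨w, hw, ew⟩ := exists_eq_dV_add H hx hx1
  set u := outJ x with hu
  have e2 : wordDLin p n k u = c := by
    have : inJ c = dV p n k (dH p n k w) + inJ (wordDLin p n k u) := by
      rw [dV_dH, ← dH_inJ, ← map_add, ← ew, hx2, e1]
    have := congrArg outJ this
    rwa [map_add, outJ_dV H, outJ_inJ, outJ_inJ, zero_add, eq_comm] at this
  have hu1 := outJ_ok hx
  -- only the part of weight `M` is needed, and it has the right filtration
  set v := u.filter fun l => (wordWt p l : ℤ) = M with hv
  have hv1 : ∀ l, v l ≠ 0 → l ∈ okSet p n k s M := by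
    intro l hl
    rw [hv, Finsupp.filter_apply] at hl
    split_ifs at hl with h0
    · exact ⟨(hu1 l hl).1, (hu1 l hl).2, h0.le⟩
    · exact absurd rfl hl
  have hU : Finsupp.linearCombination (ZMod p) (word p) v ∈ mayF p n k s M :=
    lc_mem_mayF fun l hl => hv1 l (Finsupp.mem_support_iff.1 hl)
  refine ⟨_, hU, mem_mayF.2 fun l hl => ?_⟩
  obtain ⟨a1, a2, a3⟩ := mem_mayF.1 (sub_mem hz (cobarD_mem_mayF H hU)) l hl
  refine ⟨a1, a2, ?_⟩
  by_contra h0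
  have h0 : (wordWt p l : ℤ) = M := by omega
  apply hl
  rw [map_sub, Finsupp.sub_apply, crd_cobarD H hU h0.ge, crd_lc fun l hl => (hv1 l hl).1, hv,
    wordDLin_filter (fun l hl => (hu1 l hl).1), if_pos h0, e2, hc, Finsupp.filter_apply, if_pos h0,
    sub_self]

theorem act_one_ne_zero : (Finsupp.single 0 1 : EP p (Gen n k)) ≠ 0 := by
  intro h
  have := congrArg (epPi p (Gen n k)) h
  rw [epPi_apply, Finsupp.single_eq_same, map_one, map_zero] at this
  exact one_ne_zero this

theorem mem_of_rhoM_eq_zero {M : ℤ} {z : Cobar p n k} (hz : z ∈ mayF p n k 0 M)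
    (h : rhoM p n k M z = 0) : z ∈ mayF p n k 0 (M - 1) := by
  refine mem_mayF.2 fun l hl => ?_
  obtain ⟨a1, a2, a3⟩ := mem_mayF.1 hz l hl
  refine ⟨a1, a2, ?_⟩
  by_contra h0
  have h0 : (wordWt p l : ℤ) = M := by omega
  rw [List.length_eq_zero_iff] at a2
  subst a2
  have e : crd p n k z = Finsupp.single [] (crd p n k z []) := by
    ext l'
    by_cases hl' : crd p n k z l' = 0
    · rw [hl', Finsupp.single_apply]
      split_ifs with h1
      · rw [h1, hl']
      · rfl
    · have := (mem_mayF.1 hz l' hl').2.1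
      rw [List.length_eq_zero_iff] at this
      rw [this, Finsupp.single_eq_same]
  rw [rhoM, LinearMap.comp_apply, e, Finsupp.linearCombination_single, if_pos h0, smul_eq_zero] at h
  exact h.elim hl act_one_ne_zero

end Chase

/-! ### The coproduct of the generators and its symbol -/

section Symbols

variable {p n k : ℕ} [Fact p.Prime] [NeZero n]

/-- `(s, j) ↦ (s + n, j + 1)`. -/
def plusGen (g : Gen n k) : Gen n k := (⟨g.1 + n, by have := g.1.2; omega⟩, g.2 + 1)

theorem plusGen_injective : Function.Injective (plusGen : Gen n k → Gen n k) := by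
  rintro ⟨⟨s, hs⟩, j⟩ ⟨⟨s', hs'⟩, j'⟩ h
  simp only [plusGen, Prod.mk.injEq, Subtype.mk.injEq, add_left_inj] at h
  obtain ⟨rfl, rfl⟩ := h
  rfl

theorem genWt_plusGen (H : Admissible p n k) (g : Gen n k) :
    genWt p (plusGen g) = p * genWt p g + 1 := H.mayM_add g.1 g.1.2

theorem exists_plusGen {g : Gen n k} (h : n + k ≤ g.1) : ∃ g', plusGen g' = g := by
  obtain ⟨⟨s, hs⟩, j⟩ := g
  simp only at h
  exact ⟨(⟨s - n, by omega⟩, j - 1), by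
    simp only [plusGen, sub_add_cancel, Prod.mk.injEq, Subtype.mk.injEq, and_true]; omega⟩

theorem mixedTerms_pow (m : ℕ) (x y : S p n k ⊗[ZMod p] S p n k) :
    mixedTerms p x y ^ p ^ m = mixedTerms p (x ^ p ^ m) (y ^ p ^ m) := by
  rw [mixedTerms, mixedTerms, ← frob_pow_apply, map_sum]
  refine Finset.sum_congr rfl fun i _ => ?_
  rw [← nsmul_eq_mul', map_nsmul, frob_pow_apply, nsmul_eq_mul', mul_pow, ← pow_mul, ← pow_mul,
    ← pow_mul, ← pow_mul, mul_comm i, mul_comm (p - i)]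

theorem comul_tg_of_lt (H : Admissible p n k) {g : Gen n k} (h : (g.1 : ℕ) < n + k) :
    comul p n k (tg p g) = tg p g ⊗ₜ 1 + 1 ⊗ₜ tg p g + ∑ m ∈ Finset.Icc k (g.1 - k),
      (t p n k m ^ p ^ g.2.val) ⊗ₜ (t p n k (g.1 - m) ^ p ^ (g.2 + m : ZMod n).val) := by
  rw [tg, map_pow, comul_t g.1.2, comulT_of_lt H g.1.2 h, ← frob_pow_apply, map_add, map_add,
    map_sum]
  simp only [frob_pow_apply, Algebra.TensorProduct.tmul_pow, one_pow]
  congr 1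
  refine Finset.sum_congr rfl fun m hm => ?_
  rw [Finset.mem_Icc] at hm
  have := g.1.2
  have hk := H.one_le
  have e := tg_add_natCast (p := p) (⟨g.1 - m, by omega⟩ : {s : ℕ // k ≤ s}) g.2 m
  rw [tg, tg] at e
  simp only at e
  rw [e, ← pow_mul, ← pow_mul, mul_comm]

theorem comul_tg_plusGen (H : Admissible p n k) (g : Gen n k) :
    comul p n k (tg p (plusGen g)) - tg p (plusGen g) ⊗ₜ 1 - 1 ⊗ₜ tg p (plusGen g) +
      mixedTerms p (tg p g ⊗ₜ 1) (1 ⊗ₜ tg p g) ∈ FSS p n k (p * genWt p g - 1) := by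
  have h := pow_mem_FSS (comulT_leading H g.1.2) (g.2 + 1).val
  rw [H.mayM_add _ g.1.2] at h
  have e : t p n k g.1 ^ p ^ (n - 1 + (g.2 + 1).val) = tg p g := by
    rw [← tg_natCast]
    congr 1
    refine Prod.ext rfl ?_
    simp only [Nat.cast_add, ZMod.natCast_zmod_val, Nat.cast_sub H.n_pos, ZMod.natCast_self]
    simp
  rw [← frob_pow_apply, map_add, map_sub, map_sub, frob_pow_apply, frob_pow_apply, frob_pow_apply,
    frob_pow_apply, ← comul_t (by have := g.1.2; omega), ← pow_mul, ← pow_add, mixedTerms_pow,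
    Algebra.TensorProduct.tmul_pow, Algebra.TensorProduct.tmul_pow, Algebra.TensorProduct.tmul_pow,
    Algebra.TensorProduct.tmul_pow, one_pow, one_pow, ← map_pow, e] at h
  rw [show ((p * mayM p n k g.1 + 1 : ℕ) : ℤ) - 2 = p * genWt p g - 1 by
    unfold genWt; push_cast; ring] at h
  exact h

theorem rhoM_eq_zero {s : ℕ} {M N : ℤ} {z : Cobar p n k} (hz : z ∈ mayF p n k s N) (h : N < M) :
    rhoM p n k M z = 0 := by
  rw [rhoM, LinearMap.comp_apply, Finsupp.linearCombination_apply]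
  refine Finset.sum_eq_zero fun l hl => ?_
  have := (mem_mayF.1 hz l (Finsupp.mem_support_iff.1 hl)).2.2
  have hne : ¬(wordWt p l : ℤ) = M := by omega
  simp only [if_neg hne, smul_zero]

theorem rhoM_word {l : List (Expo n k)} (hl : OkWord p l) (M : ℤ) : rhoM p n k M (word p l) =
    if (wordWt p l : ℤ) = M then act p l (Finsupp.single 0 1) else 0 := by
  rw [rhoM, LinearMap.comp_apply, crd_word hl, Finsupp.linearCombination_single, one_smul]

theorem act_append_singleton (l : List (Expo n k)) (a : Expo n k) (v : EP p (Gen n k)) :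
    act p (l ++ [a]) v = tau p a (act p l v) := by
  induction l generalizing v with
  | nil => rfl
  | cons b l ih => exact ih _

theorem rhoM_cell_gam_mul {a : Expo n k} (ha : a ≠ 0) (hv : Valid p a) (M : ℤ)
    (z : Cobar p n k) : rhoM p n k (wt p a + M) (cell p n k (gam p a) * z) =
      tau p a (rhoM p n k M z) := by
  rw [← linearCombination_crd z, Finsupp.linearCombination_apply, Finsupp.sum, Finset.mul_sum,
    map_sum, map_sum, map_sum]
  refine Finset.sum_congr rfl fun l hl => ?_
  have hl := crd_okWord z (Finsupp.mem_support_iff.1 hl)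
  have e : cell p n k (gam p a) * word p l = word p (l ++ [a]) := by
    rw [word_append, word, word, one_mul]
  have hw : wordWt p (l ++ [a]) = wt p a + wordWt p l := by simp [wordWt, add_comm]
  have hok : OkWord p (l ++ [a]) := by
    intro b hb
    rcases List.mem_append.1 hb with hb | hb
    · exact hl b hb
    · rw [List.mem_singleton] at hb
      subst hb
      exact ⟨ha, hv⟩
  rw [mul_smul_comm, map_smul, map_smul, map_smul, e, rhoM_word hok, rhoM_word hl, hw,
    act_append_singleton]
  push_cast
  simp only [add_right_inj]
  split_ifs <;> simp

/-- `T` is the symbol of left multiplication by `y`, an element of degree `a` and filtration `W`. -/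
structure HasSym (a : ℕ) (W : ℤ) (y : Cobar p n k)
    (T : EP p (Gen n k) →ₗ[ZMod p] EP p (Gen n k)) : Prop where
  mem : y ∈ mayF p n k a W
  symb : ∀ (s : ℕ) (M : ℤ) (z : Cobar p n k), z ∈ mayF p n k s M →
    rhoM p n k (W + M) (y * z) = T (rhoM p n k M z)

variable {a a' : ℕ} {W W' : ℤ} {y y' : Cobar p n k}
  {T T' : EP p (Gen n k) →ₗ[ZMod p] EP p (Gen n k)}

theorem HasSym.add (h : HasSym a W y T) (h' : HasSym a W y' T') :
    HasSym a W (y + y') (T + T') where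
  mem := add_mem h.mem h'.mem
  symb s M z hz := by rw [add_mul, map_add, h.symb s M z hz, h'.symb s M z hz, LinearMap.add_apply]

theorem HasSym.smul (c : ZMod p) (h : HasSym a W y T) : HasSym a W (c • y) (c • T) where
  mem := Submodule.smul_mem _ c h.mem
  symb s M z hz := by rw [smul_mul_assoc, map_smul, h.symb s M z hz, LinearMap.smul_apply]

theorem HasSym.neg (h : HasSym a W y T) : HasSym a W (-y) (-T) where
  mem := neg_mem h.mem
  symb s M z hz := by rw [neg_mul, map_neg, h.symb s M z hz, LinearMap.neg_apply]

theorem hasSym_zero (a : ℕ) (W : ℤ) : HasSym a W (0 : Cobar p n k) 0 where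
  mem := zero_mem _
  symb s M z hz := by rw [zero_mul, map_zero, LinearMap.zero_apply]

theorem HasSym.sum {ι : Type*} (I : Finset ι) {f : ι → Cobar p n k}
    {F : ι → EP p (Gen n k) →ₗ[ZMod p] EP p (Gen n k)} (h : ∀ i ∈ I, HasSym a W (f i) (F i)) :
    HasSym a W (∑ i ∈ I, f i) (∑ i ∈ I, F i) := by
  classical
  induction I using Finset.induction_on with
  | empty => exact hasSym_zero a W
  | insert i I hi ih =>
    rw [Finset.sum_insert hi, Finset.sum_insert hi]
    exact (h i (Finset.mem_insert_self i I)).add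
      (ih fun j hj => h j (Finset.mem_insert_of_mem hj))

theorem HasSym.mul (h : HasSym a W y T) (h' : HasSym a' W' y' T') :
    HasSym (a + a') (W + W') (y * y') (T ∘ₗ T') where
  mem := mul_mem_mayF h.mem h'.mem
  symb s M z hz := by
    rw [mul_assoc, add_assoc, h.symb _ _ _ (mul_mem_mayF h'.mem hz), h'.symb s M z hz,
      LinearMap.comp_apply]

theorem hasSym_of_mem (h : y ∈ mayF p n k a (W - 1)) : HasSym a W y 0 where
  mem := mayF_mono (by omega) h
  symb s M z hz := by
    rw [rhoM_eq_zero (mul_mem_mayF h hz) (by omega), LinearMap.zero_apply]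

theorem hasSym_cell_gam {b : Expo n k} (hb : b ≠ 0) (hv : Valid p b) :
    HasSym 1 (wt p b) (cell p n k (gam p b)) (tau p b) where
  mem := cell_gam_mem le_rfl
  symb _ M z _ := rhoM_cell_gam_mul hb hv M z

theorem wt_single (g : Gen n k) (i : ℕ) : wt p (Finsupp.single g i) = i * genWt p g := by
  simp [wt, Finsupp.weight_apply]

theorem hasSym_cell_tg_pow (g : Gen n k) {i : ℕ} (h0 : 0 < i) (hi : i < p) :
    HasSym 1 ((i * genWt p g : ℕ) : ℤ) (cell p n k (tg p g ^ i))
      ((i.factorial : ZMod p) • tau p (Finsupp.single g i)) := by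
  have hv : Valid p (Finsupp.single g i) := by
    intro g'
    rw [Finsupp.single_apply]
    split_ifs <;> omega
  have e : tg p g ^ i = (i.factorial : ZMod p) • gam p (Finsupp.single g i) := by
    rw [← monom_single, ← facts_smul_dpow hv, facts, Finsupp.prod_single_index]
    · rfl
    · simp
  rw [e, map_smul, ← wt_single]
  exact (hasSym_cell_gam (fun h => h0.ne' (Finsupp.single_eq_zero.1 h)) hv).smul _

theorem hasSym_cell_tg (H : Admissible p n k) (g : Gen n k) :
    HasSym 1 (genWt p g) (cell p n k (tg p g)) (Lop p g) := by
  have := hasSym_cell_tg_pow (p := p) g one_pos (by have := H.three_le; omega)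
  simpa [tau_single_one] using this

/-- The symbol of `∑ p⁻¹ C(p,i) [t_g^i|t_g^{p-i}]` is `-b_g`: only `i = 1` and `i = p - 1`
contribute, with `h_g b_g ∂_g + b_g ∂_g h_g = b_g`, and `(p-1)! = -1` in `Z/p`. -/
theorem hasSym_mixedTerms (H : Admissible p n k) (g : Gen n k) :
    HasSym 2 (p * genWt p g) (cell₂ p n k (mixedTerms p (tg p g ⊗ₜ 1) (1 ⊗ₜ tg p g)))
      (-Bop p g) := by
  have hp := H.three_le
  have hpp : p.Prime := Fact.out
  have e : cell₂ p n k (mixedTerms p (tg p g ⊗ₜ 1) (1 ⊗ₜ tg p g)) =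
      ∑ i ∈ Finset.Ioo 0 p, ((p.choose i / p : ℕ) : ZMod p) •
        (cell p n k (tg p g ^ i) * cell p n k (tg p g ^ (p - i))) := by
    rw [mixedTerms, map_sum]
    refine Finset.sum_congr rfl fun i _ => ?_
    rw [← nsmul_eq_mul', map_nsmul, Algebra.TensorProduct.tmul_pow, Algebra.TensorProduct.tmul_pow,
      Algebra.TensorProduct.tmul_mul_tmul, one_pow, one_pow, one_mul, mul_one, cell₂_tmul,
      Nat.cast_smul_eq_nsmul]
  have e2 : -Bop p g = ∑ i ∈ Finset.Ioo 0 p, ((p.choose i / p : ℕ) : ZMod p) •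
      (((i.factorial : ZMod p) • tau p (Finsupp.single g i)) ∘ₗ
        (((p - i).factorial : ZMod p) • tau p (Finsupp.single g (p - i)))) := by
    have hw : (((p - 1).factorial : ℕ) : ZMod p) = -1 := ZMod.wilsons_lemma p
    have hc : (p.choose (p - 1)) = p := by
      rw [Nat.choose_symm (by omega), Nat.choose_one_right]
    rw [Finset.sum_eq_add_of_mem 1 (p - 1) (Finset.mem_Ioo.2 (by omega))
      (Finset.mem_Ioo.2 (by omega)) (by omega)]
    · rw [hc, Nat.choose_one_right, Nat.div_self hpp.pos, show p - (p - 1) = 1 by omega, hw,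
        tau_single_one, tau_single_pred hp]
      refine LinearMap.ext fun v => ?_
      simp only [Nat.cast_one, Nat.factorial_one, one_smul, LinearMap.add_apply,
        LinearMap.comp_apply, LinearMap.smul_apply, LinearMap.neg_apply, map_smul]
      rw [Aop_eq, Aop_eq, Lop_Bop, Dop_Lop_self, map_sub, ← smul_add]
      simp
    · intro i _ hi
      rw [tau_single_of_ne hi.1 hi.2]
      simp
  rw [e, e2]
  refine HasSym.sum _ fun i hi => ?_
  rw [Finset.mem_Ioo] at hi
  have := (hasSym_cell_tg_pow g hi.1 hi.2).mul (hasSym_cell_tg_pow (p := p) g (i := p - i)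
    (by omega) (by omega))
  have e3 : ((i * genWt p g : ℕ) : ℤ) + (((p - i) * genWt p g : ℕ) : ℤ) = p * genWt p g := by
    rw [← Nat.cast_add, ← add_mul, show i + (p - i) = p by omega, Nat.cast_mul]
  rw [e3] at this
  exact this.smul _

variable (p n k) in
/-- Multiplication by `h_{m,j}`. -/
def LopN (m : ℕ) (j : ZMod n) : EP p (Gen n k) →ₗ[ZMod p] EP p (Gen n k) :=
  if h : k ≤ m then Lop p (⟨m, h⟩, j) else 0

variable (p) in
/-- Multiplication by `∑ h_{m,j} h_{s-m,j+m}`. -/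
def Qlow (g : Gen n k) : EP p (Gen n k) →ₗ[ZMod p] EP p (Gen n k) :=
  ∑ m ∈ Finset.Icc k (g.1 - k), LopN p n k m g.2 ∘ₗ LopN p n k (g.1 - m) (g.2 + m)

theorem cell₂_comul_tg (x : S p n k ⊗[ZMod p] S p n k) (g : Gen n k) :
    cell₂ p n k (tg p g ⊗ₜ 1 + 1 ⊗ₜ tg p g + x) = cell₂ p n k x := by
  rw [map_add, map_add, cell₂_tmul, cell₂_tmul, cell_one, mul_zero, zero_mul, add_zero, zero_add]

theorem hasSym_comul_of_lt (H : Admissible p n k) {g : Gen n k} (h : (g.1 : ℕ) < n + k) :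
    HasSym 2 (genWt p g - 1) (cell₂ p n k (comul p n k (tg p g))) (Qlow p g) := by
  rw [comul_tg_of_lt H h, cell₂_comul_tg, map_sum]
  refine HasSym.sum _ fun m hm => ?_
  rw [Finset.mem_Icc] at hm
  have hk := H.one_le
  have h1 := hasSym_cell_tg H ((⟨m, hm.1⟩, g.2) : Gen n k)
  have h2 := hasSym_cell_tg H ((⟨g.1 - m, by have := g.1.2; omega⟩, g.2 + m) : Gen n k)
  have hg := g.1.2
  have hle : k ≤ (g.1 : ℕ) - m := by omega
  rw [cell₂_tmul, LopN, LopN, dif_pos hm.1, dif_pos hle]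
  have := h1.mul h2
  rw [show (genWt p ((⟨m, hm.1⟩, g.2) : Gen n k) : ℤ) +
      genWt p ((⟨g.1 - m, hle⟩, g.2 + m) : Gen n k) = genWt p g - 1 by
    simp only [genWt]
    rw [mayM_of_lt h, mayM_of_lt (by omega), mayM_of_lt (by omega)]
    omega] at this
  exact this

theorem hasSym_comul_plusGen (H : Admissible p n k) (g : Gen n k) :
    HasSym 2 (genWt p (plusGen g) - 1) (cell₂ p n k (comul p n k (tg p (plusGen g))))
      (Bop p g) := by
  have h := hasSym_of_mem (cell₂_mem_mayF (comul_tg_plusGen H g))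
  rw [show (genWt p (plusGen g) : ℤ) - 1 = p * genWt p g by
    rw [genWt_plusGen H]; push_cast; ring]
  have := h.add (hasSym_mixedTerms H g).neg
  have e : -(-Bop p g) = Bop p g := LinearMap.ext fun v => by simp
  rw [zero_add, e, ← map_neg, ← map_add, add_neg_cancel_right] at this
  rw [map_sub, map_sub, cell₂_tmul, cell₂_tmul, cell_one, mul_zero, zero_mul, sub_zero,
    sub_zero] at this
  exact this

open Finset.HasAntidiagonal in
/-- The values of the twisting cochain cancel on boundaries of words. -/
theorem act_wordD (H : Admissible p n k) {l : List (Expo n k)} (hl : OkWord p l)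
    (v : EP p (Gen n k)) :
    Finsupp.linearCombination (ZMod p) (fun l => act p l v) (wordD p l) = 0 := by
  induction l generalizing v with
  | nil => simp [wordD]
  | cons a l ih =>
    have hl' := okWord_cons.1 hl
    rw [wordD, map_sub, map_smul, Finsupp.linearCombination_mapDomain]
    have e1 : Finsupp.linearCombination (ZMod p) ((fun l => act p l v) ∘ List.cons a) (wordD p l) =
        0 := ih hl'.2 (tau p a v)
    have e2 : Finsupp.linearCombination (ZMod p) (fun l => act p l v) (splitSum p a l) =
        act p l (∑ x ∈ antidiagonal a, tau p x.1 (tau p x.2 v)) := by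
      rw [splitSum, map_sum, map_sum, Finset.sum_filter]
      refine Finset.sum_congr rfl fun x _ => ?_
      split_ifs with h
      · rw [Finsupp.linearCombination_single, one_smul]
        rfl
      · rw [not_and_or, not_not, not_not] at h
        rcases h with h | h <;> simp [h, tau_zero H.three_le]
    rw [e1, e2, sum_tau_tau H.three_le hl'.1.2, map_zero, smul_zero, sub_zero]

/-- The symbol of a leading boundary vanishes. -/
theorem rhoM_cobarD_eq_zero (H : Admissible p n k) {s : ℕ} {M : ℤ} {z : Cobar p n k}
    (hz : z ∈ mayF p n k s M) : rhoM p n k M (cobarD p n k z) = 0 := by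
  have e : ((crd p n k (cobarD p n k z)).filter fun l => (wordWt p l : ℤ) = M) =
      wordDLin p n k ((crd p n k z).filter fun l => (wordWt p l : ℤ) = M) := by
    ext l
    rw [wordDLin_filter (fun l hl => crd_okWord z hl), Finsupp.filter_apply]
    split_ifs with hl
    · exact crd_cobarD H hz hl.ge
    · rfl
  rw [rhoM_apply, e, wordDLin, Finsupp.linearCombination_apply (ZMod p) (v := wordD p),
    Finsupp.sum, map_sum]
  refine Finset.sum_eq_zero fun l hl => ?_
  have hl : OkWord p l := by
    refine crd_okWord z fun h0 => Finsupp.mem_support_iff.1 hl ?_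
    rw [Finsupp.filter_apply, h0, ite_self]
  rw [map_smul, act_wordD H hl, smul_zero]

end Symbols

/-! ### The first differential on symbols -/

section FirstDifferential

variable {p n k : ℕ} [Fact p.Prime] [NeZero n]

theorem finite_gens (N : ℕ) : {g : Gen n k | (g.1 : ℕ) ≤ N}.Finite := by
  have hf : ((Set.Iic N) ×ˢ (Set.univ : Set (ZMod n))).Finite :=
    (Set.finite_Iic N).prod (Set.toFinite _)
  refine Set.Finite.of_finite_image (f := fun g : Gen n k => ((g.1 : ℕ), g.2))
    (hf.subset ?_) ?_
  · rintro _ ⟨g, hg, rfl⟩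
    exact ⟨hg, trivial⟩
  · rintro ⟨⟨s, hs⟩, j⟩ _ ⟨⟨s2, hs2⟩, j2⟩ _ h
    simp only [Prod.mk.injEq] at h
    obtain ⟨rfl, rfl⟩ := h
    rfl

variable (n k) in
/-- The indices `(s, j)` with `s ≤ N`. -/
def gensLE (N : ℕ) : Finset (Gen n k) := (finite_gens N).toFinset

theorem mem_gensLE {N : ℕ} {g : Gen n k} : g ∈ gensLE n k N ↔ (g.1 : ℕ) ≤ N := by simp [gensLE]

theorem LopN_Lop (m : ℕ) (j : ZMod n) (g : Gen n k) (v : EP p (Gen n k)) :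
    LopN p n k m j (Lop p g v) = -Lop p g (LopN p n k m j v) := by
  unfold LopN
  split_ifs
  · exact Lop_Lop _ _ _
  · simp

theorem LopN_Bop (m : ℕ) (j : ZMod n) (g : Gen n k) (v : EP p (Gen n k)) :
    LopN p n k m j (Bop p g v) = Bop p g (LopN p n k m j v) := by
  unfold LopN
  split_ifs
  · exact Lop_Bop _ _ _
  · simp

theorem LopN_Cop (m : ℕ) (j : ZMod n) (g : Gen n k) (v : EP p (Gen n k)) :
    LopN p n k m j (Cop p g v) = Cop p g (LopN p n k m j v) := by
  unfold LopN
  split_ifs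
  · exact Lop_Cop _ _ _
  · simp

theorem Qlow_apply (g : Gen n k) (v : EP p (Gen n k)) : Qlow p g v =
    ∑ m ∈ Finset.Icc k (g.1 - k), LopN p n k m g.2 (LopN p n k (g.1 - m) (g.2 + m) v) := by
  rw [Qlow, LinearMap.sum_apply]
  rfl

theorem Qlow_Lop (g g' : Gen n k) (v : EP p (Gen n k)) :
    Qlow p g (Lop p g' v) = Lop p g' (Qlow p g v) := by
  rw [Qlow_apply, Qlow_apply, map_sum]
  refine Finset.sum_congr rfl fun m _ => ?_
  rw [LopN_Lop, map_neg, LopN_Lop, neg_neg]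

theorem Qlow_Bop (g g' : Gen n k) (v : EP p (Gen n k)) :
    Qlow p g (Bop p g' v) = Bop p g' (Qlow p g v) := by
  rw [Qlow_apply, Qlow_apply, map_sum]
  refine Finset.sum_congr rfl fun m _ => ?_
  rw [LopN_Bop, LopN_Bop]

theorem Qlow_Cop (g g' : Gen n k) (v : EP p (Gen n k)) :
    Qlow p g (Cop p g' v) = Cop p g' (Qlow p g v) := by
  rw [Qlow_apply, Qlow_apply, map_sum]
  refine Finset.sum_congr rfl fun m _ => ?_
  rw [LopN_Cop, LopN_Cop]

variable (p n k) in
/-- The first differential on symbols, with `h_{s,j} ↦ -∑ h_{m,j} h_{s-m,j+m}` for `s < n + k` and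
`h_{s+n,j+1} ↦ -b_{s,j}`; it is truncated to `s ≤ N` in the second case. -/
def symD (N : ℕ) : EP p (Gen n k) →ₗ[ZMod p] EP p (Gen n k) :=
  -(∑ g ∈ gensLE n k (n + k - 1), Qlow p g ∘ₗ Dop p g +
    ∑ g ∈ gensLE n k N, Bop p g ∘ₗ Dop p (plusGen g))

theorem symD_apply (N : ℕ) (v : EP p (Gen n k)) : symD p n k N v =
    -(∑ g ∈ gensLE n k (n + k - 1), Qlow p g (Dop p g v) +
      ∑ g ∈ gensLE n k N, Bop p g (Dop p (plusGen g) v)) := by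
  simp only [symD, LinearMap.neg_apply, LinearMap.add_apply, LinearMap.sum_apply,
    LinearMap.comp_apply]

theorem Dop_Lop [DecidableEq (Gen n k)] (g g' : Gen n k) (v : EP p (Gen n k)) :
    Dop p g (Lop p g' v) = (if g = g' then v else 0) - Lop p g' (Dop p g v) := by
  split_ifs with h
  · rw [h, Dop_Lop_self]
  · rw [Dop_Lop_of_ne h, zero_sub]

/-- The first differential is an antiderivation with respect to the `h_g`. -/
theorem symD_Lop [DecidableEq (Gen n k)] (N : ℕ) (g : Gen n k) (v : EP p (Gen n k)) :
    symD p n k N (Lop p g v) =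
      -(if (g.1 : ℕ) ≤ n + k - 1 then Qlow p g v else 0) -
      ∑ g' ∈ gensLE n k N, (if plusGen g' = g then Bop p g' v else 0) -
      Lop p g (symD p n k N v) := by
  have e1 : ∀ g' ∈ gensLE n k (n + k - 1), Qlow p g' (Dop p g' (Lop p g v)) =
      (if g' = g then Qlow p g v else 0) - Lop p g (Qlow p g' (Dop p g' v)) := by
    intro g' _
    rw [Dop_Lop, map_sub, Qlow_Lop]
    split_ifs with h
    · rw [h]
    · rw [map_zero]
  have e2 : ∀ g' ∈ gensLE n k N, Bop p g' (Dop p (plusGen g') (Lop p g v)) =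
      (if plusGen g' = g then Bop p g' v else 0) - Lop p g (Bop p g' (Dop p (plusGen g') v)) := by
    intro g' _
    rw [Dop_Lop, map_sub, Lop_Bop]
    split_ifs with h
    · rfl
    · rw [map_zero]
  rw [symD_apply, symD_apply, Finset.sum_congr rfl e1, Finset.sum_congr rfl e2,
    Finset.sum_sub_distrib, Finset.sum_sub_distrib, Finset.sum_ite_eq', map_neg, map_add, map_sum,
    map_sum]
  simp only [mem_gensLE]
  abel

theorem plusGen_ne_of_lt {g : Gen n k} (h : (g.1 : ℕ) < n + k) (g' : Gen n k) : plusGen g' ≠ g := by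
  rintro rfl
  have := g'.1.2
  simp only [plusGen] at h
  omega

theorem symD_Lop_of_lt (N : ℕ) {g : Gen n k} (h : (g.1 : ℕ) < n + k) (v : EP p (Gen n k)) :
    symD p n k N (Lop p g v) = -Qlow p g v - Lop p g (symD p n k N v) := by
  classical
  rw [symD_Lop, if_pos (by omega), Finset.sum_eq_zero fun g' _ => if_neg (plusGen_ne_of_lt h g'),
    sub_zero]

theorem symD_Lop_plusGen {N : ℕ} {g : Gen n k} (h : (g.1 : ℕ) ≤ N) (v : EP p (Gen n k)) :
    symD p n k N (Lop p (plusGen g) v) = -Bop p g v - Lop p (plusGen g) (symD p n k N v) := by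
  classical
  have e : ∀ g' ∈ gensLE n k N, (if plusGen g' = plusGen g then Bop p g' v else 0) =
      if g' = g then Bop p g v else 0 := by
    intro g' _
    by_cases h : g' = g
    · rw [if_pos h, if_pos (by rw [h]), h]
    · rw [if_neg h, if_neg fun h' => h (plusGen_injective h')]
  rw [symD_Lop, Finset.sum_congr rfl e, Finset.sum_ite_eq', if_pos (mem_gensLE.2 h), if_neg,
    neg_zero, zero_sub]
  have := g.1.2
  have := NeZero.pos n
  simp only [plusGen]
  omega

theorem symD_Bop (N : ℕ) (g : Gen n k) (v : EP p (Gen n k)) :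
    symD p n k N (Bop p g v) = Bop p g (symD p n k N v) := by
  rw [symD_apply, symD_apply, map_neg, map_add, map_sum, map_sum]
  congr 2
  · refine Finset.sum_congr rfl fun g' _ => ?_
    rw [Dop_Bop, Qlow_Bop]
  · refine Finset.sum_congr rfl fun g' _ => ?_
    rw [Dop_Bop, Bop_Bop]

theorem Dop_one (g : Gen n k) : Dop p g (Finsupp.single 0 1) = 0 := by
  rw [Dop_single, contr_one]
  exact Finsupp.single_zero 0

theorem symD_one (N : ℕ) : symD p n k N (Finsupp.single 0 1) = 0 := by
  simp only [symD_apply, Dop_one, map_zero, Finset.sum_const_zero, add_zero, neg_zero]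

variable (p) in
/-- The monomials in the `h_g` and `b_g`, with their degree and May filtration. -/
inductive SymMono {n k : ℕ} : ℕ → ℕ → EP p (Gen n k) → Prop
  | one : SymMono 0 0 (Finsupp.single 0 1)
  | mul_h {s M : ℕ} {x : EP p (Gen n k)} (g : Gen n k) (h : SymMono s M x) :
      SymMono (s + 1) (M + genWt p g) (Lop p g x)
  | mul_b {s M : ℕ} {x : EP p (Gen n k)} (g : Gen n k) (h : SymMono s M x) :
      SymMono (s + 2) (M + p * genWt p g) (Bop p g x)

variable (p n k) in
/-- The symbols of degree `s` and May filtration `M`. -/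
def symV (s M : ℕ) : Submodule (ZMod p) (EP p (Gen n k)) :=
  Submodule.span (ZMod p) {x | SymMono p s M x}

theorem map_mem_of_symMono {s M : ℕ} {A : Type*} [AddCommGroup A] [Module (ZMod p) A]
    (f : EP p (Gen n k) →ₗ[ZMod p] A) (N : Submodule (ZMod p) A)
    (h : ∀ x, SymMono p s M x → f x ∈ N) {v : EP p (Gen n k)} (hv : v ∈ symV p n k s M) :
    f v ∈ N :=
  (show symV p n k s M ≤ N.comap f from Submodule.span_le.2 h) hv

theorem Lop_mem_symV {s M : ℕ} {v : EP p (Gen n k)} (hv : v ∈ symV p n k s M) (g : Gen n k) :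
    Lop p g v ∈ symV p n k (s + 1) (M + genWt p g) :=
  map_mem_of_symMono _ _ (fun _ hx => Submodule.subset_span (hx.mul_h g)) hv

theorem Bop_mem_symV {s M : ℕ} {v : EP p (Gen n k)} (hv : v ∈ symV p n k s M) (g : Gen n k) :
    Bop p g v ∈ symV p n k (s + 2) (M + p * genWt p g) :=
  map_mem_of_symMono _ _ (fun _ hx => Submodule.subset_span (hx.mul_b g)) hv

theorem one_mem_symV : (Finsupp.single 0 1 : EP p (Gen n k)) ∈ symV p n k 0 0 :=
  Submodule.subset_span .one

theorem Aop_mem_symV {s M : ℕ} {v : EP p (Gen n k)} (hv : v ∈ symV p n k s M) (g : Gen n k) :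
    Aop p g v ∈ symV p n k (s + 1) (M + (p - 1) * genWt p g) := by
  refine map_mem_of_symMono _ _ (fun x hx => ?_) hv
  clear hv
  induction hx with
  | one => rw [Aop_eq, Dop_one, map_zero]; exact zero_mem _
  | @mul_h s M x g' h ih =>
    classical
    rw [Aop_eq, Dop_Lop, map_sub, ← Lop_Bop]
    refine sub_mem ?_ ?_
    · split_ifs with e
      · subst e
        have := Bop_mem_symV (Submodule.subset_span h) g
        have hp := (Fact.out : p.Prime).one_le
        have e2 : M + p * genWt p g = M + genWt p g + (p - 1) * genWt p g := by
          obtain ⟨q, rfl⟩ : ∃ q, p = q + 1 := ⟨p - 1, by omega⟩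
          simp only [Nat.add_sub_cancel]
          ring
        rwa [e2] at this
      · rw [map_zero]; exact zero_mem _
    · rw [add_right_comm M]
      exact Lop_mem_symV ih g'
  | @mul_b s M x g' h ih =>
    rw [Aop_eq, Dop_Bop, Bop_Bop, add_right_comm M]
    exact Bop_mem_symV ih g'

theorem tau_mem_symV (H : Admissible p n k) {s M : ℕ} {v : EP p (Gen n k)}
    (hv : v ∈ symV p n k s M) (a : Expo n k) : tau p a v ∈ symV p n k (s + 1) (M + wt p a) := by
  rcases tau_cases H.three_le a with ⟨g, rfl, e⟩ | ⟨g, rfl, e⟩ | e <;> rw [e]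
  · rw [wt_single, one_mul]
    exact Lop_mem_symV hv g
  · rw [wt_single]
    exact Aop_mem_symV hv g
  · exact zero_mem _

theorem act_mem_symV (H : Admissible p n k) (l : List (Expo n k)) {s M : ℕ} {v : EP p (Gen n k)}
    (hv : v ∈ symV p n k s M) : act p l v ∈ symV p n k (s + l.length) (M + wordWt p l) := by
  induction l generalizing s M v with
  | nil => simpa [act, wordWt] using hv
  | cons a l ih =>
    have := ih (tau_mem_symV H hv a)
    rw [wordWt_cons, List.length_cons, add_comm l.length, ← add_assoc, ← add_assoc]
    exact this

theorem rhoM_mem_symV (H : Admissible p n k) {s M : ℕ} {N : ℤ} {z : Cobar p n k}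
    (hz : z ∈ mayF p n k s N) : rhoM p n k M z ∈ symV p n k s M := by
  rw [rhoM, LinearMap.comp_apply, Finsupp.linearCombination_apply]
  refine Submodule.sum_mem _ fun l hl => ?_
  obtain ⟨-, h, -⟩ := mem_mayF.1 hz l (Finsupp.mem_support_iff.1 hl)
  simp only
  split_ifs with hw
  · refine Submodule.smul_mem _ _ ?_
    have := act_mem_symV H l (one_mem_symV (p := p) (n := n) (k := k))
    rw [zero_add, zero_add, h, Nat.cast_injective hw] at this
    exact this
  · rw [smul_zero]; exact zero_mem _

/-- `r` represents the symbol `v` in degree `s` and filtration `M`, and its differential represents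
the first differential of `v`. -/
structure Represents (N s M : ℕ) (v : EP p (Gen n k)) (r : Cobar p n k) : Prop where
  mem : r ∈ mayF p n k s M
  d_mem : cobarD p n k r ∈ mayF p n k (s + 1) (M - 1)
  symb : rhoM p n k M r = v
  d_symb : rhoM p n k (M - 1) (cobarD p n k r) = symD p n k N v

variable {N s M : ℕ} {v v' : EP p (Gen n k)} {r r' : Cobar p n k}

theorem Represents.add (h : Represents N s M v r) (h' : Represents N s M v' r') :
    Represents N s M (v + v') (r + r') where
  mem := add_mem h.mem h'.mem
  d_mem := by rw [map_add]; exact add_mem h.d_mem h'.d_mem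
  symb := by rw [map_add, h.symb, h'.symb]
  d_symb := by rw [map_add, map_add, map_add, h.d_symb, h'.d_symb]

theorem Represents.smul (c : ZMod p) (h : Represents N s M v r) :
    Represents N s M (c • v) (c • r) where
  mem := Submodule.smul_mem _ c h.mem
  d_mem := by rw [map_smul]; exact Submodule.smul_mem _ c h.d_mem
  symb := by rw [map_smul, h.symb]
  d_symb := by rw [map_smul, map_smul, map_smul, h.d_symb]

theorem represents_zero (N s M : ℕ) : Represents N s M 0 (0 : Cobar p n k) where
  mem := zero_mem _
  d_mem := by rw [map_zero]; exact zero_mem _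
  symb := map_zero _
  d_symb := by rw [map_zero, map_zero, map_zero]

theorem represents_one (N : ℕ) : Represents N 0 0 (Finsupp.single 0 1) (1 : Cobar p n k) where
  mem := one_mem_mayF le_rfl
  d_mem := by rw [cobarD_one]; exact zero_mem _
  symb := by
    have := rhoM_word (p := p) (l := ([] : List (Expo n k))) (by simp [OkWord]) 0
    rw [if_pos (by simp [wordWt])] at this
    exact this
  d_symb := by rw [cobarD_one, map_zero, symD_one]

theorem Represents.cell_tg_mul (H : Admissible p n k) {g : Gen n k}
    {Q : EP p (Gen n k) →ₗ[ZMod p] EP p (Gen n k)}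
    (hQ : HasSym 2 (genWt p g - 1) (cell₂ p n k (comul p n k (tg p g))) Q)
    (hD : symD p n k N (Lop p g v) = -Q v - Lop p g (symD p n k N v))
    (h : Represents N s M v r) :
    Represents N (s + 1) (M + genWt p g) (Lop p g v) (cell p n k (tg p g) * r) := by
  have h1 := hasSym_cell_tg H g
  have e1 : ((M + genWt p g : ℕ) : ℤ) = genWt p g + M := by push_cast; ring
  have e2 : ((M + genWt p g : ℕ) : ℤ) - 1 = (genWt p g - 1) + M := by push_cast; ring
  have e3 : ((M + genWt p g : ℕ) : ℤ) - 1 = genWt p g + (M - 1) := by push_cast; ring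
  refine ⟨?_, ?_, ?_, ?_⟩
  · rw [e1, add_comm s]
    exact mul_mem_mayF h1.mem h.mem
  · rw [cobarD_cell_mul, neg_mul]
    refine sub_mem (neg_mem ?_) ?_
    · rw [e2, show s + 1 + 1 = 2 + s by omega]
      exact mul_mem_mayF hQ.mem h.mem
    · rw [e3, add_comm (s + 1)]
      exact mul_mem_mayF h1.mem h.d_mem
  · rw [e1, h1.symb s M r h.mem, h.symb]
  · rw [cobarD_cell_mul, neg_mul, map_sub, map_neg, hD]
    congr 1
    · rw [e2, hQ.symb s M r h.mem, h.symb]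
    · rw [e3, h1.symb _ _ _ h.d_mem, h.d_symb]

theorem Represents.mul_low (H : Admissible p n k) {g : Gen n k} (hg : (g.1 : ℕ) < n + k)
    (h : Represents N s M v r) :
    Represents N (s + 1) (M + genWt p g) (Lop p g v) (cell p n k (tg p g) * r) :=
  h.cell_tg_mul H (hasSym_comul_of_lt H hg) (symD_Lop_of_lt N hg v)

theorem Represents.mul_b (H : Admissible p n k) (g : Gen n k) (h : Represents N s M v r) :
    Represents N (s + 2) (M + p * genWt p g) (Bop p g v)
      (cell₂ p n k (comul p n k (tg p (plusGen g))) * r) := by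
  have hQ := hasSym_comul_plusGen H g
  rw [genWt_plusGen H, Nat.cast_add, Nat.cast_one, add_sub_cancel_right] at hQ
  have e1 : ((M + p * genWt p g : ℕ) : ℤ) = ((p * genWt p g : ℕ) : ℤ) + M := by push_cast; ring
  have e2 : ((M + p * genWt p g : ℕ) : ℤ) - 1 = ((p * genWt p g : ℕ) : ℤ) + (M - 1) := by
    push_cast; ring
  have e3 : cobarD p n k (cell₂ p n k (comul p n k (tg p (plusGen g))) * r) =
      cell₂ p n k (comul p n k (tg p (plusGen g))) * cobarD p n k r := by
    rw [cobarD_mul (cell₂_mem_cobarC _), cobarD_cell₂_comul H]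
    simp
  refine ⟨?_, ?_, ?_, ?_⟩
  · rw [e1, add_comm s]
    exact mul_mem_mayF hQ.mem h.mem
  · rw [e2, e3, show s + 2 + 1 = 2 + (s + 1) by omega]
    exact mul_mem_mayF hQ.mem h.d_mem
  · rw [e1, hQ.symb s M r h.mem, h.symb]
  · rw [e2, e3, hQ.symb _ _ _ h.d_mem, h.d_symb, symD_Bop]

theorem exists_represents (H : Admissible p n k) (hM : M ≤ N) (hv : v ∈ symV p n k s M) :
    ∃ r : Cobar p n k, Represents N s M v r := by
  have key : ∀ {s M x}, SymMono p s M x → M ≤ N → ∃ r : Cobar p n k, Represents N s M x r := by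
    intro s M x hx
    induction hx with
    | one => exact fun _ => ⟨1, represents_one N⟩
    | @mul_h s M x g _ ih =>
      intro hM
      obtain ⟨r, hr⟩ := ih (by omega)
      rcases lt_or_ge (g.1 : ℕ) (n + k) with hg | hg
      · exact ⟨_, hr.mul_low H hg⟩
      · obtain ⟨g, rfl⟩ := exists_plusGen hg
        have h1 : (g.1 : ℕ) + n ≤ genWt p (plusGen g) := self_le_mayM p n k _
        exact ⟨_, hr.cell_tg_mul H (hasSym_comul_plusGen H g)
          (symD_Lop_plusGen (by omega) x)⟩
    | mul_b g _ ih =>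
      intro hM
      obtain ⟨r, hr⟩ := ih (by omega)
      exact ⟨_, hr.mul_b H g⟩
  induction hv using Submodule.span_induction with
  | mem x hx => exact key hx hM
  | zero => exact ⟨0, represents_zero N s M⟩
  | add x y _ _ hx hy =>
    obtain ⟨r, hr⟩ := hx
    obtain ⟨r', hr'⟩ := hy
    exact ⟨_, hr.add hr'⟩
  | smul c x _ hx =>
    obtain ⟨r, hr⟩ := hx
    exact ⟨_, hr.smul c⟩

/-- The symbol of `d z` is the first differential of the symbol of `z`. -/
theorem rhoM_cobarD (H : Admissible p n k) (hM : M ≤ N) {z : Cobar p n k}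
    (hz : z ∈ mayF p n k s M) (hdz : cobarD p n k z ∈ mayF p n k (s + 1) (M - 1)) :
    rhoM p n k (M - 1) (cobarD p n k z) = symD p n k N (rhoM p n k M z) := by
  -- subtract an explicit representative, so that the symbol may be assumed to vanish
  obtain ⟨r, hr⟩ := exists_represents H hM (rhoM_mem_symV H hz)
  have h1 : z - r ∈ mayF p n k s M := sub_mem hz hr.mem
  have h2 : rhoM p n k M (z - r) = 0 := by rw [map_sub, hr.symb, sub_self]
  have h3 : cobarD p n k (z - r) ∈ mayF p n k (s + 1) (M - 1) := by
    rw [map_sub]; exact sub_mem hdz hr.d_mem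
  have h4 : rhoM p n k (M - 1) (cobarD p n k (z - r)) = 0 := by
    rcases s with - | s
    · exact rhoM_cobarD_eq_zero H (mem_of_rhoM_eq_zero h1 h2)
    · obtain ⟨u, -, hu⟩ := exists_sub_cobarD_mem H h1 h3 h2
      have := rhoM_cobarD_eq_zero H hu
      rwa [map_sub, cobarD_cobarD H, sub_zero] at this
  rw [map_sub, map_sub, sub_eq_zero] at h4
  rw [h4, hr.d_symb]

theorem symD_eq_zero (H : Admissible p n k) (hv : v ∈ symV p n k s 0) : symD p n k N v = 0 := by
  obtain ⟨r, hr⟩ := exists_represents H (Nat.zero_le N) hv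
  have := hr.d_mem
  rw [mayF_neg (by simp), Submodule.mem_bot] at this
  rw [← hr.d_symb, this, map_zero]

theorem symD_mem (H : Admissible p n k) (hM : M + 1 ≤ N) (hv : v ∈ symV p n k s (M + 1)) :
    symD p n k N v ∈ symV p n k (s + 1) M := by
  obtain ⟨r, hr⟩ := exists_represents H hM hv
  have := rhoM_mem_symV H (M := M) hr.d_mem
  have h := hr.d_symb
  rw [Nat.cast_add, Nat.cast_one, add_sub_cancel_right] at h
  rwa [h] at this

theorem symD_symD (H : Admissible p n k) (hM : M ≤ N) (hv : v ∈ symV p n k s M) :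
    symD p n k N (symD p n k N v) = 0 := by
  rcases M with - | M
  · rw [symD_eq_zero H hv, map_zero]
  · obtain ⟨r, hr⟩ := exists_represents H hM hv
    have h1 := hr.d_mem
    have h := hr.d_symb
    rw [Nat.cast_add, Nat.cast_one, add_sub_cancel_right] at h h1
    rw [← h, ← rhoM_cobarD H (by omega) h1, cobarD_cobarD H, map_zero]
    rw [cobarD_cobarD H]
    exact zero_mem _

end FirstDifferential

/-! ### Cancelling the `b_g` against the `h_{s+n,j+1}` -/

section Koszul

variable {p n k : ℕ} [Fact p.Prime] [NeZero n]

variable (p) in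
/-- The homotopy `h_{s+n,j+1} b_{s,j}⁻¹`. -/
def symK (g : Gen n k) : EP p (Gen n k) →ₗ[ZMod p] EP p (Gen n k) :=
  Lop p (plusGen g) ∘ₗ Cop p g

variable (p) in
/-- The projection to the part that involves neither `h_{s+n,j+1}` nor `b_{s,j}`. -/
def symE (g : Gen n k) : EP p (Gen n k) →ₗ[ZMod p] EP p (Gen n k) :=
  Dop p (plusGen g) ∘ₗ Lop p (plusGen g) ∘ₗ (LinearMap.id - Bop p g ∘ₗ Cop p g)

theorem symK_apply (g : Gen n k) (v : EP p (Gen n k)) :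
    symK p g v = Lop p (plusGen g) (Cop p g v) := rfl

theorem symE_apply (g : Gen n k) (v : EP p (Gen n k)) : symE p g v =
    Dop p (plusGen g) (Lop p (plusGen g) (v - Bop p g (Cop p g v))) := rfl

theorem symD_symK {N : ℕ} {g : Gen n k} (hg : (g.1 : ℕ) ≤ N) (v : EP p (Gen n k)) :
    symD p n k N (symK p g v) + symK p g (symD p n k N v) = symE p g v - v := by
  classical
  have e1 : Cop p g (symD p n k N v) = symD p n k N (Cop p g v) - Dop p (plusGen g) v +
      Bop p g (Cop p g (Dop p (plusGen g) v)) := by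
    rw [symD_apply, symD_apply, map_neg, map_add, map_sum, map_sum]
    have h1 : ∀ g' ∈ gensLE n k (n + k - 1), Cop p g (Qlow p g' (Dop p g' v)) =
        Qlow p g' (Dop p g' (Cop p g v)) := fun g' _ => by rw [← Qlow_Cop, Dop_Cop]
    have h2 : ∀ g' ∈ gensLE n k N, Cop p g (Bop p g' (Dop p (plusGen g') v)) =
        Bop p g' (Dop p (plusGen g') (Cop p g v)) +
          if g' = g then Dop p (plusGen g) v - Bop p g (Cop p g (Dop p (plusGen g) v)) else 0 := by
      intro g' _
      split_ifs with h
      · rw [h, Cop_Bop_self, Dop_Cop]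
        abel
      · rw [Cop_Bop_of_ne (Ne.symm h), Dop_Cop, add_zero]
    rw [Finset.sum_congr rfl h1, Finset.sum_congr rfl h2, Finset.sum_add_distrib,
      Finset.sum_ite_eq', if_pos (mem_gensLE.2 hg)]
    abel
  rw [symK_apply, symK_apply, symD_Lop_plusGen hg, e1, symE_apply, map_add, map_sub, map_sub,
    map_sub, Dop_Lop_self, Dop_Lop_self, Dop_Bop, Dop_Cop, Lop_Bop, Lop_Cop]
  abel

variable (p n k) in
/-- The symbols of degree `s - 1`. -/
def symVPred (s M : ℕ) : Submodule (ZMod p) (EP p (Gen n k)) :=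
  match s with
  | 0 => ⊥
  | s + 1 => symV p n k s M

theorem Lop_mem_symVPred {s M : ℕ} {v : EP p (Gen n k)} (hv : v ∈ symVPred p n k s M)
    (g : Gen n k) : Lop p g v ∈ symV p n k s (M + genWt p g) := by
  rcases s with - | s
  · rw [(Submodule.mem_bot _).1 hv, map_zero]; exact zero_mem _
  · exact Lop_mem_symV hv g

theorem Bop_mem_symVPred {s M : ℕ} {v : EP p (Gen n k)} (hv : v ∈ symVPred p n k s M)
    (g : Gen n k) : Bop p g v ∈ symV p n k (s + 1) (M + p * genWt p g) := by
  rcases s with - | s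
  · rw [(Submodule.mem_bot _).1 hv, map_zero]; exact zero_mem _
  · exact Bop_mem_symV hv g

theorem symK_mem (H : Admissible p n k) (g : Gen n k) {s M : ℕ} {v : EP p (Gen n k)}
    (hv : v ∈ symV p n k s M) : symK p g v ∈ symVPred p n k s (M + 1) := by
  refine map_mem_of_symMono _ _ (fun x hx => ?_) hv
  clear hv
  induction hx with
  | one =>
    have : Cop p g (Finsupp.single 0 1) = (0 : EP p (Gen n k)) := by
      ext1 m
      rw [Cop_apply, Finsupp.zero_apply, Finsupp.single_eq_of_ne]
      intro h
      have := DFunLike.congr_fun h g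
      simp at this
    rw [symK_apply, this, map_zero]
    exact zero_mem _
  | @mul_h s M x g' h ih =>
    rw [symK_apply, ← Lop_Cop, Lop_Lop, ← symK_apply]
    refine neg_mem ?_
    rw [add_right_comm]
    exact Lop_mem_symVPred ih g'
  | @mul_b s M x g' h ih =>
    by_cases e : g = g'
    · subst e
      rw [symK_apply, Cop_Bop_self]
      have := Lop_mem_symV (Submodule.subset_span h) (plusGen g)
      rw [genWt_plusGen H, ← add_assoc] at this
      exact this
    · rw [symK_apply, Cop_Bop_of_ne e, Lop_Bop, ← symK_apply, add_right_comm]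
      exact Bop_mem_symVPred ih g'

variable (p) in
/-- The composite of the projections `symE` over a list. -/
def symEList : List (Gen n k) → EP p (Gen n k) →ₗ[ZMod p] EP p (Gen n k)
  | [] => LinearMap.id
  | g :: L => symE p g ∘ₗ symEList L

theorem exists_eq_symD_add (H : Admissible p n k) {N s M : ℕ} (hM : M + 1 ≤ N)
    {v : EP p (Gen n k)} (hv : v ∈ symV p n k s M) (h : symD p n k N v = 0)
    (L : List (Gen n k)) (hL : ∀ g ∈ L, (g.1 : ℕ) ≤ N) :
    ∃ w ∈ symVPred p n k s (M + 1), v = symD p n k N w + symEList p L v := by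
  have hD : ∀ w ∈ symVPred p n k s (M + 1), symD p n k N w ∈ symV p n k s M ∧
      symD p n k N (symD p n k N w) = 0 := by
    intro w hw
    rcases s with - | s
    · rw [(Submodule.mem_bot _).1 hw, map_zero, map_zero]
      exact ⟨zero_mem _, rfl⟩
    · exact ⟨symD_mem H hM hw, symD_symD H hM hw⟩
  induction L with
  | nil => exact ⟨0, zero_mem _, by simp [symEList]⟩
  | cons g L ih =>
    obtain ⟨w, hw, e⟩ := ih fun g hg => hL g (List.mem_cons_of_mem _ hg)
    have e' : symEList p L v = v - symD p n k N w := by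
      nth_rewrite 2 [e]
      rw [add_sub_cancel_left]
    have h1 : symEList p L v ∈ symV p n k s M := by
      rw [e']; exact sub_mem hv (hD w hw).1
    have h2 : symD p n k N (symEList p L v) = 0 := by
      rw [e', map_sub, h, (hD w hw).2, sub_zero]
    have h3 := symD_symK (p := p) (hL g List.mem_cons_self) (symEList p L v)
    rw [h2, map_zero, add_zero] at h3
    refine ⟨w - symK p g (symEList p L v), sub_mem hw (symK_mem H g h1), ?_⟩
    rw [map_sub, h3, symEList, LinearMap.comp_apply]
    nth_rewrite 1 [e]
    abel

theorem symE_Lop_of_ne {g g' : Gen n k} (h : plusGen g ≠ g') (v : EP p (Gen n k)) :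
    symE p g (Lop p g' v) = Lop p g' (symE p g v) := by
  rw [symE_apply, symE_apply, ← Lop_Cop, ← Lop_Bop, ← map_sub, Lop_Lop, map_neg, Dop_Lop_of_ne h,
    neg_neg]

theorem symE_Lop_plusGen (g : Gen n k) (v : EP p (Gen n k)) :
    symE p g (Lop p (plusGen g) v) = 0 := by
  rw [symE_apply, ← Lop_Cop, ← Lop_Bop, ← map_sub, Lop_self, map_zero]

theorem symE_Bop_of_ne {g g' : Gen n k} (h : g ≠ g') (v : EP p (Gen n k)) :
    symE p g (Bop p g' v) = Bop p g' (symE p g v) := by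
  rw [symE_apply, symE_apply, Cop_Bop_of_ne h, Bop_Bop, ← map_sub, Lop_Bop, Dop_Bop]

theorem symE_Bop_self (g : Gen n k) (v : EP p (Gen n k)) : symE p g (Bop p g v) = 0 := by
  rw [symE_apply, Cop_Bop_self, sub_self, map_zero, map_zero]

theorem symEList_Lop_of_lt (L : List (Gen n k)) {g : Gen n k} (h : (g.1 : ℕ) < n + k)
    (v : EP p (Gen n k)) : symEList p L (Lop p g v) = Lop p g (symEList p L v) := by
  induction L with
  | nil => rfl
  | cons g' L ih =>
    rw [symEList, LinearMap.comp_apply, LinearMap.comp_apply, ih,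
      symE_Lop_of_ne (plusGen_ne_of_lt h g')]

theorem symEList_Lop_plusGen [DecidableEq (Gen n k)] (L : List (Gen n k)) (g : Gen n k)
    (v : EP p (Gen n k)) : symEList p L (Lop p (plusGen g) v) =
      if g ∈ L then 0 else Lop p (plusGen g) (symEList p L v) := by
  induction L with
  | nil => simp [symEList]
  | cons g' L ih =>
    rw [symEList, LinearMap.comp_apply, LinearMap.comp_apply, ih]
    by_cases e : g' = g
    · subst e
      rw [if_pos List.mem_cons_self]
      split_ifs
      · exact map_zero _
      · exact symE_Lop_plusGen _ _
    · have : g ∈ g' :: L ↔ g ∈ L := by simp [Ne.symm e]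
      simp only [this]
      split_ifs
      · exact map_zero _
      · exact symE_Lop_of_ne (fun h => e (plusGen_injective h)) _

theorem symEList_Bop [DecidableEq (Gen n k)] (L : List (Gen n k)) (g : Gen n k)
    (v : EP p (Gen n k)) : symEList p L (Bop p g v) =
      if g ∈ L then 0 else Bop p g (symEList p L v) := by
  induction L with
  | nil => simp [symEList]
  | cons g' L ih =>
    rw [symEList, LinearMap.comp_apply, LinearMap.comp_apply, ih]
    by_cases e : g' = g
    · subst e
      rw [if_pos List.mem_cons_self]
      split_ifs
      · exact map_zero _
      · exact symE_Bop_self _ _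
    · have : g ∈ g' :: L ↔ g ∈ L := by simp [Ne.symm e]
      simp only [this]
      split_ifs
      · exact map_zero _
      · exact symE_Bop_of_ne e _

theorem symE_one (g : Gen n k) : symE p g (Finsupp.single 0 1) = Finsupp.single 0 1 := by
  have : Cop p g (Finsupp.single 0 1) = (0 : EP p (Gen n k)) := by
    ext1 m
    rw [Cop_apply, Finsupp.zero_apply, Finsupp.single_eq_of_ne]
    intro h
    have := DFunLike.congr_fun h g
    simp at this
  rw [symE_apply, this, map_zero, sub_zero, Dop_Lop_self, Dop_one, map_zero, sub_zero]

theorem symEList_one (L : List (Gen n k)) :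
    symEList p L (Finsupp.single 0 1) = Finsupp.single 0 1 := by
  induction L with
  | nil => rfl
  | cons g L ih => rw [symEList, LinearMap.comp_apply, ih, symE_one]

end Koszul

/-! ### The comparison with the exterior algebra on the `h_{i,j}`, `k ≤ i < n + k` -/

section Comparison

variable {p n k : ℕ} [Fact p.Prime] [NeZero n]

/-- The inclusion of the indices with `s < n + k`. -/
def idxGen (i : Idx n k) : Gen n k := (⟨i.1, i.1.2.1⟩, i.2)

theorem idxGen_injective : Function.Injective (idxGen : Idx n k → Gen n k) := by
  rintro ⟨⟨s, hs⟩, j⟩ ⟨⟨s', hs'⟩, j'⟩ h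
  simp only [idxGen, Prod.mk.injEq, Subtype.mk.injEq] at h
  obtain ⟨rfl, rfl⟩ := h
  rfl

variable (p n k) in
/-- The inclusion of the exterior algebra on the `h_{i,j}`, `k ≤ i < n + k`. -/
def inclExt : Ext p n k →ₗ[ZMod p] EP p (Gen n k) :=
  (Finsupp.lsingle 0 : Lam p (Gen n k) →ₗ[ZMod p] EP p (Gen n k)) ∘ₗ
    (ExteriorAlgebra.map (Finsupp.lmapDomain (ZMod p) (ZMod p) idxGen)).toLinearMap

variable (p n k) in
/-- The projection onto the exterior algebra on the `h_{i,j}`, `k ≤ i < n + k`. -/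
def projExt : EP p (Gen n k) →ₗ[ZMod p] Ext p n k :=
  (ExteriorAlgebra.map (Finsupp.lcomapDomain (R := ZMod p) (M := ZMod p) idxGen
    idxGen_injective)).toLinearMap ∘ₗ (Finsupp.lapply 0 : EP p (Gen n k) →ₗ[ZMod p] Lam p (Gen n k))

theorem inclExt_apply (x : Ext p n k) : inclExt p n k x =
    Finsupp.single 0 (ExteriorAlgebra.map (Finsupp.lmapDomain (ZMod p) (ZMod p) idxGen) x) := rfl

theorem projExt_apply (v : EP p (Gen n k)) : projExt p n k v =
    ExteriorAlgebra.map (Finsupp.lcomapDomain (R := ZMod p) (M := ZMod p) idxGen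
      idxGen_injective) (v 0) := rfl

theorem inclExt_one : inclExt p n k 1 = Finsupp.single 0 1 := by rw [inclExt_apply, map_one]

theorem projExt_one : projExt p n k (Finsupp.single 0 1) = 1 := by
  rw [projExt_apply, Finsupp.single_eq_same, map_one]

theorem projExt_Bop (g : Gen n k) (v : EP p (Gen n k)) : projExt p n k (Bop p g v) = 0 := by
  rw [projExt_apply, Bop_apply_of_eq_zero _ _ rfl, map_zero]

theorem projExt_Lop (g : Gen n k) (v : EP p (Gen n k)) :
    projExt p n k (Lop p g v) = h p n k g.1 g.2 * projExt p n k v := by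
  rw [projExt_apply, Lop_apply, map_mul, ← projExt_apply, hGen, ExteriorAlgebra.map_apply_ι]
  congr 1
  obtain ⟨⟨s, hs⟩, j⟩ := g
  rw [h]
  simp only
  split_ifs with h1
  · congr 1
    ext i
    rw [Finsupp.lcomapDomain_apply, Finsupp.comapDomain_apply, Finsupp.single_apply,
      Finsupp.single_apply]
    congr 1
    rw [← idxGen_injective.eq_iff]
    rfl
  · rw [show Finsupp.lcomapDomain (R := ZMod p) (M := ZMod p) idxGen idxGen_injective
      (Finsupp.single ((⟨s, hs⟩, j) : Gen n k) 1) = 0 from ?_, map_zero]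
    ext i
    rw [Finsupp.lcomapDomain_apply, Finsupp.comapDomain_apply, Finsupp.zero_apply,
      Finsupp.single_eq_of_ne]
    rintro h2
    have h3 : (i.1 : ℕ) = s := congrArg (fun g : Gen n k => (g.1 : ℕ)) h2
    exact h1 ⟨hs, by have := i.1.2.2; omega⟩

theorem inclExt_h_mul {i : ℕ} (hi : k ≤ i) (hi' : i < n + k) (j : ZMod n) (y : Ext p n k) :
    inclExt p n k (h p n k i j * y) = LopN p n k i j (inclExt p n k y) := by
  rw [h, dif_pos ⟨hi, hi'⟩, LopN, dif_pos hi, inclExt_apply, inclExt_apply, Lop_single, map_mul,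
    ExteriorAlgebra.map_apply_ι]
  congr 2
  rw [hGen]
  congr 1
  simp [idxGen]

theorem projExt_inclExt (x : Ext p n k) : projExt p n k (inclExt p n k x) = x := by
  rw [projExt_apply, inclExt_apply, Finsupp.single_eq_same]
  have e : (Finsupp.lcomapDomain (R := ZMod p) (M := ZMod p) (idxGen (n := n) (k := k))
      idxGen_injective) ∘ₗ (Finsupp.lmapDomain (ZMod p) (ZMod p) idxGen) = LinearMap.id := by
    refine LinearMap.ext fun v => Finsupp.ext fun i => ?_
    exact Finsupp.mapDomain_apply idxGen_injective v i
  have := AlgHom.congr_fun (ExteriorAlgebra.map_comp_map (Finsupp.lmapDomain (ZMod p) (ZMod p)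
    (idxGen (n := n) (k := k))) (Finsupp.lcomapDomain (R := ZMod p) (M := ZMod p) (idxGen (n := n) (k := k))
      idxGen_injective)) x
  rw [e, ExteriorAlgebra.map_id] at this
  exact this

theorem projExt_LopN (m : ℕ) (j : ZMod n) (v : EP p (Gen n k)) :
    projExt p n k (LopN p n k m j v) = h p n k m j * projExt p n k v := by
  rw [LopN]
  split_ifs with hm
  · exact projExt_Lop _ _
  · rw [LinearMap.zero_apply, map_zero, h, dif_neg (fun h => hm h.1), zero_mul]

theorem extD_h_mul {i : ℕ} (hi : k ≤ i) (hi' : i < n + k) (j : ZMod n) (y : Ext p n k) :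
    extD p n k (h p n k i j * y) =
      -(∑ m ∈ Finset.Icc k (i - k), h p n k m j * (h p n k (i - m) (j + m) * y)) -
        h p n k i j * extD p n k y := by
  rw [h, dif_pos ⟨hi, hi'⟩, extD_ι_mul, extDGen, Finsupp.linearCombination_single, one_smul,
    neg_mul, Finset.sum_mul]
  simp only [mul_assoc]

theorem projExt_Qlow (g : Gen n k) (v : EP p (Gen n k)) : projExt p n k (Qlow p g v) =
    ∑ m ∈ Finset.Icc k (g.1 - k), h p n k m g.2 * (h p n k (g.1 - m) (g.2 + m) *
      projExt p n k v) := by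
  rw [Qlow_apply, map_sum]
  refine Finset.sum_congr rfl fun m _ => ?_
  rw [projExt_LopN, projExt_LopN]

theorem h_eq_zero {i : ℕ} (hi : n + k ≤ i) (j : ZMod n) : h p n k i j = 0 := by
  rw [h, dif_neg (by omega)]

/-- The projection is a chain map. -/
theorem projExt_symD {N s M : ℕ} (hM : M ≤ N) {v : EP p (Gen n k)} (hv : v ∈ symV p n k s M) :
    projExt p n k (symD p n k N v) = extD p n k (projExt p n k v) := by
  rw [← sub_eq_zero, ← LinearMap.comp_apply, ← LinearMap.comp_apply, ← LinearMap.sub_apply,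
    ← Submodule.mem_bot (ZMod p)]
  refine map_mem_of_symMono _ _ (fun x hx => ?_) hv
  clear hv v
  rw [LinearMap.sub_apply, LinearMap.comp_apply, LinearMap.comp_apply, Submodule.mem_bot,
    sub_eq_zero]
  induction hx with
  | one => rw [symD_one, projExt_one, map_zero, extD_one]
  | @mul_h s M x g _ ih =>
    have ih := ih (by omega)
    rcases lt_or_ge (g.1 : ℕ) (n + k) with hg | hg
    · rw [symD_Lop_of_lt N hg, projExt_Lop, extD_h_mul g.1.2 hg, map_sub, map_neg, projExt_Lop,
        ih, projExt_Qlow]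
    · obtain ⟨g, rfl⟩ := exists_plusGen hg
      have h1 : (g.1 : ℕ) + n ≤ genWt p (plusGen g) := self_le_mayM p n k _
      rw [symD_Lop_plusGen (by omega), map_sub, map_neg, projExt_Lop, projExt_Lop, projExt_Bop,
        h_eq_zero hg]
      simp
  | @mul_b s M x g _ ih =>
    rw [symD_Bop, projExt_Bop, projExt_Bop, map_zero]

theorem extDGen_h (y : Ext p n k) (i : Idx n k) (r : ZMod p) :
    ExteriorAlgebra.ι (ZMod p) (Finsupp.single i r) * y = r • (h p n k i.1 i.2 * y) := by
  rw [h, dif_pos i.1.2, ← smul_mul_assoc, ← map_smul, Finsupp.smul_single, smul_eq_mul, mul_one]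

/-- The inclusion is a chain map. -/
theorem symD_inclExt (N : ℕ) (x : Ext p n k) :
    symD p n k N (inclExt p n k x) = inclExt p n k (extD p n k x) := by
  induction x using lam_induction with
  | halg r =>
    rw [Algebra.algebraMap_eq_smul_one, map_smul, map_smul, map_smul, map_smul, inclExt_one,
      symD_one, extD_one, map_zero]
  | hadd x y hx hy => simp only [map_add, hx, hy]
  | hmul v x ih =>
    induction v using Finsupp.induction_linear with
    | zero => simp
    | add v w hv hw => simp only [map_add, add_mul, hv, hw]
    | single i r =>
      have h1 := i.1.2.1
      have h2 := i.1.2.2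
      rw [extDGen_h, map_smul, map_smul, map_smul, map_smul, extD_h_mul h1 h2, map_sub, map_neg,
        map_sum, inclExt_h_mul h1 h2, inclExt_h_mul h1 h2, LopN, dif_pos h1,
        symD_Lop_of_lt N (by exact h2), ih, Qlow_apply]
      congr 3
      refine Finset.sum_congr rfl fun m hm => ?_
      rw [Finset.mem_Icc] at hm
      rw [inclExt_h_mul hm.1 (by omega), inclExt_h_mul (by omega) (by omega)]

/-- Cancelling everything that can be cancelled leaves the exterior algebra. -/
theorem symEList_eq {N s M : ℕ} (hM : M ≤ N) {L : List (Gen n k)}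
    (hL : ∀ g : Gen n k, (g.1 : ℕ) ≤ N → g ∈ L) (hp : p ≠ 0) {v : EP p (Gen n k)}
    (hv : v ∈ symV p n k s M) : symEList p L v = inclExt p n k (projExt p n k v) := by
  classical
  rw [← sub_eq_zero, ← LinearMap.comp_apply, ← LinearMap.sub_apply, ← Submodule.mem_bot (ZMod p)]
  refine map_mem_of_symMono _ _ (fun x hx => ?_) hv
  clear hv v
  rw [LinearMap.sub_apply, LinearMap.comp_apply, Submodule.mem_bot, sub_eq_zero]
  induction hx with
  | one => rw [symEList_one, projExt_one, inclExt_one]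
  | @mul_h s M x g _ ih =>
    have ih := ih (by omega)
    rcases lt_or_ge (g.1 : ℕ) (n + k) with hg | hg
    · rw [symEList_Lop_of_lt L hg, ih, projExt_Lop, inclExt_h_mul g.1.2 hg, LopN, dif_pos g.1.2]
    · obtain ⟨g, rfl⟩ := exists_plusGen hg
      have h1 : (g.1 : ℕ) + n ≤ genWt p (plusGen g) := self_le_mayM p n k _
      rw [symEList_Lop_plusGen, if_pos (hL g (by omega)), projExt_Lop, h_eq_zero hg, zero_mul,
        map_zero]
  | @mul_b s M x g _ ih =>
    have h1 : (g.1 : ℕ) ≤ genWt p g := self_le_mayM p n k _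
    have h2 : genWt p g ≤ p * genWt p g := Nat.le_mul_of_pos_left _ (Nat.pos_of_ne_zero hp)
    rw [symEList_Bop, if_pos (hL g (by omega)), projExt_Bop, map_zero]

/-- A cycle of symbols that projects to zero is a boundary. -/
theorem exists_eq_symD (H : Admissible p n k) {N s M : ℕ} (hM : M + 1 ≤ N) {v : EP p (Gen n k)}
    (hv : v ∈ symV p n k s M) (h : symD p n k N v = 0) (h0 : projExt p n k v = 0) :
    ∃ w ∈ symVPred p n k s (M + 1), v = symD p n k N w := by
  obtain ⟨w, hw, e⟩ := exists_eq_symD_add H hM hv h (gensLE n k N).toList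
    fun g hg => mem_gensLE.1 (Finset.mem_toList.1 hg)
  rw [symEList_eq (by omega) (fun g hg => Finset.mem_toList.2 (mem_gensLE.2 hg))
    (Fact.out : p.Prime).ne_zero hv, h0, map_zero, add_zero] at e
  exact ⟨w, hw, e⟩

end Comparison

/-! ### Words in the exterior algebra -/

section Words

variable {p n k : ℕ} [Fact p.Prime] [NeZero n]

theorem genWt_idxGen (hk : 1 ≤ k) (i : Idx n k) :
    (genWt p (idxGen i) : ℤ) = 2 * ((i.1 : ℕ) : ℤ) - 1 := by
  have h1 := i.1.2.1
  have h2 : genWt p (idxGen i) = 2 * (i.1 : ℕ) - 1 := mayM_of_lt i.1.2.2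
  omega

variable (p) in
/-- `wordWeight`, as a natural number. -/
def natWeight {s : ℕ} (g : Fin s → Idx n k) : ℕ := ∑ a, genWt p (idxGen (g a))

theorem natWeight_cast (hk : 1 ≤ k) {s : ℕ} (g : Fin s → Idx n k) :
    (natWeight p g : ℤ) = wordWeight g := by
  rw [natWeight, wordWeight, Nat.cast_sum]
  exact Finset.sum_congr rfl fun a _ => genWt_idxGen hk (g a)

theorem extWord_succ {s : ℕ} (g : Fin (s + 1) → Idx n k) :
    extWord p g = h p n k (g 0).1 (g 0).2 * extWord p fun a => g a.succ := by
  rw [extWord, List.ofFn_succ, List.prod_cons]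
  rfl

theorem cobarWord_succ {s : ℕ} (g : Fin (s + 1) → Idx n k) :
    cobarWord p g = cell p n k (tg p (idxGen (g 0))) * cobarWord p fun a => g a.succ := by
  rw [cobarWord, List.ofFn_succ, List.prod_cons]
  rfl

theorem inclExt_extWord_succ {s : ℕ} (g : Fin (s + 1) → Idx n k) :
    inclExt p n k (extWord p g) =
      Lop p (idxGen (g 0)) (inclExt p n k (extWord p fun a => g a.succ)) := by
  rw [extWord_succ, inclExt_h_mul (g 0).1.2.1 (g 0).1.2.2, LopN, dif_pos (g 0).1.2.1]
  rfl

theorem natWeight_succ {s : ℕ} (g : Fin (s + 1) → Idx n k) :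
    natWeight p g = natWeight p (fun a => g a.succ) + genWt p (idxGen (g 0)) := by
  rw [natWeight, Fin.sum_univ_succ, add_comm]
  rfl

theorem inclExt_extWord_mem {s : ℕ} (g : Fin s → Idx n k) :
    inclExt p n k (extWord p g) ∈ symV p n k s (natWeight p g) := by
  induction s with
  | zero => simpa [extWord, natWeight, inclExt_one] using one_mem_symV
  | succ s ih =>
    rw [inclExt_extWord_succ, natWeight_succ]
    exact Lop_mem_symV (ih _) _

/-- The word `[t_{i_1}^{p^{j_1}}|…|t_{i_s}^{p^{j_s}}]` represents `h_{i_1,j_1} ⋯ h_{i_s,j_s}`. -/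
theorem represents_cobarWord (H : Admissible p n k) (N : ℕ) {s : ℕ} (g : Fin s → Idx n k) :
    Represents N s (natWeight p g) (inclExt p n k (extWord p g)) (cobarWord p g) := by
  induction s with
  | zero => simpa [extWord, cobarWord, natWeight, inclExt_one] using represents_one N
  | succ s ih =>
    rw [inclExt_extWord_succ, natWeight_succ, cobarWord_succ]
    exact (ih _).mul_low H (g 0).1.2.2

theorem represents_linearCombination (H : Admissible p n k) (N : ℕ) {s M : ℕ}
    (w : (Fin s → Idx n k) →₀ ZMod p) (hw : ∀ g ∈ w.support, wordWeight g = M) :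
    Represents N s M (inclExt p n k (Finsupp.linearCombination (ZMod p) (extWord p) w))
      (Finsupp.linearCombination (ZMod p) (cobarWord p) w) := by
  rw [Finsupp.linearCombination_apply, Finsupp.linearCombination_apply, Finsupp.sum, Finsupp.sum,
    map_sum]
  simp only [map_smul]
  generalize w.support = t at hw
  classical
  induction t using Finset.induction_on with
  | empty => simpa using represents_zero N s M
  | insert g t hg ih =>
    rw [Finset.sum_insert hg, Finset.sum_insert hg]
    have := represents_cobarWord H N g
    rw [Nat.cast_injective ((natWeight_cast H.one_le g).trans (hw g (Finset.mem_insert_self g t)))]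
      at this
    exact (this.smul _).add (ih fun g' hg' => hw g' (Finset.mem_insert_of_mem hg'))

theorem exists_linearCombination {s : ℕ} {M : ℤ} {x : Ext p n k} (hx : x ∈ extPart p n k s M) :
    ∃ w : (Fin s → Idx n k) →₀ ZMod p, (∀ g ∈ w.support, wordWeight g = M) ∧
      Finsupp.linearCombination (ZMod p) (extWord p) w = x := by
  have e : {x | ∃ g : Fin s → Idx n k, wordWeight g = M ∧ x = extWord p g} =
      extWord p '' {g : Fin s → Idx n k | wordWeight g = M} := by
    ext x
    simp only [Set.mem_ofPred_eq, Set.mem_image, eq_comm]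
  rw [extPart, e, Finsupp.mem_span_image_iff_linearCombination] at hx
  obtain ⟨w, hw, e⟩ := hx
  exact ⟨w, fun g hg => (Finsupp.mem_supported _ w).1 hw hg, e⟩

theorem inclExt_mem_symV (hk : 1 ≤ k) {s M : ℕ} {x : Ext p n k} (hx : x ∈ extPart p n k s M) :
    inclExt p n k x ∈ symV p n k s M := by
  refine (show extPart p n k s M ≤ (symV p n k s M).comap (inclExt p n k) from
    Submodule.span_le.2 ?_) hx
  rintro _ ⟨g, hg, rfl⟩
  have := inclExt_extWord_mem (p := p) g
  rwa [Nat.cast_injective ((natWeight_cast hk g).trans hg)] at this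

theorem h_mul_mem_extPart (hk : 1 ≤ k) {s M : ℕ} (g : Gen n k) {x : Ext p n k}
    (hx : x ∈ extPart p n k s M) :
    h p n k g.1 g.2 * x ∈ extPart p n k (s + 1) (M + genWt p g : ℕ) := by
  rcases lt_or_ge (g.1 : ℕ) (n + k) with hg | hg
  · refine (show extPart p n k s M ≤ (extPart p n k (s + 1) (M + genWt p g : ℕ)).comap
      (LinearMap.mulLeft (ZMod p) (h p n k g.1 g.2)) from Submodule.span_le.2 ?_) hx
    rintro _ ⟨f, hf, rfl⟩
    refine Submodule.subset_span
      ⟨Fin.cons (⟨⟨g.1, g.1.2, hg⟩, g.2⟩ : Idx n k) f, ?_, ?_⟩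
    · have := genWt_idxGen (p := p) hk (⟨⟨g.1, g.1.2, hg⟩, g.2⟩ : Idx n k)
      rw [← natWeight_cast (p := p) hk] at hf ⊢
      rw [natWeight_succ]
      simp only [Fin.cons_zero, Fin.cons_succ]
      push_cast
      rw [hf]
      rfl
    · rw [extWord_succ]
      rfl
  · rw [h_eq_zero hg, zero_mul]
    exact zero_mem _

theorem projExt_mem_extPart (hk : 1 ≤ k) {s M : ℕ} {v : EP p (Gen n k)}
    (hv : v ∈ symV p n k s M) : projExt p n k v ∈ extPart p n k s M := by
  refine map_mem_of_symMono _ _ (fun x hx => ?_) hv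
  clear hv v
  induction hx with
  | one =>
    rw [projExt_one]
    exact Submodule.subset_span ⟨Fin.elim0, by simp [wordWeight], by simp [extWord]⟩
  | mul_h g _ ih =>
    rw [projExt_Lop]
    exact h_mul_mem_extPart hk g ih
  | mul_b g _ ih =>
    rw [projExt_Bop]
    exact zero_mem _

theorem h_eq_ι (i : Idx n k) :
    h p n k i.1 i.2 = ExteriorAlgebra.ι (ZMod p) (Finsupp.single i 1) := by
  rw [h, dif_pos i.1.2]

theorem extWord_eq_ιMulti {s : ℕ} (g : Fin s → Idx n k) :
    extWord p g = ExteriorAlgebra.ιMulti (ZMod p) s fun a => Finsupp.single (g a) 1 := by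
  rw [ExteriorAlgebra.ιMulti_apply, extWord]
  simp only [h_eq_ι]

theorem injective_of_extWord_ne_zero {s : ℕ} {g : Fin s → Idx n k} (hg : extWord p g ≠ 0) :
    Function.Injective g := by
  intro a b hab
  by_contra h
  refine hg ?_
  rw [extWord_eq_ιMulti]
  exact AlternatingMap.map_eq_zero_of_eq _ _ (by simp only [hab]) h

variable (n k) in
/-- An enumeration of the `n²` indices. -/
def idxEquiv : Fin (n ^ 2) ≃ Idx n k :=
  (finCongr (sq n)).trans <| finProdFinEquiv.symm.trans <| Equiv.prodCongr
    { toFun := fun a => ⟨k + a, by omega, by omega⟩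
      invFun := fun i => ⟨i - k, by have := i.2; omega⟩
      left_inv := fun a => by ext; simp
      right_inv := fun i => by ext; have := i.2; simp; omega }
    (ZMod.finEquiv n).toEquiv

variable (n k) in
/-- The May filtration of the product of all the `h_{i,j}`. -/
def topWeight : ℤ := wordWeight (idxEquiv n k)

theorem wordWeight_le (hk : 1 ≤ k) {s : ℕ} {g : Fin s → Idx n k} (hg : Function.Injective g) :
    wordWeight g ≤ topWeight n k := by
  have e : wordWeight g = ∑ b ∈ Finset.univ.map
      ⟨fun a => (idxEquiv n k).symm (g a), (idxEquiv n k).symm.injective.comp hg⟩,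
      (2 * ((idxEquiv n k b).1 : ℤ) - 1) := by
    rw [Finset.sum_map]
    simp [wordWeight]
  rw [e]
  refine Finset.sum_le_univ_sum_of_nonneg fun b => ?_
  have := (idxEquiv n k b).1.2.1
  omega

theorem extPart_eq_bot_of_topWeight_lt (hk : 1 ≤ k) (s : ℕ) {M : ℤ} (hM : topWeight n k < M) :
    extPart p n k s M = ⊥ := by
  refine Submodule.span_eq_bot.2 ?_
  rintro _ ⟨g, hg, rfl⟩
  by_contra h0
  have := wordWeight_le hk (injective_of_extWord_ne_zero h0)
  omega

theorem extPart_eq_bot_of_sq_lt {s : ℕ} (hs : n ^ 2 < s) (M : ℤ) : extPart p n k s M = ⊥ := by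
  refine Submodule.span_eq_bot.2 ?_
  rintro _ ⟨g, hg, rfl⟩
  by_contra h0
  have := Fintype.card_le_of_injective _
    ((idxEquiv n k).symm.injective.comp (injective_of_extWord_ne_zero h0))
  simp only [Fintype.card_fin] at this
  omega

theorem extWord_idxEquiv_ne_zero : extWord p (idxEquiv n k) ≠ 0 := by
  classical
  intro h0
  let b : Module.Basis (Fin (n ^ 2)) (ZMod p) (Idx n k →₀ ZMod p) :=
    Finsupp.basisSingleOne.reindex (idxEquiv n k).symm
  have h1 := ExteriorAlgebra.liftAlternating_apply_ιMulti
    (fun i => if hi : i = n ^ 2 then b.det.domDomCongr (finCongr hi.symm) else 0) b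
  have h2 : (b : Fin (n ^ 2) → Idx n k →₀ ZMod p) =
      fun a => Finsupp.single (idxEquiv n k a) 1 := by
    funext a
    simp [b]
  rw [h2, ← extWord_eq_ιMulti, h0, map_zero, dif_pos rfl, ← h2] at h1
  have h3 : b.det b = 1 := b.det_self
  simp only [finCongr_refl, AlternatingMap.domDomCongr_refl, h3] at h1
  exact zero_ne_one h1

end Words

/-! ### The `E₂`-term -/

section SecondTerm

variable {p n k : ℕ} [Fact p.Prime] [NeZero n]

variable (p n k) in
/-- The part of the symbol in filtration `M` that lies in the exterior algebra on the `h_{i,j}`. -/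
def extSymbol (M : ℤ) : Cobar p n k →ₗ[ZMod p] Ext p n k := projExt p n k ∘ₗ rhoM p n k M

theorem extSymbol_apply (M : ℤ) (z : Cobar p n k) :
    extSymbol p n k M z = projExt p n k (rhoM p n k M z) := rfl

variable {s : ℕ} {M : ℤ} {z : Cobar p n k}

theorem extSymbol_eq_zero {N : ℤ} (hz : z ∈ mayF p n k s N) (h : N < M) :
    extSymbol p n k M z = 0 := by
  rw [extSymbol_apply, rhoM_eq_zero hz h, map_zero]

theorem extSymbol_mem_extPart (H : Admissible p n k) (hz : z ∈ mayF p n k s M) :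
    extSymbol p n k M z ∈ extPart p n k s M := by
  rcases lt_or_ge M 0 with hM | hM
  · rw [mayF_neg hM, Submodule.mem_bot] at hz
    rw [hz, map_zero]
    exact zero_mem _
  · lift M to ℕ using hM
    exact projExt_mem_extPart H.one_le (rhoM_mem_symV H hz)

theorem extD_extSymbol (H : Admissible p n k) (hz : z ∈ mayF p n k s M)
    (hdz : cobarD p n k z ∈ mayF p n k (s + 1) (M - 1)) :
    extD p n k (extSymbol p n k M z) = extSymbol p n k (M - 1) (cobarD p n k z) := by
  rcases lt_or_ge M 0 with hM | hM
  · rw [mayF_neg hM, Submodule.mem_bot] at hz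
    simp only [hz, map_zero]
  · lift M to ℕ using hM
    rw [extSymbol_apply, extSymbol_apply, rhoM_cobarD H le_rfl hz hdz,
      projExt_symD le_rfl (rhoM_mem_symV H hz)]

theorem mem_mayZ {r : ℤ} : z ∈ mayZ p n k r s M ↔
    z ∈ mayF p n k s M ∧ cobarD p n k z ∈ mayF p n k (s + 1) (M - r) := Iff.rfl

theorem extSymbol_mem_extZ (H : Admissible p n k) (hz : z ∈ mayZ p n k 2 s M) :
    extSymbol p n k M z ∈ extZ p n k s M := by
  rw [mem_mayZ] at hz
  refine ⟨extSymbol_mem_extPart H hz.1, ?_⟩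
  refine LinearMap.mem_ker.2 ?_
  rw [extD_extSymbol H hz.1 (mayF_mono (by omega) hz.2)]
  exact extSymbol_eq_zero hz.2 (by omega)

theorem mem_mayB_zero : z ∈ mayB p n k 2 0 M ↔
    z ∈ mayF p n k 0 (M - 1) ∧ cobarD p n k z ∈ mayF p n k 1 (M - 2) := by
  rw [mayB, mem_mayZ, show M - 1 - (2 - 1) = M - 2 by ring]

theorem mem_mayB_succ : z ∈ mayB p n k 2 (s + 1) M ↔
    ∃ z' ∈ mayF p n k (s + 1) (M - 1), cobarD p n k z' ∈ mayF p n k (s + 2) (M - 2) ∧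
    ∃ y ∈ mayF p n k s (M + 1), cobarD p n k y ∈ mayF p n k (s + 1) M ∧
      z' + cobarD p n k y = z := by
  simp only [mayB, Submodule.mem_sup, Submodule.mem_map, mem_mayZ]
  rw [show M - 1 - (2 - 1) = M - 2 by ring, show M + 2 - 1 - (2 - 1) = M by ring,
    show M + 2 - 1 = M + 1 by ring]
  constructor
  · rintro ⟨z', ⟨h1, h2⟩, _, ⟨y, ⟨h3, h4⟩, rfl⟩, e⟩
    exact ⟨z', h1, h2, y, h3, h4, e⟩
  · rintro ⟨z', h1, h2, y, h3, h4, e⟩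
    exact ⟨z', ⟨h1, h2⟩, _, ⟨y, ⟨h3, h4⟩, rfl⟩, e⟩

theorem extSymbol_mem_extB (H : Admissible p n k) (hz : z ∈ mayB p n k 2 s M) :
    extSymbol p n k M z ∈ extB p n k s M := by
  rcases s with - | s
  · exact (Submodule.mem_bot _).2 (extSymbol_eq_zero (mem_mayB_zero.1 hz).1 (by omega))
  · obtain ⟨z', h1, -, y, h3, h4, rfl⟩ := mem_mayB_succ.1 hz
    refine ⟨extSymbol p n k (M + 1) y, extSymbol_mem_extPart H h3, ?_⟩
    rw [extD_extSymbol H h3 (by rwa [add_sub_cancel_right]), map_add,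
      extSymbol_eq_zero h1 (by omega), zero_add, add_sub_cancel_right]

/-- Injectivity on the `E₂`-term: if the projected symbol of a cycle is a boundary, then so is the
whole symbol, and the cycle has lower filtration up to a coboundary. -/
theorem mem_mayB_of_extSymbol (H : Admissible p n k) (hz : z ∈ mayZ p n k 2 s M)
    (h : extSymbol p n k M z ∈ extB p n k s M) : z ∈ mayB p n k 2 s M := by
  rw [mem_mayZ] at hz
  obtain ⟨hz, hdz⟩ := hz
  rcases lt_or_ge M 0 with hM | hM
  · rw [mayF_neg hM, Submodule.mem_bot] at hz
    rw [hz]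
    exact zero_mem _
  lift M to ℕ using hM
  have hdz1 : cobarD p n k z ∈ mayF p n k (s + 1) (M - 1) := mayF_mono (by omega) hdz
  have hv := rhoM_mem_symV (M := M) H hz
  have hDv : symD p n k (M + 1) (rhoM p n k M z) = 0 := by
    rw [← rhoM_cobarD H (by omega) hz hdz1]
    exact rhoM_eq_zero hdz (by omega)
  rcases s with - | s
  · obtain ⟨w, hw, e⟩ := exists_eq_symD H le_rfl hv hDv ((Submodule.mem_bot _).1 h)
    rw [(Submodule.mem_bot _).1 hw, map_zero] at e
    exact mem_mayB_zero.2 ⟨mem_of_rhoM_eq_zero hz e, hdz⟩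
  · obtain ⟨e, he, hx⟩ := h
    -- the part of the symbol outside the exterior algebra is a boundary as well
    have hie : inclExt p n k e ∈ symV p n k s (M + 1) := inclExt_mem_symV H.one_le he
    obtain ⟨w, hw, hwe⟩ := exists_eq_symD H le_rfl
      (sub_mem hv (symD_mem H le_rfl hie))
      (by rw [map_sub, hDv, symD_symD H le_rfl hie, sub_zero])
      (by rw [map_sub, symD_inclExt, projExt_inclExt, hx, extSymbol_apply, sub_self])
    obtain ⟨r, hr⟩ := exists_represents H le_rfl (add_mem hw hie)
    have hr1 := hr.mem
    have hr2 := hr.d_mem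
    have hr3 := hr.d_symb
    rw [map_add, ← hwe, sub_add_cancel] at hr3
    push_cast at hr1 hr2 hr3
    rw [add_sub_cancel_right] at hr2 hr3
    -- subtracting the coboundary of a representative leaves a zero symbol
    have hd : cobarD p n k (z - cobarD p n k r) = cobarD p n k z := by
      rw [map_sub, cobarD_cobarD H, sub_zero]
    obtain ⟨u, hu, hu2⟩ := exists_sub_cobarD_mem H (sub_mem hz hr2) (by rwa [hd])
      (by rw [map_sub, hr3, sub_self])
    refine mem_mayB_succ.2 ⟨_, hu2, ?_, r + u, add_mem hr1 (mayF_mono (by omega) hu), ?_, ?_⟩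
    · rwa [map_sub, cobarD_cobarD H, sub_zero, hd]
    · have : cobarD p n k (r + u) =
          z - (z - cobarD p n k r - cobarD p n k u) := by rw [map_add]; abel
      rw [this]
      exact sub_mem hz (mayF_mono (by omega) hu2)
    · rw [map_add]; abel

/-- A cocycle of the exterior algebra lifts to a cycle that is congruent to the corresponding sum of
words modulo lower filtration. -/
theorem exists_mem_mayZ (H : Admissible p n k) (w : (Fin s → Idx n k) →₀ ZMod p)
    (hw : ∀ g ∈ w.support, wordWeight g = M)
    (hD : extD p n k (Finsupp.linearCombination (ZMod p) (extWord p) w) = 0) :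
    ∃ z ∈ mayZ p n k 2 s M,
      z - Finsupp.linearCombination (ZMod p) (cobarWord p) w ∈ mayF p n k s (M - 1) ∧
      extSymbol p n k M z = Finsupp.linearCombination (ZMod p) (extWord p) w := by
  rcases lt_or_ge M 0 with hM | hM
  · have : w = 0 := by
      by_contra h
      obtain ⟨g, hg⟩ := Finsupp.support_nonempty_iff.2 h
      have := natWeight_cast (p := p) H.one_le g
      have := hw g hg
      omega
    subst this
    exact ⟨0, zero_mem _, by simp, by simp⟩
  lift M to ℕ using hM
  -- the sum of words has coboundary of zero symbol, so a correction of lower filtration exists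
  have hr := represents_linearCombination H M w hw
  set r := Finsupp.linearCombination (ZMod p) (cobarWord p) w with hr0
  have h1 := hr.d_symb
  rw [symD_inclExt, hD, map_zero] at h1
  obtain ⟨u, hu, hu2⟩ := exists_sub_cobarD_mem H hr.d_mem
    (by rw [cobarD_cobarD H]; exact zero_mem _) h1
  have hur := mayF_mono (show (M : ℤ) - 1 ≤ M by omega) hu
  refine ⟨r - u, ⟨sub_mem hr.mem hur, ?_⟩, ?_, ?_⟩
  · refine Submodule.mem_comap.2 ?_
    rw [map_sub]
    rwa [show (M : ℤ) - 1 - 1 = M - 2 by ring] at hu2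
  · rw [sub_sub_cancel_left]
    exact neg_mem hu
  · rw [map_sub, extSymbol_eq_zero hu (by omega), sub_zero, extSymbol_apply, hr.symb,
      projExt_inclExt]

variable (s M) in
/-- The map from cycles to cocycles of the exterior algebra. -/
def cycleMap (H : Admissible p n k) : mayZ p n k 2 s M →ₗ[ZMod p] extZ p n k s M :=
  (extSymbol p n k M).restrict fun _ hz => extSymbol_mem_extZ H hz

variable (s M) in
/-- The map from the `E₂`-term to the cohomology of the exterior algebra. -/
def mayEMap (H : Admissible p n k) : mayE p n k 2 s M →ₗ[ZMod p] extH p n k s M :=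
  Submodule.mapQ _ _ (cycleMap s M H) fun _ hz => extSymbol_mem_extB H hz

theorem mayEMap_mk (H : Admissible p n k) (z : mayZ p n k 2 s M) :
    mayEMap s M H (Submodule.Quotient.mk z) = Submodule.Quotient.mk (cycleMap s M H z) := rfl

theorem mayEMap_bijective (H : Admissible p n k) : Function.Bijective (mayEMap s M H) := by
  constructor
  · refine (injective_iff_map_eq_zero _).2 fun x hx => ?_
    obtain ⟨z, rfl⟩ := Submodule.Quotient.mk_surjective _ x
    rw [mayEMap_mk, Submodule.Quotient.mk_eq_zero] at hx
    exact (Submodule.Quotient.mk_eq_zero _).2 (mem_mayB_of_extSymbol H z.2 hx)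
  · intro y
    obtain ⟨⟨x, hx⟩, rfl⟩ := Submodule.Quotient.mk_surjective _ y
    obtain ⟨w, hw, rfl⟩ := exists_linearCombination hx.1
    obtain ⟨z, hz, -, e⟩ := exists_mem_mayZ H w hw hx.2
    refine ⟨Submodule.Quotient.mk ⟨z, hz⟩, ?_⟩
    rw [mayEMap_mk]
    congr 1
    exact Subtype.ext e

variable (s M) in
/-- The isomorphism from the cohomology of the exterior algebra onto the `E₂`-term. -/
def extHEquiv (H : Admissible p n k) : extH p n k s M ≃ₗ[ZMod p] mayE p n k 2 s M :=
  (LinearEquiv.ofBijective (mayEMap s M H) (mayEMap_bijective H)).symm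

theorem extHEquiv_mk (H : Admissible p n k) {x : Ext p n k} (hx : x ∈ extZ p n k s M)
    (hz : z ∈ mayZ p n k 2 s M) (e : extSymbol p n k M z = x) :
    extHEquiv s M H (Submodule.Quotient.mk ⟨x, hx⟩) = Submodule.Quotient.mk ⟨z, hz⟩ := by
  subst e
  rw [extHEquiv, LinearEquiv.symm_apply_eq]
  rfl

end SecondTerm

/-! ### The cohomological dimension -/

section Dimension

variable {p n k : ℕ} [Fact p.Prime] [NeZero n] {s : ℕ} {M : ℤ} {z : Cobar p n k}

theorem mem_mayB_of_extPart_eq_bot (H : Admissible p n k) (h : extPart p n k s M = ⊥)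
    (hz : z ∈ mayZ p n k 2 s M) : z ∈ mayB p n k 2 s M := by
  refine mem_mayB_of_extSymbol H hz ?_
  have := extSymbol_mem_extPart H hz.1
  rw [h, Submodule.mem_bot] at this
  rw [this]
  exact zero_mem _

theorem mem_mayZ_of_cobarD_eq_zero (hz : z ∈ mayF p n k s M) (h : cobarD p n k z = 0) (r : ℤ) :
    z ∈ mayZ p n k r s M :=
  mem_mayZ.2 ⟨hz, by rw [h]; exact zero_mem _⟩

/-- Above degree `n²` every cocycle is a coboundary, with control of the filtration. -/
theorem exists_cobarD_eq (H : Admissible p n k) (hs : n ^ 2 < s + 1)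
    (hz : z ∈ mayF p n k (s + 1) M) (h : cobarD p n k z = 0) :
    ∃ y ∈ mayF p n k s (M + 1), cobarD p n k y = z := by
  have key : ∀ (m : ℕ) (z : Cobar p n k), z ∈ mayF p n k (s + 1) ((m : ℤ) - 1) →
      cobarD p n k z = 0 → ∃ y ∈ mayF p n k s m, cobarD p n k y = z := by
    intro m
    induction m with
    | zero =>
      intro z hz _
      rw [mayF_neg (by simp), Submodule.mem_bot] at hz
      exact ⟨0, zero_mem _, by rw [hz, map_zero]⟩
    | succ m ih =>
      intro z hz h
      push_cast at hz ⊢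
      rw [add_sub_cancel_right] at hz
      obtain ⟨z', h1, -, y, h2, -, rfl⟩ := mem_mayB_succ.1 <| mem_mayB_of_extPart_eq_bot H
        (extPart_eq_bot_of_sq_lt hs _) (mem_mayZ_of_cobarD_eq_zero hz h 2)
      rw [map_add, cobarD_cobarD H, add_zero] at h
      obtain ⟨y', hy', rfl⟩ := ih z' h1 h
      exact ⟨y' + y, add_mem (mayF_mono (by omega) hy') h2, map_add _ _ _⟩
  rcases lt_or_ge M 0 with hM | hM
  · rw [mayF_neg hM, Submodule.mem_bot] at hz
    exact ⟨0, zero_mem _, by rw [hz, map_zero]⟩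
  · lift M to ℕ using hM
    simpa using key (M + 1) z (by simpa using hz) h

theorem subsingleton_H (H : Admissible p n k) (hs : n ^ 2 < s) :
    Subsingleton (Morava.H p n k s) := by
  obtain ⟨s, rfl⟩ : ∃ q, s = q + 1 := ⟨s - 1, by omega⟩
  rw [Submodule.Quotient.subsingleton_iff, Submodule.submoduleOf,
    Submodule.comap_subtype_eq_top]
  rintro z ⟨hz, h⟩
  obtain ⟨M, hM⟩ := exists_mem_mayF hz
  obtain ⟨y, hy, e⟩ := exists_cobarD_eq H hs hM h
  exact ⟨y, mayF_le_cobarC _ _ hy, e⟩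

/-- A coboundary in filtration at most `topWeight` comes from filtration at most `topWeight + 1`. -/
theorem exists_mem_mayF_topWeight (H : Admissible p n k) {x : Cobar p n k}
    (hx : x ∈ cobarC p n k s)
    (hdx : cobarD p n k x ∈ mayF p n k (s + 1) (topWeight n k)) :
    ∃ x' ∈ mayF p n k s (topWeight n k + 1), cobarD p n k x' = cobarD p n k x := by
  have key : ∀ (m : ℕ) (x : Cobar p n k), x ∈ mayF p n k s (topWeight n k + 1 + m) →
      cobarD p n k x ∈ mayF p n k (s + 1) (topWeight n k) →
      ∃ x' ∈ mayF p n k s (topWeight n k + 1), cobarD p n k x' = cobarD p n k x := by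
    intro m
    induction m with
    | zero => exact fun x hx _ => ⟨x, by simpa using hx, rfl⟩
    | succ m ih =>
      intro x hx hdx
      have hB := mem_mayB_of_extPart_eq_bot H
        (extPart_eq_bot_of_topWeight_lt H.one_le s (M := topWeight n k + 1 + (m + 1 : ℕ)) (by omega))
        ⟨hx, mayF_mono (by push_cast; omega) hdx⟩
      have e : topWeight n k + 1 + (m + 1 : ℕ) - 1 = topWeight n k + 1 + m := by push_cast; ring
      rcases s with - | s
      · have := (mem_mayB_zero.1 hB).1
        rw [e] at this
        exact ih x this hdx
      · obtain ⟨z', h1, -, y, -, -, rfl⟩ := mem_mayB_succ.1 hB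
        rw [e] at h1
        rw [map_add, cobarD_cobarD H, add_zero] at hdx ⊢
        exact ih z' h1 hdx
  obtain ⟨M, hM⟩ := exists_mem_mayF hx
  exact key (M - topWeight n k).toNat x (mayF_mono (by omega) hM) hdx

theorem nontrivial_H (H : Admissible p n k) : Nontrivial (Morava.H p n k (n ^ 2)) := by
  obtain ⟨q, hq⟩ : ∃ q, n ^ 2 = q + 1 :=
    ⟨n ^ 2 - 1, by have := pow_pos (NeZero.pos n) 2; omega⟩
  have hr := represents_cobarWord (p := p) H (natWeight p (idxEquiv n k)) (idxEquiv n k)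
  have hD : extD p n k (extWord p (idxEquiv n k)) = 0 := by
    have h1 := congrArg (projExt p n k) hr.d_symb
    rw [symD_inclExt, projExt_inclExt, ← extSymbol_apply] at h1
    have h2 := extSymbol_mem_extPart H hr.d_mem
    rwa [extPart_eq_bot_of_sq_lt (Nat.lt_succ_self _), Submodule.mem_bot, h1] at h2
  obtain ⟨z, hz, -, e⟩ := exists_mem_mayZ (M := topWeight n k) H
    (Finsupp.single (idxEquiv n k) (1 : ZMod p)) (by
      intro g hg
      rw [Finset.mem_singleton.1 (Finsupp.support_single_subset hg)]
      rfl) (by rw [Finsupp.linearCombination_single, one_smul, hD])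
  rw [Finsupp.linearCombination_single, one_smul] at e
  rw [mem_mayZ] at hz
  -- `d z` is a cocycle in degree `n² + 1`, so `z` can be corrected to a cocycle in lower filtration
  obtain ⟨y, hy, hyz⟩ := exists_cobarD_eq H (Nat.lt_succ_self _) hz.2 (cobarD_cobarD H z)
  rw [show topWeight n k - 2 + 1 = topWeight n k - 1 by ring] at hy
  have hzy : z - y ∈ mayF p n k (n ^ 2) (topWeight n k) :=
    sub_mem hz.1 (mayF_mono (by omega) hy)
  have he : extSymbol p n k (topWeight n k) (z - y) = extWord p (idxEquiv n k) := by
    rw [map_sub, e, extSymbol_eq_zero hy (by omega), sub_zero]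
  by_contra hn
  rw [not_nontrivial_iff_subsingleton, Submodule.Quotient.subsingleton_iff,
    Submodule.submoduleOf, Submodule.comap_subtype_eq_top] at hn
  have hB := hn (show z - y ∈ cocycles p n k (n ^ 2) from
    ⟨mayF_le_cobarC _ _ hzy, LinearMap.mem_ker.2 (by rw [map_sub, hyz, sub_self])⟩)
  rw [hq] at hB hzy
  obtain ⟨x, hx, hxz⟩ := hB
  -- a cochain with coboundary `z - y` may be taken in filtration `topWeight + 1`, where the
  -- exterior algebra is zero
  obtain ⟨x', hx', e'⟩ := exists_mem_mayF_topWeight H hx (by rwa [hxz])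
  rw [hxz] at e'
  have h1 := extD_extSymbol H hx' (by rwa [e', add_sub_cancel_right])
  have h2 := extSymbol_mem_extPart H hx'
  rw [extPart_eq_bot_of_topWeight_lt H.one_le _ (by omega), Submodule.mem_bot] at h2
  rw [h2, map_zero, add_sub_cancel_right, e', he] at h1
  exact extWord_idxEquiv_ne_zero h1.symm

end Dimension

end Morava
end

theorem theorem3p4 (p n k : ℕ) [Fact p.Prime] (hk : 1 ≤ k) (hkn : k ≤ n)
    (hpnk : (2 * p * n + p - 2 : ℚ) / (2 * (p - 1)) ≤ n + k - 1) :
    (∀ (s : ℕ) (M : ℤ),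
      ∃ Φ : Morava.extH p n k s M ≃ₗ[ZMod p] Morava.mayE p n k 2 s M,
        -- `Φ` is induced by `h_{i,j} ↦ t_i^{p^j}`
        ∀ w : (Fin s → Morava.Idx n k) →₀ ZMod p,
          (∀ g ∈ w.support, Morava.wordWeight g = M) →
          ∀ hw : Finsupp.linearCombination (ZMod p) (Morava.extWord p) w ∈ Morava.extZ p n k s M,
            ∃ (z : Morava.Cobar p n k) (hz : z ∈ Morava.mayZ p n k 2 s M),
              z - Finsupp.linearCombination (ZMod p) (Morava.cobarWord p) w ∈
                  Morava.mayF p n k s (M - 1) ∧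
                Φ (Submodule.Quotient.mk ⟨_, hw⟩) = Submodule.Quotient.mk ⟨z, hz⟩) ∧
    (∀ s : ℕ, n ^ 2 < s → Subsingleton (Morava.H p n k s)) ∧
    Nontrivial (Morava.H p n k (n ^ 2)) := by
  have H : Morava.Admissible p n k := Morava.admissible_of_le hk hkn hpnk
  have : NeZero n := ⟨by omega⟩
  refine ⟨fun s M => ⟨Morava.extHEquiv s M H, fun w hw hwZ => ?_⟩,
    fun s hs => Morava.subsingleton_H H hs, Morava.nontrivial_H H⟩
  obtain ⟨z, hz, hzw, e⟩ := Morava.exists_mem_mayZ H w hw hwZ.2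
  exact ⟨z, hz, hzw, Morava.extHEquiv_mk H hwZ hz e⟩
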